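/- **Setting.** *Tasks.* Let $n\ge 0$ and $\Pi=\{p_0,\dots,p_n\}$. A colorless task $(\mathcal I^*,\mathcal O^*,\Delta^*)$ consists of finite simplicial complexes $\mathcal I^*,\mathcal O^*$ and a monotone map $\Delta^*$ from simplices of $\mathcal I^*$ to subcomplexes of $\mathcal O^*$ with $\dim\Delta^*(\sigma)\le\dim\sigma$. Its colored form $(\mathcal I,\mathcal O,\Delta)$ has as simplices of $\mathcal I$ (resp. $\mathcal O$) the sets of pairs (process, value) with distinct processes whose values span a simplex of $\mathcal I^*$ (resp. $\mathcal O^*$); $\tau\in\Delta(\sigma)$ iff $ids(\tau)\subseteq ids(\sigma)$, the processes in $\tau$ are distinct, and $vals(\tau)\in\Delta^*(vals(\sigma))$. *NIIS model.* Processes access immediate snapshot (IS) objects $IS_1,IS_2,\dots$ in order. Scheduling a non-empty set $P$ of active processes that are poised to access the same IS object means that all of them write their states to it and then all of them read it; the new state of a process is its id together with the snapshot. A protocol is a map $\delta$ from local states to output values or $\bot$ (always $\bot$ on initial states); a process whose state $s$ has $\delta(s)\ne\bot$ outputs $\delta(s)$ and terminates. Outputs are *valid* in a configuration if, for each non-empty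 set $Q$ of terminated processes, the outputs of $Q$ form a simplex of $\Delta(\sigma)$, where $\sigma\in\mathcal I$ consists of the inputs that the processes in $Q$ have seen, directly or indirectly (the carrier). *Extension-based proofs.* A prover interacts with an adversary in phases. Phase $\varphi$ has a set $\mathcal A(\varphi)$ of starting configurations ($\mathcal A(1)$: all initial configurations) and the set $\mathcal A'(\varphi)$, initially empty, of configurations reached in it. In a query $(C,P)$ the prover picks $C\in\mathcal A(\varphi)\cup\mathcal A'(\varphi)$ and a non-empty set $P$ of active processes poised to access the same IS object in $C$; the adversary replies with the values of $\delta$ for the processes of $P$ in the resulting configuration $CP$, which is added to $\mathcal A'(\varphi)$. *Extension-based* provers may also make output queries $(C,P,y)$ with such $P$ (the reply is a $P$-only schedule from $C$ after which some process of $P$ has output $y$, or NULL if there is none); *augmented* ones may in addition make assignment queries $(C,P,f)$ with any $P\subseteq \Pi$ and a map $f$ from some $Q\subseteq P$ to output values (the reply is a $P$-only schedule from $C$ after which each $q\in Q$ has output $f(q)$, or NULL if there is none); *restricted* ones may make neither. The prover ends a phase by choosing some $C'\in\mathcal A'(\varphi)$, reached from an initial configuration $C_0$ by a schedule $\alpha$;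 then $\mathcal A(\varphi+1)$ is the set of configurations reached by $\alpha$ from the initial configurations that differ from $C_0$ only in the inputs of processes not occurring in $\alpha$. A chain is a sequence of queries $(C_i,P_i)$ with $C_{i+1}=C_iP_i$. In a phase a prover may construct only finitely many chains and make only finitely many output and assignment queries. The prover wins if a reply to a query $(C,P)$ yields invalid outputs in the configuration $CP$, or if it constructs an infinite chain in some phase or infinitely many phases. An adversary (a strategy that chooses each reply depending on the interaction so far) *wins* against a prover if the prover does not win and at every time all replies given so far are those of some protocol. *Partial protocols.* Let $[U_1,\dots,U_k]$ be a sequence of non-empty faces of an $n$-simplex of $\mathcal I$ such that $ids(U_1),\dots,ids(U_k)$ is a full 1-round schedule, i.e. an ordered partition of $\Pi$. A *partial protocol with respect to $[U_1,\dots,U_k]$* is a protocol $\delta$ such that, among the executions that start in the initial configuration $\bigcup_i U_i$ and in which $ids(U_1),\dots,ids(U_k)$ are the first $k$ sets of processes to take a step, none is infinite, and all configurations reached by them from the end of the $k$-th step on have valid outputs. Let $\mathbb F_1([U_1,\dots,U_k])$ be the simplex, with all its faces, formed by the local states after these first $k$ steps. For a simplex $S$ of $\mathbb F_1$, $CEN(S)$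 is the configuration reached from $S$ by repeating $ids(S)$ (its active members take a step each time) until all processes in $ids(S)$ have terminated. Partial protocols $\delta,\delta'$ with respect to $[U_1,\dots,U_k]$ and $[U'_1,\dots,U'_{k'}]$ are *compatible* if for every non-empty simplex $S$ that lies in both complexes $\mathbb F_1$ the processes in $ids(S)$ have the same outputs in $CEN(S)$ under $\delta$ and under $\delta'$. **Theorem.** Let $(\mathcal I,\mathcal O,\Delta)$ be the colored form for $n+1$ processes of a colorless task. For each of the three classes of provers (restricted extension-based, extension-based, augmented extension-based), the following are equivalent: 1. there is an adversary that wins against every prover of the class; 2. one can choose for every sequence $[U_1,\dots,U_k]$ as above a partial protocol $\delta_{[U_1,\dots,U_k]}$ with respect to it, in such a way that any two of the chosen partial protocols are compatible. -/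

import Mathlib

/-! ### Tasks -/

/-- A (colored) task for the processes `p₀, …, pₙ`: finite chromatic input and output complexes,
whose vertices are pairs (process id, value), and a carrier map `Δ`. -/
structure DecisionTask (n : ℕ) (V W : Type*) where
  input : PreAbstractSimplicialComplex (Fin (n + 1) × V)
  output : PreAbstractSimplicialComplex (Fin (n + 1) × W)
  finite_input : input.faces.Finite
  finite_output : output.faces.Finite
  chromatic_input : ∀ σ ∈ input, Set.InjOn Prod.fst (σ : Set (Fin (n + 1) × V))
  chromatic_output : ∀ τ ∈ output, Set.InjOn Prod.fst (τ : Set (Fin (n + 1) × W))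
  Δ : Finset (Fin (n + 1) × V) → PreAbstractSimplicialComplex (Fin (n + 1) × W)
  Δ_le : ∀ σ ∈ input, Δ σ ≤ output
  Δ_mono : ∀ σ ∈ input, ∀ σ' ∈ input, σ ⊆ σ' → Δ σ ≤ Δ σ'

/-- A colorless task `(I*, O*, Δ*)`, given without process ids. -/
structure ColorlessTask (V W : Type*) where
  input : PreAbstractSimplicialComplex V
  output : PreAbstractSimplicialComplex W
  finite_input : input.faces.Finite
  finite_output : output.faces.Finite
  Δ : Finset V → PreAbstractSimplicialComplex W
  Δ_le : ∀ σ ∈ input, Δ σ ≤ output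
  Δ_mono : ∀ σ ∈ input, ∀ σ' ∈ input, σ ⊆ σ' → Δ σ ≤ Δ σ'
  Δ_dim : ∀ σ ∈ input, ∀ τ ∈ Δ σ, τ.card ≤ σ.card

/-- The set of process ids of a set of (process id, value) pairs. -/
def ids {n : ℕ} {V : Type*} (σ : Finset (Fin (n + 1) × V)) : Finset (Fin (n + 1)) :=
  σ.image Prod.fst

open scoped Classical in
/-- The set of values of a set of (process id, value) pairs. -/
noncomputable def vals {n : ℕ} {V : Type*} (σ : Finset (Fin (n + 1) × V)) : Finset V :=
  σ.image Prod.snd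

open scoped Classical in
/-- The colorized complex: every simplex is replaced with the pseudosphere in which each of the
`n + 1` processes independently gets one of its vertices as value. -/
noncomputable def colorize (n : ℕ) {V : Type*} (K : PreAbstractSimplicialComplex V) :
    PreAbstractSimplicialComplex (Fin (n + 1) × V) where
  faces := {σ | Set.InjOn Prod.fst (σ : Set (Fin (n + 1) × V)) ∧ vals σ ∈ K}
  isRelLowerSet_faces := by
    rintro σ ⟨h1, h2⟩
    refine ⟨Finset.image_nonempty.mp (K.isRelLowerSet_faces h2).1, ?_⟩
    intro τ hτ hne
    refine ⟨h1.mono (by exact_mod_cast hτ), ?_⟩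
    exact (K.isRelLowerSet_faces h2).2 (Finset.image_subset_image hτ) (hne.image _)

theorem colorize_finite (n : ℕ) {V : Type*} (K : PreAbstractSimplicialComplex V)
    (hK : K.faces.Finite) : (colorize n K).faces.Finite := by
  classical
  let A : Finset V := hK.toFinset.biUnion id
  refine ((Finset.univ ×ˢ A : Finset (Fin (n + 1) × V)).powerset).finite_toSet.subset ?_
  rintro σ ⟨-, h2⟩
  simp only [Finset.coe_powerset, Set.mem_preimage, Set.mem_powerset_iff, Finset.coe_subset]
  intro a ha
  refine Finset.mem_product.mpr ⟨Finset.mem_univ _, Finset.mem_biUnion.mpr ⟨vals σ, ?_, ?_⟩⟩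
  · exact hK.mem_toFinset.mpr h2
  · simp only [vals, id]
    convert Finset.mem_image_of_mem Prod.snd ha

open scoped Classical in
/-- The colored form `(I, O, Δ)` of a colorless task for `n + 1` processes: the processes that
occur in `σ` may output any tuple of values that spans a simplex of `Δ*` of the values in `σ`. -/
noncomputable def ColorlessTask.toTask {V W : Type*} (T : ColorlessTask V W) (n : ℕ) :
    DecisionTask n V W where
  input := colorize n T.input
  output := colorize n T.output
  finite_input := colorize_finite n T.input T.finite_input
  finite_output := colorize_finite n T.output T.finite_output
  chromatic_input := fun _ h => h.1
  chromatic_output := fun _ h => h.1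
  Δ := fun σ =>
    { faces := {τ | τ ∈ colorize n (T.Δ (vals σ)) ∧ ids τ ⊆ ids σ}
      isRelLowerSet_faces := by
        rintro τ ⟨h1, h2⟩
        refine ⟨((colorize n _).isRelLowerSet_faces h1).1, ?_⟩
        intro τ' hτ hne
        exact ⟨((colorize n _).isRelLowerSet_faces h1).2 hτ hne,
          (Finset.image_subset_image hτ).trans h2⟩ }
  Δ_le := fun σ hσ _ h => ⟨h.1.1, T.Δ_le (vals σ) hσ.2 h.1.2⟩
  Δ_mono := fun σ hσ σ' hσ' hle _ h =>
    ⟨⟨h.1.1, T.Δ_mono (vals σ) hσ.2 (vals σ') hσ'.2 (Finset.image_subset_image hle) h.1.2⟩,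
      h.2.trans (Finset.image_subset_image hle)⟩

/-- `x` (the input value of every process) is an initial configuration, i.e. it spans an
`n`-simplex of the input complex. -/
def DecisionTask.IsInitial {n : ℕ} {V W : Type*} (T : DecisionTask n V W) (x : Fin (n + 1) → V) : Prop :=
  Finset.univ.map ⟨fun p => (p, x p), fun _ _ h => congrArg Prod.fst h⟩ ∈ T.input

/-! ### The non-uniform iterated immediate snapshot model -/

/-- Local states: initially id and input value; after each `writeread`, the id and the snapshot
(array of states, `none` for an empty cell) that it returned. -/
inductive LocalState (n : ℕ) (V : Type*) : Type _
  | init (p : Fin (n + 1)) (v : V) : LocalState n V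
  | view (p : Fin (n + 1)) (snap : Fin (n + 1) → Option (LocalState n V)) : LocalState n V

open scoped Classical in
mutual

/-- The carrier of a local state: the (process id, input value) pairs it has seen, directly or
indirectly. -/
noncomputable def LocalState.carrier {n : ℕ} {V : Type*} :
    LocalState n V → Finset (Fin (n + 1) × V)
  | .init p v => {(p, v)}
  | .view _ snap => Finset.univ.biUnion fun q => LocalState.cellCarrier (snap q)

/-- The carrier of the contents of a cell of an IS object. -/
noncomputable def LocalState.cellCarrier {n : ℕ} {V : Type*} :
    Option (LocalState n V) → Finset (Fin (n + 1) × V)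
  | none => ∅
  | some s => s.carrier

end

/-- A configuration: the state of each process, the number of IS objects it has accessed, and the
contents of the IS objects (`mem r` is the object accessed in round `r + 1`). -/
structure Config (n : ℕ) (V : Type*) where
  state : Fin (n + 1) → LocalState n V
  round : Fin (n + 1) → ℕ
  mem : ℕ → Fin (n + 1) → Option (LocalState n V)

/-- A schedule: the sets of processes that take a step, in order. -/
abbrev Schedule (n : ℕ) : Type := List (Finset (Fin (n + 1)))

namespace Config

variable {n : ℕ} {V W : Type*}

/-- The initial configuration with input values `x`. -/
def initial (x : Fin (n + 1) → V) : Config n V where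
  state p := .init p (x p)
  round _ := 0
  mem _ _ := none

/-- Memory after all processes in `P` have written their states to their next IS object. -/
def write (C : Config n V) (P : Finset (Fin (n + 1))) :
    ℕ → Fin (n + 1) → Option (LocalState n V) :=
  fun r q => if q ∈ P ∧ C.round q = r then some (C.state q) else C.mem r q

/-- The resulting configuration `CP`: all processes in `P` write their states to their next IS
object, and then all of them read it. -/
def step (C : Config n V) (P : Finset (Fin (n + 1))) : Config n V where
  state p := if p ∈ P then .view p (C.write P (C.round p)) else C.state p
  round p := if p ∈ P then C.round p + 1 else C.round p
  mem := C.write P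

/-- The configuration reached from `C` by a schedule. -/
def run (C : Config n V) (α : Schedule n) : Config n V := α.foldl step C

/-- Relative to the decision map `d`, `P` is a non-empty set of active processes that are poised to
access the same IS object. -/
def Poised (d : LocalState n V → Option W) (C : Config n V) (P : Finset (Fin (n + 1))) : Prop :=
  P.Nonempty ∧ (∀ p ∈ P, d (C.state p) = none) ∧ ∀ p ∈ P, ∀ q ∈ P, C.round p = C.round q

/-- `α` is a schedule from `C` under the decision map `d`. -/
def IsSchedule (d : LocalState n V → Option W) : Config n V → Schedule n → Prop
  | _, [] => True
  | C, P :: α => C.Poised d P ∧ IsSchedule d (C.step P) α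

/-- The inputs seen by the processes of `Q` in `C`, i.e. the carrier of the simplex formed by their
states. -/
noncomputable def carrier (C : Config n V) (Q : Finset (Fin (n + 1))) :
    Finset (Fin (n + 1) × V) :=
  open scoped Classical in Q.biUnion fun p => (C.state p).carrier

/-- The outputs in `C` (determined by `d`) respect the task specification: whenever `τ` consists of
outputs of terminated processes, `τ` is allowed for the inputs that these processes have seen. -/
def Valid (T : DecisionTask n V W) (d : LocalState n V → Option W) (C : Config n V) : Prop :=
  ∀ τ : Finset (Fin (n + 1) × W), τ.Nonempty → (∀ o ∈ τ, d (C.state o.1) = some o.2) →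
    τ ∈ T.Δ (C.carrier (ids τ))

end Config

/-- An NIIS protocol: a decision map from local states to output values or `⊥` (`none`). No process
terminates before taking a step. -/
structure Protocol (n : ℕ) (V W : Type*) where
  decide : LocalState n V → Option W
  decide_init : ∀ p v, decide (.init p v) = none

/-! ### Partial protocols and compatibility -/

section PartialProtocols

variable {n : ℕ} {V W : Type*}

/-- `U = [U₁, …, U_k]` is a sequence of non-empty subsimplices of one `n`-simplex of the input
complex such that `ids U₁, …, ids U_k` is a full 1-round schedule (an ordered partition of the set
of all processes). -/
def IsFullRoundLabel (T : DecisionTask n V W) (U : List (Finset (Fin (n + 1) × V))) : Prop :=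
  (∃ s ∈ T.input, s.card = n + 1 ∧ ∀ u ∈ U, u ⊆ s) ∧ (∀ u ∈ U, u.Nonempty) ∧
    U.Pairwise (fun u u' => Disjoint (ids u) (ids u')) ∧ ∀ p, ∃ u ∈ U, p ∈ ids u

/-- The initial configuration `x` contains `U_sum`, the union of the simplices in `U`. -/
def ContainsLabel (x : Fin (n + 1) → V) (U : List (Finset (Fin (n + 1) × V))) : Prop :=
  ∀ u ∈ U, ∀ a ∈ u, x a.1 = a.2

/-- `δ` is a wait-free partial protocol with respect to `U = [U₁, …, U_k]` that satisfies the task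
specification: only executions count that start in an initial configuration containing `U_sum` and
in which `ids U₁, …, ids U_k` are the first sets of processes to take a step. -/
def IsPartialProtocol (T : DecisionTask n V W) (U : List (Finset (Fin (n + 1) × V)))
    (δ : Protocol n V W) : Prop :=
  ∀ x : Fin (n + 1) → V, T.IsInitial x → ContainsLabel x U →
    (∀ β : Schedule n, (Config.initial x).IsSchedule δ.decide (U.map ids ++ β) →
      ((Config.initial x).run (U.map ids ++ β)).Valid T δ.decide) ∧
    ¬ ∃ α : ℕ → Finset (Fin (n + 1)), ∀ k,
      (Config.initial x).IsSchedule δ.decide (U.map ids ++ (List.range k).map α)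

/-- One more repetition of `Q`: those processes of `Q` take a step that have not terminated. -/
def cenStep (δ : Protocol n V W) (Q : Finset (Fin (n + 1))) (C : Config n V) : Config n V :=
  C.step (Q.filter fun p => (δ.decide (C.state p)).isNone)

/-- `w` is the output of `p` when, starting from `C`, the set `Q` is repeated until its processes
have terminated. If `S` is the simplex of the states of `Q` in `C`, this is the output of `p` in the
configuration `CEN(S)`. -/
def CenOutput (δ : Protocol n V W) (C : Config n V) (Q : Finset (Fin (n + 1)))
    (p : Fin (n + 1)) (w : W) : Prop :=
  ∃ k : ℕ, δ.decide (((cenStep δ Q)^[k] C).state p) = some w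

/-- Partial protocols `δ`, `δ'` with respect to `U`, `U'` (full 1-round schedules) are compatible:
for every non-empty simplex `S` (with process ids `Q`) that belongs both to the protocol complex
`F₁(U)` and to `F₁(U')`, they give the same outputs in `CEN(S)`. -/
def Compatible (T : DecisionTask n V W) (U U' : List (Finset (Fin (n + 1) × V)))
    (δ δ' : Protocol n V W) : Prop :=
  ∀ x x' : Fin (n + 1) → V, T.IsInitial x → ContainsLabel x U →
    T.IsInitial x' → ContainsLabel x' U' →
    ∀ Q : Finset (Fin (n + 1)), Q.Nonempty →
      (∀ p ∈ Q, ((Config.initial x).run (U.map ids)).state p =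
        ((Config.initial x').run (U'.map ids)).state p) →
      ∀ p ∈ Q, ∀ w, CenOutput δ ((Config.initial x).run (U.map ids)) Q p w ↔
        CenOutput δ' ((Config.initial x').run (U'.map ids)) Q p w

end PartialProtocols

/-! ### Extension-based proofs -/

/-- A configuration in the interaction, given by input values and a schedule that leads to it. -/
structure Node (n : ℕ) (V : Type*) where
  input : Fin (n + 1) → V
  sched : Schedule n

/-- The configuration that a node stands for. -/
def Node.config {n : ℕ} {V : Type*} (C : Node n V) : Config n V :=
  (Config.initial C.input).run C.sched

/-- Schedule `P` after `C`. -/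
def Node.extend {n : ℕ} {V : Type*} (C : Node n V) (P : Finset (Fin (n + 1))) : Node n V :=
  ⟨C.input, C.sched ++ [P]⟩

/-- The three classes of extension-based provers. -/
inductive ProverClass
  | restricted
  | standard
  | augmented

/-- Moves of a prover: a query `(C, P)`; an output query `(C, P, y)`; an assignment query
`(C, P, f)` with a partial function `f`; ending the phase by choosing a configuration. -/
inductive Move (n : ℕ) (V W : Type*)
  | query (C : Node n V) (P : Finset (Fin (n + 1)))
  | outputQuery (C : Node n V) (P : Finset (Fin (n + 1))) (y : W)
  | assignQuery (C : Node n V) (P : Finset (Fin (n + 1))) (f : Fin (n + 1) → Option W)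
  | endPhase (C : Node n V)

/-- A move together with the adversary's reply: the decisions of the processes in `P` in the
resulting configuration, or a schedule, or NULL (`none`). -/
inductive Event (n : ℕ) (V W : Type*)
  | query (C : Node n V) (P : Finset (Fin (n + 1))) (reply : Fin (n + 1) → Option W)
  | outputQuery (C : Node n V) (P : Finset (Fin (n + 1))) (y : W) (reply : Option (Schedule n))
  | assignQuery (C : Node n V) (P : Finset (Fin (n + 1))) (f : Fin (n + 1) → Option W)
      (reply : Option (Schedule n))
  | endPhase (C : Node n V)

/-- The interaction so far, most recent event first. -/
abbrev History (n : ℕ) (V W : Type*) := List (Event n V W)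

/-- A prover chooses its next move depending on the interaction so far. -/
abbrev Prover (n : ℕ) (V W : Type*) := History n V W → Move n V W

/-- An adversary chooses its replies depending on the interaction so far. -/
structure Adversary (n : ℕ) (V W : Type*) where
  replyQuery : History n V W → Node n V → Finset (Fin (n + 1)) → Fin (n + 1) → Option W
  replyOutput : History n V W → Node n V → Finset (Fin (n + 1)) → W → Option (Schedule n)
  replyAssign : History n V W → Node n V → Finset (Fin (n + 1)) → (Fin (n + 1) → Option W) →
    Option (Schedule n)

section Interaction

variable {n : ℕ} {V W : Type*}

/-- The event that results from a move of the prover. -/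
def Adversary.respond (A : Adversary n V W) (h : History n V W) : Move n V W → Event n V W
  | .query C P => .query C P (A.replyQuery h C P)
  | .outputQuery C P y => .outputQuery C P y (A.replyOutput h C P y)
  | .assignQuery C P f => .assignQuery C P f (A.replyAssign h C P f)
  | .endPhase C => .endPhase C

/-- The interaction of `A` and `R` after `k` moves. -/
def play (A : Adversary n V W) (R : Prover n V W) : ℕ → History n V W
  | 0 => []
  | k + 1 => A.respond (play A R k) (R (play A R k)) :: play A R k

namespace History

open scoped Classical in
/-- The decision for a local state as far as it has been disclosed by replies to queries `(C, P)`;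
`none` means "active" for initial states and for states in such a reply. -/
noncomputable def decision : History n V W → LocalState n V → Option W
  | [], _ => none
  | .query C P reply :: h, s =>
      if hs : ∃ p ∈ P, (C.extend P).config.state p = s then reply hs.choose else decision h s
  | .outputQuery _ _ _ _ :: h, s => decision h s
  | .assignQuery _ _ _ _ :: h, s => decision h s
  | .endPhase _ :: h, s => decision h s

/-- The set `A(φ)` of configurations with which the current phase `φ` starts: all initial
configurations in phase 1; after a phase that ended with `C`, the configurations reached by the
schedule of `C` from the initial configurations that differ from that of `C` only in the inputs of
processes that do not occur in the schedule. -/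
def phaseStart (T : DecisionTask n V W) : History n V W → Set (Node n V)
  | [] => {D | T.IsInitial D.input ∧ D.sched = []}
  | .endPhase C :: _ => {D | T.IsInitial D.input ∧ D.sched = C.sched ∧
      ∀ P ∈ C.sched, ∀ p ∈ P, D.input p = C.input p}
  | .query _ _ _ :: h => phaseStart T h
  | .outputQuery _ _ _ _ :: h => phaseStart T h
  | .assignQuery _ _ _ _ :: h => phaseStart T h

/-- The set `A'(φ)` of configurations reached by queries in the current phase. -/
def reached : History n V W → Set (Node n V)
  | [] => ∅
  | .endPhase _ :: _ => ∅
  | .query C P _ :: h => insert (C.extend P) (reached h)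
  | .outputQuery _ _ _ _ :: h => reached h
  | .assignQuery _ _ _ _ :: h => reached h

/-- The rules for the next move of a prover. If all processes have terminated in all configurations
of `A(φ)` at the start of phase `φ`, then the prover can neither make a query `(C, P)` nor ever end
the phase. -/
def Legal (c : ProverClass) (T : DecisionTask n V W) (h : History n V W) : Move n V W → Prop
  | .query C P => C ∈ h.phaseStart T ∪ h.reached ∧ C.config.Poised h.decision P
  | .outputQuery C P _ => (c = .standard ∨ c = .augmented) ∧
      C ∈ h.phaseStart T ∪ h.reached ∧ C.config.Poised h.decision P
  | .assignQuery C P f => c = .augmented ∧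
      C ∈ h.phaseStart T ∪ h.reached ∧ ∀ q, f q ≠ none → q ∈ P
  | .endPhase C => C ∈ h.reached

/-- Some reply to a query disclosed output values that are not valid. -/
def Violation (T : DecisionTask n V W) (h : History n V W) : Prop :=
  ∃ C P reply, Event.query C P reply ∈ h ∧ ¬ (C.extend P).config.Valid T h.decision

end History

/-- `β` is a `P`-only schedule from `C` under the protocol `δ`. -/
def IsOnlySchedule (δ : Protocol n V W) (C : Config n V) (P : Finset (Fin (n + 1)))
    (β : Schedule n) : Prop :=
  C.IsSchedule δ.decide β ∧ ∀ B ∈ β, B ⊆ P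

/-- The reply in an event is correct for the protocol `δ`. -/
def Event.Correct (δ : Protocol n V W) : Event n V W → Prop
  | .query C P reply => ∀ p ∈ P, δ.decide ((C.extend P).config.state p) = reply p
  | .outputQuery C P y (some β) => IsOnlySchedule δ C.config P β ∧
      ∃ p ∈ P, δ.decide ((C.config.run β).state p) = some y
  | .outputQuery C P y none => ¬ ∃ β, IsOnlySchedule δ C.config P β ∧
      ∃ p ∈ P, δ.decide ((C.config.run β).state p) = some y
  | .assignQuery C P f (some β) => IsOnlySchedule δ C.config P β ∧
      ∀ q w, f q = some w → δ.decide ((C.config.run β).state q) = some w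
  | .assignQuery C P f none => ¬ ∃ β, IsOnlySchedule δ C.config P β ∧
      ∀ q w, f q = some w → δ.decide ((C.config.run β).state q) = some w
  | .endPhase _ => True

/-- The replies in `h` are those of some protocol. -/
def Truthful (h : History n V W) : Prop :=
  ∃ δ : Protocol n V W, ∀ e ∈ h, e.Correct δ

/-- An infinite sequence of moves ends infinitely many phases. -/
def InfinitelyManyPhases (m : ℕ → Move n V W) : Prop :=
  ∀ N, ∃ k ≥ N, ∃ C, m k = .endPhase C

/-- In an infinite sequence of moves, the prover constructs an infinite chain of queries. In a phase
only finitely many chains (and finitely many output and assignment queries) are allowed; so from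
some point on all moves are queries `(C, P)` of one phase, and these are divided into finitely many
chains, in each of which a query is made in the configuration resulting from the previous one. -/
def InfiniteChain (m : ℕ → Move n V W) : Prop :=
  ∃ (N : ℕ) (C : ℕ → Node n V) (P : ℕ → Finset (Fin (n + 1))),
    (∀ k ≥ N, m k = .query (C k) (P k)) ∧
    ∃ (r : ℕ) (chain : ℕ → Fin r), ∀ i j, N ≤ i → i < j → chain i = chain j →
      (∀ l, i < l → l < j → chain l ≠ chain i) →
      (C j).config = ((C i).extend (P i)).config

/-- `A` wins against `R`: as long as `R` keeps to the rules, the replies of `A` are those of some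
protocol and no violation of the task specification is found, and `R` does not manage to construct
an infinite chain of queries or infinitely many phases. -/
def Adversary.WinsAgainst (c : ProverClass) (T : DecisionTask n V W) (A : Adversary n V W)
    (R : Prover n V W) : Prop :=
  (∀ k, (∀ j < k, (play A R j).Legal c T (R (play A R j))) →
    Truthful (play A R k) ∧ ¬ (play A R k).Violation T) ∧
  ¬ ((∀ j, (play A R j).Legal c T (R (play A R j))) ∧
    (InfinitelyManyPhases (fun j => R (play A R j)) ∨
      InfiniteChain (fun j => R (play A R j))))

end Interaction

/-!
Both sides are equivalent to the existence of a *hub map* `H` (`IsHub`), which depends neither on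
the class of provers nor on any model of computation: to every input simplex `σ` it assigns an
output value that is allowed for `σ`, such that for a face `σ ⊆ σ'` the values `H σ` and `H σ'` are
connected by a path in the 1-skeleton of the outputs allowed for `σ'`.

*To a hub map* lead the outputs of processes that run alone after the first round
(`exists_hub_of_outputs`). They are allowed for the inputs these processes have seen, so the point is
that the outputs `w` of `p` and `u` of `q` are connected when both processes can be in one
configuration. Suppose that they are not, and call `p` and `q` *bivalent*. If both processes are
still active, each of the schedules `{p} {q}`, `{p, q}` and `{q} {p}` gives a pair of new states, and
these pairs form a path from the state of `p` after a step alone to that of `q`. Hence one of the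
pairs is bivalent again (`Bivalent.next`). A process that has terminated with an output not connected
to what the other one outputs when it runs alone contradicts validity. So bivalence persists forever.
A partial protocol would have an infinite execution (`IsPartialProtocol.not_bivalent`), and
compatibility makes the outputs independent of the chosen partial protocol
(`exists_hub_of_partialProtocols`). Against an adversary, a restricted prover can learn by queries
alone what is needed, and end a phase after each such step, for infinitely many phases
(`BivalentAt.next`, `exists_hub_of_adversary`).

*From a hub map* one decides by averaging. A local state `s` of depth at least two is a snapshot;
giving each state of the first round a number, let the position of `s` be the mean of the positions in
its snapshot. All snapshots of one round share a cell, so the positions of the states of depth at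
least `d` in one execution lie within a distance `κ d` that tends to zero (`WF.exists_interval`). For
the indicator function of the carriers with at least `j` elements this gives a weight, decreasing
in `j`. The carriers of one execution form a chain, and cutting the weights at a threshold singles out
one carrier, the label of `s` (`IsLab`). Processes of one execution that are far from the threshold
have the same label `τ` and may output `H τ`; near the threshold, processes follow a path between hub
values.

The adversary fixes a finite part of a protocol at a time: a decision map on the states of bounded
depth, together with an interval to which the thresholds are still confined (`Know`, `Good`).
A pattern of outputs that is admissible beyond this part can be realised by narrowing the interval
(`Good.exists_spot`): either all labels are determined and the same, or some label is undetermined,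
and the later states are led along a path to the value of one of the labels still possible. Whatever
is fixed later is admissible in this sense (`Future`). Hence an output or assignment query can be
answered at once and for good: a reply is realised if an admissible one exists, and otherwise NULL
stays correct (`Good.exists_answered`). When a phase ends with a further process having taken its
first step, the processes that have seen no more than the known part of the first round are made to
terminate (`Good.exists_fill`). Therefore no chain is infinite, and there are only finitely many
phases (`IsHub.exists_adversary`).

The same construction, applied along `[U₁, …, U_k]`, yields the partial protocols
(`IsHub.exists_partialProtocols`). They are compatible for the following reason. In `CEN(S)` all
processes repeat the same snapshot, so their weights are means over `ids(S)`, that is, multiples of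
`1 / |ids(S)| ≥ 1 / (n + 1)`. As the thresholds are kept below `1 / (n + 1)`, the output is the value
of `H` at the largest carrier in `S`, which does not depend on the partial protocol.
-/

/-! ### Local states: depth, seen first-round states, and averages -/

namespace LocalState

variable {n : ℕ} {V : Type*}

mutual

/-- The depth of a local state; in an execution, the number of IS objects that the process has
accessed. -/
def depth : LocalState n V → ℕ
  | .init _ _ => 0
  | .view _ snap => 1 + Finset.univ.sup fun q => cellDepth (snap q)

/-- The depth of the contents of a cell. -/
def cellDepth : Option (LocalState n V) → ℕ
  | none => 0
  | some s => depth s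

end

/-- `Sees s v`: the first-round state `v` occurs in `s`, i.e. the process in state `s` has seen it,
directly or indirectly. -/
inductive Sees : LocalState n V → LocalState n V → Prop
  | refl {s : LocalState n V} : s.depth = 1 → Sees s s
  | cell {p : Fin (n + 1)} {snap : Fin (n + 1) → Option (LocalState n V)} {q : Fin (n + 1)}
      {s v : LocalState n V} : snap q = some s → Sees s v → Sees (.view p snap) v

/-- The number of non-empty cells of a snapshot. -/
def cells (snap : Fin (n + 1) → Option (LocalState n V)) : ℕ :=
  (Finset.univ.filter fun q => (snap q).isSome).card

mutual

/-- The position of a local state with respect to a weight function `g` on first-round states: `g`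
itself on first-round states; afterwards a process moves to the mean of the positions that it sees
in its snapshot. -/
noncomputable def pos (g : LocalState n V → ℝ) : LocalState n V → ℝ
  | .init _ _ => 0
  | .view p snap =>
      if depth (.view p snap) = 1 then g (.view p snap)
      else (∑ q, cellPos g (snap q)) / cells snap

/-- The contribution of a cell to the mean in `pos`. -/
noncomputable def cellPos (g : LocalState n V → ℝ) : Option (LocalState n V) → ℝ
  | none => 0
  | some s => pos g s

end

theorem depth_cell_lt {p q : Fin (n + 1)} {snap : Fin (n + 1) → Option (LocalState n V)}
    {s : LocalState n V} (h : snap q = some s) : s.depth < (LocalState.view p snap).depth := by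
  have h1 : cellDepth (snap q) ≤ Finset.univ.sup fun q => cellDepth (snap q) :=
    Finset.le_sup (f := fun q => cellDepth (snap q)) (Finset.mem_univ q)
  rw [h] at h1
  simp only [cellDepth] at h1
  simp only [depth]
  omega

theorem one_le_depth_view {p : Fin (n + 1)} {snap : Fin (n + 1) → Option (LocalState n V)} :
    1 ≤ (LocalState.view p snap).depth := by
  simp only [depth]
  omega

theorem pos_of_depth_eq_one (g : LocalState n V → ℝ) {s : LocalState n V} (h : s.depth = 1) :
    pos g s = g s := by
  cases s with
  | init p v => simp [depth] at h
  | view p snap => rw [pos, if_pos h]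

theorem pos_view (g : LocalState n V → ℝ) {p : Fin (n + 1)}
    {snap : Fin (n + 1) → Option (LocalState n V)} (h : (LocalState.view p snap).depth ≠ 1) :
    pos g (.view p snap) = (∑ q, cellPos g (snap q)) / cells snap := by
  rw [pos, if_neg h]

/-- Induction on local states along the cells of snapshots. -/
theorem cell_induction {P : LocalState n V → Prop} (init : ∀ p v, P (.init p v))
    (view : ∀ p snap, (∀ q s, snap q = some s → P s) → P (.view p snap)) (s : LocalState n V) :
    P s := by
  induction hd : s.depth using Nat.strong_induction_on generalizing s with
  | _ d ih =>
    cases s with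
    | init p v => exact init p v
    | view p snap =>
      exact view p snap fun q s hs => ih _ (hd ▸ depth_cell_lt hs) s rfl

theorem Sees.carrier_subset {s v : LocalState n V} (h : Sees s v) : v.carrier ⊆ s.carrier := by
  classical
  induction h with
  | refl _ => exact subset_rfl
  | @cell p snap q s v hq _ ih =>
    refine ih.trans ?_
    intro a ha
    rw [carrier, Finset.mem_biUnion]
    refine ⟨q, Finset.mem_univ _, ?_⟩
    rw [hq, cellCarrier]
    exact ha

theorem pos_congr {g g' : LocalState n V → ℝ} (s : LocalState n V)
    (h : ∀ v, Sees s v → g v = g' v) : pos g s = pos g' s := by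
  induction s using cell_induction with
  | init p v => simp [pos]
  | view p snap ih =>
    by_cases hd : (LocalState.view p snap).depth = 1
    · rw [pos_of_depth_eq_one g hd, pos_of_depth_eq_one g' hd]
      exact h _ (.refl hd)
    · rw [pos_view g hd, pos_view g' hd]
      congr 1
      refine Finset.sum_congr rfl fun q _ => ?_
      cases hq : snap q with
      | none => simp [cellPos]
      | some s => simpa [cellPos] using ih q s hq fun v hv => h v (.cell hq hv)

theorem pos_mono {g g' : LocalState n V → ℝ} (s : LocalState n V)
    (h : ∀ v, Sees s v → g v ≤ g' v) : pos g s ≤ pos g' s := by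
  induction s using cell_induction with
  | init p v => simp [pos]
  | view p snap ih =>
    by_cases hd : (LocalState.view p snap).depth = 1
    · rw [pos_of_depth_eq_one g hd, pos_of_depth_eq_one g' hd]
      exact h _ (.refl hd)
    · rw [pos_view g hd, pos_view g' hd]
      refine div_le_div_of_nonneg_right (Finset.sum_le_sum fun q _ => ?_) (Nat.cast_nonneg _)
      cases hq : snap q with
      | none => simp [cellPos]
      | some s => simpa [cellPos] using ih q s hq fun v hv => h v (.cell hq hv)

theorem pos_zero (s : LocalState n V) : pos (fun _ => 0) s = 0 := by
  induction s using cell_induction with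
  | init p v => simp [pos]
  | view p snap ih =>
    by_cases hd : (LocalState.view p snap).depth = 1
    · rw [pos_of_depth_eq_one _ hd]
    · rw [pos_view _ hd, Finset.sum_eq_zero, zero_div]
      intro q _
      cases hq : snap q with
      | none => simp [cellPos]
      | some s => simpa [cellPos] using ih q s hq

theorem pos_nonneg {g : LocalState n V → ℝ} (hg : ∀ v, 0 ≤ g v) (s : LocalState n V) :
    0 ≤ pos g s := by
  rw [← pos_zero s]
  exact pos_mono s fun v _ => hg v

/-- A positive position is caused by a seen first-round state of positive weight. -/
theorem exists_sees_of_pos {g : LocalState n V → ℝ} {s : LocalState n V} (h : 0 < pos g s) :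
    ∃ v, Sees s v ∧ 0 < g v := by
  by_contra! hc
  have := pos_mono (g := g) (g' := fun _ => 0) s fun v hv => hc v hv
  rw [pos_zero] at this
  linarith

theorem sum_cellPos (g : LocalState n V → ℝ) (snap : Fin (n + 1) → Option (LocalState n V)) :
    ∑ q, cellPos g (snap q) =
      ∑ q ∈ Finset.univ.filter fun q => (snap q).isSome, cellPos g (snap q) := by
  rw [Finset.sum_filter]
  refine Finset.sum_congr rfl fun q _ => ?_
  cases snap q <;> simp [cellPos]

theorem cells_le (snap : Fin (n + 1) → Option (LocalState n V)) : cells snap ≤ n + 1 := by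
  simpa [cells] using Finset.card_filter_le (Finset.univ : Finset (Fin (n + 1))) fun q => (snap q).isSome

theorem cells_pos {snap : Fin (n + 1) → Option (LocalState n V)} {q : Fin (n + 1)}
    (hq : snap q ≠ none) : 0 < cells snap :=
  Finset.card_pos.mpr ⟨q, by simpa [Option.isSome_iff_ne_none] using hq⟩

theorem lt_pos_view {g : LocalState n V → ℝ} {p : Fin (n + 1)} {q₀ : Fin (n + 1)}
    {snap : Fin (n + 1) → Option (LocalState n V)} (hd : (LocalState.view p snap).depth ≠ 1)
    (hq₀ : snap q₀ ≠ none) {a : ℝ} (h : ∀ q s, snap q = some s → a < pos g s) :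
    a < pos g (.view p snap) := by
  have hc : (0 : ℝ) < cells snap := by exact_mod_cast cells_pos hq₀
  rw [pos_view g hd, lt_div_iff₀ hc, sum_cellPos]
  have : a * (cells snap : ℝ) = ∑ q ∈ Finset.univ.filter fun q => (snap q).isSome, a := by
    simp [cells, mul_comm]
  rw [this]
  refine Finset.sum_lt_sum_of_nonempty ⟨q₀, by simpa [Option.isSome_iff_ne_none] using hq₀⟩ ?_
  intro q hq
  obtain ⟨s, hs⟩ := Option.isSome_iff_exists.mp (Finset.mem_filter.mp hq).2
  rw [hs, cellPos]
  exact h q s hs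

/-- If all positions in a snapshot lie in `[a, b]` and one of them is that of `s₀`, then the mean is at least
as far from the end points as if all others were there. -/
theorem pos_view_mem {g : LocalState n V → ℝ} {p : Fin (n + 1)} {q₀ : Fin (n + 1)}
    {snap : Fin (n + 1) → Option (LocalState n V)} (hd : (LocalState.view p snap).depth ≠ 1)
    {s₀ : LocalState n V} (hq₀ : snap q₀ = some s₀) {a b : ℝ}
    (h : ∀ q s, snap q = some s → a ≤ pos g s ∧ pos g s ≤ b) :
    a + (pos g s₀ - a) / (n + 1) ≤ pos g (.view p snap) ∧
      pos g (.view p snap) ≤ b - (b - pos g s₀) / (n + 1) := by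
  have hc : (0 : ℝ) < cells snap := by exact_mod_cast cells_pos (q := q₀) (by simp [hq₀])
  have hcn : (cells snap : ℝ) ≤ n + 1 := by exact_mod_cast cells_le snap
  set F := Finset.univ.filter fun q => (snap q).isSome with hF
  have hmem : q₀ ∈ F := by simp [hF, hq₀]
  have hcard : (F.card : ℝ) = cells snap := rfl
  have hval : ∀ q ∈ F, a ≤ cellPos g (snap q) ∧ cellPos g (snap q) ≤ b := by
    intro q hq
    obtain ⟨s, hs⟩ := Option.isSome_iff_exists.mp (Finset.mem_filter.mp hq).2
    rw [hs, cellPos]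
    exact h q s hs
  have h₀ : cellPos g (snap q₀) = pos g s₀ := by rw [hq₀, cellPos]
  have key : ∀ y : ℝ, ∑ q ∈ F, (cellPos g (snap q) - y) = (∑ q ∈ F, cellPos g (snap q)) - cells snap * y := by
    intro y
    rw [Finset.sum_sub_distrib, Finset.sum_const, nsmul_eq_mul, hcard]
  have h1 : pos g s₀ - a ≤ (∑ q ∈ F, cellPos g (snap q)) - cells snap * a := by
    rw [← key, ← h₀]
    exact Finset.single_le_sum (f := fun q => cellPos g (snap q) - a)
      (fun q hq => sub_nonneg.mpr (hval q hq).1) hmem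
  have h2 : b - pos g s₀ ≤ cells snap * b - ∑ q ∈ F, cellPos g (snap q) := by
    have : ∑ q ∈ F, (b - cellPos g (snap q)) = cells snap * b - ∑ q ∈ F, cellPos g (snap q) := by
      rw [Finset.sum_sub_distrib, Finset.sum_const, nsmul_eq_mul, hcard]
    rw [← this, ← h₀]
    exact Finset.single_le_sum (f := fun q => b - cellPos g (snap q))
      (fun q hq => sub_nonneg.mpr (hval q hq).2) hmem
  have ha := (h q₀ s₀ hq₀).1
  have hb := (h q₀ s₀ hq₀).2
  have hN : (0 : ℝ) < n + 1 := by positivity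
  rw [pos_view g hd, sum_cellPos]
  constructor
  · have e1 : (pos g s₀ - a) / (n + 1) ≤ (pos g s₀ - a) / cells snap :=
      div_le_div_of_nonneg_left (by linarith) hc hcn
    have e2 : a + (pos g s₀ - a) / cells snap ≤ (∑ q ∈ F, cellPos g (snap q)) / cells snap := by
      rw [le_div_iff₀ hc, add_mul, div_mul_cancel₀ _ hc.ne']
      linarith
    linarith
  · have e1 : (b - pos g s₀) / (n + 1) ≤ (b - pos g s₀) / cells snap :=
      div_le_div_of_nonneg_left (by linarith) hc hcn
    have e2 : (∑ q ∈ F, cellPos g (snap q)) / cells snap ≤ b - (b - pos g s₀) / cells snap := by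
      rw [div_le_iff₀ hc, sub_mul, div_mul_cancel₀ _ hc.ne']
      linarith
    linarith

end LocalState

/-! ### The structure of executions -/

namespace Config

variable {n : ℕ} {V W : Type*}

open LocalState

/-- In the execution that led to `D`, process `p` was in state `s` after `r` rounds. -/
def Occ (D : Config n V) (p : Fin (n + 1)) (r : ℕ) (s : LocalState n V) : Prop :=
  D.mem r p = some s ∨ (D.round p = r ∧ D.state p = s)

/-- The structural invariants of the configurations that are reached from the initial configuration
with inputs `x`: snapshots of one IS object are nested and share a cell. -/
structure WF (x : Fin (n + 1) → V) (D : Config n V) : Prop where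
  mem_none : ∀ p r, D.mem r p = none ↔ D.round p ≤ r
  zero : ∀ p s, D.Occ p 0 s → s = .init p (x p)
  succ : ∀ p r s, D.Occ p (r + 1) s →
    ∃ snap, s = .view p snap ∧ snap p ≠ none ∧ ∀ q, snap q = none ∨ snap q = D.mem r q
  nested : ∀ r p p' snap snap', D.Occ p (r + 1) (.view p snap) →
    D.Occ p' (r + 1) (.view p' snap') →
    (∀ q, snap q ≠ none → snap' q ≠ none) ∨ (∀ q, snap' q ≠ none → snap q ≠ none)
  common : ∀ r, ∃ q₀, ∀ p snap, D.Occ p (r + 1) (.view p snap) → snap q₀ ≠ none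

theorem WF.initial (x : Fin (n + 1) → V) : (Config.initial x).WF x where
  mem_none := by simp [Config.initial]
  zero := by
    rintro p s (h | ⟨-, h⟩)
    · simp [Config.initial] at h
    · exact h.symm
  succ := by
    rintro p r s (h | ⟨h, -⟩) <;> simp [Config.initial] at h
  nested := by
    rintro r p p' snap snap' (h | ⟨h, -⟩) <;> simp [Config.initial] at h
  common := by
    refine fun r => ⟨0, ?_⟩
    rintro p snap (h | ⟨h, -⟩) <;> simp [Config.initial] at h

theorem occ_step {x : Fin (n + 1) → V} {D : Config n V} (h : D.WF x) (P : Finset (Fin (n + 1)))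
    (p : Fin (n + 1)) (r : ℕ) (s : LocalState n V) :
    (D.step P).Occ p r s ↔
      D.Occ p r s ∨ (p ∈ P ∧ r = D.round p + 1 ∧ s = .view p (D.write P (D.round p))) := by
  by_cases hp : p ∈ P
  · simp only [Occ, step, write, hp, true_and, if_true]
    by_cases hr : D.round p = r
    · subst hr
      have : D.mem (D.round p) p = none := (h.mem_none p _).mpr le_rfl
      simp [this]
    · simp [hr, eq_comm]
  · simp [Occ, step, write, hp]

theorem WF.step {x : Fin (n + 1) → V} {D : Config n V} (h : D.WF x) (P : Finset (Fin (n + 1))) :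
    (D.step P).WF x := by
  have hw : ∀ r q, D.mem r q ≠ none → (D.step P).mem r q = D.mem r q := by
    intro r q hq
    have : ¬ D.round q ≤ r := fun hle => hq ((h.mem_none q r).mpr hle)
    simp only [Config.step, write]
    rw [if_neg]
    rintro ⟨-, hr⟩
    omega
  have hself : ∀ p ∈ P, D.write P (D.round p) p = some (D.state p) := by
    intro p hp
    simp [write, hp]
  have hsnap : ∀ p r snap, D.Occ p (r + 1) (.view p snap) → ∀ q, snap q ≠ none →
      D.mem r q ≠ none := by
    intro p r snap ho q hq
    obtain ⟨snap', he, -, hs⟩ := h.succ p r _ ho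
    obtain rfl : snap = snap' := by simpa using he
    rcases hs q with h1 | h1
    · exact absurd h1 hq
    · rwa [← h1]
  have hold : ∀ p r snap, D.Occ p (r + 1) (.view p snap) → ∀ p' ∈ P, r = D.round p' → ∀ q,
      snap q ≠ none → D.write P (D.round p') q ≠ none := by
    intro p r snap ho p' _ hr q hq
    have h1 := hsnap p r snap ho q hq
    have h2 := hw r q h1
    rw [← hr]
    change (D.step P).mem r q ≠ none
    rw [h2]
    exact h1
  constructor
  · intro p r
    by_cases hp : p ∈ P
    · simp only [Config.step, write, hp, true_and, if_true]
      split_ifs with hr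
      · simp; omega
      · rw [h.mem_none]; omega
    · simp [Config.step, write, hp, h.mem_none]
  · intro p s ho
    rw [occ_step h] at ho
    rcases ho with ho | ⟨-, h0, -⟩
    · exact h.zero p s ho
    · omega
  · intro p r s ho
    rw [occ_step h] at ho
    rcases ho with ho | ⟨hp, hr, rfl⟩
    · obtain ⟨snap, he, hsp, hs⟩ := h.succ p r s ho
      refine ⟨snap, he, hsp, fun q => ?_⟩
      by_cases hq : snap q = none
      · exact Or.inl hq
      · refine Or.inr ?_
        have h1 := (hs q).resolve_left hq
        rw [hw r q (by rwa [← h1])]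
        exact h1
    · refine ⟨_, rfl, by simp [hself p hp], fun q => Or.inr ?_⟩
      have : r = D.round p := by omega
      rw [this]
      rfl
  · intro r p p' snap snap' ho ho'
    rw [occ_step h] at ho ho'
    rcases ho with ho | ⟨hp, hr, he⟩ <;> rcases ho' with ho' | ⟨hp', hr', he'⟩
    · exact h.nested r p p' snap snap' ho ho'
    · left
      obtain rfl : snap' = _ := by simpa using he'
      exact hold p r snap ho p' hp' (by omega)
    · right
      obtain rfl : snap = _ := by simpa using he
      exact hold p' r snap' ho' p hp (by omega)
    · left
      obtain rfl : snap = _ := by simpa using he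
      obtain rfl : snap' = _ := by simpa using he'
      have : D.round p = D.round p' := by omega
      rw [this]
      exact fun q hq => hq
  · intro r
    by_cases hex : ∃ p snap, D.Occ p (r + 1) (.view p snap)
    · obtain ⟨q₀, hq₀⟩ := h.common r
      obtain ⟨p₁, snap₁, ho₁⟩ := hex
      refine ⟨q₀, fun p snap ho => ?_⟩
      rw [occ_step h] at ho
      rcases ho with ho | ⟨hp, hr, he⟩
      · exact hq₀ p snap ho
      · obtain rfl : snap = _ := by simpa using he
        exact hold p₁ r snap₁ ho₁ p hp (by omega) q₀ (hq₀ _ _ ho₁)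
    · by_cases hP : ∃ p ∈ P, D.round p = r
      · obtain ⟨p₀, hp₀, hr₀⟩ := hP
        refine ⟨p₀, fun p snap ho => ?_⟩
        rw [occ_step h] at ho
        rcases ho with ho | ⟨hp, hr, he⟩
        · exact absurd ⟨p, snap, ho⟩ hex
        · obtain rfl : snap = _ := by simpa using he
          have : D.round p = D.round p₀ := by omega
          rw [this, hself p₀ hp₀]
          simp
      · refine ⟨0, fun p snap ho => ?_⟩
        rw [occ_step h] at ho
        rcases ho with ho | ⟨hp, hr, he⟩
        · exact absurd ⟨p, snap, ho⟩ hex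
        · exact absurd ⟨p, hp, by omega⟩ hP

theorem WF.run {x : Fin (n + 1) → V} {D : Config n V} (h : D.WF x) (α : Schedule n) :
    (D.run α).WF x := by
  induction α generalizing D with
  | nil => exact h
  | cons P α ih => exact ih (h.step P)

theorem WF.run_initial (x : Fin (n + 1) → V) (α : Schedule n) :
    ((Config.initial x).run α).WF x :=
  (WF.initial x).run α

theorem occ_state (D : Config n V) (p : Fin (n + 1)) : D.Occ p (D.round p) (D.state p) :=
  Or.inr ⟨rfl, rfl⟩

section WF

variable {x : Fin (n + 1) → V} {D : Config n V}

theorem WF.round_of_occ (h : D.WF x) {p : Fin (n + 1)} {r : ℕ} {s : LocalState n V}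
    (hs : D.Occ p r s) : r ≤ D.round p := by
  rcases hs with hs | ⟨hr, -⟩
  · by_contra hc
    have := (h.mem_none p r).mpr (by omega)
    simp [hs] at this
  · exact hr.ge

theorem WF.occ_cell (h : D.WF x) {p q : Fin (n + 1)} {r : ℕ}
    {snap : Fin (n + 1) → Option (LocalState n V)} {s : LocalState n V}
    (ho : D.Occ p (r + 1) (.view p snap)) (hq : snap q = some s) : D.mem r q = some s := by
  obtain ⟨snap', he, -, hs⟩ := h.succ p r _ ho
  obtain rfl : snap = snap' := by simpa using he
  rcases hs q with h1 | h1
  · simp [hq] at h1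
  · rw [← h1, hq]

theorem WF.occ_self_ne_none (h : D.WF x) {p : Fin (n + 1)} {r : ℕ}
    {snap : Fin (n + 1) → Option (LocalState n V)}
    (ho : D.Occ p (r + 1) (.view p snap)) : snap p ≠ none := by
  obtain ⟨snap', he, hs, -⟩ := h.succ p r _ ho
  obtain rfl : snap = snap' := by simpa using he
  exact hs

theorem WF.depth_eq (h : D.WF x) {p : Fin (n + 1)} {r : ℕ} {s : LocalState n V}
    (hs : D.Occ p r s) : s.depth = r := by
  induction r generalizing p s with
  | zero => rw [h.zero p s hs, depth]
  | succ r ih =>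
    obtain ⟨snap, rfl, hp, -⟩ := h.succ p r s hs
    have hcell : ∀ q, cellDepth (snap q) ≤ r := by
      intro q
      cases hq : snap q with
      | none => simp [cellDepth]
      | some s => exact (ih (Or.inl (h.occ_cell hs hq))).le
    obtain ⟨s', hs'⟩ := Option.ne_none_iff_exists'.mp hp
    have hself : cellDepth (snap p) = r := by
      rw [hs', cellDepth]
      exact ih (Or.inl (h.occ_cell hs hs'))
    rw [depth, add_comm, add_left_inj]
    refine le_antisymm (Finset.sup_le fun q _ => hcell q) ?_
    rw [← hself]
    exact Finset.le_sup (f := fun q => cellDepth (snap q)) (Finset.mem_univ p)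

theorem WF.depth_state (h : D.WF x) (p : Fin (n + 1)) : (D.state p).depth = D.round p :=
  h.depth_eq (D.occ_state p)

theorem WF.occ_proc_unique (h : D.WF x) {p p' : Fin (n + 1)} {r r' : ℕ} {s : LocalState n V}
    (hs : D.Occ p r s) (hs' : D.Occ p' r' s) : p = p' := by
  have hr : r = r' := (h.depth_eq hs).symm.trans (h.depth_eq hs')
  subst hr
  cases r with
  | zero =>
    have := (h.zero p s hs).symm.trans (h.zero p' s hs')
    simp at this
    exact this.1
  | succ r =>
    obtain ⟨snap, rfl, -⟩ := h.succ p r s hs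
    obtain ⟨snap', he, -⟩ := h.succ p' r _ hs'
    simp at he
    exact he.1

/-- A process has been in a state of every smaller depth, and has since seen all that it had seen
then. -/
theorem WF.exists_ancestor (h : D.WF x) {p : Fin (n + 1)} {r d : ℕ} {s : LocalState n V}
    (hs : D.Occ p r s) (hd : d < r) :
    ∃ s', D.mem d p = some s' ∧ ∀ v, Sees s' v → Sees s v := by
  induction r generalizing s with
  | zero => omega
  | succ r ih =>
    obtain ⟨snap, rfl, hp, -⟩ := h.succ p r s hs
    obtain ⟨s₁, hs₁⟩ := Option.ne_none_iff_exists'.mp hp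
    have hm := h.occ_cell hs hs₁
    rcases Nat.lt_succ_iff_lt_or_eq.mp hd with hlt | rfl
    · obtain ⟨s', hs', hv⟩ := ih (Or.inl hm) hlt
      exact ⟨s', hs', fun v h' => .cell hs₁ (hv v h')⟩
    · exact ⟨s₁, hm, fun v h' => .cell hs₁ h'⟩

theorem WF.occ_of_sees (h : D.WF x) {p : Fin (n + 1)} {r : ℕ} {s v : LocalState n V}
    (hs : D.Occ p r s) (hv : Sees s v) : ∃ q, D.Occ q 1 v := by
  induction hv generalizing p r with
  | refl h1 => exact ⟨p, (h.depth_eq hs ▸ h1) ▸ hs⟩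
  | @cell p' snap q s v hq _ ih =>
    cases r with
    | zero => simpa using h.zero p _ hs
    | succ r =>
      obtain ⟨snap', he, -⟩ := h.succ p r _ hs
      simp only [LocalState.view.injEq] at he
      obtain ⟨rfl, rfl⟩ := he
      exact ih (Or.inl (h.occ_cell hs hq))

/-- Induction on the states of depth at least `d` that occur in an execution. -/
theorem WF.occ_induction (h : D.WF x) {P : LocalState n V → Prop} {d : ℕ}
    (base : ∀ p s, D.Occ p d s → P s)
    (step : ∀ p e snap, d ≤ e → D.Occ p (e + 1) (.view p snap) →
      (∀ q s, snap q = some s → D.mem e q = some s ∧ P s) → P (.view p snap))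
    {e : ℕ} (hde : d ≤ e) {p : Fin (n + 1)} {s : LocalState n V} (hs : D.Occ p e s) : P s := by
  induction e, hde using Nat.le_induction generalizing p s with
  | base => exact base p s hs
  | succ e hde ih =>
    obtain ⟨snap, rfl, -⟩ := h.succ p e s hs
    exact step p e snap hde hs fun q s' hq => ⟨h.occ_cell hs hq, ih (Or.inl (h.occ_cell hs hq))⟩

/-- The carrier of a first-round state consists of the inputs of the processes in its snapshot. -/
theorem WF.carrier_first (h : D.WF x) {p : Fin (n + 1)} {snap : Fin (n + 1) → Option (LocalState n V)}
    (hs : D.Occ p 1 (.view p snap)) (a : Fin (n + 1) × V) :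
    a ∈ (LocalState.view p snap).carrier ↔ snap a.1 ≠ none ∧ a.2 = x a.1 := by
  classical
  have hin : ∀ q s, snap q = some s → s = .init q (x q) := fun q s hq =>
    h.zero q s (Or.inl (h.occ_cell hs hq))
  rw [LocalState.carrier, Finset.mem_biUnion]
  constructor
  · rintro ⟨q, -, hq⟩
    cases hs' : snap q with
    | none => simp [hs', cellCarrier] at hq
    | some s =>
      rw [hs', cellCarrier, hin q s hs', LocalState.carrier, Finset.mem_singleton] at hq
      subst hq
      simp [hs']
  · rintro ⟨h1, h2⟩
    obtain ⟨s, hs'⟩ := Option.ne_none_iff_exists'.mp h1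
    refine ⟨a.1, Finset.mem_univ _, ?_⟩
    rw [hs', cellCarrier, hin _ s hs', LocalState.carrier, Finset.mem_singleton, ← h2]

theorem WF.carrier_first_nested (h : D.WF x) {p p' : Fin (n + 1)} {v v' : LocalState n V}
    (hv : D.Occ p 1 v) (hv' : D.Occ p' 1 v') : v.carrier ⊆ v'.carrier ∨ v'.carrier ⊆ v.carrier := by
  obtain ⟨snap, rfl, -⟩ := h.succ p 0 v hv
  obtain ⟨snap', rfl, -⟩ := h.succ p' 0 v' hv'
  rcases h.nested 0 p p' snap snap' hv hv' with hn | hn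
  · left
    intro a ha
    rw [h.carrier_first hv] at ha
    rw [h.carrier_first hv']
    exact ⟨hn _ ha.1, ha.2⟩
  · right
    intro a ha
    rw [h.carrier_first hv'] at ha
    rw [h.carrier_first hv]
    exact ⟨hn _ ha.1, ha.2⟩

/-- All (process, input) pairs of the inputs `x`. -/
def _root_.allPairs (x : Fin (n + 1) → V) : Finset (Fin (n + 1) × V) :=
  Finset.univ.map ⟨fun p => (p, x p), fun _ _ h => congrArg Prod.fst h⟩

theorem _root_.mem_allPairs {x : Fin (n + 1) → V} {a : Fin (n + 1) × V} :
    a ∈ allPairs x ↔ a.2 = x a.1 := by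
  constructor
  · intro h
    obtain ⟨p, -, rfl⟩ := Finset.mem_map.mp h
    rfl
  · intro h
    exact Finset.mem_map.mpr ⟨a.1, Finset.mem_univ _, Prod.ext rfl h.symm⟩

theorem WF.carrier_subset (h : D.WF x) {p : Fin (n + 1)} {r : ℕ} {s : LocalState n V}
    (hs : D.Occ p r s) : s.carrier ⊆ allPairs x := by
  classical
  induction r generalizing p s with
  | zero =>
    rw [h.zero p s hs, LocalState.carrier]
    intro a ha
    rw [Finset.mem_singleton] at ha
    subst ha
    exact mem_allPairs.mpr rfl
  | succ r ih =>
    obtain ⟨snap, rfl, hp, -⟩ := h.succ p r s hs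
    intro a ha
    rw [LocalState.carrier, Finset.mem_biUnion] at ha
    obtain ⟨q, -, hq⟩ := ha
    cases hs' : snap q with
    | none => simp [hs', cellCarrier] at hq
    | some s =>
      rw [hs', cellCarrier] at hq
      exact ih (Or.inl (h.occ_cell hs hs')) hq

theorem WF.self_mem_carrier (h : D.WF x) {p : Fin (n + 1)} {r : ℕ} {s : LocalState n V}
    (hs : D.Occ p r s) : (p, x p) ∈ s.carrier := by
  classical
  induction r generalizing s with
  | zero =>
    rw [h.zero p s hs, LocalState.carrier]
    simp
  | succ r ih =>
    obtain ⟨snap, rfl, hp, -⟩ := h.succ p r s hs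
    obtain ⟨s₁, hs₁⟩ := Option.ne_none_iff_exists'.mp hp
    rw [LocalState.carrier, Finset.mem_biUnion]
    refine ⟨p, Finset.mem_univ _, ?_⟩
    rw [hs₁, cellCarrier]
    exact ih (Or.inl (h.occ_cell hs hs₁))

theorem WF.carrier_card_le (h : D.WF x) {p : Fin (n + 1)} {r : ℕ} {s : LocalState n V}
    (hs : D.Occ p r s) : s.carrier.card ≤ n + 1 := by
  refine (Finset.card_le_card (h.carrier_subset hs)).trans ?_
  simp [allPairs]

theorem WF.view_depth_ne_one (h : D.WF x) {p : Fin (n + 1)} {e : ℕ}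
    {snap : Fin (n + 1) → Option (LocalState n V)} (he : 1 ≤ e)
    (hs : D.Occ p (e + 1) (.view p snap)) : (LocalState.view p snap).depth ≠ 1 := by
  rw [h.depth_eq hs]
  omega

/-- `κ d` bounds the distance of the positions of states of depth at least `d` that occur in one
execution. -/
noncomputable def _root_.kappa (n d : ℕ) : ℝ := ((n : ℝ) / (n + 1)) ^ (d - 1)

/-- All states of depth at least `d` that occur in one execution lie in an interval of length
`kappa n d`: in each round, all snapshots share a cell, which pulls the means together. -/
theorem WF.exists_interval (h : D.WF x) {g : LocalState n V → ℝ} (hg : ∀ v, 0 ≤ g v ∧ g v ≤ 1)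
    {d : ℕ} (hd : 1 ≤ d) :
    ∃ a b : ℝ, b - a ≤ kappa n d ∧
      ∀ e, d ≤ e → ∀ p s, D.Occ p e s → a ≤ pos g s ∧ pos g s ≤ b := by
  have hN : (0 : ℝ) < n + 1 := by positivity
  have hbound : ∀ d, 1 ≤ d → ∀ a b : ℝ, (∀ p s, D.Occ p d s → a ≤ pos g s ∧ pos g s ≤ b) →
      ∀ e, d ≤ e → ∀ p s, D.Occ p e s → a ≤ pos g s ∧ pos g s ≤ b := by
    intro d hd a b hbase e hde p s hs
    refine h.occ_induction (P := fun s => a ≤ pos g s ∧ pos g s ≤ b) hbase ?_ hde hs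
    intro p e snap hde ho hcell
    obtain ⟨s₁, hs₁⟩ := Option.ne_none_iff_exists'.mp (h.occ_self_ne_none ho)
    have hm := pos_view_mem (g := g) (h.view_depth_ne_one (hd.trans hde) ho) hs₁
      (a := a) (b := b) fun q s hq => (hcell q s hq).2
    have h1 := (hcell p s₁ hs₁).2
    have e1 : 0 ≤ (pos g s₁ - a) / (n + 1) := div_nonneg (by linarith [h1.1]) hN.le
    have e2 : 0 ≤ (b - pos g s₁) / (n + 1) := div_nonneg (by linarith [h1.2]) hN.le
    exact ⟨by linarith [hm.1], by linarith [hm.2]⟩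
  induction d, hd using Nat.le_induction with
  | base =>
    refine ⟨0, 1, by simp [kappa], hbound 1 le_rfl 0 1 ?_⟩
    intro p s hs
    rw [pos_of_depth_eq_one g (h.depth_eq hs)]
    exact hg s
  | succ d hd ih =>
    obtain ⟨a, b, hab, hall⟩ := ih
    by_cases hex : ∃ p s, D.Occ p (d + 1) s
    · obtain ⟨p₁, s₁, ho₁⟩ := hex
      obtain ⟨q₀, hq₀⟩ := h.common d
      obtain ⟨snap₁, rfl, -⟩ := h.succ p₁ d s₁ ho₁
      obtain ⟨s₀, hs₀⟩ := Option.ne_none_iff_exists'.mp (hq₀ p₁ snap₁ ho₁)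
      have hmem₀ := h.occ_cell ho₁ hs₀
      refine ⟨a + (pos g s₀ - a) / (n + 1), b - (b - pos g s₀) / (n + 1), ?_,
        hbound (d + 1) (by omega) _ _ ?_⟩
      · have : b - (b - pos g s₀) / (n + 1) - (a + (pos g s₀ - a) / (n + 1)) =
            (b - a) * ((n : ℝ) / (n + 1)) := by
          field_simp
          ring
        rw [this]
        have hk : kappa n (d + 1) = kappa n d * ((n : ℝ) / (n + 1)) := by
          obtain ⟨d, rfl⟩ : ∃ d', d = d' + 1 := ⟨d - 1, by omega⟩
          simp [kappa, pow_succ]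
        rw [hk]
        exact mul_le_mul_of_nonneg_right hab (by positivity)
      · intro p s hs
        obtain ⟨snap, rfl, -⟩ := h.succ p d s hs
        obtain ⟨s', hs'⟩ := Option.ne_none_iff_exists'.mp (hq₀ p snap hs)
        obtain rfl : s₀ = s' := by
          have := h.occ_cell hs hs'
          simpa [hmem₀] using this
        exact pos_view_mem (h.view_depth_ne_one hd hs) hs' fun q s hq =>
          hall d le_rfl q s (Or.inl (h.occ_cell hs hq))
    · refine ⟨0, 0, by simp only [sub_self, kappa]; positivity, ?_⟩
      intro e hde p s hs
      exfalso
      rcases Nat.eq_or_lt_of_le hde with rfl | hlt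
      · exact hex ⟨p, s, hs⟩
      · obtain ⟨s', hs', -⟩ := h.exists_ancestor hs hlt
        exact hex ⟨p, s', Or.inl hs'⟩

theorem WF.pos_close (h : D.WF x) {g : LocalState n V → ℝ} (hg : ∀ v, 0 ≤ g v ∧ g v ≤ 1)
    {d e e' : ℕ} (hd : 1 ≤ d) (he : d ≤ e) (he' : d ≤ e') {p p' : Fin (n + 1)}
    {s s' : LocalState n V} (hs : D.Occ p e s) (hs' : D.Occ p' e' s') :
    |pos g s - pos g s'| ≤ kappa n d := by
  obtain ⟨a, b, hab, hall⟩ := h.exists_interval hg hd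
  have h1 := hall e he p s hs
  have h2 := hall e' he' p' s' hs'
  rw [abs_le]
  constructor <;> linarith [h1.1, h1.2, h2.1, h2.2]

end WF

theorem _root_.kappa_nonneg (n d : ℕ) : 0 ≤ kappa n d := by
  unfold kappa
  positivity

theorem _root_.kappa_succ (n : ℕ) {d : ℕ} (hd : 1 ≤ d) :
    kappa n (d + 1) = kappa n d * ((n : ℝ) / (n + 1)) := by
  obtain ⟨d, rfl⟩ : ∃ d', d = d' + 1 := ⟨d - 1, by omega⟩
  simp [kappa, pow_succ]

theorem _root_.kappa_anti (n : ℕ) {d e : ℕ} (h : d ≤ e) : kappa n e ≤ kappa n d := by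
  refine pow_le_pow_of_le_one (by positivity) ?_ (by omega)
  rw [div_le_one (by positivity)]
  linarith

theorem _root_.exists_kappa_lt (n m : ℕ) {ε : ℝ} (hε : 0 < ε) :
    ∃ d, m ≤ d ∧ 1 ≤ d ∧ kappa n d < ε := by
  have hlt : (n : ℝ) / (n + 1) < 1 := by
    rw [div_lt_one (by positivity)]
    linarith
  obtain ⟨k, hk⟩ := exists_pow_lt_of_lt_one hε hlt
  refine ⟨max m (k + 1), le_max_left _ _, le_trans (by omega) (le_max_right m (k + 1)), ?_⟩
  refine lt_of_le_of_lt (kappa_anti n (le_max_right m (k + 1))) ?_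
  simpa [kappa] using hk

end Config

/-! ### Weights and labels -/

section Weights

open LocalState Config

variable {n : ℕ} {V W : Type*}

/-- The weight of the first-round states in `A` in the position of `s`. -/
noncomputable def weight (A : Set (LocalState n V)) (s : LocalState n V) : ℝ :=
  pos (A.indicator 1) s

/-- The weight of the first-round states with a carrier of at least `j` elements. -/
noncomputable def level (j : ℕ) (s : LocalState n V) : ℝ :=
  weight {v | j ≤ v.carrier.card} s

theorem indicator_mem_unit (A : Set (LocalState n V)) (v : LocalState n V) :
    0 ≤ A.indicator (1 : LocalState n V → ℝ) v ∧ A.indicator (1 : LocalState n V → ℝ) v ≤ 1 := by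
  by_cases h : v ∈ A <;> simp [h]

theorem weight_nonneg (A : Set (LocalState n V)) (s : LocalState n V) : 0 ≤ weight A s :=
  pos_nonneg (fun v => (indicator_mem_unit A v).1) s

theorem weight_mono {A B : Set (LocalState n V)} {s : LocalState n V}
    (h : ∀ v, Sees s v → v ∈ A → v ∈ B) : weight A s ≤ weight B s := by
  refine pos_mono s fun v hv => ?_
  by_cases hA : v ∈ A
  · simp [hA, h v hv hA]
  · simpa [hA] using (indicator_mem_unit B v).1

theorem exists_sees_of_weight_lt {A B : Set (LocalState n V)} {s : LocalState n V}
    (h : weight A s < weight B s) : ∃ v, Sees s v ∧ v ∈ B ∧ v ∉ A := by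
  by_contra! hc
  exact absurd (weight_mono hc) (not_le.mpr h)

theorem exists_sees_of_weight_pos {A : Set (LocalState n V)} {s : LocalState n V}
    (h : 0 < weight A s) : ∃ v, Sees s v ∧ v ∈ A := by
  obtain ⟨v, hv, hpos⟩ := exists_sees_of_pos h
  refine ⟨v, hv, ?_⟩
  by_contra hA
  simp [hA] at hpos

theorem level_anti {i j : ℕ} (h : i ≤ j) (s : LocalState n V) : level j s ≤ level i s :=
  weight_mono fun _ _ hv => h.trans hv

theorem Config.WF.weight_close {x : Fin (n + 1) → V} {D : Config n V} (h : D.WF x)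
    {d e e' : ℕ} (hd : 1 ≤ d) (he : d ≤ e) (he' : d ≤ e') {p p' : Fin (n + 1)}
    {s s' : LocalState n V} (hs : D.Occ p e s) (hs' : D.Occ p' e' s')
    (A : Set (LocalState n V)) : |weight A s - weight A s'| ≤ kappa n d :=
  h.pos_close (indicator_mem_unit A) hd he he' hs hs'

theorem Config.WF.pos_const_one {x : Fin (n + 1) → V} {D : Config n V} (h : D.WF x)
    {e : ℕ} (he : 1 ≤ e) {p : Fin (n + 1)} {s : LocalState n V} (hs : D.Occ p e s) :
    pos (fun _ => 1) s = 1 := by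
  refine h.occ_induction (P := fun s => pos (fun _ => 1) s = 1) ?_ ?_ he hs
  · intro p s hs
    exact pos_of_depth_eq_one _ (h.depth_eq hs)
  · intro p e snap he hs hc
    obtain ⟨s₁, hs₁⟩ := Option.ne_none_iff_exists'.mp (h.occ_self_ne_none hs)
    have := pos_view_mem (g := fun _ => 1) (h.view_depth_ne_one he hs) hs₁ (a := 1) (b := 1)
      fun q s hq => by rw [(hc q s hq).2]; simp
    rw [(hc _ _ hs₁).2] at this
    simp only [sub_self, zero_div, add_zero, sub_zero] at this
    exact le_antisymm this.2 this.1

theorem Config.WF.weight_eq_one {x : Fin (n + 1) → V} {D : Config n V} (h : D.WF x)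
    {e : ℕ} (he : 1 ≤ e) {p : Fin (n + 1)} {s : LocalState n V} (hs : D.Occ p e s)
    {A : Set (LocalState n V)} (hA : ∀ v, Sees s v → v ∈ A) : weight A s = 1 := by
  rw [← h.pos_const_one he hs]
  exact pos_congr s fun v hv => by simp [hA v hv]

theorem Config.WF.level_one {x : Fin (n + 1) → V} {D : Config n V} (h : D.WF x)
    {e : ℕ} (he : 1 ≤ e) {p : Fin (n + 1)} {s : LocalState n V} (hs : D.Occ p e s) :
    level 1 s = 1 := by
  refine h.weight_eq_one he hs fun v hv => ?_
  obtain ⟨q, hq⟩ := h.occ_of_sees hs hv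
  exact Finset.card_pos.mpr ⟨_, h.self_mem_carrier hq⟩

theorem Config.WF.level_eq_zero {x : Fin (n + 1) → V} {D : Config n V} (h : D.WF x)
    {e : ℕ} {p : Fin (n + 1)} {s : LocalState n V} (hs : D.Occ p e s) {j : ℕ} (hj : n + 1 < j) :
    level j s = 0 := by
  refine le_antisymm (not_lt.mp fun hpos => ?_) (weight_nonneg _ _)
  obtain ⟨v, hv, hvj⟩ := exists_sees_of_weight_pos hpos
  obtain ⟨q, hq⟩ := h.occ_of_sees hs hv
  have := h.carrier_card_le hq
  simp only [Set.mem_ofPred_eq] at hvj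
  omega

/-- First-round states that occur in one execution have equal carriers if these have equally many
elements. -/
theorem Config.WF.carrier_eq_of_card {x : Fin (n + 1) → V} {D : Config n V} (h : D.WF x)
    {e e' : ℕ} {p p' : Fin (n + 1)} {s s' v v' : LocalState n V} (hs : D.Occ p e s)
    (hs' : D.Occ p' e' s') (hv : Sees s v) (hv' : Sees s' v')
    (hc : v.carrier.card = v'.carrier.card) : v.carrier = v'.carrier := by
  obtain ⟨q, hq⟩ := h.occ_of_sees hs hv
  obtain ⟨q', hq'⟩ := h.occ_of_sees hs' hv'
  rcases h.carrier_first_nested hq hq' with hsub | hsub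
  · exact Finset.eq_of_subset_of_card_le hsub hc.ge
  · exact (Finset.eq_of_subset_of_card_le hsub hc.le).symm

theorem Config.WF.carrier_subset_of_card {x : Fin (n + 1) → V} {D : Config n V} (h : D.WF x)
    {e e' : ℕ} {p p' : Fin (n + 1)} {s s' v v' : LocalState n V} (hs : D.Occ p e s)
    (hs' : D.Occ p' e' s') (hv : Sees s v) (hv' : Sees s' v')
    (hc : v.carrier.card ≤ v'.carrier.card) : v.carrier ⊆ v'.carrier := by
  obtain ⟨q, hq⟩ := h.occ_of_sees hs hv
  obtain ⟨q', hq'⟩ := h.occ_of_sees hs' hv'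
  rcases h.carrier_first_nested hq hq' with hsub | hsub
  · exact hsub
  · exact (Finset.eq_of_subset_of_card_le hsub hc).symm.subset

/-- What is known about the first round after a schedule: the carriers (`chain`) of the processes
that occurred in it, and the union `top` of these, which is the inputs of all these processes. -/
structure FirstRound (n : ℕ) (V : Type*) where
  top : Finset (Fin (n + 1) × V)
  chain : Set (Finset (Fin (n + 1) × V))
  le_top : ∀ σ ∈ chain, σ ⊆ top

/-- Everything seen in `s` is consistent with `S`: the carriers of the first-round states that are
not in the chain properly contain its top. -/
def FirstRound.In (S : FirstRound n V) (s : LocalState n V) : Prop :=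
  ∀ v, Sees s v → v.carrier ∈ S.chain ∨ S.top ⊂ v.carrier

theorem FirstRound.In.ssubset_of_card {S : FirstRound n V} {s v : LocalState n V} (h : S.In s) (hv : Sees s v)
    (hc : S.top.card < v.carrier.card) : S.top ⊂ v.carrier :=
  (h v hv).resolve_left fun hmem =>
    absurd (Finset.card_le_card (S.le_top _ hmem)) (not_le.mpr hc)

/-- `τ` is the label of `s` with respect to thresholds in `(l, r)`: the largest carrier such that
the weight of the carriers at least as large is above the threshold, whatever threshold is chosen in
this interval. Carriers inside `S.top` are identified with `S.top`. -/
def IsLab (S : FirstRound n V) (l r : ℝ) (s : LocalState n V) (τ : Finset (Fin (n + 1) × V)) : Prop :=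
  (τ = S.top ∧ S.top.Nonempty ∧ level (S.top.card + 1) s ≤ l) ∨
    (S.top ⊂ τ ∧ (∃ v, Sees s v ∧ v.carrier = τ) ∧ r ≤ level τ.card s ∧ level (τ.card + 1) s ≤ l)

theorem IsLab.mono {S : FirstRound n V} {l r l' r' : ℝ} {s : LocalState n V}
    {τ : Finset (Fin (n + 1) × V)} (h : IsLab S l r s τ) (hl : l ≤ l') (hr : r' ≤ r) :
    IsLab S l' r' s τ := by
  rcases h with ⟨h1, h2, h3⟩ | ⟨h1, h2, h3, h4⟩
  · exact Or.inl ⟨h1, h2, h3.trans hl⟩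
  · exact Or.inr ⟨h1, h2, hr.trans h3, h4.trans hl⟩

theorem IsLab.clear {S : FirstRound n V} {l r : ℝ} {s : LocalState n V}
    {τ : Finset (Fin (n + 1) × V)} (h : IsLab S l r s τ) {j : ℕ} (hj : S.top.card < j) :
    level j s ≤ l ∨ r ≤ level j s := by
  rcases h with ⟨-, -, h3⟩ | ⟨-, -, h3, h4⟩
  · exact Or.inl ((level_anti hj s).trans h3)
  · rcases Nat.lt_or_ge τ.card j with hlt | hge
    · exact Or.inl ((level_anti hlt s).trans h4)
    · exact Or.inr (h3.trans (level_anti hge s))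

theorem IsLab.nonempty {S : FirstRound n V} {l r : ℝ} {s : LocalState n V}
    {τ : Finset (Fin (n + 1) × V)} (h : IsLab S l r s τ) : τ.Nonempty := by
  rcases h with ⟨rfl, h2, -⟩ | ⟨h1, -⟩
  · exact h2
  · exact (Finset.nonempty_of_ne_empty fun h0 => by simp [h0] at h1)

/-- States of one execution have the same label, even for different intervals of thresholds if these
overlap by more than `kappa n d`. -/
theorem IsLab.unique {S : FirstRound n V} {l r l' r' : ℝ} {x : Fin (n + 1) → V} {D : Config n V}
    (h : D.WF x) {d e e' : ℕ} (hd : 1 ≤ d) (he : d ≤ e) (he' : d ≤ e') {p p' : Fin (n + 1)}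
    {s s' : LocalState n V} (hs : D.Occ p e s) (hs' : D.Occ p' e' s')
    {τ τ' : Finset (Fin (n + 1) × V)} (hτ : IsLab S l r s τ) (hτ' : IsLab S l' r' s' τ')
    (h1 : kappa n d < r - l') (h2 : kappa n d < r' - l) : τ = τ' := by
  have hcl := fun j => abs_le.mp (h.weight_close hd he he' hs hs' {v | j ≤ v.carrier.card})
  have hcl' : ∀ j, -kappa n d ≤ level j s - level j s' ∧ level j s - level j s' ≤ kappa n d := hcl
  rcases hτ with ⟨rfl, -, a3⟩ | ⟨a1, ⟨v, hv, rfl⟩, a3, a4⟩ <;>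
    rcases hτ' with ⟨b0, -, b3⟩ | ⟨b1, ⟨v', hv', rfl⟩, b3, b4⟩
  · exact b0.symm
  · exfalso
    have := level_anti (Finset.card_lt_card b1) s'
    have := hcl' (S.top.card + 1)
    linarith
  · exfalso
    have := level_anti (Finset.card_lt_card a1) s
    have := hcl' (S.top.card + 1)
    linarith
  · refine h.carrier_eq_of_card hs hs' hv hv' ?_
    rcases Nat.lt_trichotomy v.carrier.card v'.carrier.card with hlt | heq | hgt
    · exfalso
      have := level_anti (Nat.succ_le_of_lt hlt) s'
      have := hcl' (v.carrier.card + 1)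
      linarith
    · exact heq
    · exfalso
      have := level_anti (Nat.succ_le_of_lt hgt) s
      have := hcl' (v'.carrier.card + 1)
      linarith

/-- Labels carry over to states with nearby weights, also to those of other executions. -/
theorem IsLab.transfer {S : FirstRound n V} {l r M : ℝ} {x : Fin (n + 1) → V} {D : Config n V}
    (h : D.WF x) {e : ℕ} {p : Fin (n + 1)} {s s' : LocalState n V} (hs : D.Occ p e s)
    {τ : Finset (Fin (n + 1) × V)} (hτ : IsLab S l r s τ)
    (hM : ∀ A : Set (LocalState n V), |weight A s' - weight A s| ≤ M) (hlr : l + M < r - M) :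
    IsLab S (l + M) (r - M) s' τ := by
  have hM' := fun A => abs_le.mp (hM A)
  rcases hτ with ⟨rfl, h2, h3⟩ | ⟨h1, ⟨v, hv, rfl⟩, h3, h4⟩
  · refine Or.inl ⟨rfl, h2, ?_⟩
    have : _ ≤ level _ s' - level _ s ∧ level _ s' - level _ s ≤ M :=
      hM' {v | S.top.card + 1 ≤ v.carrier.card}
    linarith
  · have e1 : _ ≤ level _ s' - level _ s ∧ level _ s' - level _ s ≤ M :=
      hM' {v' | v.carrier.card ≤ v'.carrier.card}
    have e2 : _ ≤ level _ s' - level _ s ∧ level _ s' - level _ s ≤ M :=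
      hM' {v' | v.carrier.card + 1 ≤ v'.carrier.card}
    refine Or.inr ⟨h1, ?_, by linarith, by linarith⟩
    -- Compare the weight of the larger carriers with and without the label itself.
    set A : Set (LocalState n V) :=
      {v' | v'.carrier = v.carrier ∨ v.carrier.card + 1 ≤ v'.carrier.card} with hA
    have h5 : level v.carrier.card s ≤ weight A s := by
      refine weight_mono fun v' hv' hc => ?_
      rcases Nat.lt_or_eq_of_le hc with hlt | heq
      · exact Or.inr hlt
      · exact Or.inl (h.carrier_eq_of_card hs hs hv' hv heq.symm)
    have h6 := hM' A
    obtain ⟨v', hv', hin, hout⟩ := exists_sees_of_weight_lt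
      (A := {v' | v.carrier.card + 1 ≤ v'.carrier.card}) (B := A) (s := s') (by
        change level _ _ < _
        linarith)
    exact ⟨v', hv', hin.resolve_right hout⟩

/-- A state has a label for `(a, b)` if none of its levels lies between `a` and `b`. -/
theorem exists_isLab {S : FirstRound n V} {a b : ℝ} {x : Fin (n + 1) → V} {D : Config n V}
    (h : D.WF x) {e : ℕ} (he : 1 ≤ e) {p : Fin (n + 1)} {s : LocalState n V} (hs : D.Occ p e s)
    (hin : S.In s) (ha : 0 ≤ a) (hab : a < b) (hb : b ≤ 1)
    (hclear : ∀ j, S.top.card < j → level j s ≤ a ∨ b ≤ level j s) : ∃ τ, IsLab S a b s τ := by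
  classical
  set P : ℕ → Prop := fun j => j ≤ S.top.card ∨ b ≤ level j s with hP
  have hzero : ∀ j, n + 1 < j → level j s = 0 := fun j hj => h.level_eq_zero hs hj
  set N := max (n + 1) S.top.card
  have hP0 : P 0 := Or.inl (Nat.zero_le _)
  set j := Nat.findGreatest P N with hj
  have hPj : P j := Nat.findGreatest_spec (Nat.zero_le N) hP0
  have hjs : S.top.card ≤ j := Nat.le_findGreatest (le_max_right _ _) (Or.inl le_rfl)
  have hsucc : level (j + 1) s ≤ a := by
    rcases hclear (j + 1) (by omega) with h1 | h1
    · exact h1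
    · exfalso
      rcases Nat.lt_or_ge N (j + 1) with hlt | hge
      · have := hzero (j + 1) (lt_of_le_of_lt (le_max_left _ _) hlt)
        linarith
      · have := Nat.le_findGreatest hge (show P (j + 1) from Or.inr h1)
        omega
  rcases Nat.eq_or_lt_of_le hjs with heq | hlt
  · refine ⟨S.top, Or.inl ⟨rfl, ?_, heq ▸ hsucc⟩⟩
    by_contra hne
    rw [Finset.not_nonempty_iff_eq_empty] at hne
    rw [← heq, hne, Finset.card_empty, zero_add, h.level_one he hs] at hsucc
    linarith
  · have hbj : b ≤ level j s := hPj.resolve_left (by omega)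
    obtain ⟨v, hv, hv1, hv2⟩ := exists_sees_of_weight_lt
      (A := {v : LocalState n V | j + 1 ≤ v.carrier.card}) (B := {v | j ≤ v.carrier.card})
      (s := s) (lt_of_le_of_lt hsucc (lt_of_lt_of_le hab hbj))
    have hcard : v.carrier.card = j := by
      simp only [Set.mem_ofPred_eq] at hv1 hv2
      omega
    refine ⟨v.carrier, Or.inr ⟨hin.ssubset_of_card hv (by omega), ⟨v, hv, rfl⟩, ?_, ?_⟩⟩
    · rwa [hcard]
    · rwa [hcard]

/-- In one execution, the weight of the carriers of at least `|τ|` elements is the weight of those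
that contain `τ`, provided that `τ` occurs. -/
theorem Config.WF.level_le_weight {x : Fin (n + 1) → V} {D : Config n V} (h : D.WF x)
    {e e' : ℕ} {p p' : Fin (n + 1)} {s s' v : LocalState n V} (hs : D.Occ p e s)
    (hs' : D.Occ p' e' s') (hv : Sees s v) :
    level v.carrier.card s' ≤ weight {v' | v.carrier ⊆ v'.carrier} s' :=
  weight_mono fun _ hv' hc => h.carrier_subset_of_card hs hs' hv hv' hc

/-- Order of first-round data: `S'` records at least as many steps as `S`. -/
structure FirstRound.Le (S S' : FirstRound n V) : Prop where
  top : S.top ⊆ S'.top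
  chain : ∀ σ ∈ S'.chain, σ ∈ S.chain ∨ S.top ⊂ σ

theorem FirstRound.Le.refl (S : FirstRound n V) : S.Le S := ⟨subset_rfl, fun _ h => Or.inl h⟩

theorem FirstRound.Le.trans {S S' S'' : FirstRound n V} (h : S.Le S') (h' : S'.Le S'') : S.Le S'' where
  top := h.top.trans h'.top
  chain := fun σ hσ => by
    rcases h'.chain σ hσ with h1 | h1
    · exact h.chain σ h1
    · exact Or.inr (lt_of_le_of_lt h.top h1)

theorem FirstRound.Le.in {S S' : FirstRound n V} (h : S.Le S') {s : LocalState n V} (hs : S'.In s) : S.In s := by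
  intro v hv
  rcases hs v hv with h1 | h1
  · exact h.chain _ h1
  · exact Or.inr (lt_of_le_of_lt h.top h1)

theorem FirstRound.In.of_sees {S : FirstRound n V} {s s' : LocalState n V} (h : S.In s)
    (hs : ∀ v, Sees s' v → Sees s v) : S.In s' := fun v hv => h v (hs v hv)

end Weights

/-! ### Partial decision maps -/

section Knowledge

open LocalState Config

variable {n : ℕ} {V W : Type*}

/-- `a` and `b` are joined by a path in the 1-skeleton of `K`. -/
def Conn (K : PreAbstractSimplicialComplex W) : W → W → Prop :=
  Relation.ReflTransGen fun a b => ∃ ρ ∈ K, a ∈ ρ ∧ b ∈ ρ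

theorem Conn.mono {K L : PreAbstractSimplicialComplex W} (h : K ≤ L) {a b : W} (hab : Conn K a b) :
    Conn L a b := by
  induction hab with
  | refl => exact .refl
  | tail _ hbc ih =>
    obtain ⟨ρ, hρ, h1, h2⟩ := hbc
    exact ih.tail ⟨ρ, h hρ, h1, h2⟩

theorem Conn.symm {K : PreAbstractSimplicialComplex W} {a b : W} (hab : Conn K a b) :
    Conn K b a := by
  induction hab with
  | refl => exact .refl
  | tail _ hbc ih =>
    obtain ⟨ρ, hρ, h1, h2⟩ := hbc
    exact ih.head ⟨ρ, hρ, h2, h1⟩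

theorem Conn.exists_path {K : PreAbstractSimplicialComplex W} {a b : W} (hab : Conn K a b) :
    ∃ (N : ℕ) (y : ℕ → W), y 0 = a ∧ y N = b ∧ ∀ i < N, ∃ ρ ∈ K, y i ∈ ρ ∧ y (i + 1) ∈ ρ := by
  induction hab with
  | refl => exact ⟨0, fun _ => a, rfl, rfl, by simp⟩
  | @tail b c _ hbc ih =>
    obtain ⟨N, y, h0, hN, hy⟩ := ih
    refine ⟨N + 1, fun i => if i ≤ N then y i else c, by simp [h0], by simp, fun i hi => ?_⟩
    rcases Nat.lt_or_eq_of_le (Nat.lt_succ_iff.mp hi) with hlt | rfl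
    · simpa [hlt.le, Nat.succ_le_of_lt hlt] using hy i hlt
    · simpa [hN] using hbc

/-- An assignment of an output value to every input simplex such that the values of a face and of
the simplex are connected in the outputs allowed for the simplex. The existence of such a map is
equivalent both to the existence of compatible partial protocols and to that of an adversary. -/
def IsHub (T : ColorlessTask V W) (n : ℕ) (H : Finset (Fin (n + 1) × V) → W) : Prop :=
  ∀ σ ∈ (T.toTask n).input, (∃ ρ ∈ T.Δ (vals σ), H σ ∈ ρ) ∧
    ∀ σ' ∈ (T.toTask n).input, σ ⊆ σ' → Conn (T.Δ (vals σ')) (H σ) (H σ')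

theorem ColorlessTask.Δ_vals_mono (T : ColorlessTask V W) {σ σ' : Finset (Fin (n + 1) × V)}
    (hσ : σ ∈ (T.toTask n).input) (hσ' : σ' ∈ (T.toTask n).input) (h : σ ⊆ σ') :
    T.Δ (vals σ) ≤ T.Δ (vals σ') := by
  classical
  exact T.Δ_mono _ hσ.2 _ hσ'.2 (by unfold vals; exact Finset.image_subset_image h)

theorem ColorlessTask.input_of_subset (T : ColorlessTask V W) {σ σ' : Finset (Fin (n + 1) × V)}
    (hσ' : σ' ∈ (T.toTask n).input) (h : σ ⊆ σ') (hne : σ.Nonempty) : σ ∈ (T.toTask n).input :=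
  ((T.toTask n).input.isRelLowerSet_faces hσ').2 h hne

/-- `D` is reached from the initial configuration `x` under the decision map `d`. -/
def Reach (T : ColorlessTask V W) (d : LocalState n V → Option W) (x : Fin (n + 1) → V)
    (D : Config n V) : Prop :=
  (T.toTask n).IsInitial x ∧
    ∃ γ : Schedule n, (Config.initial x).IsSchedule d γ ∧ D = (Config.initial x).run γ

theorem Config.run_append (C : Config n V) (α β : Schedule n) :
    C.run (α ++ β) = (C.run α).run β := by
  simp [Config.run]

theorem Config.isSchedule_append {d : LocalState n V → Option W} (C : Config n V)
    (α β : Schedule n) :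
    C.IsSchedule d (α ++ β) ↔ C.IsSchedule d α ∧ (C.run α).IsSchedule d β := by
  induction α generalizing C with
  | nil => simp [Config.IsSchedule, Config.run]
  | cons P α ih =>
    simp only [List.cons_append, Config.IsSchedule, ih, and_assoc]
    rfl

theorem Config.IsSchedule.mono {d d' : LocalState n V → Option W}
    (h : ∀ s, d' s = none → d s = none) {C : Config n V} {α : Schedule n}
    (hα : C.IsSchedule d' α) : C.IsSchedule d α := by
  induction α generalizing C with
  | nil => trivial
  | cons P α ih => exact ⟨⟨hα.1.1, fun p hp => h _ (hα.1.2.1 p hp), hα.1.2.2⟩, ih hα.2⟩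

section Reach

variable {T : ColorlessTask V W} {d d' : LocalState n V → Option W} {x : Fin (n + 1) → V}
  {D : Config n V}

theorem Reach.wf (h : Reach T d x D) : D.WF x := by
  obtain ⟨-, γ, -, rfl⟩ := h
  exact WF.run_initial x γ

theorem Reach.mono (h : ∀ s, d' s = none → d s = none) (hD : Reach T d' x D) : Reach T d x D := by
  obtain ⟨hx, γ, hγ, rfl⟩ := hD
  exact ⟨hx, γ, hγ.mono h, rfl⟩

theorem Reach.run (h : Reach T d x D) {β : Schedule n} (hβ : D.IsSchedule d β) :
    Reach T d x (D.run β) := by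
  obtain ⟨hx, γ, hγ, rfl⟩ := h
  exact ⟨hx, γ ++ β, (isSchedule_append _ _ _).mpr ⟨hγ, hβ⟩, (run_append _ _ _).symm⟩

/-- States that a process has left were active. -/
theorem Reach.active (h : Reach T d x D) {r : ℕ} {p : Fin (n + 1)} {s : LocalState n V}
    (hs : D.mem r p = some s) : d s = none := by
  obtain ⟨-, γ, hγ, rfl⟩ := h
  suffices ∀ (C : Config n V), (∀ r p s, C.mem r p = some s → d s = none) → C.IsSchedule d γ →
      ∀ r p s, (C.run γ).mem r p = some s → d s = none from
    this _ (by simp [Config.initial]) hγ r p s hs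
  clear hs hγ
  induction γ with
  | nil => exact fun C hC _ => hC
  | cons P γ ih =>
    intro C hC hγ
    refine ih (C.step P) ?_ hγ.2
    intro r p s hs
    simp only [Config.step, Config.write] at hs
    split_ifs at hs with hp
    · simp only [Option.some.injEq] at hs
      rw [← hs]
      exact hγ.1.2.1 p hp.1
    · exact hC r p s hs

theorem Reach.input (h : Reach T d x D) {σ : Finset (Fin (n + 1) × V)} (hσ : σ ⊆ allPairs x)
    (hne : σ.Nonempty) : σ ∈ (T.toTask n).input :=
  T.input_of_subset h.1 hσ hne

theorem Reach.sees_subset (h : Reach T d x D) {p : Fin (n + 1)} {r : ℕ} {s v : LocalState n V}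
    (hs : D.Occ p r s) (hv : Sees s v) : v.carrier ⊆ allPairs x :=
  hv.carrier_subset.trans (h.wf.carrier_subset hs)

theorem Reach.carrier_subset (h : Reach T d x D) (Q : Finset (Fin (n + 1))) :
    D.carrier Q ⊆ allPairs x := by
  classical
  intro a ha
  simp only [Config.carrier, Finset.mem_biUnion] at ha
  obtain ⟨q, -, hq⟩ := ha
  exact h.wf.carrier_subset (D.occ_state q) hq

theorem subset_carrier {Q : Finset (Fin (n + 1))} {q : Fin (n + 1)} (hq : q ∈ Q) :
    (D.state q).carrier ⊆ D.carrier Q := by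
  classical
  intro a ha
  simp only [Config.carrier, Finset.mem_biUnion]
  exact ⟨q, hq, ha⟩

theorem Reach.Δ_le_carrier (h : Reach T d x D) {Q : Finset (Fin (n + 1))} {q : Fin (n + 1)}
    (hq : q ∈ Q) {σ : Finset (Fin (n + 1) × V)} (hσ : σ ⊆ (D.state q).carrier)
    (hne : σ.Nonempty) : T.Δ (vals σ) ≤ T.Δ (vals (D.carrier Q)) := by
  have h1 := hσ.trans (subset_carrier hq)
  have h2 := h.carrier_subset Q
  exact T.Δ_vals_mono (h.input (h1.trans h2) hne) (h.input h2 (hne.mono h1)) h1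

end Reach

/-- A partial decision map: `δ` is settled on all states of depth at most `t`, where `none` means
that the process continues, and open beyond. The numbers `l < r` and `g` are thresholds for levels;
see `Good`. -/
structure Know (n : ℕ) (V W : Type*) where
  δ : LocalState n V → Option W
  t : ℕ
  g : ℝ
  l : ℝ
  r : ℝ

/-- A safety margin for the weights of states of depth at least `t`. -/
noncomputable def eta (n t : ℕ) : ℝ := (n + 5) * kappa n t

theorem eta_nonneg (n t : ℕ) : 0 ≤ eta n t := mul_nonneg (by positivity) (kappa_nonneg n t)

theorem eta_anti (n : ℕ) {t t' : ℕ} (h : t ≤ t') : eta n t' ≤ eta n t :=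
  mul_le_mul_of_nonneg_left (kappa_anti n h) (by positivity)

theorem kappa_le_eta (n t : ℕ) : 5 * kappa n t ≤ eta n t :=
  mul_le_mul_of_nonneg_right (by linarith [(Nat.cast_nonneg n : (0 : ℝ) ≤ n)]) (kappa_nonneg n t)

theorem exists_eta_le (n m : ℕ) {ε : ℝ} (hε : 0 < ε) : ∃ t, m ≤ t ∧ 1 ≤ t ∧ eta n t ≤ ε := by
  obtain ⟨t, h1, h2, h3⟩ := exists_kappa_lt n m (ε := ε / (n + 5)) (by positivity)
  refine ⟨t, h1, h2, ?_⟩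
  rw [lt_div_iff₀ (by positivity)] at h3
  rw [eta, mul_comm]
  exact h3.le

/-- The invariants of the partial decision map `K` of an adversary that knows the part `S` of the
first round. Outputs are valid (`valid`). If a process has terminated, then all states of other
processes at the frontier (depth `t` or more) have a label for all thresholds in a neighbourhood of
`(l, r)`, and the output is the value of this label (`frontier`); so there is still complete freedom
for states whose label depends on the threshold in `(l, r)`. Processes at the frontier have seen
enough of the processes that do not occur in `S` (`outside`); in particular, those that run without
these have terminated. -/
structure Good (T : ColorlessTask V W) (H : Finset (Fin (n + 1) × V) → W) (S : FirstRound n V)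
    (K : Know n V W) : Prop where
  dom : ∀ s w, K.δ s = some w → 1 ≤ s.depth ∧ s.depth ≤ K.t
  t_pos : 1 ≤ K.t
  top_mem : S.top.Nonempty → S.top ∈ (T.toTask n).input
  g_nonneg : 0 ≤ K.g
  l_pos : 0 < K.l
  lt : K.l < K.r
  r_le : K.r ≤ 1
  low : 2 * eta n K.t ≤ K.l
  width : 8 * (n + 2) * eta n K.t ≤ K.r - K.l
  valid : ∀ x D, Reach T K.δ x D → ∀ (Q : Finset (Fin (n + 1))) (o : Fin (n + 1) → W),
    Q.Nonempty → (∀ q ∈ Q, S.In (D.state q) ∧ K.δ (D.state q) = some (o q)) →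
    ∃ ρ ∈ T.Δ (vals (D.carrier Q)), ∀ q ∈ Q, o q ∈ ρ
  frontier : ∀ x D, Reach T K.δ x D → ∀ p w, K.δ (D.state p) = some w →
    ∀ q e s, K.t ≤ e → D.Occ q e s → S.In s → K.δ s = none →
    ∃ τ, IsLab S (K.l - eta n K.t) (K.r + eta n K.t) s τ ∧ w = H τ
  outside : ∀ x D, Reach T K.δ x D → ∀ q e s, K.t ≤ e → D.Occ q e s → S.In s → K.δ s = none →
    K.g < level (S.top.card + 1) s

/-- The carrier `σ` plays an essential role in the position of `s`. -/
def Ess (S : FirstRound n V) (l : ℝ) (σ : Finset (Fin (n + 1) × V)) (s : LocalState n V) : Prop :=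
  (σ = S.top ∧ S.top.Nonempty) ∨ (S.top ⊂ σ ∧ l < weight {v | σ ⊆ v.carrier} s)

/-- The outputs `o` of the processes in `Q` are admissible in `D` for states beyond the frontier:
either all these states have the same label and output its value, or the label of one of these
states is not determined, and the outputs form a simplex that is allowed for an essential carrier
and connected to the value of this carrier. -/
def Adm (T : ColorlessTask V W) (H : Finset (Fin (n + 1) × V) → W) (S : FirstRound n V) (l r : ℝ)
    (D : Config n V) (Q : Finset (Fin (n + 1))) (o : Fin (n + 1) → W) : Prop :=
  (∀ q ∈ Q, S.In (D.state q)) ∧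
    ((∃ τ, ∀ q ∈ Q, IsLab S l r (D.state q) τ ∧ o q = H τ) ∨
      ((∃ q ∈ Q, ∃ j, S.top.card < j ∧ l < level j (D.state q) ∧ level j (D.state q) < r) ∧
        ∃ q₀ ∈ Q, ∃ σ, Ess S l σ (D.state q₀) ∧ (∃ ρ ∈ T.Δ (vals σ), ∀ q ∈ Q, o q ∈ ρ) ∧
          ∀ q ∈ Q, Conn (T.Δ (vals σ)) (o q) (H σ)))

/-- `K'` (with `S'`) is a good extension of `K` (with `S`) in which all new outputs are admissible
with respect to slightly enlarged thresholds. -/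
structure KnowExt (T : ColorlessTask V W) (H : Finset (Fin (n + 1) × V) → W) (S : FirstRound n V)
    (K : Know n V W) (S' : FirstRound n V) (K' : Know n V W) : Prop where
  good : Good T H S' K'
  t_le : K.t ≤ K'.t
  agree : ∀ s : LocalState n V, s.depth ≤ K.t → K'.δ s = K.δ s
  l_le : K.l ≤ K'.l - eta n K'.t
  r_le : K'.r + eta n K'.t ≤ K.r
  star : S.Le S'
  base : (S'.top = S.top ∧ K.g ≤ K'.g) ∨ (S.top ⊂ S'.top ∧ K.l ≤ K'.g)
  new : ∀ x D, Reach T K'.δ x D → ∀ (Q : Finset (Fin (n + 1))) (o : Fin (n + 1) → W), Q.Nonempty →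
    (∀ q ∈ Q, K.t < (D.state q).depth ∧ K'.δ (D.state q) = some (o q)) →
    Adm T H S (K.l - eta n K.t) (K.r + eta n K.t) D Q o

variable {T : ColorlessTask V W} {H : Finset (Fin (n + 1) × V) → W} {S : FirstRound n V}
  {K : Know n V W}

theorem IsLab.mem_input {x : Fin (n + 1) → V} {D : Config n V} (hx : (T.toTask n).IsInitial x)
    (hD : D.WF x) (htop : S.top.Nonempty → S.top ∈ (T.toTask n).input) {l r : ℝ} {p : Fin (n + 1)}
    {e : ℕ} {s : LocalState n V} (hs : D.Occ p e s) {τ : Finset (Fin (n + 1) × V)}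
    (hτ : IsLab S l r s τ) : τ ∈ (T.toTask n).input := by
  rcases id hτ with ⟨rfl, h1, -⟩ | ⟨-, ⟨v, hv, rfl⟩, -⟩
  · exact htop h1
  · exact T.input_of_subset hx (hv.carrier_subset.trans (hD.carrier_subset hs)) hτ.nonempty

theorem Ess.mono {l l' : ℝ} (h : l' ≤ l) {σ : Finset (Fin (n + 1) × V)} {s : LocalState n V}
    (hs : Ess S l σ s) : Ess S l' σ s :=
  hs.imp id fun h1 => ⟨h1.1, lt_of_le_of_lt h h1.2⟩

/-- If the interval of thresholds is enlarged, then a label may cease to be a label, but it is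
essential then. -/
theorem Adm.mono (hH : IsHub T n H) {x : Fin (n + 1) → V} {D : Config n V}
    (hx : (T.toTask n).IsInitial x) (hD : D.WF x)
    (htop : S.top.Nonempty → S.top ∈ (T.toTask n).input) {l r l' r' : ℝ} (hl : l' ≤ l)
    (hlr : l < r) (hr : r ≤ r') {Q : Finset (Fin (n + 1))} {o : Fin (n + 1) → W}
    (h : Adm T H S l r D Q o) : Adm T H S l' r' D Q o := by
  obtain ⟨hin, ⟨τ, hτ⟩ | ⟨⟨q, hq, j, hj, h1, h2⟩, q₀, hq₀, σ, h3, h4⟩⟩ := h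
  · refine ⟨hin, ?_⟩
    by_cases hdeep : ∃ q ∈ Q, ∃ j, S.top.card < j ∧ l' < level j (D.state q) ∧
        level j (D.state q) < r'
    · obtain ⟨q, hq, hj⟩ := hdeep
      have hlab := (hτ q hq).1
      obtain ⟨ρ, hρ, hmem⟩ := (hH τ (hlab.mem_input hx hD htop (D.occ_state q))).1
      refine Or.inr ⟨⟨q, hq, hj⟩, q, hq, τ, ?_, ⟨ρ, hρ, fun q' hq' => (hτ q' hq').2 ▸ hmem⟩,
        fun q' hq' => (hτ q' hq').2 ▸ Relation.ReflTransGen.refl⟩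
      rcases hlab with ⟨h1, h2, -⟩ | ⟨h1, ⟨v, hv, rfl⟩, h2, -⟩
      · exact Or.inl ⟨h1, h2⟩
      · have := hD.level_le_weight (D.occ_state q) (D.occ_state q) hv
        exact Or.inr ⟨h1, by linarith⟩
    · push Not at hdeep
      refine Or.inl ⟨τ, fun q hq => ⟨?_, (hτ q hq).2⟩⟩
      have hlow : ∀ j, S.top.card < j → level j (D.state q) ≤ l → level j (D.state q) ≤ l' := by
        intro j hj h1
        by_contra h2
        have := hdeep q hq j hj (not_le.mp h2)
        linarith
      rcases (hτ q hq).1 with ⟨h1, h2, h3⟩ | ⟨h1, h2, h3, h4⟩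
      · exact Or.inl ⟨h1, h2, hlow _ (Nat.lt_succ_self _) h3⟩
      · have := Finset.card_lt_card h1
        exact Or.inr ⟨h1, h2, hdeep q hq _ this (by linarith), hlow _ (by omega) h4⟩
  · exact ⟨hin, Or.inr ⟨⟨q, hq, j, hj, by linarith, by linarith⟩, q₀, hq₀, σ, h3.mono hl, h4⟩⟩

theorem Good.none_of_lt (h : Good T H S K) {s : LocalState n V} (hs : K.t < s.depth) :
    K.δ s = none := by
  by_contra hne
  obtain ⟨w, hw⟩ := Option.ne_none_iff_exists'.mp hne
  have := (h.dom s w hw).2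
  omega

theorem Good.none_of_agree (h : Good T H S K) {d : LocalState n V → Option W}
    (hd : ∀ s : LocalState n V, s.depth ≤ K.t → d s = K.δ s) :
    ∀ s, d s = none → K.δ s = none := by
  intro s hs
  rcases Nat.lt_or_ge K.t s.depth with hlt | hge
  · exact h.none_of_lt hlt
  · rwa [← hd s hge]

theorem Good.eta_le (h : Good T H S K) : 16 * eta n K.t ≤ K.r - K.l := by
  refine le_trans ?_ h.width
  have := eta_nonneg n K.t
  have hn : (0 : ℝ) ≤ n := Nat.cast_nonneg n
  nlinarith

theorem Good.kappa_lt (h : Good T H S K) {d : ℕ} (hd : K.t ≤ d) : 10 * kappa n d < K.r - K.l := by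
  have h1 := h.eta_le
  have h2 := kappa_le_eta n K.t
  have h3 := kappa_anti n hd
  have h4 := kappa_nonneg n d
  have h5 := h.lt
  rcases h4.eq_or_lt with h0 | h0
  · rw [← h0]; linarith
  · linarith

/-- A state at the frontier has seen a carrier that properly contains the top. -/
theorem Good.exists_outside (h : Good T H S K) {x : Fin (n + 1) → V} {D : Config n V}
    (hD : Reach T K.δ x D) {q : Fin (n + 1)} {e : ℕ} {s : LocalState n V} (he : K.t ≤ e)
    (hs : D.Occ q e s) (hin : S.In s) (hn : K.δ s = none) :
    ∃ v, Sees s v ∧ S.top ⊂ v.carrier := by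
  have h1 := h.outside x D hD q e s he hs hin hn
  obtain ⟨v, hv, hvA⟩ := exists_sees_of_weight_pos (lt_of_le_of_lt h.g_nonneg h1)
  exact ⟨v, hv, hin.ssubset_of_card hv hvA⟩

theorem Good.isLab_subset (h : Good T H S K) {x : Fin (n + 1) → V} {D : Config n V}
    (hD : Reach T K.δ x D) {q : Fin (n + 1)} {e : ℕ} {s : LocalState n V} (he : K.t ≤ e)
    (hs : D.Occ q e s) (hin : S.In s) (hn : K.δ s = none) {l r : ℝ}
    {τ : Finset (Fin (n + 1) × V)} (hτ : IsLab S l r s τ) : τ ⊆ s.carrier := by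
  rcases hτ with ⟨rfl, -⟩ | ⟨-, ⟨v, hv, rfl⟩, -⟩
  · obtain ⟨v, hv, hsub⟩ := h.exists_outside hD he hs hin hn
    exact hsub.subset.trans hv.carrier_subset
  · exact hv.carrier_subset

/-- Narrowing the thresholds and settling that no state up to some depth terminates. -/
theorem Good.shrink (h : Good T H S K) (m : ℕ) :
    ∃ K', KnowExt T H S K S K' ∧ m ≤ K'.t ∧ K'.δ = K.δ := by
  have he := h.eta_le
  have h0 := eta_nonneg n K.t
  have hlt := h.lt
  have hw : 0 < (K.r - eta n K.t) - (K.l + eta n K.t) := by linarith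
  obtain ⟨t, ht1, ht2, ht3⟩ := exists_eta_le n (max m K.t)
    (ε := min (K.l / 2) (((K.r - eta n K.t) - (K.l + eta n K.t)) / (8 * (n + 2))))
    (lt_min (by linarith [h.l_pos]) (by positivity))
  have htK : K.t ≤ t := (le_max_right _ _).trans ht1
  have he' := eta_anti n htK
  have hlow := ht3.trans (min_le_left _ _)
  have hwid := ht3.trans (min_le_right _ _)
  rw [le_div_iff₀ (by positivity)] at hwid
  refine ⟨⟨K.δ, t, K.g, K.l + eta n K.t, K.r - eta n K.t⟩, ⟨?_, htK, fun _ _ => rfl, ?_, ?_,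
    .refl S, Or.inl ⟨rfl, le_rfl⟩, ?_⟩, (le_max_left _ _).trans ht1, rfl⟩
  · refine ⟨fun s w hs => ⟨(h.dom s w hs).1, (h.dom s w hs).2.trans htK⟩, ht2, h.top_mem, h.g_nonneg, ?_, ?_,
      ?_, ?_, ?_, h.valid, ?_, ?_⟩
    · dsimp only; linarith [h.l_pos]
    · dsimp only; linarith
    · dsimp only; linarith [h.r_le]
    · dsimp only; linarith
    · dsimp only; linarith
    · intro x D hD p w hp q e s hes hs hin hn
      obtain ⟨τ, hτ, hw⟩ := h.frontier x D hD p w hp q e s (htK.trans hes) hs hin hn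
      exact ⟨τ, hτ.mono (by dsimp only; linarith) (by dsimp only; linarith), hw⟩
    · intro x D hD q e s hes hs hin hn
      exact h.outside x D hD q e s (htK.trans hes) hs hin hn
  · dsimp only; linarith
  · dsimp only; linarith
  · intro x D hD Q o ⟨q, hq⟩ hnew
    have h1 := hnew q hq
    simp [h.none_of_lt h1.1] at h1

/-- Beyond the frontier, some outputs are admissible. -/
theorem Good.exists_adm (hH : IsHub T n H) (h : Good T H S K) {x : Fin (n + 1) → V}
    {D : Config n V} (hD : Reach T K.δ x D) {Q : Finset (Fin (n + 1))} (hQ : Q.Nonempty)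
    (hdepth : ∀ q ∈ Q, K.t < (D.state q).depth) (hin : ∀ q ∈ Q, S.In (D.state q)) :
    ∃ o, Adm T H S K.l K.r D Q o := by
  have hwf := hD.wf
  by_cases hdeep : ∃ q ∈ Q, ∃ j, S.top.card < j ∧ K.l < level j (D.state q) ∧
      level j (D.state q) < K.r
  · obtain ⟨q, hq, j, hj, h1, h2⟩ := hdeep
    -- The smallest carrier in this execution that is counted by `level j` is essential.
    obtain ⟨v₀, hv₀, hv₀j⟩ := exists_sees_of_weight_pos (h.l_pos.trans h1)
    obtain ⟨v, ⟨hv, hvj⟩, hmin⟩ := WellFounded.has_min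
      (InvImage.wf (fun v : LocalState n V => v.carrier.card) Nat.lt_wfRel.wf)
      {v | Sees (D.state q) v ∧ j ≤ v.carrier.card} ⟨v₀, hv₀, hv₀j⟩
    have hsub : S.top ⊂ v.carrier := (hin q hq).ssubset_of_card hv (lt_of_lt_of_le hj hvj)
    have hwt : level j (D.state q) ≤ weight {v' | v.carrier ⊆ v'.carrier} (D.state q) := by
      refine weight_mono fun v' hv' hc => ?_
      refine hwf.carrier_subset_of_card (D.occ_state q) (D.occ_state q) hv hv' ?_
      by_contra hlt
      exact hmin v' ⟨hv', hc⟩ (not_le.mp hlt)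
    have hinp : v.carrier ∈ (T.toTask n).input :=
      hD.input (hD.sees_subset (D.occ_state q) hv) (Finset.card_pos.mp (by omega))
    refine ⟨fun _ => H v.carrier, hin, Or.inr ⟨⟨q, hq, j, hj, h1, h2⟩, q, hq, v.carrier,
      Or.inr ⟨hsub, lt_of_lt_of_le h1 hwt⟩, ?_, fun _ _ => Relation.ReflTransGen.refl⟩⟩
    obtain ⟨ρ, hρ, hmem⟩ := (hH _ hinp).1
    exact ⟨ρ, hρ, fun _ _ => hmem⟩
  · push Not at hdeep
    have hlab : ∀ q ∈ Q, ∃ τ, IsLab S K.l K.r (D.state q) τ := by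
      intro q hq
      refine exists_isLab hwf ?_ (D.occ_state q) (hin q hq) h.l_pos.le h.lt h.r_le ?_
      · have := hdepth q hq
        rw [hwf.depth_state] at this
        omega
      · intro j hj
        rcases le_or_gt (level j (D.state q)) K.l with h1 | h1
        · exact Or.inl h1
        · exact Or.inr (hdeep q hq j hj h1)
    obtain ⟨q₀, hq₀⟩ := hQ
    obtain ⟨τ, hτ⟩ := hlab q₀ hq₀
    refine ⟨fun _ => H τ, hin, Or.inl ⟨τ, fun q hq => ⟨?_, rfl⟩⟩⟩
    obtain ⟨τ', hτ'⟩ := hlab q hq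
    have hd := hdepth q hq
    have hd₀ := hdepth q₀ hq₀
    rw [hwf.depth_state] at hd hd₀
    have hk := h.kappa_lt le_rfl
    have hk0 := kappa_nonneg n K.t
    rwa [IsLab.unique hwf h.t_pos hd₀.le hd.le (D.occ_state q₀) (D.occ_state q) hτ hτ'
      (by linarith) (by linarith)]

/-- Settling further states: `K.δ` up to depth `K.t` and `f` beyond. -/
def Know.upd (K : Know n V W) (f : LocalState n V → Option W) (s : LocalState n V) : Option W :=
  if s.depth ≤ K.t then K.δ s else f s

theorem Know.upd_of_le (f : LocalState n V → Option W) {s : LocalState n V} (h : s.depth ≤ K.t) :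
    K.upd f s = K.δ s := if_pos h

theorem Know.upd_of_lt (f : LocalState n V → Option W) {s : LocalState n V} (h : K.t < s.depth) :
    K.upd f s = f s := if_neg (by omega)

theorem Good.reach_of_upd (h : Good T H S K) {f : LocalState n V → Option W}
    {x : Fin (n + 1) → V} {D : Config n V} (hD : Reach T (K.upd f) x D) : Reach T K.δ x D :=
  hD.mono (h.none_of_agree fun _ hs => K.upd_of_le f hs)

theorem Good.none_of_upd (h : Good T H S K) {f : LocalState n V → Option W} {s : LocalState n V}
    (hs : K.upd f s = none) : K.δ s = none :=
  h.none_of_agree (fun _ hs => K.upd_of_le f hs) s hs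

/-- A process that has terminated is old or new. -/
theorem Know.upd_cases (K : Know n V W) {f : LocalState n V → Option W} {s : LocalState n V}
    {w : W} (hs : K.upd f s = some w) :
    (s.depth ≤ K.t ∧ K.δ s = some w) ∨ (K.t < s.depth ∧ f s = some w) := by
  rcases Nat.lt_or_ge K.t s.depth with hlt | hge
  · exact Or.inr ⟨hlt, by rwa [K.upd_of_lt f hlt] at hs⟩
  · exact Or.inl ⟨hge, by rwa [K.upd_of_le f hge] at hs⟩

end Knowledge

/-! ### Making processes terminate -/

section Spot

open LocalState Config

variable {n : ℕ} {V W : Type*} {T : ColorlessTask V W} {H : Finset (Fin (n + 1) × V) → W}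
  {S : FirstRound n V} {K : Know n V W}

theorem Good.exists_depth (h : Good T H S K) (m : ℕ) {c : ℝ} (hc : 0 < c) :
    ∃ t, m ≤ t ∧ K.t < t ∧ eta n t ≤ eta n K.t ∧ 2 * eta n t ≤ K.l ∧
      8 * (n + 2) * eta n t ≤ c := by
  obtain ⟨t, ht1, -, ht3⟩ := exists_eta_le n (max m (K.t + 1))
    (ε := min (K.l / 2) (c / (8 * (n + 2)))) (lt_min (by linarith [h.l_pos]) (by positivity))
  have htK : K.t + 1 ≤ t := (le_max_right _ _).trans ht1
  have hlow := ht3.trans (min_le_left _ _)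
  have hwid := ht3.trans (min_le_right _ _)
  rw [le_div_iff₀ (by positivity)] at hwid
  exact ⟨t, (le_max_left _ _).trans ht1, htK, eta_anti n (by omega), by linarith, by linarith⟩

theorem exists_depth_bound (D : Config n V) : ∃ M, ∀ p, (D.state p).depth ≤ M :=
  ⟨∑ p, (D.state p).depth, fun p =>
    Finset.single_le_sum (f := fun p => (D.state p).depth) (fun _ _ => Nat.zero_le _)
      (Finset.mem_univ p)⟩

theorem Config.WF.mem_ne_state {x : Fin (n + 1) → V} {D : Config n V} (h : D.WF x) {r : ℕ}
    {p q : Fin (n + 1)} {s : LocalState n V} (hs : D.mem r p = some s) : D.state q ≠ s := by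
  rintro rfl
  obtain rfl := h.occ_proc_unique (Or.inl hs) (D.occ_state q)
  have h1 : D.Occ p r (D.state p) := Or.inl hs
  have h2 := (h.mem_none p r).mpr (by rw [← h.depth_state, h.depth_eq h1])
  simp [hs] at h2

/-- What is required of an extension of `K` in which the processes in `Q` terminate in `D` with the
outputs `o`. -/
structure Spot (T : ColorlessTask V W) (H : Finset (Fin (n + 1) × V) → W) (S : FirstRound n V)
    (K : Know n V W) (D : Config n V) (Q : Finset (Fin (n + 1))) (o : Fin (n + 1) → W)
    (K' : Know n V W) : Prop where
  ext : KnowExt T H S K S K'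
  depth : ∀ p, (D.state p).depth ≤ K'.t
  out : ∀ q ∈ Q, K'.δ (D.state q) = some (o q)
  mem : ∀ r p s, D.mem r p = some s → K'.δ s = K.δ s

/-- If all processes in `Q` have the label `τ`, they can terminate with the hub value of `τ`:
by closeness, the later states that occur in one execution with them have the label `τ` as well, for
slightly weaker thresholds. -/
theorem Good.spot_label (hH : IsHub T n H) (h : Good T H S K) {x₀ : Fin (n + 1) → V}
    {D₀ : Config n V} (hD₀ : Reach T K.δ x₀ D₀) {Q : Finset (Fin (n + 1))}
    (hdepth : ∀ q ∈ Q, K.t < (D₀.state q).depth) (hin : ∀ q ∈ Q, S.In (D₀.state q))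
    {o : Fin (n + 1) → W} {τ : Finset (Fin (n + 1) × V)}
    (hτ : ∀ q ∈ Q, IsLab S K.l K.r (D₀.state q) τ ∧ o q = H τ) :
    ∃ K', Spot T H S K D₀ Q o K' := by
  classical
  have he := h.eta_le
  have h0 := eta_nonneg n K.t
  have hlt := h.lt
  have hκ := kappa_le_eta n K.t
  have hκ0 := kappa_nonneg n K.t
  have hκt := h.kappa_lt le_rfl
  obtain ⟨M, hM⟩ := exists_depth_bound D₀
  obtain ⟨t, ht1, htK, hte, htl, htw⟩ := h.exists_depth M
    (c := (K.r - 2 * eta n K.t) - (K.l + 2 * eta n K.t)) (by linarith)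
  have het := eta_nonneg n t
  set f : LocalState n V → Option W := fun s => if ∃ q ∈ Q, D₀.state q = s then some (H τ) else none
    with hf
  have hnew : ∀ {s w}, f s = some w → S.In s ∧ IsLab S K.l K.r s τ ∧ w = H τ ∧ s.depth ≤ M := by
    intro s w hs
    simp only [hf] at hs
    split_ifs at hs with hq
    obtain ⟨q, hq, rfl⟩ := hq
    exact ⟨hin q hq, (hτ q hq).1, by simpa using hs.symm, hM q⟩
  have hMt : M ≤ t := ht1
  refine ⟨⟨K.upd f, t, K.g, K.l + 2 * eta n K.t, K.r - 2 * eta n K.t⟩,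
    ⟨⟨?_, htK.le, fun s hs => K.upd_of_le f hs, ?_, ?_, .refl S, Or.inl ⟨rfl, le_rfl⟩, ?_⟩,
    fun p => (hM p).trans hMt, ?_, ?_⟩⟩
  · refine ⟨?_, by dsimp only; omega, h.top_mem, h.g_nonneg, ?_, ?_, ?_, ?_, ?_, ?_, ?_, ?_⟩
    · intro s w hs
      rcases K.upd_cases (f := f) hs with ⟨h1, h2⟩ | ⟨h1, h2⟩
      · exact ⟨(h.dom s w h2).1, h1.trans htK.le⟩
      · exact ⟨by omega, (hnew h2).2.2.2.trans hMt⟩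
    · dsimp only; linarith [h.l_pos]
    · dsimp only; linarith
    · dsimp only; linarith [h.r_le]
    · dsimp only; linarith
    · exact htw
    · intro x D hD Q' o' hQ' ho'
      have hDK := h.reach_of_upd hD
      by_cases hall : ∀ q ∈ Q', (D.state q).depth ≤ K.t
      · refine h.valid x D hDK Q' o' hQ' fun q hq => ⟨(ho' q hq).1, ?_⟩
        rw [← K.upd_of_le f (hall q hq)]
        exact (ho' q hq).2
      · push Not at hall
        obtain ⟨e, heQ, hed⟩ := hall
        have hef : f (D.state e) = some (o' e) := by
          rw [← K.upd_of_lt f hed]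
          exact (ho' e heQ).2
        obtain ⟨hein, hlbl, -⟩ := hnew hef
        have hed' := hed.le
        rw [hDK.wf.depth_state] at hed'
        -- All outputs are the value of the label of the new states.
        have hval : ∀ q ∈ Q', o' q = H τ := by
          intro q hq
          rcases K.upd_cases (f := f) (ho' q hq).2 with ⟨h1, h2⟩ | ⟨h1, h2⟩
          · obtain ⟨τ', hτ', hw⟩ := h.frontier x D hDK q _ h2 e _ _ hed' (D.occ_state e) hein
              (h.none_of_lt hed)
            rw [hw, IsLab.unique hDK.wf h.t_pos hed' hed' (D.occ_state e) (D.occ_state e) hτ'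
              hlbl (by linarith) (by linarith)]
          · exact (hnew h2).2.2.1
        have hsub := h.isLab_subset hDK hed' (D.occ_state e) hein (h.none_of_lt hed) hlbl
        obtain ⟨ρ, hρ, hmem⟩ := (hH τ (hDK.input (hsub.trans (hDK.wf.carrier_subset
          (D.occ_state e))) hlbl.nonempty)).1
        exact ⟨ρ, hDK.Δ_le_carrier heQ hsub hlbl.nonempty hρ, fun q hq => hval q hq ▸ hmem⟩
    · intro x D hD p w hp q e s hes hs hsin hn
      have hDK := h.reach_of_upd hD
      have hn' := h.none_of_upd (f := f) hn
      dsimp only at hes ⊢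
      rcases K.upd_cases (f := f) hp with ⟨h1, h2⟩ | ⟨h1, h2⟩
      · obtain ⟨τ', hτ', hw⟩ := h.frontier x D hDK p w h2 q e s (by omega) hs hsin hn'
        exact ⟨τ', hτ'.mono (by linarith) (by linarith), hw⟩
      · obtain ⟨-, hlab, hw, -⟩ := hnew h2
        rw [hDK.wf.depth_state] at h1
        refine ⟨τ, (hlab.transfer hDK.wf (D.occ_state p) (s' := s) (M := kappa n K.t)
          (fun A => hDK.wf.weight_close h.t_pos (by omega) h1.le hs (D.occ_state p) A)
          (by linarith)).mono (by linarith) (by linarith), hw⟩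
    · intro x D hD q e s hes hs hsin hn
      exact h.outside x D (h.reach_of_upd hD) q e s (htK.le.trans hes) hs hsin (h.none_of_upd (f := f) hn)
  · dsimp only; linarith
  · dsimp only; linarith
  · intro x D hD Q' o' hQ' ho'
    have hn : ∀ q ∈ Q', f (D.state q) = some (o' q) := fun q hq => by
      rw [← K.upd_of_lt f (ho' q hq).1]
      exact (ho' q hq).2
    refine Adm.mono (l := K.l) (r := K.r) hH hD.1 hD.wf h.top_mem (by linarith) hlt (by linarith)
      ⟨fun q hq => (hnew (hn q hq)).1, Or.inl ⟨τ, fun q hq =>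
        ⟨(hnew (hn q hq)).2.1, (hnew (hn q hq)).2.2.1⟩⟩⟩
  · intro q hq
    dsimp only
    rw [K.upd_of_lt f (hdepth q hq), (hτ q hq).2]
    exact if_pos ⟨q, hq, rfl⟩
  · intro r p s hs
    dsimp only
    rcases Nat.lt_or_ge K.t s.depth with h1 | h1
    · rw [K.upd_of_lt f h1, h.none_of_lt h1]
      refine if_neg ?_
      rintro ⟨q, -, hq⟩
      exact hD₀.wf.mem_ne_state hs hq
    · exact K.upd_of_le f h1

/-- An interval that contains none of finitely many numbers. -/
theorem exists_gap (N : ℕ) (c : Fin N → ℝ) {l r : ℝ} (hlr : l < r) :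
    ∃ a, l ≤ a ∧ a + (r - l) / (N + 1) ≤ r ∧ ∀ i, c i ≤ a ∨ a + (r - l) / (N + 1) ≤ c i := by
  set w := (r - l) / (N + 1) with hw
  have hN : (0 : ℝ) < N + 1 := by positivity
  have hw0 : 0 < w := div_pos (by linarith) hN
  have hwN : (N + 1) * w = r - l := by rw [hw]; field_simp
  by_contra! hc
  have hk : ∀ k : Fin (N + 1), ∃ i, l + k * w < c i ∧ c i < l + k * w + w := by
    intro k
    have hkN : (k : ℝ) ≤ N := by exact_mod_cast Nat.lt_succ_iff.mp k.2
    exact hc (l + k * w) (by have : 0 ≤ (k : ℝ) * w := by positivity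
                             linarith) (by nlinarith)
  choose g hg using hk
  obtain ⟨k, k', hne, heq⟩ := Fintype.exists_ne_map_eq_of_card_lt g (by simp)
  have key : ∀ k k' : Fin (N + 1), k < k' → g k = g k' → False := by
    intro k k' hlt heq
    have h1 := (hg k).2
    have h2 := (hg k').1
    rw [heq] at h1
    have : (k : ℝ) + 1 ≤ k' := by exact_mod_cast hlt
    nlinarith
  rcases lt_or_gt_of_ne hne with h1 | h1
  · exact key _ _ h1 heq
  · exact key _ _ h1 heq.symm

/-- `s` and `s'` occur in one execution. -/
def Co (s s' : LocalState n V) : Prop :=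
  ∃ x D p e p' e', D.WF x ∧ Config.Occ D p e s ∧ Config.Occ D p' e' s'

/-- The states that come close to those in `N` in time: those of depth `d + i` are to react to
those of the previous stage that occur in the same execution. -/
def ladder (S : FirstRound n V) (N : Set (LocalState n V)) (d : ℕ) : ℕ → Set (LocalState n V)
  | 0 => N
  | i + 1 => {s | s.depth = d + i + 1 ∧ S.In s ∧ ∃ s' ∈ ladder S N d i, Co s s'}

theorem Co.weight_close {s s' : LocalState n V} (h : Co s s') {d : ℕ} (hd : 1 ≤ d)
    (hs : d ≤ s.depth) (hs' : d ≤ s'.depth) (A : Set (LocalState n V)) :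
    |weight A s - weight A s'| ≤ kappa n d := by
  obtain ⟨x, D, p, e, p', e', hD, h1, h2⟩ := h
  rw [hD.depth_eq h1] at hs
  rw [hD.depth_eq h2] at hs'
  exact hD.weight_close hd hs hs' h1 h2 A

/-- All states of the ladder have nearly the weights of `s₀`: the bounds on the distances between
consecutive stages form a geometric series. -/
theorem ladder_close {N : Set (LocalState n V)} {s₀ : LocalState n V} {t d : ℕ} (ht : 1 ≤ t)
    (htd : t ≤ d) (hN : ∀ s ∈ N, t ≤ s.depth ∧ Co s s₀) (hs₀ : t ≤ s₀.depth) (i : ℕ)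
    {s : LocalState n V} (hs : s ∈ ladder S N d i) (A : Set (LocalState n V)) :
    |weight A s - weight A s₀| ≤ (n + 3) * kappa n t := by
  have hn : (0 : ℝ) ≤ n := Nat.cast_nonneg n
  have hk0 := kappa_nonneg n t
  rcases i with _ | i
  · refine ((hN s hs).2.weight_close ht (hN s hs).1 hs₀ A).trans ?_
    nlinarith
  · have key : ∀ i, ∀ s ∈ ladder S N d (i + 1), |weight A s - weight A s₀| ≤
        2 * kappa n t + (n + 1) * (kappa n (d + 1) - kappa n (d + i + 1)) := by
      intro i
      induction i with
      | zero =>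
        rintro s ⟨hsd, -, s', hs', hco⟩
        have h1 := hco.weight_close ht (by omega) (hN s' hs').1 A
        have h2 := (hN s' hs').2.weight_close ht (hN s' hs').1 hs₀ A
        have := abs_sub_le (weight A s) (weight A s') (weight A s₀)
        simp only [add_zero, sub_self, mul_zero]
        linarith
      | succ i ih =>
        rintro s ⟨hsd, -, s', hs', hco⟩
        have h1 := hco.weight_close (d := d + i + 1) (by omega) (by omega) hs'.1.ge A
        have h2 := ih s' hs'
        have := abs_sub_le (weight A s) (weight A s') (weight A s₀)
        have h3 : (n + 1) * (kappa n (d + i + 1) - kappa n (d + (i + 1) + 1)) =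
            kappa n (d + i + 1) := by
          rw [show d + (i + 1) + 1 = d + i + 1 + 1 by ring, kappa_succ n (d := d + i + 1) (by omega)]
          field_simp
          ring
        linarith
    refine (key i s hs).trans ?_
    have h1 := kappa_anti n (show t ≤ d + 1 by omega)
    have h2 := kappa_nonneg n (d + i + 1)
    nlinarith

end Spot

section SpotDeep

open LocalState Config

variable {n : ℕ} {V W : Type*} {T : ColorlessTask V W} {H : Finset (Fin (n + 1) × V) → W}
  {S : FirstRound n V} {K : Know n V W}

theorem Conn.of_path {L : PreAbstractSimplicialComplex W} {N : ℕ} {y : ℕ → W}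
    (hy : ∀ i < N, ∃ ρ ∈ L, y i ∈ ρ ∧ y (i + 1) ∈ ρ) {i : ℕ} (hi : i ≤ N) :
    Conn L (y i) (y N) := by
  induction N, hi using Nat.le_induction with
  | base => exact .refl
  | succ N hN ih => exact (ih fun i hi => hy i (by omega)).tail (hy N (by omega))

open scoped Classical in
/-- As the carriers seen in one execution form a chain, a weight that is attained for the carriers
containing `σ` and for those containing `u` is attained for those that contain both. -/
theorem Config.WF.lt_weight_union {x : Fin (n + 1) → V} {D : Config n V} (h : D.WF x)
    {p : Fin (n + 1)} {e : ℕ} {s : LocalState n V} (hs : D.Occ p e s)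
    {σ u : Finset (Fin (n + 1) × V)} {c : ℝ} (h1 : c < weight {v | σ ⊆ v.carrier} s)
    (h2 : c < weight {v | u ⊆ v.carrier} s) : c < weight {v | σ ∪ u ⊆ v.carrier} s := by
  by_cases hall : ∀ v, Sees s v → σ ⊆ v.carrier → u ⊆ v.carrier
  · exact lt_of_lt_of_le h1 (weight_mono fun v hv hσ => Finset.union_subset hσ (hall v hv hσ))
  · push Not at hall
    obtain ⟨v₁, hv₁, hσ, hu⟩ := hall
    refine lt_of_lt_of_le h2 (weight_mono fun v hv hvu => Finset.union_subset ?_ hvu)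
    obtain ⟨q, hq⟩ := h.occ_of_sees hs hv
    obtain ⟨q₁, hq₁⟩ := h.occ_of_sees hs hv₁
    rcases h.carrier_first_nested hq hq₁ with h3 | h3
    · exact absurd (subset_trans hvu h3) hu
    · exact hσ.trans h3

open scoped Classical in
/-- If the label of a state `e₀` of a process in `Q` is not determined, then any simplex of outputs
`o` that is connected to the value of an essential carrier `σ` can be realised for the processes
in `Q`. The interval of thresholds is narrowed so that `e₀` gets a label `u`. The states that meet an
output one round later output the next vertex of a path from `o q₀` via `H (σ ∪ u)` to `H u`.
Therefore the outputs in one execution are consecutive on this path, and the states beyond the ladder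
only meet the output `H u`, which is the value of their label. -/
theorem Good.spot_deep (hH : IsHub T n H) (h : Good T H S K) {x₀ : Fin (n + 1) → V}
    {D₀ : Config n V} (hD₀ : Reach T K.δ x₀ D₀) {Q : Finset (Fin (n + 1))}
    (hdepth : ∀ q ∈ Q, K.t < (D₀.state q).depth) (hin : ∀ q ∈ Q, S.In (D₀.state q))
    {o : Fin (n + 1) → W} {qe : Fin (n + 1)} (hqe : qe ∈ Q) {j : ℕ} (hj : S.top.card < j)
    (hj1 : K.l < level j (D₀.state qe)) (hj2 : level j (D₀.state qe) < K.r) {q₀ : Fin (n + 1)}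
    (hq₀ : q₀ ∈ Q) {σ : Finset (Fin (n + 1) × V)} (hσ : Ess S K.l σ (D₀.state q₀))
    {ρ₀ : Finset W} (hρ₀ : ρ₀ ∈ T.Δ (vals σ)) (hoρ : ∀ q ∈ Q, o q ∈ ρ₀)
    (hconn : ∀ q ∈ Q, Conn (T.Δ (vals σ)) (o q) (H σ)) :
    ∃ K', Spot T H S K D₀ Q o K' := by
  have he := h.eta_le
  have h0 := eta_nonneg n K.t
  have hlt := h.lt
  have hl0 := h.l_pos
  have hκ := kappa_le_eta n K.t
  have hκ0 := kappa_nonneg n K.t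
  have hκt := h.kappa_lt le_rfl
  have hwid := h.width
  have hlow := h.low
  have hηdef : eta n K.t = (n + 5) * kappa n K.t := rfl
  set η := eta n K.t with hη
  set κ := kappa n K.t with hκd
  have hn0 : (0 : ℝ) ≤ n := Nat.cast_nonneg n
  have hwf₀ := hD₀.wf
  set e₀ := D₀.state qe with he₀
  have hround : ∀ q ∈ Q, K.t < D₀.round q := fun q hq => hwf₀.depth_state q ▸ hdepth q hq
  -- A subinterval of the thresholds for which `e₀` has a label.
  obtain ⟨a, ha1, ha2, hgap⟩ := exists_gap (n + 1) (fun i => level (i + 1) e₀) hlt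
  set w := (K.r - K.l) / ((n + 1 : ℕ) + 1) with hw
  have hw0 : 0 < w := div_pos (by linarith) (by positivity)
  have hwη : 8 * η ≤ w := by
    rw [hw, le_div_iff₀ (by positivity)]
    push_cast
    linarith
  set b := a + w with hb
  have hclear : ∀ i, S.top.card < i → level i e₀ ≤ a ∨ b ≤ level i e₀ := by
    intro i hi
    rcases Nat.lt_or_ge (n + 1) i with hlt | hge
    · left
      rw [hwf₀.level_eq_zero (D₀.occ_state qe) hlt]
      linarith
    · obtain ⟨k, rfl⟩ : ∃ k, i = k + 1 := ⟨i - 1, by omega⟩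
      exact hgap ⟨k, by omega⟩
  obtain ⟨u, hu⟩ := exists_isLab hwf₀ (by have := hround qe hqe; omega) (D₀.occ_state qe)
    (hin qe hqe) (by linarith) (by linarith : a < b) (by linarith [h.r_le]) hclear
  -- The outputs are led along a path to the value of this label.
  have huin := hu.mem_input hD₀.1 hwf₀ h.top_mem (D₀.occ_state qe)
  have hσin : σ ∈ (T.toTask n).input := by
    rcases hσ with ⟨rfl, h1⟩ | ⟨h1, h2⟩
    · exact h.top_mem h1
    · obtain ⟨v, hv, hvσ⟩ := exists_sees_of_weight_pos (hl0.trans h2)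
      exact hD₀.input (subset_trans hvσ (hD₀.sees_subset (D₀.occ_state q₀) hv))
        (Finset.nonempty_of_ne_empty fun h0 => by simp [h0] at h1)
  have hσne : σ.Nonempty := ((T.toTask n).input.isRelLowerSet_faces hσin).1
  have htop_sub : S.top ⊆ allPairs x₀ := by
    obtain ⟨v, hv, hvt⟩ := h.exists_outside hD₀ (hround q₀ hq₀).le (D₀.occ_state q₀) (hin q₀ hq₀)
      (h.none_of_lt (hdepth q₀ hq₀))
    exact hvt.subset.trans (hD₀.sees_subset (D₀.occ_state q₀) hv)
  have hσu : σ ∪ u ∈ (T.toTask n).input := by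
    refine hD₀.input (Finset.union_subset ?_ ?_) (hσne.mono Finset.subset_union_left)
    · rcases hσ with ⟨rfl, -⟩ | ⟨-, h2⟩
      · exact htop_sub
      · obtain ⟨v, hv, hvσ⟩ := exists_sees_of_weight_pos (hl0.trans h2)
        exact subset_trans hvσ (hD₀.sees_subset (D₀.occ_state q₀) hv)
    · rcases hu with ⟨rfl, -⟩ | ⟨-, ⟨v, hv, rfl⟩, -⟩
      · exact htop_sub
      · exact hD₀.sees_subset (D₀.occ_state qe) hv
  set L := T.Δ (vals (σ ∪ u)) with hL
  have hσL : T.Δ (vals σ) ≤ L := T.Δ_vals_mono hσin hσu Finset.subset_union_left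
  have hσconn : Conn L (H σ) (H (σ ∪ u)) := (hH σ hσin).2 _ hσu Finset.subset_union_left
  have huconn : Conn L (H u) (H (σ ∪ u)) := (hH u huin).2 _ hσu Finset.subset_union_right
  obtain ⟨N, y, hy0, hyN, hy⟩ := Conn.exists_path (((hconn q₀ hq₀).mono hσL).trans
    (hσconn.trans huconn.symm))
  obtain ⟨M, hM⟩ := exists_depth_bound D₀
  set d := max K.t M with hd
  set N₀ : Set (LocalState n V) := {s | ∃ q ∈ Q, D₀.state q = s} with hN₀
  set lad := ladder S N₀ d with hlad
  set f : LocalState n V → Option W := fun s =>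
    if hq : ∃ q ∈ Q, D₀.state q = s then some (o hq.choose)
    else if s.depth ≤ d + N + 1 ∧ s ∈ lad (s.depth - d) then some (y (s.depth - d - 1))
    else none with hf
  have hf0 : ∀ q ∈ Q, f (D₀.state q) = some (o q) := by
    intro q hq
    have hex : ∃ q' ∈ Q, D₀.state q' = D₀.state q := ⟨q, hq, rfl⟩
    simp only [hf, dif_pos hex]
    have h2 := hex.choose_spec.2
    have := hwf₀.occ_proc_unique (D₀.occ_state hex.choose) (h2 ▸ D₀.occ_state q)
    rw [this]
  have hf1 : ∀ i ≤ N, ∀ s ∈ lad (i + 1), f s = some (y i) := by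
    intro i hi s hs
    have hsd : s.depth = d + i + 1 := hs.1
    have hne : ¬ ∃ q ∈ Q, D₀.state q = s := by
      rintro ⟨q, -, rfl⟩
      have := hM q
      omega
    have e1 : s.depth - d = i + 1 := by omega
    simp only [hf, dif_neg hne, e1]
    rw [if_pos ⟨by omega, hs⟩]
    simp
  have hfc : ∀ s c, f s = some c → (∃ q ∈ Q, D₀.state q = s ∧ c = o q) ∨
      ∃ i ≤ N, s ∈ lad (i + 1) ∧ c = y i := by
    intro s c hs
    by_cases hq : ∃ q ∈ Q, D₀.state q = s
    · obtain ⟨q, hq, rfl⟩ := hq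
      rw [hf0 q hq] at hs
      exact Or.inl ⟨q, hq, rfl, by simpa using hs.symm⟩
    · simp only [hf, dif_neg hq] at hs
      split_ifs at hs with hs1
      right
      rcases hi : s.depth - d with _ | i
      · rw [hi] at hs1
        exact absurd hs1.2 hq
      · rw [hi] at hs1 hs
        exact ⟨i, by omega, hs1.2, by simpa using hs.symm⟩
  have hN₀co : ∀ s ∈ N₀, K.t ≤ s.depth ∧ Co s e₀ := by
    rintro s ⟨q, hq, rfl⟩
    exact ⟨(hdepth q hq).le, x₀, D₀, q, _, qe, _, hwf₀, D₀.occ_state q, D₀.occ_state qe⟩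
  have hclose : ∀ i, ∀ s ∈ lad i, ∀ A, |weight A s - weight A e₀| ≤ (n + 3) * κ := fun i s hs A =>
    ladder_close h.t_pos (le_max_left _ _) hN₀co (hdepth qe hqe).le i hs A
  have hMη : (n + 3) * κ ≤ η - 2 * κ := by rw [hηdef]; linarith
  have hladin : ∀ i, ∀ s ∈ lad i, S.In s := by
    rintro (_ | i) s hs
    · obtain ⟨q, hq, rfl⟩ := hs
      exact hin q hq
    · exact hs.2.1
  -- The new states, all of which have a weight close to that of `e₀`.
  have hnew : ∀ {s c}, f s = some c → ∃ i ≤ N + 1, s ∈ lad i := by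
    intro s c hs
    rcases hfc s c hs with ⟨q, hq, hqs, -⟩ | ⟨i, hi, hs', -⟩
    · exact ⟨0, by omega, q, hq, hqs⟩
    · exact ⟨i + 1, by omega, hs'⟩
  have hσu_wt : S.top ⊂ σ ∪ u → K.l - κ < weight {v | σ ∪ u ⊆ v.carrier} e₀ := by
    intro hss
    have hu' : S.top ⊂ u → K.l - κ < weight {v | u ⊆ v.carrier} e₀ := by
      intro hsu
      rcases hu with ⟨rfl, -⟩ | ⟨-, ⟨v, hv, rfl⟩, h1, -⟩
      · exact absurd hsu (ssubset_irrefl _)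
      · have := hwf₀.level_le_weight (D₀.occ_state qe) (D₀.occ_state qe) hv
        linarith
    have hσ' : S.top ⊂ σ → K.l - κ < weight {v | σ ⊆ v.carrier} e₀ := by
      intro hss
      rcases hσ with ⟨rfl, -⟩ | ⟨-, h2⟩
      · exact absurd hss (ssubset_irrefl _)
      · have := abs_le.mp (hwf₀.weight_close h.t_pos (hround q₀ hq₀).le (hround qe hqe).le
          (D₀.occ_state q₀) (D₀.occ_state qe) {v | σ ⊆ v.carrier})
        linarith
    have hσ_or : σ = S.top ∨ S.top ⊂ σ := hσ.imp (·.1) (·.1)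
    have hu_or : u = S.top ∨ S.top ⊂ u := by
      rcases hu with ⟨h1, -⟩ | ⟨h1, -⟩
      exacts [Or.inl h1, Or.inr h1]
    rcases hσ_or with h1 | h1 <;> rcases hu_or with h2 | h2
    · rw [h1, h2, Finset.union_self] at hss
      exact absurd hss (ssubset_irrefl _)
    · rw [h1, Finset.union_eq_right.mpr h2.subset]
      exact hu' h2
    · rw [h2, Finset.union_eq_left.mpr h1.subset]
      exact hσ' h1
    · exact hwf₀.lt_weight_union (D₀.occ_state qe) (hσ' h1) (hu' h2)
  have hσu_or : σ ∪ u = S.top ∨ S.top ⊂ σ ∪ u := by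
    have hσt : S.top ⊆ σ := by rcases hσ with ⟨h1, -⟩ | ⟨h1, -⟩; exacts [h1.ge, h1.subset]
    rcases (hσt.trans Finset.subset_union_left : S.top ⊆ σ ∪ u).eq_or_ssubset with h1 | h1
    exacts [Or.inl h1.symm, Or.inr h1]
  have hess : ∀ i, ∀ s ∈ lad i, Ess S (K.l - η) (σ ∪ u) s := by
    intro i s hs
    rcases hσu_or with h1 | h1
    · exact Or.inl ⟨h1, h1 ▸ hσne.mono Finset.subset_union_left⟩
    · have := abs_le.mp (hclose i s hs {v | σ ∪ u ⊆ v.carrier})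
      have := hσu_wt h1
      exact Or.inr ⟨h1, by linarith⟩
  -- In one execution, the new outputs are among two consecutive ones of the path.
  have hsimp : ∀ x D, Reach T (K.upd f) x D → ∀ (Q' : Finset (Fin (n + 1))) (o' : Fin (n + 1) → W),
      Q'.Nonempty → (∀ q ∈ Q', f (D.state q) = some (o' q)) → ∃ ρ ∈ L, ∀ q ∈ Q', o' q ∈ ρ := by
    intro x D hD Q' o' hQ' ho'
    have hDK := h.reach_of_upd hD
    have hfc' : ∀ q ∈ Q', ∃ i, D.state q ∈ lad i ∧ ((i = 0 ∧ o' q ∈ ρ₀) ∨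
        ∃ k ≤ N, i = k + 1 ∧ o' q = y k) := by
      intro q hq
      rcases hfc _ _ (ho' q hq) with ⟨q', hq', hs, hc⟩ | ⟨i, hi, hs, hc⟩
      · exact ⟨0, ⟨q', hq', hs⟩, Or.inl ⟨rfl, hc ▸ hoρ q' hq'⟩⟩
      · exact ⟨i + 1, hs, Or.inr ⟨i, hi, rfl, hc⟩⟩
    choose! ι hι1 hι2 using hfc'
    obtain ⟨qm, hqm, hmin⟩ := Q'.exists_min_image ι hQ'
    have hι : ∀ q ∈ Q', ι q = ι qm ∨ ι q = ι qm + 1 := by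
      intro q hq
      have h1 := hmin q hq
      by_contra hc
      have hlt : ι qm + 1 < ι q := by omega
      obtain ⟨k, hkN, hk, -⟩ := (hι2 q hq).resolve_left fun h => by omega
      have hqd : (D.state q).depth = d + k + 1 := by
        have := hι1 q hq
        rw [hk] at this
        exact this.1
      rw [hDK.wf.depth_state] at hqd
      obtain ⟨s', hs', hsees⟩ := hDK.wf.exists_ancestor (D.occ_state q) (d := d + ι qm + 1)
        (by omega)
      have hs'o : D.Occ q (d + ι qm + 1) s' := Or.inl hs'
      have hmem : s' ∈ lad (ι qm + 1) := ⟨hDK.wf.depth_eq hs'o,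
        (hladin _ _ (hι1 q hq)).of_sees hsees, _, hι1 qm hqm, x, D, q, _, qm, _, hDK.wf, hs'o,
        D.occ_state qm⟩
      have hact := hD.active hs'
      have hlts : K.t < s'.depth := by
        rw [hDK.wf.depth_eq hs'o]
        have := le_max_left K.t M
        omega
      rw [K.upd_of_lt f hlts, hf1 (ι qm) (by omega) s' hmem] at hact
      simp at hact
    rcases hm : ι qm with _ | k
    · refine ⟨ρ₀, hσL hρ₀, fun q hq => ?_⟩
      rcases hι2 q hq with ⟨-, h2⟩ | ⟨k, -, hk, h2⟩
      · exact h2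
      · have : k = 0 := by have := hι q hq; omega
        rw [h2, this, hy0]
        exact hoρ q₀ hq₀
    · have hkN : k ≤ N := by
        rcases hι2 qm hqm with ⟨h1, -⟩ | ⟨k', h1, h2, -⟩ <;> omega
      have hval : ∀ q ∈ Q', (o' q = y k) ∨ (k < N ∧ o' q = y (k + 1)) := by
        intro q hq
        rcases hι2 q hq with ⟨h1, -⟩ | ⟨k', h1, h2, h3⟩
        · have := hmin q hq
          omega
        · rcases hι q hq with h4 | h4
          · left
            rw [h3, show k' = k by omega]
          · right
            rw [h3, show k' = k + 1 by omega]
            exact ⟨by omega, rfl⟩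
      rcases hkN.lt_or_eq with hlt | heq
      · obtain ⟨ρ, hρ, h1, h2⟩ := hy k hlt
        refine ⟨ρ, hρ, fun q hq => ?_⟩
        rcases hval q hq with h3 | ⟨-, h3⟩ <;> rw [h3] <;> assumption
      · obtain ⟨ρ, hρ, h1⟩ := (hH u huin).1
        refine ⟨ρ, T.Δ_vals_mono huin hσu Finset.subset_union_right hρ, fun q hq => ?_⟩
        rcases hval q hq with h3 | ⟨h3, -⟩
        · rwa [h3, heq, hyN]
        · omega
  obtain ⟨t, ht1, htK, hte, htl, htw⟩ := h.exists_depth (d + N + 2)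
    (c := (b - 2 * η) - (a + 2 * η)) (by linarith)
  have het := eta_nonneg n t
  have hdt : d + N + 2 ≤ t := ht1
  have hMd : M ≤ d := le_max_right _ _
  have hladd : ∀ i ≤ N + 1, ∀ s ∈ lad i, s.depth ≤ d + N + 1 := by
    rintro (_ | i) hi s hs
    · obtain ⟨q, hq, rfl⟩ := hs
      have := hM q
      omega
    · have := hs.1
      omega
  refine ⟨⟨K.upd f, t, K.g, a + 2 * η, b - 2 * η⟩,
    ⟨⟨?_, htK.le, fun s hs => K.upd_of_le f hs, ?_, ?_, .refl S, Or.inl ⟨rfl, le_rfl⟩, ?_⟩,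
    fun p => ?_, ?_, ?_⟩⟩
  · refine ⟨?_, by dsimp only; omega, h.top_mem, h.g_nonneg, ?_, ?_, ?_, ?_, ?_, ?_, ?_, ?_⟩
    · intro s c hs
      rcases K.upd_cases (f := f) hs with ⟨h1, h2⟩ | ⟨h1, h2⟩
      · exact ⟨(h.dom s c h2).1, h1.trans htK.le⟩
      · obtain ⟨i, hi, his⟩ := hnew h2
        have := hladd i hi s his
        dsimp only
        omega
    · dsimp only; linarith
    · dsimp only; linarith
    · dsimp only; linarith [h.r_le]
    · dsimp only; linarith
    · exact htw
    · intro x D hD Q' o' hQ' ho'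
      have hDK := h.reach_of_upd hD
      by_cases hall : ∀ q ∈ Q', (D.state q).depth ≤ K.t
      · refine h.valid x D hDK Q' o' hQ' fun q hq => ⟨(ho' q hq).1, ?_⟩
        rw [← K.upd_of_le f (hall q hq)]
        exact (ho' q hq).2
      · push Not at hall
        obtain ⟨e, heQ, hed⟩ := hall
        have hef : f (D.state e) = some (o' e) := by
          rw [← K.upd_of_lt f hed]
          exact (ho' e heQ).2
        obtain ⟨i, hi, his⟩ := hnew hef
        have hen := h.none_of_lt hed
        have hed' := hed.le
        rw [hDK.wf.depth_state] at hed'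
        have hlev : |level j (D.state e) - level j e₀| ≤ (n + 3) * κ := hclose i _ his _
        rw [abs_le] at hlev
        -- Old outputs do not occur together with new ones, as the latter have no label.
        have hval : ∀ q ∈ Q', f (D.state q) = some (o' q) := by
          intro q hq
          rcases K.upd_cases (f := f) (ho' q hq).2 with ⟨h1, h2⟩ | ⟨h1, h2⟩
          · obtain ⟨τ', hτ', -⟩ := h.frontier x D hDK q _ h2 e _ _ hed' (D.occ_state e)
              (hladin i _ his) hen
            exfalso
            rcases hτ'.clear hj with h3 | h3 <;> linarith
          · exact h2
        obtain ⟨ρ, hρ, hmem⟩ := hsimp x D hD Q' o' hQ' hval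
        refine ⟨ρ, hDK.Δ_le_carrier heQ ?_ (hσne.mono Finset.subset_union_left) hρ, hmem⟩
        rcases hess i _ his with ⟨h1, -⟩ | ⟨h1, h2⟩
        · rw [h1]
          obtain ⟨v, hv, hvt⟩ := h.exists_outside hDK hed' (D.occ_state e) (hladin i _ his) hen
          exact hvt.subset.trans hv.carrier_subset
        · obtain ⟨v, hv, hvt⟩ := exists_sees_of_weight_pos
            (lt_of_le_of_lt (by linarith : 0 ≤ K.l - η) h2)
          exact subset_trans hvt hv.carrier_subset
    · intro x D hD p c hp q e s hes hs hsin hn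
      have hDK := h.reach_of_upd hD
      have hn' := h.none_of_upd (f := f) hn
      dsimp only at hes ⊢
      rcases K.upd_cases (f := f) hp with ⟨h1, h2⟩ | ⟨h1, h2⟩
      · obtain ⟨τ', hτ', hc⟩ := h.frontier x D hDK p c h2 q e s (by omega) hs hsin hn'
        exact ⟨τ', hτ'.mono (by linarith) (by linarith), hc⟩
      · have hstep : ∀ i ≤ N, D.state p ∉ lad i := by
          intro i hi his
          obtain ⟨s', hs', hsees⟩ := hDK.wf.exists_ancestor hs (d := d + i + 1) (by omega)
          have hs'o : D.Occ q (d + i + 1) s' := Or.inl hs'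
          have hmem : s' ∈ lad (i + 1) := ⟨hDK.wf.depth_eq hs'o, hsin.of_sees hsees, _, his, x, D,
            q, _, p, _, hDK.wf, hs'o, D.occ_state p⟩
          have hact : K.upd f s' = none := hD.active hs'
          have hlts : K.t < s'.depth := by
            rw [hDK.wf.depth_eq hs'o]
            have := le_max_left K.t M
            omega
          rw [K.upd_of_lt f hlts, hf1 i hi s' hmem] at hact
          simp at hact
        rcases hfc _ _ h2 with ⟨q', hq', hs', -⟩ | ⟨i, hi, hs', hc⟩
        · exact absurd ⟨q', hq', hs'⟩ (hstep 0 (Nat.zero_le _))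
        · obtain rfl : i = N := by
            by_contra hne
            exact hstep (i + 1) (by omega) hs'
          rw [hDK.wf.depth_state] at h1
          refine ⟨u, (hu.transfer hwf₀ (D₀.occ_state qe) (s' := s) (M := η) (fun A => ?_)
            (by linarith)).mono (by linarith) (by linarith), by rw [hc, hyN]⟩
          have h3 := hclose _ _ hs' A
          have h4 := hDK.wf.weight_close h.t_pos (by omega) h1.le hs (D.occ_state p) A
          have := abs_sub_le (weight A s) (weight A (D.state p)) (weight A e₀)
          linarith
    · intro x D hD q e s hes hs hsin hn
      exact h.outside x D (h.reach_of_upd hD) q e s (htK.le.trans hes) hs hsin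
        (h.none_of_upd (f := f) hn)
  · dsimp only; linarith
  · dsimp only; linarith
  · intro x D hD Q' o' hQ' ho'
    have hn : ∀ q ∈ Q', f (D.state q) = some (o' q) := fun q hq => by
      rw [← K.upd_of_lt f (ho' q hq).1]
      exact (ho' q hq).2
    obtain ⟨e, heQ⟩ := hQ'
    obtain ⟨i, hi, his⟩ := hnew (hn e heQ)
    have hlev : |level j (D.state e) - level j e₀| ≤ (n + 3) * κ := hclose i _ his _
    rw [abs_le] at hlev
    refine ⟨fun q hq => ?_, Or.inr ⟨⟨e, heQ, j, hj, by linarith, by linarith⟩, e, heQ, σ ∪ u,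
      hess i _ his, hsimp x D hD Q' o' ⟨e, heQ⟩ hn, fun q hq => ?_⟩⟩
    · obtain ⟨i', -, his'⟩ := hnew (hn q hq)
      exact hladin i' _ his'
    · rcases hfc _ _ (hn q hq) with ⟨q', hq', -, hc⟩ | ⟨k, hk, -, hc⟩
      · rw [hc]
        exact ((hconn q' hq').mono hσL).trans hσconn
      · rw [hc]
        exact (Conn.of_path hy hk).trans (hyN ▸ huconn)
  · have := hM p
    dsimp only
    omega
  · intro q hq
    dsimp only
    rw [K.upd_of_lt f (hdepth q hq)]
    exact hf0 q hq
  · intro r p s hs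
    dsimp only
    rcases Nat.lt_or_ge K.t s.depth with h1 | h1
    · rw [K.upd_of_lt f h1, h.none_of_lt h1]
      by_contra hne
      obtain ⟨c, hc⟩ := Option.ne_none_iff_exists'.mp hne
      rcases hfc _ _ hc with ⟨q, -, hq, -⟩ | ⟨i, -, hi, -⟩
      · exact hwf₀.mem_ne_state hs hq
      · have h2 : s.depth = d + i + 1 := hi.1
        have hso : D₀.Occ p r s := Or.inl hs
        have h3 := hwf₀.round_of_occ hso
        have h4 := hM p
        rw [hwf₀.depth_state] at h4
        rw [hwf₀.depth_eq hso] at h2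
        omega
    · exact K.upd_of_le f h1

/-- Outputs that are admissible beyond the frontier can be realised. -/
theorem Good.exists_spot (hH : IsHub T n H) (h : Good T H S K) {x₀ : Fin (n + 1) → V}
    {D₀ : Config n V} (hD₀ : Reach T K.δ x₀ D₀) {Q : Finset (Fin (n + 1))}
    (hdepth : ∀ q ∈ Q, K.t < (D₀.state q).depth) {o : Fin (n + 1) → W}
    (ho : Adm T H S K.l K.r D₀ Q o) : ∃ K', Spot T H S K D₀ Q o K' := by
  obtain ⟨hin, ⟨τ, hτ⟩ | ⟨⟨q, hq, j, hj, h1, h2⟩, q₀, hq₀, σ, h3, ⟨ρ, hρ, h4⟩, h5⟩⟩ := ho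
  · exact h.spot_label hH hD₀ hdepth hin hτ
  · exact h.spot_deep hH hD₀ hdepth hin hq hj h1 h2 hq₀ h3 hρ h4 h5

end SpotDeep

/-! ### Extending the known part of the first round -/

section Fill

open LocalState Config

variable {n : ℕ} {V W : Type*} {T : ColorlessTask V W} {H : Finset (Fin (n + 1) × V) → W}
  {S : FirstRound n V} {K : Know n V W}

/-- A monotone function onto `{0, …, N}` that is constant outside of `[a, b]` and increases by at
most one on short intervals. -/
theorem exists_ramp (N : ℕ) {a b : ℝ} (hab : a < b) :
    ∃ (ε : ℝ) (idx : ℝ → ℕ), 0 < ε ∧ (∀ c ≤ a, idx c = 0) ∧ (∀ c, b ≤ c → idx c = N) ∧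
      (∀ c, idx c ≤ N) ∧ ∀ c c', |c - c'| < ε → idx c ≤ idx c' + 1 := by
  have hba : 0 < b - a := by linarith
  refine ⟨(b - a) / (N + 1), fun c => ⌊N * max 0 (min 1 ((c - a) / (b - a)))⌋₊, by positivity,
    fun c hc => ?_, fun c hc => ?_, fun c => ?_, fun c c' hcc => ?_⟩
  · have : (c - a) / (b - a) ≤ 0 := div_nonpos_of_nonpos_of_nonneg (by linarith) hba.le
    simp [max_eq_left ((min_le_right _ _).trans this)]
  · have : 1 ≤ (c - a) / (b - a) := by rw [le_div_iff₀ hba]; linarith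
    simp [min_eq_left this]
  · refine Nat.floor_le_of_le ?_
    have : max 0 (min 1 ((c - a) / (b - a))) ≤ 1 := max_le zero_le_one (min_le_left _ _)
    nlinarith [(Nat.cast_nonneg N : (0 : ℝ) ≤ N)]
  · rw [← Nat.floor_add_one (by positivity)]
    refine Nat.floor_mono ?_
    rw [lt_div_iff₀ (by positivity)] at hcc
    have hN : (0 : ℝ) ≤ N := Nat.cast_nonneg N
    have h1 : (c - a) / (b - a) - (c' - a) / (b - a) ≤ |c - c'| / (b - a) := by
      rw [← sub_div]
      refine div_le_div_of_nonneg_right ?_ hba.le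
      have := le_abs_self (c - c')
      linarith
    have h2 : max 0 (min 1 ((c - a) / (b - a))) - max 0 (min 1 ((c' - a) / (b - a))) ≤
        |c - c'| / (b - a) := by
      have h0 : 0 ≤ |c - c'| / (b - a) := by positivity
      rcases le_total 1 ((c - a) / (b - a)) with h3 | h3 <;>
      rcases le_total 1 ((c' - a) / (b - a)) with h4 | h4 <;>
      rcases le_total 0 ((c - a) / (b - a)) with h5 | h5 <;>
      rcases le_total 0 ((c' - a) / (b - a)) with h6 | h6 <;>
      simp only [min_eq_left, min_eq_right, max_eq_left, max_eq_right, zero_le_one, h3, h4, h5,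
        h6] <;> linarith
    have h3 : |c - c'| / (b - a) * N ≤ 1 := by
      rw [div_mul_eq_mul_div, div_le_one hba]
      nlinarith [abs_nonneg (c - c')]
    nlinarith

open scoped Classical in
/-- If a further set of processes has taken its first step and has seen the inputs `τ`, then the
processes that do not see more than these can be made to terminate. The output is led from the value
of `S.top` to that of `τ` as the weight of `τ` increases. -/
theorem Good.exists_fill (hH : IsHub T n H) (h : Good T H S K) {τ : Finset (Fin (n + 1) × V)}
    (hτ : τ ∈ (T.toTask n).input) (hSτ : S.top ⊂ τ) (m : ℕ) (S' : FirstRound n V)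
    (hS't : S'.top = τ) (hS'c : S'.chain = insert τ S.chain) :
    ∃ K', KnowExt T H S K S' K' ∧ m ≤ K'.t := by
  have he := h.eta_le
  have h0 := eta_nonneg n K.t
  have hlt := h.lt
  have hl0 := h.l_pos
  have hκ := kappa_le_eta n K.t
  have hκ0 := kappa_nonneg n K.t
  have hκt := h.kappa_lt le_rfl
  set η := eta n K.t with hη
  set w := K.r - K.l with hw
  have hw0 : 0 < w := by linarith
  have hstar : S.Le S' := ⟨hS't ▸ hSτ.subset, fun σ hσ => by
    rw [hS'c] at hσ
    rcases hσ with rfl | hσ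
    exacts [Or.inr hSτ, Or.inl hσ]⟩
  have hin : ∀ {s : LocalState n V}, S'.In s → S.In s := fun hs => hstar.in hs
  -- Every state that has seen more than `S.top` has seen `τ`.
  have hsees : ∀ {s v : LocalState n V}, S'.In s → Sees s v → S.top.card + 1 ≤ v.carrier.card →
      τ ⊆ v.carrier := by
    intro s v hs hv hc
    rcases hs v hv with h1 | h1
    · rw [hS'c] at h1
      rcases h1 with h1 | h1
      · exact h1.ge
      · have := Finset.card_le_card (S.le_top _ h1)
        omega
    · rw [hS't] at h1
      exact h1.subset
  have hcard := Finset.card_lt_card hSτ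
  obtain ⟨N, y, hy0, hyN, hy⟩ : ∃ (N : ℕ) (y : ℕ → W), (S.top.Nonempty → y 0 = H S.top) ∧
      y N = H τ ∧ ∀ i < N, ∃ ρ ∈ T.Δ (vals τ), y i ∈ ρ ∧ y (i + 1) ∈ ρ := by
    by_cases hne : S.top.Nonempty
    · obtain ⟨N, y, h1, h2, h3⟩ := Conn.exists_path ((hH _ (h.top_mem hne)).2 τ hτ hSτ.subset)
      exact ⟨N, y, fun _ => h1, h2, h3⟩
    · exact ⟨0, fun _ => H τ, fun h1 => absurd h1 hne, rfl, by simp⟩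
  obtain ⟨ε, idx, hε, hidx0, hidxN, hidxle, hidx⟩ := exists_ramp N
    (a := K.l + w / 4) (b := K.l + w / 2) (by linarith)
  -- The depth of the states that are to terminate.
  obtain ⟨d, hd1, -, hd3⟩ := exists_kappa_lt n (K.t + 1) (ε := min ε (w / 64))
    (lt_min hε (by linarith))
  have hdε : kappa n d < ε := lt_of_lt_of_le hd3 (min_le_left _ _)
  have hdw : kappa n d < w / 64 := lt_of_lt_of_le hd3 (min_le_right _ _)
  have hd0 := kappa_nonneg n d
  set ln := K.l + 5 * w / 8 with hln
  set f : LocalState n V → Option W := fun s =>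
    if s.depth = d ∧ S'.In s ∧ level (τ.card + 1) s ≤ ln then
      some (y (idx (level (S.top.card + 1) s))) else none with hf
  have hnew : ∀ {s c}, f s = some c → s.depth = d ∧ S'.In s ∧ level (τ.card + 1) s ≤ ln ∧
      c = y (idx (level (S.top.card + 1) s)) := by
    intro s c hs
    simp only [hf] at hs
    split_ifs at hs with h1
    exact ⟨h1.1, h1.2.1, h1.2.2, by simpa using hs.symm⟩
  have hactive : ∀ {s : LocalState n V}, s.depth = d → S'.In s → K.upd f s = none → ln < level (τ.card + 1) s := by
    intro s hs1 hs2 hs3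
    rw [K.upd_of_lt f (by omega)] at hs3
    by_contra hc
    simp only [hf] at hs3
    rw [if_pos ⟨hs1, hs2, not_lt.mp hc⟩] at hs3
    simp at hs3
  have hval0 : ∀ {s c}, f s = some c → level (S.top.card + 1) s ≤ K.l + w / 4 → c = y 0 := by
    intro s c hs h1
    rw [(hnew hs).2.2.2, hidx0 _ h1]
  have hvalN : ∀ {s c}, f s = some c → K.l + w / 2 ≤ level (S.top.card + 1) s → c = H τ := by
    intro s c hs h1
    rw [(hnew hs).2.2.2, hidxN _ h1, hyN]
  have hclose : ∀ {x : Fin (n + 1) → V} {D : Config n V}, D.WF x → ∀ {p p' : Fin (n + 1)} {e e' : ℕ}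
      {s s' : LocalState n V}, d ≤ e → d ≤ e' → D.Occ p e s → D.Occ p' e' s' →
      ∀ j, |level j s - level j s'| ≤ kappa n d :=
    fun hD _ _ _ _ _ _ he he' hs hs' _ => hD.weight_close (by omega) he he' hs hs' _
  have hsimp : ∀ x D, Config.WF x D → ∀ (Q : Finset (Fin (n + 1))) (o : Fin (n + 1) → W),
      Q.Nonempty → (∀ q ∈ Q, f (D.state q) = some (o q)) →
      ∃ ρ ∈ T.Δ (vals τ), ∀ q ∈ Q, o q ∈ ρ := by
    intro x D hD Q o hQ ho
    obtain ⟨qm, hqm, hmin⟩ := Q.exists_min_image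
      (fun q => idx (level (S.top.card + 1) (D.state q))) hQ
    have hdq : ∀ q ∈ Q, D.round q = d := fun q hq =>
      (hD.depth_state q).symm.trans (hnew (ho q hq)).1
    set i := idx (level (S.top.card + 1) (D.state qm)) with hi
    have hval : ∀ q ∈ Q, o q = y i ∨ (i < N ∧ o q = y (i + 1)) := by
      intro q hq
      rw [(hnew (ho q hq)).2.2.2]
      have h1 := hmin q hq
      have h2 := hidx (level (S.top.card + 1) (D.state q)) (level (S.top.card + 1) (D.state qm))
        (lt_of_le_of_lt (hclose hD (hdq q hq).ge (hdq qm hqm).ge (D.occ_state q) (D.occ_state qm) _)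
          hdε)
      have h3 := hidxle (level (S.top.card + 1) (D.state q))
      rcases Nat.lt_or_eq_of_le h1 with h4 | h4
      · right
        rw [show idx (level (S.top.card + 1) (D.state q)) = i + 1 by omega] at h3 ⊢
        exact ⟨by omega, rfl⟩
      · left
        rw [← h4]
    rcases (show i ≤ N from hidxle _).lt_or_eq with hlt | heq
    · obtain ⟨ρ, hρ, h1, h2⟩ := hy i hlt
      refine ⟨ρ, hρ, fun q hq => ?_⟩
      rcases hval q hq with h3 | ⟨-, h3⟩ <;> rw [h3] <;> assumption
    · obtain ⟨ρ, hρ, h1⟩ := (hH τ hτ).1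
      refine ⟨ρ, hρ, fun q hq => ?_⟩
      rcases hval q hq with h3 | ⟨h3, -⟩
      · rw [h3, show i = N from heq, hyN]
        exact h1
      · omega
  obtain ⟨t, ht1, htK, hte, htl, htw⟩ := h.exists_depth (max m (d + 1)) (c := w / 8) (by linarith)
  have het := eta_nonneg n t
  have hetw : 16 * eta n t ≤ w / 8 := by
    refine le_trans ?_ htw
    nlinarith [(Nat.cast_nonneg n : (0 : ℝ) ≤ n)]
  have hdt : d + 1 ≤ t := (le_max_right _ _).trans ht1
  -- A label with respect to `S` of a state that sees `S'` is the top or `τ` or belongs to `S'`.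
  have hlabel : ∀ {s : LocalState n V} {l r : ℝ} {σ : Finset (Fin (n + 1) × V)}, S'.In s → IsLab S l r s σ → σ = S.top ∨ σ = τ ∨ τ ⊂ σ := by
    intro s l r σ hs hσ
    rcases hσ with ⟨h1, -⟩ | ⟨h1, ⟨v, hv, rfl⟩, -⟩
    · exact Or.inl h1
    · have h2 := Finset.card_lt_card h1
      rcases (hsees hs hv h2).eq_or_ssubset with h3 | h3
      exacts [Or.inr (Or.inl h3.symm), Or.inr (Or.inr h3)]
  refine ⟨⟨K.upd f, t, ln, K.l + 3 * w / 4, K.r - w / 8⟩,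
    ⟨?_, htK.le, fun s hs => K.upd_of_le f hs, ?_, ?_, hstar,
      Or.inr ⟨hS't ▸ hSτ, by dsimp only; linarith⟩, ?_⟩, (le_max_left _ _).trans ht1⟩
  · refine ⟨?_, by dsimp only; omega, fun _ => hS't ▸ hτ, ?_, ?_, ?_, ?_, ?_, ?_, ?_, ?_, ?_⟩
    · intro s c hs
      rcases K.upd_cases (f := f) hs with ⟨h1, h2⟩ | ⟨h1, h2⟩
      · exact ⟨(h.dom s c h2).1, h1.trans htK.le⟩
      · have := (hnew h2).1
        dsimp only
        omega
    · dsimp only; linarith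
    · dsimp only; linarith
    · dsimp only; linarith
    · dsimp only; linarith [h.r_le]
    · dsimp only; linarith
    · dsimp only; linarith
    · intro x D hD Q' o' hQ' ho'
      have hDK := h.reach_of_upd hD
      by_cases hall : ∀ q ∈ Q', (D.state q).depth ≤ K.t
      · refine h.valid x D hDK Q' o' hQ' fun q hq => ⟨hin (ho' q hq).1, ?_⟩
        rw [← K.upd_of_le f (hall q hq)]
        exact (ho' q hq).2
      · push Not at hall
        obtain ⟨e, heQ, hed⟩ := hall
        have hef : f (D.state e) = some (o' e) := by
          rw [← K.upd_of_lt f hed]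
          exact (ho' e heQ).2
        obtain ⟨hedep, hein, hele, -⟩ := hnew hef
        have hen := h.none_of_lt hed
        have hed' := hed.le
        rw [hDK.wf.depth_state] at hed' hedep
        by_cases hold : ∃ p ∈ Q', (D.state p).depth ≤ K.t
        · -- All outputs are the value of the label that determined the old ones.
          obtain ⟨p, hp, hpd⟩ := hold
          obtain ⟨σ, hσ, -⟩ := h.frontier x D hDK p (o' p)
            (by rw [← K.upd_of_le f hpd]; exact (ho' p hp).2) e _ _ hed' (D.occ_state e)
            (hin hein) hen
          have hval : ∀ q ∈ Q', o' q = H σ := by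
            intro q hq
            rcases K.upd_cases (f := f) (ho' q hq).2 with ⟨h1, h2⟩ | ⟨h1, h2⟩
            · obtain ⟨σ', hσ', hc⟩ := h.frontier x D hDK q _ h2 e _ _ hed' (D.occ_state e)
                (hin hein) hen
              rw [hc, IsLab.unique hDK.wf h.t_pos hed' hed' (D.occ_state e) (D.occ_state e) hσ' hσ
                (by linarith) (by linarith)]
            · have hqd := (hnew h2).1
              rw [hDK.wf.depth_state] at hqd
              have hcl := abs_le.mp (hclose hDK.wf hqd.ge hedep.ge (D.occ_state q) (D.occ_state e)
                (S.top.card + 1))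
              rcases hlabel hein hσ with rfl | rfl | h3
              · rcases hσ with ⟨-, h4, h5⟩ | ⟨h4, -⟩
                · rw [hval0 h2 (by linarith), hy0 h4]
                · exact absurd h4 (ssubset_irrefl _)
              · rcases hσ with ⟨h4, -⟩ | ⟨-, -, h4, -⟩
                · rw [h4] at hSτ
                  exact absurd hSτ (ssubset_irrefl _)
                · have := level_anti (Nat.succ_le_of_lt hcard) (D.state e)
                  exact hvalN h2 (by linarith)
              · rcases hσ with ⟨rfl, -⟩ | ⟨-, -, h4, -⟩
                · exact absurd (h3.trans hSτ) (ssubset_irrefl _)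
                · have := level_anti (Nat.succ_le_of_lt (Finset.card_lt_card h3)) (D.state e)
                  linarith
          have hsub := h.isLab_subset hDK hed' (D.occ_state e) (hin hein) hen hσ
          obtain ⟨ρ, hρ, hmem⟩ := (hH σ (hσ.mem_input hDK.1 hDK.wf h.top_mem (D.occ_state e))).1
          exact ⟨ρ, hDK.Δ_le_carrier heQ hsub hσ.nonempty hρ, fun q hq => hval q hq ▸ hmem⟩
        · push Not at hold
          obtain ⟨ρ, hρ, hmem⟩ := hsimp x D hDK.wf Q' o' hQ' fun q hq => by
            rw [← K.upd_of_lt f (hold q hq)]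
            exact (ho' q hq).2
          obtain ⟨v, hv, hvs⟩ := h.exists_outside hDK hed' (D.occ_state e) (hin hein) hen
          have hτv := hsees hein hv (Finset.card_lt_card hvs)
          exact ⟨ρ, hDK.Δ_le_carrier heQ (hτv.trans hv.carrier_subset)
            ((T.toTask n).input.isRelLowerSet_faces hτ).1 hρ, hmem⟩
    · intro x D hD p c hp q e s hes hs hsin hn
      have hDK := h.reach_of_upd hD
      have hn' := h.none_of_upd (f := f) hn
      dsimp only at hes ⊢
      obtain ⟨s', hs', hss'⟩ := hDK.wf.exists_ancestor hs (d := d) (by omega)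
      have hs'o : D.Occ q d s' := Or.inl hs'
      have hs'l := hactive (hDK.wf.depth_eq hs'o) (hsin.of_sees hss') (hD.active hs')
      have hcl := abs_le.mp (hclose hDK.wf (by omega) le_rfl hs hs'o (τ.card + 1))
      rcases K.upd_cases (f := f) hp with ⟨h1, h2⟩ | ⟨h1, h2⟩
      · obtain ⟨σ, hσ, hc⟩ := h.frontier x D hDK p c h2 q e s (by omega) hs (hin hsin) hn'
        refine ⟨σ, ?_, hc⟩
        have hbig : K.r + η ≤ level (τ.card + 1) s := by
          rcases hσ.clear (j := τ.card + 1) (by omega) with h3 | h3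
          · linarith
          · exact h3
        rcases hlabel hsin hσ with h3 | h3 | h3
        · rcases hσ with ⟨-, -, h4⟩ | ⟨h4, -⟩
          · have := level_anti (show S.top.card + 1 ≤ τ.card + 1 by omega) s
            linarith
          · rw [h3] at h4
            exact absurd h4 (ssubset_irrefl _)
        · rcases hσ with ⟨h4, -⟩ | ⟨-, -, -, h4⟩
          · rw [← h4, h3] at hSτ
            exact absurd hSτ (ssubset_irrefl _)
          · rw [h3] at h4
            linarith
        · rcases hσ with ⟨rfl, -⟩ | ⟨-, h4, h5, h6⟩
          · exact absurd (h3.trans hSτ) (ssubset_irrefl _)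
          · exact Or.inr ⟨hS't ▸ h3, h4, by linarith, by linarith⟩
      · have hpd := (hnew h2).1
        rw [hDK.wf.depth_state] at hpd
        have hcl' := abs_le.mp (hclose hDK.wf hpd.ge le_rfl (D.occ_state p) hs'o (τ.card + 1))
        have hpl := (hnew h2).2.2.1
        have := level_anti (show S.top.card + 1 ≤ τ.card + 1 by omega) (D.state p)
        refine ⟨τ, Or.inl ⟨hS't.symm, hS't ▸ ((T.toTask n).input.isRelLowerSet_faces hτ).1, ?_⟩,
          hvalN h2 (by linarith)⟩
        rw [hS't]
        linarith
    · intro x D hD q e s hes hs hsin hn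
      dsimp only at hes ⊢
      have hDK := h.reach_of_upd hD
      rw [hS't]
      refine hDK.wf.occ_induction (d := d)
        (P := fun s => S'.In s → K.upd f s = none → ln < level (τ.card + 1) s) ?_ ?_ (by omega) hs
        hsin hn
      · intro p s hs hsin hn
        exact hactive (hDK.wf.depth_eq hs) hsin hn
      · intro p e snap hde ho hc hsin _
        obtain ⟨s₁, hs₁⟩ := Option.ne_none_iff_exists'.mp (hDK.wf.occ_self_ne_none ho)
        refine lt_pos_view (hDK.wf.view_depth_ne_one (by omega) ho) (q₀ := p) (by simp [hs₁]) ?_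
        intro q s hq
        exact (hc q s hq).2 (hsin.of_sees fun v hv => .cell hq hv) (hD.active (hc q s hq).1)
  · dsimp only; linarith
  · dsimp only; linarith
  · intro x D hD Q' o' hQ' ho'
    have hDK := h.reach_of_upd hD
    have hn : ∀ q ∈ Q', f (D.state q) = some (o' q) := fun q hq => by
      rw [← K.upd_of_lt f (ho' q hq).1]
      exact (ho' q hq).2
    have hdq : ∀ q ∈ Q', D.round q = d := fun q hq =>
      (hDK.wf.depth_state q).symm.trans (hnew (hn q hq)).1
    have hτlevel : ∀ q ∈ Q', level (S.top.card + 1) (D.state q) ≤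
        weight {v | τ ⊆ v.carrier} (D.state q) := fun q hq =>
      weight_mono fun v hv hc => hsees (hnew (hn q hq)).2.1 hv hc
    refine Adm.mono (l := K.l) (r := K.r) hH hD.1 hD.wf h.top_mem (by linarith) hlt (by linarith)
      ⟨fun q hq => hin (hnew (hn q hq)).2.1, ?_⟩
    by_cases hdeep : ∃ q ∈ Q', ∃ j, (j = S.top.card + 1 ∨ j = τ.card + 1) ∧
        K.l < level j (D.state q) ∧ level j (D.state q) < K.r
    · obtain ⟨q, hq, j, hj, h1, h2⟩ := hdeep
      have hj' : S.top.card + 1 ≤ j := by omega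
      have h3 := level_anti hj' (D.state q)
      refine Or.inr ⟨⟨q, hq, j, hj', h1, h2⟩, q, hq, τ, Or.inr ⟨hSτ, ?_⟩,
        hsimp x D hDK.wf Q' o' hQ' hn, fun q' hq' => ?_⟩
      · linarith [hτlevel q hq]
      · rw [(hnew (hn q' hq')).2.2.2]
        exact hyN ▸ Conn.of_path hy (hidxle _)
    · push Not at hdeep
      have hlow : ∀ q ∈ Q', level (τ.card + 1) (D.state q) ≤ K.l := by
        intro q hq
        by_contra hc
        have h1 := hdeep q hq _ (Or.inr rfl) (not_le.mp hc)
        have h2 := (hnew (hn q hq)).2.2.1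
        linarith
      have hcl := fun q hq q' hq' => abs_le.mp (hclose hDK.wf (hdq q hq).ge (hdq q' hq').ge
        (D.occ_state q) (D.occ_state q') (S.top.card + 1))
      obtain ⟨q₁, hq₁⟩ := hQ'
      refine Or.inl ?_
      rcases le_or_gt (level (S.top.card + 1) (D.state q₁)) K.l with h1 | h1
      · have hall : ∀ q ∈ Q', level (S.top.card + 1) (D.state q) ≤ K.l := by
          intro q hq
          by_contra hc
          have h2 := hdeep q hq _ (Or.inl rfl) (not_le.mp hc)
          have h3 := hcl q hq q₁ hq₁
          linarith
        have hne : S.top.Nonempty := by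
          by_contra hne
          rw [Finset.not_nonempty_iff_eq_empty] at hne
          rw [hne, Finset.card_empty, zero_add, hDK.wf.level_one (by have := hdq q₁ hq₁; omega)
            (D.occ_state q₁)] at h1
          linarith [h.r_le]
        refine ⟨S.top, fun q hq => ⟨Or.inl ⟨rfl, hne, hall q hq⟩, ?_⟩⟩
        rw [hval0 (hn q hq) (by linarith [hall q hq]), hy0 hne]
      · have hall : ∀ q ∈ Q', K.r ≤ level (S.top.card + 1) (D.state q) := by
          intro q hq
          refine hdeep q hq _ (Or.inl rfl) ?_
          have h2 := hdeep q₁ hq₁ _ (Or.inl rfl) h1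
          have h3 := hcl q hq q₁ hq₁
          linarith
        refine ⟨τ, fun q hq => ⟨Or.inr ⟨hSτ, ?_, ?_, hlow q hq⟩, hvalN (hn q hq)
          (by linarith [hall q hq])⟩⟩
        · obtain ⟨v, hv, hv1, hv2⟩ := exists_sees_of_weight_lt
            (lt_of_le_of_lt (hlow q hq) (lt_of_lt_of_le hlt (hall q hq)))
          refine ⟨v, hv, (Finset.eq_of_subset_of_card_le (hsees (hnew (hn q hq)).2.1 hv hv1) ?_).symm⟩
          simp only [Set.mem_ofPred_eq] at hv2
          omega
        · refine (hall q hq).trans (weight_mono fun v hv hc => ?_)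
          exact Finset.card_le_card (hsees (hnew (hn q hq)).2.1 hv hc)

end Fill

/-! ### Evolution of partial decision maps -/

section Future

open LocalState Config

variable {n : ℕ} {V W : Type*} {T : ColorlessTask V W} {H : Finset (Fin (n + 1) × V) → W}
  {S : FirstRound n V} {K : Know n V W} {S₀ : FirstRound n V} {K₀ : Know n V W}

/-- `K` (with `S`) is a later stage of `K₀` (with `S₀`) in which all outputs beyond the frontier of
`K₀` are admissible with respect to `K₀`. -/
structure Future (T : ColorlessTask V W) (H : Finset (Fin (n + 1) × V) → W) (S₀ : FirstRound n V)
    (K₀ : Know n V W) (S : FirstRound n V) (K : Know n V W) : Prop where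
  t_le : K₀.t ≤ K.t
  agree : ∀ s : LocalState n V, s.depth ≤ K₀.t → K.δ s = K₀.δ s
  l_le : K₀.l ≤ K.l - eta n K.t
  r_le : K.r + eta n K.t ≤ K₀.r
  star : S₀.Le S
  base : S.top = S₀.top ∨ (S₀.top ⊂ S.top ∧ K₀.l ≤ K.g)
  adm : ∀ x D, Reach T K.δ x D → ∀ (Q : Finset (Fin (n + 1))) (o : Fin (n + 1) → W), Q.Nonempty →
    (∀ q ∈ Q, K₀.t < (D.state q).depth ∧ K.δ (D.state q) = some (o q)) →
    Adm T H S₀ K₀.l K₀.r D Q o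

theorem KnowExt.future (h : Good T H S K) {K' : Know n V W} (he : KnowExt T H S K S K')
    (hδ : K'.δ = K.δ) : Future T H S K S K' where
  t_le := he.t_le
  agree := he.agree
  l_le := he.l_le
  r_le := he.r_le
  star := he.star
  base := Or.inl rfl
  adm := by
    rintro x D - Q o ⟨q, hq⟩ ho
    have h1 := ho q hq
    rw [hδ, h.none_of_lt h1.1] at h1
    simp at h1

/-- Constant outputs are admissible if one of them is. -/
theorem Adm.of_const {x : Fin (n + 1) → V} {D : Config n V} (h : Good T H S K) (hH : IsHub T n H)
    (hD : Reach T K.δ x D) {Q : Finset (Fin (n + 1))} {o : Fin (n + 1) → W} {q₁ : Fin (n + 1)}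
    (hq₁ : q₁ ∈ Q) (hconst : ∀ q ∈ Q, o q = o q₁) (hin : ∀ q ∈ Q, S.In (D.state q))
    (hdepth : ∀ q ∈ Q, K.t < (D.state q).depth) (hadm : Adm T H S K.l K.r D {q₁} o) :
    Adm T H S K.l K.r D Q o := by
  have hwf := hD.wf
  have hround : ∀ q ∈ Q, K.t < D.round q := fun q hq => hwf.depth_state q ▸ hdepth q hq
  refine ⟨hin, ?_⟩
  by_cases hdeep : ∃ q ∈ Q, ∃ j, S.top.card < j ∧ K.l < level j (D.state q) ∧
      level j (D.state q) < K.r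
  · rcases hadm.2 with ⟨τ, hτ⟩ | ⟨-, q₀, hq₀, σ, h1, ⟨ρ, hρ, h2⟩, h3⟩
    · obtain ⟨hlab, ho⟩ := hτ q₁ (Finset.mem_singleton_self _)
      obtain ⟨ρ, hρ, hmem⟩ := (hH τ (hlab.mem_input hD.1 hwf h.top_mem (D.occ_state _))).1
      refine Or.inr ⟨hdeep, q₁, hq₁, τ, ?_, ⟨ρ, hρ, fun q hq => ?_⟩, fun q hq => ?_⟩
      · rcases hlab with ⟨h1, h2, -⟩ | ⟨h1, ⟨v, hv, rfl⟩, h2, -⟩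
        · exact Or.inl ⟨h1, h2⟩
        · have := hwf.level_le_weight (D.occ_state q₁) (D.occ_state q₁) hv
          exact Or.inr ⟨h1, by linarith [h.lt]⟩
      · rw [hconst q hq, ho]; exact hmem
      · rw [hconst q hq, ho]; exact .refl
    · rw [Finset.mem_singleton] at hq₀
      subst hq₀
      refine Or.inr ⟨hdeep, q₀, hq₁, σ, h1, ⟨ρ, hρ, fun q hq => ?_⟩, fun q hq => ?_⟩
      · rw [hconst q hq]; exact h2 _ (Finset.mem_singleton_self _)
      · rw [hconst q hq]; exact h3 _ (Finset.mem_singleton_self _)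
  · rcases hadm.2 with ⟨τ, hτ⟩ | ⟨⟨q, hq, hj⟩, -⟩
    · obtain ⟨hlab, ho⟩ := hτ q₁ (Finset.mem_singleton_self _)
      refine Or.inl ⟨τ, fun q hq => ⟨?_, by rw [hconst q hq, ho]⟩⟩
      obtain ⟨τ', hτ'⟩ := exists_isLab hwf (by have := hround q hq; omega) (D.occ_state q)
        (hin q hq) h.l_pos.le h.lt h.r_le fun j hj => by
          by_contra hc
          push Not at hc
          exact hdeep ⟨q, hq, j, hj, hc⟩
      have hk := h.kappa_lt le_rfl
      have hk0 := kappa_nonneg n K.t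
      rwa [IsLab.unique hwf h.t_pos (hround q₁ hq₁).le (hround q hq).le (D.occ_state q₁)
        (D.occ_state q) hlab hτ' (by linarith) (by linarith)]
    · rw [Finset.mem_singleton] at hq
      subst hq
      exact absurd ⟨q, hq₁, hj⟩ hdeep

/-- Admissible outputs beyond the frontier of `K` are admissible for an earlier stage. -/
theorem Future.adm_of_new (hH : IsHub T n H) (h : Good T H S K) (hf : Future T H S₀ K₀ S K)
    {x : Fin (n + 1) → V} {D : Config n V} (hD : Reach T K.δ x D) {Q : Finset (Fin (n + 1))}
    {o : Fin (n + 1) → W} (hdepth : ∀ q ∈ Q, K.t < (D.state q).depth)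
    (hadm : Adm T H S (K.l - eta n K.t) (K.r + eta n K.t) D Q o) :
    Adm T H S₀ K₀.l K₀.r D Q o := by
  have hwf := hD.wf
  have h0 := eta_nonneg n K.t
  obtain ⟨hin, hadm⟩ := Adm.mono hH hD.1 hwf h.top_mem hf.l_le (by linarith [h.lt]) hf.r_le hadm
  refine ⟨fun q hq => hf.star.in (hin q hq), ?_⟩
  -- A top that is new compared with `S₀` has a large weight.
  have hbase : ∀ q ∈ Q, S.top = S₀.top ∨
      (S₀.top ⊂ S.top ∧ K₀.l < level (S.top.card + 1) (D.state q)) := by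
    intro q hq
    refine hf.base.imp id fun h1 => ⟨h1.1, lt_of_le_of_lt h1.2 ?_⟩
    refine h.outside x D hD q _ _ ?_ (D.occ_state q) (hin q hq) (h.none_of_lt (hdepth q hq))
    rw [← hwf.depth_state]
    exact (hdepth q hq).le
  have hcard := Finset.card_le_card hf.star.top
  rcases hadm with ⟨τ, hτ⟩ | ⟨⟨q, hq, j, hj, h1⟩, q₀, hq₀, σ, h3, h4⟩
  · refine Or.inl ⟨τ, fun q hq => ⟨?_, (hτ q hq).2⟩⟩
    rcases (hτ q hq).1 with ⟨rfl, h2, h3⟩ | ⟨h2, h3⟩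
    · rcases hbase q hq with h4 | ⟨-, h4⟩
      · exact Or.inl ⟨h4, h4 ▸ h2, h4 ▸ h3⟩
      · linarith
    · exact Or.inr ⟨lt_of_le_of_lt hf.star.top h2, h3⟩
  · refine Or.inr ⟨⟨q, hq, j, lt_of_le_of_lt hcard hj, h1⟩, q₀, hq₀, σ, ?_, h4⟩
    rcases h3 with ⟨rfl, h5⟩ | ⟨h5, h6⟩
    · rcases hbase q₀ hq₀ with h4 | ⟨h4, h6⟩
      · exact Or.inl ⟨h4, h4 ▸ h5⟩
      · exact Or.inr ⟨h4, lt_of_lt_of_le h6 (weight_mono fun v hv hc =>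
          ((hin q₀ hq₀).ssubset_of_card hv hc).subset)⟩
    · exact Or.inr ⟨lt_of_le_of_lt hf.star.top h5, h6⟩

theorem Future.step (hH : IsHub T n H) (h₀ : Good T H S₀ K₀) (h : Good T H S K)
    (hf : Future T H S₀ K₀ S K) {S' : FirstRound n V} {K' : Know n V W}
    (he : KnowExt T H S K S' K') : Future T H S₀ K₀ S' K' where
  t_le := hf.t_le.trans he.t_le
  agree := fun s hs => (he.agree s (hs.trans hf.t_le)).trans (hf.agree s hs)
  l_le := by linarith [hf.l_le, he.l_le, eta_nonneg n K.t]
  r_le := by linarith [hf.r_le, he.r_le, eta_nonneg n K.t]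
  star := hf.star.trans he.star
  base := by
    have hl := hf.l_le
    have h0 := eta_nonneg n K.t
    rcases he.base with ⟨h1, h2⟩ | ⟨h1, h2⟩
    · rw [h1]
      exact hf.base.imp id fun h3 => ⟨h3.1, h3.2.trans h2⟩
    · exact Or.inr ⟨lt_of_le_of_lt hf.star.top h1, by linarith⟩
  adm := by
    classical
    intro x D hD Q o hQ ho
    have hDK : Reach T K.δ x D := hD.mono (h.none_of_agree he.agree)
    have hDK₀ : Reach T K₀.δ x D := hDK.mono (h₀.none_of_agree hf.agree)
    have hwf := hD.wf
    have hold : ∀ q ∈ Q, (D.state q).depth ≤ K.t → K.δ (D.state q) = some (o q) := fun q hq hd => by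
      rw [← he.agree _ hd]
      exact (ho q hq).2
    by_cases hall : ∀ q ∈ Q, (D.state q).depth ≤ K.t
    · exact hf.adm x D hDK Q o hQ fun q hq => ⟨(ho q hq).1, hold q hq (hall q hq)⟩
    push Not at hall
    obtain ⟨q₁, hq₁, hd₁⟩ := hall
    have hnew : ∀ Q' ⊆ Q, Q'.Nonempty → (∀ q ∈ Q', K.t < (D.state q).depth) →
        Adm T H S (K.l - eta n K.t) (K.r + eta n K.t) D Q' o := fun Q' hQ' hne hd =>
      he.new x D hD Q' o hne fun q hq => ⟨hd q hq, (ho q (hQ' hq)).2⟩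
    by_cases hall' : ∀ q ∈ Q, K.t < (D.state q).depth
    · exact hf.adm_of_new hH h hDK hall' (hnew Q subset_rfl hQ hall')
    push Not at hall'
    obtain ⟨p, hp, hdp⟩ := hall'
    -- Old and new outputs that occur together are all equal.
    have h0 := eta_nonneg n K.t
    have hk := h.kappa_lt le_rfl
    have hk0 := kappa_nonneg n K.t
    have hround : ∀ q, K.t < (D.state q).depth → K.t ≤ D.round q := fun q hq =>
      (hwf.depth_state q ▸ hq).le
    have hadm₁ := hnew {q₁} (by simpa using hq₁) (by simp) (by simpa using hd₁)
    have hin₁ := hadm₁.1 q₁ (Finset.mem_singleton_self _)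
    have hinQ : ∀ q ∈ Q, K.t < (D.state q).depth → S.In (D.state q) := fun q hq hd =>
      (hnew {q} (by simpa using hq) (by simp) (by simpa using hd)).1 q (Finset.mem_singleton_self _)
    have hconst : ∀ q ∈ Q, o q = o q₁ := by
      obtain ⟨τ, hτ, hpo⟩ := h.frontier x D hDK p _ (hold p hp hdp) q₁ _ _ (hround q₁ hd₁)
        (D.occ_state q₁) hin₁ (h.none_of_lt hd₁)
      have hnewval : ∀ q ∈ Q, K.t < (D.state q).depth → o q = o p := by
        intro q hq hd
        obtain ⟨τ', hτ', hpo'⟩ := h.frontier x D hDK p _ (hold p hp hdp) q _ _ (hround q hd)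
          (D.occ_state q) (hinQ q hq hd) (h.none_of_lt hd)
        rcases (hnew {q} (by simpa using hq) (by simp) (by simpa using hd)).2 with
          ⟨τ'', hτ''⟩ | ⟨⟨q', hq', j, hj, h1, h2⟩, -⟩
        · obtain ⟨h1, h2⟩ := hτ'' q (Finset.mem_singleton_self _)
          rw [hpo', h2, IsLab.unique hwf h.t_pos (hround q hd) (hround q hd) (D.occ_state q)
            (D.occ_state q) hτ' h1 (by linarith) (by linarith)]
        · rw [Finset.mem_singleton] at hq'
          subst hq'
          rcases hτ'.clear hj with h3 | h3 <;> linarith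
      intro q hq
      rcases Nat.lt_or_ge K.t (D.state q).depth with hd | hd
      · rw [hnewval q hq hd, hnewval q₁ hq₁ hd₁]
      · obtain ⟨τ', hτ', hqo⟩ := h.frontier x D hDK q _ (hold q hq hd) q₁ _ _ (hround q₁ hd₁)
          (D.occ_state q₁) hin₁ (h.none_of_lt hd₁)
        rw [hnewval q₁ hq₁ hd₁, hqo, hpo, IsLab.unique hwf h.t_pos (hround q₁ hd₁) (hround q₁ hd₁)
          (D.occ_state q₁) (D.occ_state q₁) hτ' hτ (by linarith) (by linarith)]
    refine Adm.of_const h₀ hH hDK₀ hq₁ hconst ?_ (fun q hq => (ho q hq).1)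
      (hf.adm_of_new hH h hDK (by simpa using hd₁) hadm₁)
    intro q hq
    rcases Nat.lt_or_ge K.t (D.state q).depth with hd | hd
    · exact hf.star.in (hinQ q hq hd)
    · exact (hf.adm x D hDK {q} o (by simp) (by simpa using ⟨(ho q hq).1, hold q hq hd⟩)).1 q
        (Finset.mem_singleton_self _)

/-- Several extensions in succession. -/
def Evolves (T : ColorlessTask V W) (H : Finset (Fin (n + 1) × V) → W) :
    FirstRound n V × Know n V W → FirstRound n V × Know n V W → Prop :=
  Relation.ReflTransGen fun a b => KnowExt T H a.1 a.2 b.1 b.2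

theorem KnowExt.evolves {S' : FirstRound n V} {K' : Know n V W} (h : KnowExt T H S K S' K') :
    Evolves T H (S, K) (S', K') := Relation.ReflTransGen.single h

theorem Evolves.good {a b : FirstRound n V × Know n V W} (h : Evolves T H a b)
    (ha : Good T H a.1 a.2) : Good T H b.1 b.2 := by
  induction h with
  | refl => exact ha
  | tail _ h1 _ => exact h1.good

theorem Evolves.t_le {a b : FirstRound n V × Know n V W} (h : Evolves T H a b) :
    a.2.t ≤ b.2.t := by
  induction h with
  | refl => exact le_rfl
  | tail _ h1 ih => exact ih.trans h1.t_le

theorem Evolves.agree {a b : FirstRound n V × Know n V W} (h : Evolves T H a b)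
    {s : LocalState n V} (hs : s.depth ≤ a.2.t) : b.2.δ s = a.2.δ s := by
  induction h with
  | refl => rfl
  | tail h0 h1 ih => exact (h1.agree s (hs.trans (Evolves.t_le h0))).trans ih

theorem Evolves.future (hH : IsHub T n H) {a b : FirstRound n V × Know n V W}
    (h : Evolves T H a b) (h₀ : Good T H S₀ K₀) (ha : Good T H a.1 a.2)
    (hf : Future T H S₀ K₀ a.1 a.2) : Future T H S₀ K₀ b.1 b.2 := by
  induction h with
  | refl => exact hf
  | tail h0 h1 ih => exact ih.step hH h₀ (Evolves.good h0 ha) h1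

end Future

/-! ### First-round data of a schedule -/

section FirstRoundOf

open LocalState Config

variable {n : ℕ} {V W : Type*} {T : ColorlessTask V W} {H : Finset (Fin (n + 1) × V) → W}

/-- The inputs `x` of the processes in `P`. -/
def inputsOf (x : Fin (n + 1) → V) (P : Finset (Fin (n + 1))) : Finset (Fin (n + 1) × V) :=
  P.map ⟨fun p => (p, x p), fun _ _ h => congrArg Prod.fst h⟩

theorem mem_inputsOf {x : Fin (n + 1) → V} {P : Finset (Fin (n + 1))} {a : Fin (n + 1) × V} :
    a ∈ inputsOf x P ↔ a.1 ∈ P ∧ a.2 = x a.1 := by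
  constructor
  · intro h
    obtain ⟨p, hp, rfl⟩ := Finset.mem_map.mp h
    exact ⟨hp, rfl⟩
  · rintro ⟨h1, h2⟩
    exact Finset.mem_map.mpr ⟨a.1, h1, Prod.ext rfl h2.symm⟩

theorem inputsOf_subset (x : Fin (n + 1) → V) (P : Finset (Fin (n + 1))) :
    inputsOf x P ⊆ allPairs x := fun _ ha => mem_allPairs.mpr (mem_inputsOf.mp ha).2

/-- Nothing is known. -/
def FirstRound.empty : FirstRound n V := ⟨∅, ∅, by simp⟩

open scoped Classical in
/-- The first-round data after a further step, in which `σ` is read if this contains new inputs. -/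
noncomputable def FirstRound.next (S : FirstRound n V) (σ : Finset (Fin (n + 1) × V)) :
    FirstRound n V :=
  if h : S.top ⊂ S.top ∪ σ then ⟨S.top ∪ σ, insert (S.top ∪ σ) S.chain, by
    rintro τ (rfl | hτ)
    · exact subset_rfl
    · exact (S.le_top τ hτ).trans h.subset⟩ else S

/-- The first-round data after the schedule `γ` with inputs `x`, starting from `S`. -/
noncomputable def FirstRound.after (x : Fin (n + 1) → V) (γ : Schedule n) (S : FirstRound n V) :
    FirstRound n V :=
  γ.foldl (fun S P => S.next (inputsOf x P)) S

theorem FirstRound.after_append (x : Fin (n + 1) → V) (γ γ' : Schedule n) (S : FirstRound n V) :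
    FirstRound.after x (γ ++ γ') S = FirstRound.after x γ' (FirstRound.after x γ S) := by
  simp [FirstRound.after]

theorem FirstRound.after_congr {x x' : Fin (n + 1) → V} {γ : Schedule n}
    (h : ∀ P ∈ γ, ∀ p ∈ P, x' p = x p) (S : FirstRound n V) :
    FirstRound.after x' γ S = FirstRound.after x γ S := by
  induction γ generalizing S with
  | nil => rfl
  | cons P γ ih =>
    have : inputsOf x' P = inputsOf x P := by
      ext a
      simp only [mem_inputsOf]
      refine and_congr_right fun ha => ?_
      rw [h P (by simp) _ ha]
    simp only [FirstRound.after, List.foldl_cons, this]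
    exact ih (fun Q hQ => h Q (by simp [hQ])) _

open scoped Classical in
theorem FirstRound.top_next (S : FirstRound n V) (σ : Finset (Fin (n + 1) × V)) :
    (S.next σ).top = S.top ∪ σ := by
  unfold FirstRound.next
  split_ifs with h
  · rfl
  · by_contra hne
    exact h (Finset.subset_union_left.ssubset_of_ne hne)

theorem FirstRound.le_next (S : FirstRound n V) (σ : Finset (Fin (n + 1) × V)) :
    S.Le (S.next σ) := by
  classical
  refine ⟨by rw [S.top_next]; exact Finset.subset_union_left, ?_⟩
  unfold FirstRound.next
  split_ifs with h
  · rintro τ (rfl | hτ)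
    exacts [Or.inr h, Or.inl hτ]
  · exact fun τ hτ => Or.inl hτ

theorem FirstRound.le_after (x : Fin (n + 1) → V) (γ : Schedule n) (S : FirstRound n V) :
    S.Le (FirstRound.after x γ S) := by
  induction γ generalizing S with
  | nil => exact .refl S
  | cons P γ ih => exact (S.le_next _).trans (ih _)

/-- `S` describes the first round of `D` exactly. -/
structure FirstRound.Fits (S : FirstRound n V) (x : Fin (n + 1) → V) (D : Config n V) : Prop where
  wf : D.WF x
  mem_top : ∀ a, a ∈ S.top ↔ 1 ≤ D.round a.1 ∧ a.2 = x a.1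
  chain : ∀ p v, D.Occ p 1 v → v.carrier ∈ S.chain

theorem FirstRound.fits_initial (x : Fin (n + 1) → V) :
    (FirstRound.empty : FirstRound n V).Fits x (Config.initial x) := by
  refine ⟨WF.initial x, fun a => by simp [FirstRound.empty, Config.initial], ?_⟩
  rintro p v (h | ⟨h, -⟩) <;> simp [Config.initial] at h

/-- A step of a set `P` adds to the first-round data the carrier read by the processes of `P` that
take their first step. -/
theorem FirstRound.Fits.step {S : FirstRound n V} {x : Fin (n + 1) → V} {D : Config n V}
    (h : S.Fits x D) (P : Finset (Fin (n + 1))) : (S.next (inputsOf x P)).Fits x (D.step P) := by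
  classical
  have hround : ∀ p, 1 ≤ (D.step P).round p ↔ 1 ≤ D.round p ∨ p ∈ P := by
    intro p
    simp only [Config.step]
    split_ifs with hp <;> simp [hp]
  refine ⟨h.wf.step P, fun a => ?_, fun p v hv => ?_⟩
  · rw [S.top_next, Finset.mem_union, h.mem_top, mem_inputsOf, hround]
    tauto
  · rcases (occ_step h.wf P p 1 v).mp hv with h1 | ⟨hp, hr, rfl⟩
    · have := h.chain p v h1
      unfold FirstRound.next
      split_ifs
      · exact Or.inr this
      · exact this
    · have hr0 : D.round p = 0 := by omega
      have hcar : (LocalState.view p (D.write P (D.round p))).carrier = S.top ∪ inputsOf x P := by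
        ext a
        rw [(h.wf.step P).carrier_first hv, Finset.mem_union, h.mem_top, mem_inputsOf, hr0]
        have : D.write P 0 a.1 ≠ none ↔ 1 ≤ D.round a.1 ∨ a.1 ∈ P := by
          have hm := h.wf.mem_none a.1 0
          simp only [Config.write]
          split_ifs with h2
          · simp [h2.1]
          · rw [Ne, hm]
            have : a.1 ∈ P → 1 ≤ D.round a.1 := fun h3 => by
              by_contra h4
              exact h2 ⟨h3, by omega⟩
            constructor
            · intro h4; left; omega
            · rintro (h4 | h4)
              · omega
              · have := this h4
                omega
        rw [this]
        tauto
      have hss : S.top ⊂ S.top ∪ inputsOf x P := by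
        refine Finset.ssubset_iff_subset_ne.mpr ⟨Finset.subset_union_left, fun heq => ?_⟩
        have : (p, x p) ∈ S.top := by
          rw [heq]
          exact Finset.mem_union_right _ (mem_inputsOf.mpr ⟨hp, rfl⟩)
        have := ((h.mem_top _).mp this).1
        simp only at this
        omega
      unfold FirstRound.next
      rw [dif_pos hss]
      exact Or.inl hcar

theorem FirstRound.Fits.run {S : FirstRound n V} {x : Fin (n + 1) → V} {D : Config n V}
    (h : S.Fits x D) (γ : Schedule n) : (FirstRound.after x γ S).Fits x (D.run γ) := by
  induction γ generalizing S D with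
  | nil => exact h
  | cons P γ ih => exact ih (h.step P)

/-- All states that occur after `D` are consistent with the first round of `D`. -/
theorem FirstRound.Fits.in_of_occ {S : FirstRound n V} {x : Fin (n + 1) → V} {D : Config n V}
    (h : S.Fits x D) (γ : Schedule n) {p : Fin (n + 1)} {e : ℕ} {s : LocalState n V}
    (hs : (D.run γ).Occ p e s) : S.In s := by
  intro v hv
  obtain ⟨q, hq⟩ := (h.run γ).wf.occ_of_sees hs hv
  exact (le_after x γ S).chain _ ((h.run γ).chain q v hq)

/-- The known part of the first round can be extended along every schedule from an initial
configuration. -/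
theorem Good.exists_fills (hH : IsHub T n H) {x : Fin (n + 1) → V}
    (hx : (T.toTask n).IsInitial x) (γ : Schedule n) {S : FirstRound n V} {K : Know n V W}
    (h : Good T H S K) (hS : S.top ⊆ allPairs x) :
    ∃ K', Evolves T H (S, K) (FirstRound.after x γ S, K') := by
  classical
  induction γ generalizing S K with
  | nil => exact ⟨K, .refl⟩
  | cons P γ ih =>
    have hsub : (S.next (inputsOf x P)).top ⊆ allPairs x := by
      rw [S.top_next]
      exact Finset.union_subset hS (inputsOf_subset x P)
    by_cases hss : S.top ⊂ S.top ∪ inputsOf x P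
    · obtain ⟨K₁, hK₁, -⟩ := h.exists_fill hH (τ := S.top ∪ inputsOf x P)
        (T.input_of_subset hx (S.top_next _ ▸ hsub) (Finset.nonempty_of_ne_empty fun h0 => by
          rw [h0] at hss; simp at hss)) hss 0 (S.next (inputsOf x P)) (S.top_next _)
        (by unfold FirstRound.next; rw [dif_pos hss])
      obtain ⟨K', hK'⟩ := ih hK₁.good hsub
      exact ⟨K', hK₁.evolves.trans hK'⟩
    · have heq : S.next (inputsOf x P) = S := by
        unfold FirstRound.next
        rw [dif_neg hss]
      obtain ⟨K', hK'⟩ := ih (S := S) h hS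
      exact ⟨K', by simpa only [FirstRound.after, List.foldl_cons, heq] using hK'⟩

/-- The initial stage: nobody terminates early, and the thresholds are below all the weights that
occur when the same processes take all steps together. -/
theorem exists_good_initial (T : ColorlessTask V W) (H : Finset (Fin (n + 1) × V) → W) (m : ℕ) :
    ∃ K : Know n V W, Good T H FirstRound.empty K ∧ m ≤ K.t ∧ K.r < 1 / (n + 1) ∧
      ∀ s, K.δ s = none := by
  have hn : (0 : ℝ) < n + 1 := by positivity
  have hn0 : (0 : ℝ) ≤ n := Nat.cast_nonneg n
  obtain ⟨t, ht1, ht2, ht3⟩ := exists_eta_le n m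
    (ε := min (1 / (8 * (n + 1))) (1 / (2 * (n + 1)) / (8 * (n + 2))))
    (lt_min (by positivity) (by positivity))
  have h1 := ht3.trans (min_le_left _ _)
  have h2 := ht3.trans (min_le_right _ _)
  rw [le_div_iff₀ (by positivity)] at h2
  have e1 : 1 / (8 * ((n : ℝ) + 1)) = 1 / (n + 1) / 8 := by field_simp
  have e2 : 1 / (2 * ((n : ℝ) + 1)) = 1 / (n + 1) / 2 := by field_simp
  have hc : 0 < 1 / ((n : ℝ) + 1) := by positivity
  have hc1 : 1 / ((n : ℝ) + 1) ≤ 1 := by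
    rw [div_le_one hn]; linarith
  rw [e1] at h1
  rw [e2] at h2
  set c := 1 / ((n : ℝ) + 1) with hcdef
  refine ⟨⟨fun _ => none, t, 0, c / 4, c * 3 / 4⟩, ⟨by simp, ht2, ?_, le_rfl, ?_, ?_, ?_, ?_, ?_,
    ?_, by simp, ?_⟩, ht1, by dsimp only; linarith, fun _ => rfl⟩
  · intro hne
    exact absurd hne (by simp [FirstRound.empty])
  · dsimp only; linarith
  · dsimp only; linarith
  · dsimp only; linarith
  · dsimp only; linarith
  · dsimp only; linarith
  · rintro x D - Q o ⟨q, hq⟩ ho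
    exact absurd (ho q hq).2 (by simp)
  · intro x D hD q e s he hs _ _
    dsimp only at he ⊢
    have : (FirstRound.empty : FirstRound n V).top.card + 1 = 1 := by simp [FirstRound.empty]
    rw [this, hD.wf.level_one (by omega) hs]
    exact one_pos

end FirstRoundOf

/-! ### Partial protocols from a hub -/

section PartialFromHub

open LocalState Config

variable {n : ℕ} {V W : Type*} {T : ColorlessTask V W} {H : Finset (Fin (n + 1) × V) → W}
  {S : FirstRound n V} {K : Know n V W}

/-- Validity concerns sets of pairs of a process and its output; it suffices to find a simplex that
contains the outputs. -/
theorem Config.valid_of_simplex {d : LocalState n V → Option W} {x : Fin (n + 1) → V}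
    {D : Config n V} (hD : D.WF x)
    (h : ∀ (Q : Finset (Fin (n + 1))) (o : Fin (n + 1) → W), Q.Nonempty →
      (∀ q ∈ Q, d (D.state q) = some (o q)) → ∃ ρ ∈ T.Δ (vals (D.carrier Q)), ∀ q ∈ Q, o q ∈ ρ) :
    D.Valid (T.toTask n) d := by
  classical
  intro τ hτ ho
  have hex : ∀ q ∈ ids τ, ∃ w, d (D.state q) = some w := by
    intro q hq
    obtain ⟨a, ha, rfl⟩ := Finset.mem_image.mp hq
    exact ⟨a.2, ho a ha⟩
  obtain ⟨a₀, ha₀⟩ := hτ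
  have : Nonempty W := ⟨a₀.2⟩
  choose! o ho' using hex
  obtain ⟨ρ, hρ, hmem⟩ := h (ids τ) o ⟨a₀.1, Finset.mem_image_of_mem _ ha₀⟩ ho'
  have hval : ∀ a ∈ τ, o a.1 = a.2 := fun a ha => by
    have := ho' a.1 (Finset.mem_image_of_mem _ ha)
    rw [ho a ha] at this
    exact (Option.some.inj this).symm
  refine ⟨⟨fun a ha b hb hab => Prod.ext hab ?_, ?_⟩, ?_⟩
  · rw [← hval a ha, ← hval b hb, hab]
  · refine ((T.Δ _).isRelLowerSet_faces hρ).2 ?_ ?_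
    · intro w hw
      unfold vals at hw
      obtain ⟨a, ha, rfl⟩ := Finset.mem_image.mp hw
      rw [← hval a ha]
      exact hmem _ (Finset.mem_image_of_mem _ ha)
    · unfold vals
      exact ⟨a₀.2, Finset.mem_image_of_mem _ ha₀⟩
  · intro q hq
    refine Finset.mem_image.mpr ⟨(q, x q), ?_, rfl⟩
    exact subset_carrier hq (hD.self_mem_carrier (D.occ_state q))

theorem Good.valid_of_in (h : Good T H S K) {x : Fin (n + 1) → V} {D : Config n V}
    (hD : Reach T K.δ x D) (hin : ∀ q, S.In (D.state q)) : D.Valid (T.toTask n) K.δ :=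
  Config.valid_of_simplex hD.wf fun Q o hQ ho =>
    h.valid x D hD Q o hQ fun q hq => ⟨hin q, ho q hq⟩

/-- States that have not seen processes outside of `S` are active only before the frontier. -/
theorem Good.lt_of_none (h : Good T H S K) {x : Fin (n + 1) → V} {D : Config n V}
    (hD : Reach T K.δ x D) {q : Fin (n + 1)} {e : ℕ} {s : LocalState n V} (hs : D.Occ q e s)
    (hin : S.In s) (hn : K.δ s = none) (hsub : ∀ v, Sees s v → v.carrier ⊆ S.top) : e < K.t := by
  by_contra hc
  obtain ⟨v, hv, hvs⟩ := h.exists_outside hD (not_lt.mp hc) hs hin hn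
  exact absurd (hvs.trans_subset (hsub v hv)) (ssubset_irrefl _)

theorem Good.round_le (h : Good T H S K) {x : Fin (n + 1) → V} {D : Config n V}
    (hD : Reach T K.δ x D) {q : Fin (n + 1)}
    (hin : ∀ e s, D.mem e q = some s → S.In s ∧ ∀ v, Sees s v → v.carrier ⊆ S.top) : D.round q ≤ K.t := by
  rcases hr : D.round q with _ | e
  · omega
  · obtain ⟨s, hs⟩ := Option.ne_none_iff_exists'.mp fun h0 => by
      have := (hD.wf.mem_none q e).mp h0
      omega
    exact h.lt_of_none hD (Or.inl hs) (hin e s hs).1 (hD.active hs) (hin e s hs).2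

theorem Config.round_run (C : Config n V) (α : Schedule n) (p : Fin (n + 1)) :
    (C.run α).round p = C.round p + α.countP (p ∈ ·) := by
  induction α generalizing C with
  | nil => simp [Config.run]
  | cons P α ih =>
    rw [show C.run (P :: α) = (C.step P).run α from rfl, ih, List.countP_cons]
    simp only [Config.step]
    split_ifs with hp <;> simp_all
    omega

theorem Config.length_le_sum_round {d : LocalState n V → Option W} {C : Config n V}
    {α : Schedule n} (h : C.IsSchedule d α) : α.length ≤ ∑ p, (C.run α).round p := by
  suffices α.length + ∑ p, C.round p ≤ ∑ p, (C.run α).round p by omega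
  induction α generalizing C with
  | nil => simp [Config.run]
  | cons P α ih =>
    have h1 := ih h.2
    have h2 : ∑ p, C.round p < ∑ p, (C.step P).round p := by
      obtain ⟨p, hp⟩ := h.1.1
      refine Finset.sum_lt_sum (fun q _ => ?_) ⟨p, Finset.mem_univ p, ?_⟩
      · simp only [Config.step]; split_ifs <;> omega
      · simp [Config.step, hp]
    rw [show C.run (P :: α) = (C.step P).run α from rfl, List.length_cons]
    omega

theorem Config.step_empty (C : Config n V) : C.step ∅ = C := by
  have : C.write ∅ = C.mem := by
    funext r q
    simp [Config.write]
  simp [Config.step, this]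

section Cen

variable {x : Fin (n + 1) → V} {C₀ : Config n V} {Q : Finset (Fin (n + 1))}

/-- The invariants of repeating `Q`, starting after the first round: all states of `Q` have the
mean position of their first-round states. -/
structure CenInv (T : ColorlessTask V W) (d : LocalState n V → Option W) (x : Fin (n + 1) → V)
    (C₀ : Config n V) (Q : Finset (Fin (n + 1))) (k : ℕ) (C : Config n V) : Prop where
  reach : Reach T d x C
  round_le : ∀ p, C.round p ≤ k + 1
  mem_none : ∀ p, C.mem (k + 1) p = none
  round : ∀ p ∈ Q, d (C.state p) = none → C.round p = k + 1
  zero : k = 0 → C = C₀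
  pos : 0 < k → ∀ p ∈ Q, ∀ g, pos g (C.state p) = (∑ q ∈ Q, g (C₀.state q)) / Q.card

theorem CenInv.step {d : LocalState n V → Option W} (hd : ∀ s, s.depth ≤ 1 → d s = none)
    (hC₀ : ∀ p, C₀.round p = 1) {k : ℕ} {C : Config n V} (h : CenInv T d x C₀ Q k C) :
    CenInv T d x C₀ Q (k + 1) (C.step (Q.filter fun p => (d (C.state p)).isNone)) := by
  classical
  set A := Q.filter fun p => (d (C.state p)).isNone with hA
  have hmemA : ∀ p, p ∈ A ↔ p ∈ Q ∧ d (C.state p) = none := by simp [hA]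
  have hround : ∀ p ∈ A, C.round p = k + 1 := fun p hp =>
    h.round p ((hmemA p).mp hp).1 ((hmemA p).mp hp).2
  have hreach : Reach T d x (C.step A) := by
    rcases A.eq_empty_or_nonempty with h0 | hne
    · rw [h0, step_empty]; exact h.reach
    · exact h.reach.run (β := [A]) ⟨⟨hne, fun p hp => ((hmemA p).mp hp).2, fun p hp q hq => by
        rw [hround p hp, hround q hq]⟩, trivial⟩
  have hr : ∀ p, (C.step A).round p ≤ k + 2 := fun p => by
    have := h.round_le p
    simp only [Config.step]
    split_ifs <;> omega
  refine ⟨hreach, hr, fun p => ?_, fun p hp hn => ?_, by omega, fun _ p hp g => ?_⟩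
  · exact (hreach.wf.mem_none p _).mpr (hr p)
  · by_cases hpA : p ∈ A
    · simp [Config.step, hpA, hround p hpA]
    · exfalso
      simp only [Config.step, if_neg hpA] at hn
      exact hpA ((hmemA p).mpr ⟨hp, hn⟩)
  · by_cases hpA : p ∈ A
    · have hst : (C.step A).state p = .view p (C.write A (k + 1)) := by
        simp [Config.step, hpA, hround p hpA]
      have hcell : ∀ q, C.write A (k + 1) q = if q ∈ A then some (C.state q) else none := by
        intro q
        simp only [Config.write]
        by_cases hq : q ∈ A
        · simp [hq, hround q hq]
        · simp [hq, h.mem_none q]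
      have hne : (LocalState.view p (C.write A (k + 1))).depth ≠ 1 := by
        have := hreach.wf.depth_state p
        rw [hst] at this
        rw [this]
        simp only [Config.step, if_pos hpA, hround p hpA]
        omega
      rw [hst, pos_view g hne]
      have hcells : cells (C.write A (k + 1)) = A.card := by
        unfold cells
        congr 1
        ext q
        by_cases hq : q ∈ A <;> simp [hcell, hq]
      have hsum : ∑ q, cellPos g (C.write A (k + 1) q) = ∑ q ∈ A, LocalState.pos g (C.state q) := by
        rw [sum_cellPos]
        refine Finset.sum_congr ?_ fun q hq => ?_
        · ext q
          by_cases hq : q ∈ A <;> simp [hcell, hq]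
        · simp [hcell, hq, cellPos]
      rw [hcells, hsum]
      rcases Nat.eq_zero_or_pos k with rfl | hk
      · obtain rfl := h.zero rfl
        have hAQ : A = Q := by
          ext q
          rw [hmemA]
          refine and_iff_left (hd _ ?_)
          rw [h.reach.wf.depth_state, hC₀]
        rw [hAQ]
        congr 1
        refine Finset.sum_congr rfl fun q hq => pos_of_depth_eq_one g ?_
        rw [h.reach.wf.depth_state, hC₀]
      · rw [Finset.sum_congr rfl fun q hq => h.pos hk q ((hmemA q).mp hq).1 g, Finset.sum_const,
          nsmul_eq_mul, mul_comm, mul_div_assoc, div_self, mul_one]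
        exact_mod_cast (Finset.card_pos.mpr ⟨p, hpA⟩).ne'
    · simp only [Config.step, if_neg hpA]
      rcases Nat.eq_zero_or_pos k with rfl | hk
      · exfalso
        obtain rfl := h.zero rfl
        exact hpA ((hmemA p).mpr ⟨hp, hd _ (by rw [h.reach.wf.depth_state, hC₀])⟩)
      · exact h.pos hk p hp g

/-- The mean of an indicator function over `Q` is zero or not small. -/
theorem mean_indicator (Q : Finset (Fin (n + 1))) (A : Set (LocalState n V))
    (s : Fin (n + 1) → LocalState n V) :
    (∑ q ∈ Q, A.indicator (1 : LocalState n V → ℝ) (s q)) / Q.card = 0 ∨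
      1 / ((n : ℝ) + 1) ≤ (∑ q ∈ Q, A.indicator (1 : LocalState n V → ℝ) (s q)) / Q.card := by
  classical
  by_cases hex : ∃ q ∈ Q, s q ∈ A
  · right
    obtain ⟨q, hq, hqA⟩ := hex
    have h1 : 1 ≤ ∑ q ∈ Q, A.indicator (1 : LocalState n V → ℝ) (s q) := by
      have := Finset.single_le_sum (f := fun q => A.indicator (1 : LocalState n V → ℝ) (s q))
        (fun q _ => (indicator_mem_unit A (s q)).1) hq
      simpa [hqA] using this
    have hc : (0 : ℝ) < Q.card := by exact_mod_cast Finset.card_pos.mpr ⟨q, hq⟩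
    have hcn : (Q.card : ℝ) ≤ n + 1 := by
      have := Finset.card_le_univ Q
      rw [Fintype.card_fin] at this
      exact_mod_cast this
    exact div_le_div₀ (by linarith) h1 hc hcn
  · left
    push Not at hex
    rw [Finset.sum_eq_zero fun q hq => by simp [hex q hq], zero_div]

/-- If a process of `Q` terminates when `Q` is repeated, its output is the value of the carrier. -/
theorem cen_output_eq {K₀ K : Know n V W} (hr : K₀.r < 1 / (n + 1)) (h0 : 0 < K₀.l)
    (hlr : K₀.l < K₀.r) (hnone : ∀ s, K₀.δ s = none) (ht : 1 ≤ K₀.t)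
    (hf : Future T H FirstRound.empty K₀ S K) (hC₀ : ∀ p, C₀.round p = 1) (hwf : C₀.WF x) {k : ℕ}
    {C : Config n V} (h : CenInv T K.δ x C₀ Q k C) {p : Fin (n + 1)} (hp : p ∈ Q) {w : W}
    (hw : K.δ (C.state p) = some w) : w = H (C₀.carrier Q) := by
  classical
  have hdep : K₀.t < (C.state p).depth := by
    by_contra hc
    rw [hf.agree _ (not_lt.mp hc), hnone] at hw
    simp at hw
  have hk : 0 < k := by
    rw [h.reach.wf.depth_state] at hdep
    have := h.round_le p
    omega
  have hwt : ∀ A, weight A (C.state p) =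
      (∑ q ∈ Q, A.indicator (1 : LocalState n V → ℝ) (C₀.state q)) / Q.card := fun A =>
    h.pos hk p hp _
  have hmean : ∀ A, weight A (C.state p) = 0 ∨ 1 / ((n : ℝ) + 1) ≤ weight A (C.state p) := fun A => by
    rw [hwt]; exact mean_indicator Q A _
  obtain ⟨-, ⟨τ, hτ⟩ | ⟨⟨q, hq, j, -, h1, h2⟩, -⟩⟩ := hf.adm x C h.reach {p} (fun _ => w) (by simp)
    (by simpa using ⟨hdep, hw⟩)
  · obtain ⟨hlab, hwτ⟩ := hτ p (Finset.mem_singleton_self _)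
    simp only at hwτ
    rw [hwτ]
    congr 1
    rcases hlab with ⟨-, h1, -⟩ | ⟨-, ⟨v, hv, hvτ⟩, h1, h2⟩
    · simp [FirstRound.empty] at h1
    have hzero : level (τ.card + 1) (C.state p) = 0 :=
      (hmean _).resolve_right fun h3 => by
        have : 1 / ((n : ℝ) + 1) ≤ level (τ.card + 1) (C.state p) := h3
        linarith
    have hQc : (0 : ℝ) < Q.card := by exact_mod_cast Finset.card_pos.mpr ⟨p, hp⟩
    have hle : ∀ q ∈ Q, (C₀.state q).carrier.card ≤ τ.card := by
      intro q hq
      by_contra hc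
      unfold level at hzero
      rw [hwt, div_eq_zero_iff, or_iff_left hQc.ne',
        Finset.sum_eq_zero_iff_of_nonneg fun q _ => (indicator_mem_unit _ _).1] at hzero
      have := hzero q hq
      simp only [Set.indicator_apply_eq_zero, Set.mem_ofPred_eq] at this
      exact one_ne_zero (this (by omega))
    obtain ⟨q₁, hq₁, hτ₁⟩ : ∃ q ∈ Q, (C₀.state q).carrier = τ := by
      by_contra! hc
      have hz : weight {v' : LocalState n V | v'.carrier = τ ∨ τ.card + 1 ≤ v'.carrier.card}
          (C.state p) = 0 := by
        rw [hwt, Finset.sum_eq_zero, zero_div]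
        intro q hq
        rw [Set.indicator_of_notMem]
        rintro (h3 | h3)
        · exact hc q hq h3
        · have := hle q hq
          omega
      have hge : level τ.card (C.state p) ≤ 0 := by
        rw [← hz]
        refine weight_mono fun v' hv' hcard => ?_
        rcases Nat.lt_or_eq_of_le hcard with h3 | h3
        · exact Or.inr h3
        · left
          rw [← hvτ] at h3 ⊢
          exact h.reach.wf.carrier_eq_of_card (C.occ_state p) (C.occ_state p) hv' hv h3.symm
      linarith
    have hocc : ∀ q, C₀.Occ q 1 (C₀.state q) := fun q => Or.inr ⟨hC₀ q, rfl⟩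
    refine subset_antisymm (hτ₁ ▸ subset_carrier hq₁) ?_
    intro a ha
    simp only [Config.carrier, Finset.mem_biUnion] at ha
    obtain ⟨q, hq, haq⟩ := ha
    rcases hwf.carrier_first_nested (hocc q) (hocc q₁) with h3 | h3
    · exact hτ₁ ▸ h3 haq
    · rw [hτ₁] at h3
      rw [Finset.eq_of_subset_of_card_le h3 (hle q hq)]
      exact haq
  · rw [Finset.mem_singleton] at hq
    subst hq
    rcases hmean {v | j ≤ v.carrier.card} with h3 | h3
    · have : level j (C.state q) = 0 := h3
      linarith
    · have : 1 / ((n : ℝ) + 1) ≤ level j (C.state q) := h3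
      linarith

end Cen

theorem IsFullRoundLabel.exists_initial {U : List (Finset (Fin (n + 1) × V))}
    (hU : IsFullRoundLabel (T.toTask n) U) :
    ∃ x, (T.toTask n).IsInitial x ∧ ContainsLabel x U := by
  classical
  obtain ⟨⟨s, hs, hcard, hsub⟩, -, -, hcov⟩ := hU
  have hinj := (T.toTask n).chromatic_input s hs
  have hx : ∀ p, ∃ v, (p, v) ∈ s := fun p => by
    obtain ⟨u, hu, hp⟩ := hcov p
    obtain ⟨a, ha, rfl⟩ := Finset.mem_image.mp hp
    exact ⟨a.2, hsub u hu ha⟩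
  choose x hx using hx
  have hxs : ∀ a ∈ s, x a.1 = a.2 := fun a ha =>
    congrArg Prod.snd (hinj (hx a.1) ha rfl)
  refine ⟨x, ?_, fun u hu a ha => hxs a (hsub u hu ha)⟩
  refine T.input_of_subset hs (fun a ha => ?_) ⟨(0, x 0), Finset.mem_map.mpr ⟨0, Finset.mem_univ _, rfl⟩⟩
  obtain ⟨p, -, rfl⟩ := Finset.mem_map.mp ha
  exact hx p

theorem ContainsLabel.unique {U : List (Finset (Fin (n + 1) × V))}
    (hU : IsFullRoundLabel (T.toTask n) U) {x x' : Fin (n + 1) → V} (h : ContainsLabel x U)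
    (h' : ContainsLabel x' U) : x' = x := by
  funext p
  obtain ⟨u, hu, hp⟩ := hU.2.2.2 p
  obtain ⟨a, ha, rfl⟩ := Finset.mem_image.mp hp
  rw [h u hu a ha, h' u hu a ha]

theorem IsFullRoundLabel.round_eq_one {U : List (Finset (Fin (n + 1) × V))}
    (hU : IsFullRoundLabel (T.toTask n) U) (x : Fin (n + 1) → V) (p : Fin (n + 1)) :
    ((Config.initial x).run (U.map ids)).round p = 1 := by
  obtain ⟨-, -, hdis, hcov⟩ := hU
  rw [round_run]
  obtain ⟨u, hu, hp⟩ := hcov p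
  have : (U.map ids).countP (p ∈ ·) = 1 := by
    clear hcov
    induction U with
    | nil => simp at hu
    | cons u' U ih =>
      rw [List.pairwise_cons] at hdis
      rw [List.map_cons, List.countP_cons]
      rcases List.mem_cons.mp hu with rfl | hu'
      · have h0 : (U.map ids).countP (p ∈ ·) = 0 := by
          rw [List.countP_eq_zero]
          intro P hP
          obtain ⟨u'', hu'', rfl⟩ := List.mem_map.mp hP
          have := Finset.disjoint_left.mp (hdis.1 u'' hu'') hp
          simpa using this
        rw [h0]
        simp [hp]
      · have hp' : p ∉ ids u' := fun h => Finset.disjoint_left.mp (hdis.1 u hu') h hp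
        rw [ih hdis.2 hu']
        simp [hp']
  rw [this]
  simp [Config.initial]

theorem IsFullRoundLabel.isSchedule {U : List (Finset (Fin (n + 1) × V))}
    (hU : IsFullRoundLabel (T.toTask n) U) (x : Fin (n + 1) → V)
    {d : LocalState n V → Option W} (hd : ∀ s, s.depth = 0 → d s = none) :
    (Config.initial x).IsSchedule d (U.map ids) := by
  obtain ⟨-, hne, hdis, -⟩ := hU
  suffices ∀ C : Config n V, C.WF x → (∀ u ∈ U, ∀ p ∈ ids u, C.round p = 0) →
      C.IsSchedule d (U.map ids) from this _ (WF.initial x) (by simp [Config.initial])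
  induction U with
  | nil => exact fun _ _ _ => trivial
  | cons u U ih =>
    intro C hwf hC
    rw [List.pairwise_cons] at hdis
    refine ⟨⟨(hne u (by simp)).image _, fun p hp => hd _ ?_, fun p hp q hq => ?_⟩, ?_⟩
    · rw [hwf.depth_state, hC u (by simp) p hp]
    · rw [hC u (by simp) p hp, hC u (by simp) q hq]
    · refine ih (fun u' hu' => hne u' (by simp [hu'])) hdis.2 (C.step (ids u)) (hwf.step _) ?_
      intro u' hu' p hp
      have : p ∉ ids u := fun h => Finset.disjoint_left.mp (hdis.1 u' hu') h hp
      simp only [Config.step, if_neg this]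
      exact hC u' (by simp [hu']) p hp

/-- A hub yields compatible partial protocols. -/
theorem IsHub.exists_partialProtocols (hH : IsHub T n H) :
    ∃ δ : List (Finset (Fin (n + 1) × V)) → Protocol n V W,
      (∀ U, IsFullRoundLabel (T.toTask n) U → IsPartialProtocol (T.toTask n) U (δ U)) ∧
      ∀ U U', IsFullRoundLabel (T.toTask n) U → IsFullRoundLabel (T.toTask n) U' →
        Compatible (T.toTask n) U U' (δ U) (δ U') := by
  classical
  obtain ⟨K₀, hK₀, ht₀, hr₀, hnone⟩ := exists_good_initial T H 1
  obtain ⟨K₁, hK₁, -, hδ₁⟩ := hK₀.shrink 0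
  have key : ∀ U, IsFullRoundLabel (T.toTask n) U → ∀ x, (T.toTask n).IsInitial x →
      ContainsLabel x U → ∃ K, Good T H (FirstRound.after x (U.map ids) .empty) K ∧
      Future T H .empty K₀ (FirstRound.after x (U.map ids) .empty) K := by
    intro U hU x hx hxU
    obtain ⟨K, hK⟩ := hK₁.good.exists_fills hH hx (U.map ids) (by simp [FirstRound.empty])
    exact ⟨K, hK.good hK₁.good, hK.future hH hK₀ hK₁.good (hK₁.future hK₀ hδ₁)⟩
  have key' : ∀ U, ∃ d : Protocol n V W, IsFullRoundLabel (T.toTask n) U →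
      ∃ x, (T.toTask n).IsInitial x ∧ ContainsLabel x U ∧ ∃ K, d.decide = K.δ ∧
      Good T H (FirstRound.after x (U.map ids) .empty) K ∧
      Future T H .empty K₀ (FirstRound.after x (U.map ids) .empty) K := by
    intro U
    by_cases hU : IsFullRoundLabel (T.toTask n) U
    · obtain ⟨x, hx, hxU⟩ := hU.exists_initial
      obtain ⟨K, hK, hf⟩ := key U hU x hx hxU
      refine ⟨⟨K.δ, fun p v => ?_⟩, fun _ => ⟨x, hx, hxU, K, rfl, hK, hf⟩⟩
      by_contra hne
      obtain ⟨w, hw⟩ := Option.ne_none_iff_exists'.mp hne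
      have := (hK.dom _ _ hw).1
      simp [depth] at this
    · exact ⟨⟨fun _ => none, fun _ _ => rfl⟩, fun h => absurd h hU⟩
  choose δ hδ using key'
  -- Facts about the configuration after the first round.
  have hfacts : ∀ U, IsFullRoundLabel (T.toTask n) U → ∀ x, (T.toTask n).IsInitial x →
      ContainsLabel x U → ∃ K, (δ U).decide = K.δ ∧
      Good T H (FirstRound.after x (U.map ids) .empty) K ∧
      Future T H .empty K₀ (FirstRound.after x (U.map ids) .empty) K ∧
      Reach T K.δ x ((Config.initial x).run (U.map ids)) ∧
      ∀ β p, ((Config.initial x).IsSchedule K.δ (U.map ids ++ β)) →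
        ((Config.initial x).run (U.map ids ++ β)).round p ≤ K.t := by
    intro U hU x hx hxU
    obtain ⟨x', -, hxU', K, hd, hK, hf⟩ := hδ U hU
    obtain rfl := ContainsLabel.unique hU hxU hxU'
    have hone : ∀ s : LocalState n V, s.depth ≤ 1 → K.δ s = none := fun s hs => by
      rw [hf.agree s (hs.trans ht₀), hnone]
    have hsch := hU.isSchedule x' fun s hs => hone s (by omega)
    refine ⟨K, hd, hK, hf, ⟨hx, _, hsch, rfl⟩, fun β p hβ => ?_⟩
    have hfit := (FirstRound.fits_initial x').run (U.map ids)
    refine hK.round_le ⟨hx, _, hβ, rfl⟩ fun e s hs => ?_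
    rw [run_append] at hs
    refine ⟨hfit.in_of_occ β (Or.inl hs), fun v hv => ?_⟩
    refine hv.carrier_subset.trans (((hfit.run β).wf.carrier_subset (Or.inl hs)).trans fun a ha => ?_)
    rw [hfit.mem_top, hU.round_eq_one x']
    exact ⟨le_rfl, mem_allPairs.mp ha⟩
  refine ⟨δ, fun U hU x hx hxU => ?_, ?_⟩
  · obtain ⟨K, hd, hK, hf, hreach, hbound⟩ := hfacts U hU x hx hxU
    rw [hd]
    refine ⟨fun β hβ => hK.valid_of_in ⟨hx, _, hβ, rfl⟩ fun q => ?_, ?_⟩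
    · rw [run_append]
      exact ((FirstRound.fits_initial x).run (U.map ids)).in_of_occ β (Config.occ_state _ q)
    · rintro ⟨α, hα⟩
      have h1 := length_le_sum_round (hα ((n + 1) * K.t + 1))
      have h2 : ∑ p, ((Config.initial x).run
          (U.map ids ++ (List.range ((n + 1) * K.t + 1)).map α)).round p ≤ ∑ _p : Fin (n + 1), K.t :=
        Finset.sum_le_sum fun p _ => hbound _ p (hα _)
      simp at h1 h2
      omega
  · intro U U' hU hU' x x' hx hxU hx' hxU' Q hQ hstate
    have hcen : ∀ U, IsFullRoundLabel (T.toTask n) U → ∀ x, (T.toTask n).IsInitial x →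
        ContainsLabel x U → ∀ p ∈ Q, ∀ w,
        CenOutput (δ U) ((Config.initial x).run (U.map ids)) Q p w ↔
          w = H (((Config.initial x).run (U.map ids)).carrier Q) := by
      intro U hU x hx hxU p hp w
      obtain ⟨K, hd, hK, hf, hreach, hbound⟩ := hfacts U hU x hx hxU
      set C₀ := (Config.initial x).run (U.map ids) with hC₀
      have hone : ∀ s : LocalState n V, s.depth ≤ 1 → K.δ s = none := fun s hs => by
        rw [hf.agree s (hs.trans ht₀), hnone]
      have hr1 : ∀ p, C₀.round p = 1 := hU.round_eq_one x
      have hinv : ∀ k, CenInv T K.δ x C₀ Q k ((cenStep (δ U) Q)^[k] C₀) := by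
        intro k
        induction k with
        | zero =>
          refine ⟨hreach, fun p => (hr1 p).le, fun p => ?_, fun p _ _ => hr1 p, fun _ => rfl,
            by omega⟩
          exact (hreach.wf.mem_none p _).mpr (hr1 p).le
        | succ k ih =>
          rw [Function.iterate_succ_apply', cenStep, hd]
          exact ih.step hone hr1
      have hsch : ∀ k, ∃ β, (Config.initial x).IsSchedule K.δ (U.map ids ++ β) ∧
          (cenStep (δ U) Q)^[k] C₀ = (Config.initial x).run (U.map ids ++ β) := by
        intro k
        induction k with
        | zero => exact ⟨[], by simpa using hU.isSchedule x fun s hs => hone s (by omega), by simp [hC₀]⟩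
        | succ k ih =>
          obtain ⟨β, h1, h2⟩ := ih
          rw [Function.iterate_succ_apply', cenStep, hd]
          set A := Q.filter fun p => (K.δ (((cenStep (δ U) Q)^[k] C₀).state p)).isNone with hA
          rcases A.eq_empty_or_nonempty with h0 | hne
          · exact ⟨β, h1, by rw [h0, step_empty, h2]⟩
          · refine ⟨β ++ [A], ?_, ?_⟩
            · rw [← List.append_assoc, isSchedule_append, ← h2]
              refine ⟨h1, ⟨hne, fun p hp => ?_, fun p hp q hq => ?_⟩, trivial⟩
              · simpa using (Finset.mem_filter.mp hp).2
              · have e1 := (hinv k).round p (Finset.mem_filter.mp hp).1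
                  (by simpa using (Finset.mem_filter.mp hp).2)
                have e2 := (hinv k).round q (Finset.mem_filter.mp hq).1
                  (by simpa using (Finset.mem_filter.mp hq).2)
                rw [e1, e2]
            · rw [← List.append_assoc, run_append, ← h2]
              rfl
      have hout : ∀ k w, (δ U).decide (((cenStep (δ U) Q)^[k] C₀).state p) = some w →
          w = H (C₀.carrier Q) := fun k w hw =>
        cen_output_eq hr₀ hK₀.l_pos hK₀.lt hnone ht₀ hf hr1 hreach.wf (hinv k) hp (hd ▸ hw)
      constructor
      · rintro ⟨k, hk⟩
        exact hout k w hk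
      · rintro rfl
        by_cases hn : (δ U).decide (((cenStep (δ U) Q)^[K.t] C₀).state p) = none
        · exfalso
          obtain ⟨β, h1, h2⟩ := hsch K.t
          have h3 := (hinv K.t).round p hp (hd ▸ hn)
          have h4 := hbound β p h1
          rw [← h2] at h4
          omega
        · obtain ⟨w, hw⟩ := Option.ne_none_iff_exists'.mp hn
          exact ⟨K.t, by rw [hw, hout _ w hw]⟩
    intro p hp w
    rw [hcen U hU x hx hxU p hp w, hcen U' hU' x' hx' hxU' p hp w]
    have : ((Config.initial x).run (U.map ids)).carrier Q =
        ((Config.initial x').run (U'.map ids)).carrier Q := by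
      simp only [Config.carrier]
      exact Finset.biUnion_congr rfl fun q hq => by rw [hstate q hq]
    rw [this]

end PartialFromHub

/-! ### Replies to queries -/

section Replies

open LocalState Config

variable {n : ℕ} {V W : Type*} {T : ColorlessTask V W} {H : Finset (Fin (n + 1) × V) → W}
  {S : FirstRound n V} {K : Know n V W}

theorem Config.WF.mem_run {x : Fin (n + 1) → V} {D : Config n V} (h : D.WF x) {r : ℕ}
    {p : Fin (n + 1)} {s : LocalState n V} (hs : D.mem r p = some s) (β : Schedule n) :
    (D.run β).mem r p = some s := by
  induction β generalizing D with
  | nil => exact hs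
  | cons P β ih =>
    refine ih (h.step P) ?_
    simp only [Config.step, Config.write]
    rw [if_neg, hs]
    rintro ⟨-, hr⟩
    have := (h.mem_none p r).mpr hr.le
    simp [hs] at this

/-- A schedule is possible if all states that were left in it are active. -/
theorem Config.IsSchedule.of_mem {d d' : LocalState n V → Option W} {x : Fin (n + 1) → V}
    {C : Config n V} (hC : C.WF x) {β : Schedule n} (h : C.IsSchedule d β)
    (hm : ∀ r p s, (C.run β).mem r p = some s → d' s = none) : C.IsSchedule d' β := by
  induction β generalizing C with
  | nil => trivial
  | cons P β ih =>
    refine ⟨⟨h.1.1, fun p hp => hm (C.round p) p _ ((hC.step P).mem_run ?_ β), h.1.2.2⟩,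
      ih (hC.step P) h.2 hm⟩
    simp [Config.step, Config.write, hp]

theorem Reach.of_mem {d d' : LocalState n V → Option W} {x : Fin (n + 1) → V} {D : Config n V}
    (h : Reach T d x D) (hm : ∀ r p s, D.mem r p = some s → d' s = none) : Reach T d' x D := by
  obtain ⟨hx, γ, hγ, rfl⟩ := h
  exact ⟨hx, γ, hγ.of_mem (WF.initial x) hm, rfl⟩

theorem Config.WF.depth_mem_lt {x : Fin (n + 1) → V} {D : Config n V} (h : D.WF x) {r : ℕ}
    {p : Fin (n + 1)} {s : LocalState n V} (hs : D.mem r p = some s) :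
    s.depth < (D.state p).depth := by
  have hso : D.Occ p r s := Or.inl hs
  rw [h.depth_eq hso, h.depth_state]
  by_contra hc
  have := (h.mem_none p r).mpr (not_lt.mp hc)
  simp [hs] at this

theorem Reach.of_agree {d d' : LocalState n V → Option W} {x : Fin (n + 1) → V} {D : Config n V}
    {t : ℕ} (h : Reach T d x D) (ht : ∀ p, (D.state p).depth ≤ t)
    (ha : ∀ s : LocalState n V, s.depth ≤ t → d' s = d s) : Reach T d' x D :=
  h.of_mem fun _ p s hs => by
    rw [ha s ((h.wf.depth_mem_lt hs).le.trans (ht p))]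
    exact h.active hs

/-- `β` is a `P`-only schedule from `C` after which outputs are as prescribed by some element of
`F`. -/
def Hits (d : LocalState n V → Option W) (C : Config n V) (P : Finset (Fin (n + 1)))
    (F : Set (Fin (n + 1) → Option W)) (β : Schedule n) : Prop :=
  (C.IsSchedule d β ∧ ∀ B ∈ β, B ⊆ P) ∧
    ∃ f ∈ F, ∀ q w, f q = some w → d ((C.run β).state q) = some w

/-- A stage of the adversary after an output query or an assignment query: the reply is settled. -/
def Answered (T : ColorlessTask V W) (H : Finset (Fin (n + 1) × V) → W) (C : Config n V)
    (P : Finset (Fin (n + 1))) (F : Set (Fin (n + 1) → Option W))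
    (a b : FirstRound n V × Know n V W) : Prop :=
  Evolves T H a b ∧ b.1 = a.1 ∧
    ((∃ β, ∀ c, Evolves T H b c → Hits c.2.δ C P F β) ∨
      ∀ c, Evolves T H b c → ¬ ∃ β, Hits c.2.δ C P F β)

/-- If some schedule leads to a goal without contradicting what is settled, then the outputs it asks
for are either settled or admissible, and can be realised. Otherwise, no schedule will ever be
correct, as all later outputs are admissible. -/
theorem Good.exists_answered (hH : IsHub T n H) (h : Good T H S K) {x : Fin (n + 1) → V}
    {C : Config n V} (hC : Reach T K.δ x C) (ht : ∀ p, (C.state p).depth ≤ K.t)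
    (P : Finset (Fin (n + 1))) (F : Set (Fin (n + 1) → Option W)) :
    ∃ K', Answered T H C P F (S, K) (S, K') := by
  classical
  -- The replies that do not contradict what is settled already.
  by_cases hex : ∃ β, ∃ f ∈ F, (C.IsSchedule K.δ β ∧ ∀ B ∈ β, B ⊆ P) ∧
      (∀ q w, f q = some w → ((C.run β).state q).depth ≤ K.t →
        K.δ ((C.run β).state q) = some w) ∧
      ((Finset.univ.filter fun q => (f q).isSome ∧ K.t < ((C.run β).state q).depth) = ∅ ∨
        ∃ o : Fin (n + 1) → W, (∀ q w, f q = some w → o q = w) ∧ Adm T H S K.l K.r (C.run β)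
          (Finset.univ.filter fun q => (f q).isSome ∧ K.t < ((C.run β).state q).depth) o)
  · obtain ⟨β, f, hf, ⟨hβ, hβP⟩, hold, hadm⟩ := hex
    have hD : Reach T K.δ x (C.run β) := hC.run hβ
    set Q := Finset.univ.filter fun q => (f q).isSome ∧ K.t < ((C.run β).state q).depth with hQ
    obtain ⟨K', hK', hdep, hout, hmem⟩ : ∃ K', KnowExt T H S K S K' ∧
        (∀ p, ((C.run β).state p).depth ≤ K'.t) ∧
        (∀ q ∈ Q, ∀ w, f q = some w → K'.δ ((C.run β).state q) = some w) ∧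
        ∀ r p s, (C.run β).mem r p = some s → K'.δ s = K.δ s := by
      rcases hadm with h0 | ⟨o, ho, hadm⟩
      · obtain ⟨M, hM⟩ := exists_depth_bound (C.run β)
        obtain ⟨K', h1, h2, h3⟩ := h.shrink M
        exact ⟨K', h1, fun p => (hM p).trans h2, by simp [h0], fun _ _ _ _ => by rw [h3]⟩
      · obtain ⟨K', h1⟩ := h.exists_spot hH hD
          (fun q hq => (Finset.mem_filter.mp hq).2.2) hadm
        exact ⟨K', h1.ext, h1.depth, fun q hq w hw => by rw [h1.out q hq, ho q w hw], h1.mem⟩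
    refine ⟨K', hK'.evolves, rfl, Or.inl ⟨β, fun c hc => ⟨⟨?_, hβP⟩, f, hf, fun q w hq => ?_⟩⟩⟩
    · refine hβ.of_mem hC.wf fun r p s hs => ?_
      rw [hc.agree ((hD.wf.depth_mem_lt hs).le.trans (hdep p))]
      exact (hmem r p s hs).trans (hD.active hs)
    · rw [hc.agree (hdep q)]
      rcases Nat.lt_or_ge K.t ((C.run β).state q).depth with h1 | h1
      · exact hout q (by simp [hQ, hq, h1]) w hq
      · exact (hK'.agree _ h1).trans (hold q w hq h1)
  · obtain ⟨K', hK', -, hδ⟩ := h.shrink 0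
    refine ⟨K', hK'.evolves, rfl, Or.inr fun c hc => ?_⟩
    have hf : Future T H S K c.1 c.2 := hc.future hH h hK'.good (hK'.future h hδ)
    rintro ⟨β, ⟨hβ, hβP⟩, f, hfF, hhit⟩
    have hDc : Reach T c.2.δ x (C.run β) := (hC.of_agree ht hf.agree).run hβ
    refine hex ⟨β, f, hfF, ⟨hβ.mono (h.none_of_agree hf.agree), hβP⟩, fun q w hq hd => ?_, ?_⟩
    · rw [← hf.agree _ hd]
      exact hhit q w hq
    · set Q := Finset.univ.filter fun q => (f q).isSome ∧ K.t < ((C.run β).state q).depth with hQ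
      refine Q.eq_empty_or_nonempty.imp id fun hQne => ?_
      obtain ⟨q₁, hq₁⟩ := hQne
      obtain ⟨w₁, -⟩ := Option.isSome_iff_exists.mp (Finset.mem_filter.mp hq₁).2.1
      refine ⟨fun q => (f q).getD w₁, fun q w hq => by simp [hq], hf.adm x _ hDc Q _ ⟨q₁, hq₁⟩
        fun q hq => ?_⟩
      obtain ⟨h1, h2⟩ := (Finset.mem_filter.mp hq).2
      obtain ⟨w, hw⟩ := Option.isSome_iff_exists.mp h1
      exact ⟨h2, by rw [hhit q w hw, hw]; rfl⟩

/-- A stage of the adversary after a query. -/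
structure Queried (T : ColorlessTask V W) (H : Finset (Fin (n + 1) × V) → W)
    (x : Fin (n + 1) → V) (D : Config n V) (P : Finset (Fin (n + 1)))
    (a b : FirstRound n V × Know n V W) : Prop where
  evolves : Evolves T H a b
  same : b.1 = a.1
  reach : Reach T b.2.δ x D
  depth : ∀ p, (D.state p).depth ≤ b.2.t
  raise : b = a ∨ ∀ p ∈ P, b.2.δ (D.state p) ≠ none

/-- After a query, either the stage need not change, as the new states are already settled, or the
processes that have taken a step can be made to terminate, if they are beyond the frontier. -/
theorem Good.exists_queried (hH : IsHub T n H) (h : Good T H S K) {x : Fin (n + 1) → V}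
    {C : Config n V} (hC : Reach T K.δ x C) (ht : ∀ p, (C.state p).depth ≤ K.t)
    {P : Finset (Fin (n + 1))} (hP : C.Poised K.δ P) (hin : ∀ p, S.In ((C.step P).state p)) :
    ∃ K', Queried T H x (C.step P) P (S, K) (S, K') := by
  have hD : Reach T K.δ x (C.step P) := hC.run (β := [P]) ⟨hP, trivial⟩
  obtain ⟨p₀, hp₀⟩ := hP.1
  have hround : ∀ p ∈ P, (C.step P).round p = C.round p₀ + 1 := fun p hp => by
    simp only [Config.step, if_pos hp, hP.2.2 p hp p₀ hp₀]
  by_cases hle : C.round p₀ + 1 ≤ K.t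
  · refine ⟨K, .refl, rfl, hD, fun p => ?_, Or.inl rfl⟩
    by_cases hp : p ∈ P
    · rw [hD.wf.depth_state, hround p hp]; exact hle
    · simp only [Config.step, if_neg hp]; exact ht p
  · have hdep : ∀ p ∈ P, K.t < ((C.step P).state p).depth := fun p hp => by
      rw [hD.wf.depth_state, hround p hp]
      exact not_le.mp hle
    obtain ⟨o, ho⟩ := h.exists_adm hH hD hP.1 hdep fun p _ => hin p
    obtain ⟨K', hK'⟩ := h.exists_spot hH hD hdep ho
    refine ⟨K', hK'.ext.evolves, rfl, hD.of_mem fun r p s hs => ?_, hK'.depth, Or.inr fun p hp => ?_⟩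
    · exact (hK'.mem r p s hs).trans (hD.active hs)
    · rw [hK'.out p hp]; simp

/-- The effect of a schedule depends only on the inputs of the processes that occur in it. -/
theorem Config.run_congr {A : Set (Fin (n + 1))} {γ : Schedule n} (hγ : ∀ P ∈ γ, ∀ p ∈ P, p ∈ A)
    {C C' : Config n V} (hm : C.mem = C'.mem) (hr : C.round = C'.round)
    (hs : ∀ p ∈ A, C.state p = C'.state p) :
    (C.run γ).mem = (C'.run γ).mem ∧ (C.run γ).round = (C'.run γ).round ∧
      ∀ p ∈ A, (C.run γ).state p = (C'.run γ).state p := by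
  induction γ generalizing C C' with
  | nil => exact ⟨hm, hr, hs⟩
  | cons P γ ih =>
    have hw : C.write P = C'.write P := by
      funext r q
      simp only [Config.write, hm, hr]
      by_cases hq : q ∈ P
      · rw [hs q (hγ P (by simp) q hq)]
      · simp [hq]
    refine ih (C := C.step P) (C' := C'.step P) (fun Q hQ => hγ Q (by simp [hQ])) hw ?_ ?_
    · simp only [Config.step, hr]
    · intro p hp
      simp only [Config.step, hw, hr, hs p hp]

theorem Config.IsSchedule.congr {d : LocalState n V → Option W} {A : Set (Fin (n + 1))}
    {γ : Schedule n} (hγ : ∀ P ∈ γ, ∀ p ∈ P, p ∈ A) {C C' : Config n V} (hm : C.mem = C'.mem)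
    (hr : C.round = C'.round) (hs : ∀ p ∈ A, C.state p = C'.state p) (h : C.IsSchedule d γ) :
    C'.IsSchedule d γ := by
  induction γ generalizing C C' with
  | nil => trivial
  | cons P γ ih =>
    obtain ⟨h1, h2, h3⟩ := run_congr (γ := [P]) (fun Q hQ => hγ Q (by simp_all)) hm hr hs
    refine ⟨⟨h.1.1, fun p hp => ?_, fun p hp q hq => ?_⟩,
      ih (fun Q hQ => hγ Q (by simp [hQ])) h1 h2 h3 h.2⟩
    · rw [← hs p (hγ P (by simp) p hp)]
      exact h.1.2.1 p hp
    · rw [← hr]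
      exact h.1.2.2 p hp q hq

theorem Config.state_run_of_notMem {p : Fin (n + 1)} {γ : Schedule n} (hγ : ∀ P ∈ γ, p ∉ P)
    (C : Config n V) : (C.run γ).state p = C.state p := by
  induction γ generalizing C with
  | nil => rfl
  | cons P γ ih =>
    refine (ih (fun Q hQ => hγ Q (by simp [hQ])) (C.step P)).trans ?_
    simp [Config.step, hγ P (by simp)]

end Replies

/-! ### The adversary -/

section Adversary

open LocalState Config

variable {n : ℕ} {V W : Type*} {T : ColorlessTask V W} {H : Finset (Fin (n + 1) × V) → W}

theorem Node.config_extend (C : Node n V) (P : Finset (Fin (n + 1))) :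
    (C.extend P).config = C.config.step P := by
  simp [Node.extend, Node.config, Config.run]

/-- The prescriptions that say that some process of `P` outputs `y`. -/
def outputGoals (P : Finset (Fin (n + 1))) (y : W) : Set (Fin (n + 1) → Option W) :=
  {f | ∃ p ∈ P, f = fun q => if q = p then some y else none}

/-- `b` is a suitable stage of the adversary after the move `m` in stage `a`. -/
def Suitable (T : ColorlessTask V W) (H : Finset (Fin (n + 1) × V) → W)
    (a : FirstRound n V × Know n V W) : Move n V W → FirstRound n V × Know n V W → Prop
  | .query C P, b => Queried T H C.input (C.extend P).config P a b
  | .outputQuery C P y, b => Answered T H C.config P (outputGoals P y) a b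
  | .assignQuery C P f, b => Answered T H C.config P {f} a b
  | .endPhase C, b => Evolves T H a b ∧ b.1 = FirstRound.after C.input C.sched .empty

open scoped Classical in
/-- The stage of the adversary after the move `m` in stage `a`. -/
noncomputable def advance (T : ColorlessTask V W) (H : Finset (Fin (n + 1) × V) → W)
    (a : FirstRound n V × Know n V W) (m : Move n V W) : FirstRound n V × Know n V W :=
  if h : ∃ b, Suitable T H a m b then h.choose else a

theorem suitable_advance {a : FirstRound n V × Know n V W} {m : Move n V W}
    (h : ∃ b, Suitable T H a m b) : Suitable T H a m (advance T H a m) := by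
  rw [advance, dif_pos h]
  exact h.choose_spec

/-- The move of the prover in an event. -/
def Event.move : Event n V W → Move n V W
  | .query C P _ => .query C P
  | .outputQuery C P y _ => .outputQuery C P y
  | .assignQuery C P f _ => .assignQuery C P f
  | .endPhase C => .endPhase C

/-- The stage of the adversary after an interaction. -/
noncomputable def stage (T : ColorlessTask V W) (H : Finset (Fin (n + 1) × V) → W)
    (K₀ : Know n V W) : History n V W → FirstRound n V × Know n V W
  | [] => (.empty, K₀)
  | e :: h => advance T H (stage T H K₀ h) e.move

open scoped Classical in
/-- The reply in stage `a` to the question for a schedule: one that will remain correct. -/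
noncomputable def replySchedule (T : ColorlessTask V W) (H : Finset (Fin (n + 1) × V) → W)
    (a : FirstRound n V × Know n V W) (C : Config n V) (P : Finset (Fin (n + 1)))
    (F : Set (Fin (n + 1) → Option W)) : Option (Schedule n) :=
  if h : ∃ β, ∀ c, Evolves T H a c → Hits c.2.δ C P F β then some h.choose else none

/-- The adversary that maintains a partial decision map as described by `Good`. -/
noncomputable def hubAdversary (T : ColorlessTask V W) (H : Finset (Fin (n + 1) × V) → W)
    (K₀ : Know n V W) : Adversary n V W where
  replyQuery h C P p :=
    (advance T H (stage T H K₀ h) (.query C P)).2.δ ((C.extend P).config.state p)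
  replyOutput h C P y :=
    replySchedule T H (advance T H (stage T H K₀ h) (.outputQuery C P y)) C.config P
      (outputGoals P y)
  replyAssign h C P f :=
    replySchedule T H (advance T H (stage T H K₀ h) (.assignQuery C P f)) C.config P {f}

theorem Adversary.move_respond (A : Adversary n V W) (h : History n V W) (m : Move n V W) :
    (A.respond h m).move = m := by
  cases m <;> rfl

/-- The schedule with which the current phase starts. -/
def History.startSched : History n V W → Schedule n
  | [] => []
  | .endPhase C :: _ => C.sched
  | .query _ _ _ :: h => startSched h
  | .outputQuery _ _ _ _ :: h => startSched h
  | .assignQuery _ _ _ _ :: h => startSched h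

/-- The decision for `s` is known to the prover. -/
def History.Known (h : History n V W) (s : LocalState n V) : Prop :=
  s.depth = 0 ∨ ∃ C P r, Event.query C P r ∈ h ∧ ∃ p ∈ P, (C.extend P).config.state p = s

theorem History.Known.cons {h : History n V W} {s : LocalState n V} (hs : h.Known s)
    (e : Event n V W) : History.Known (e :: h) s :=
  hs.imp id fun ⟨C, P, r, h1, h2⟩ => ⟨C, P, r, List.mem_cons_of_mem _ h1, h2⟩

theorem one_le_depth_extend {C : Node n V} {P : Finset (Fin (n + 1))} {p : Fin (n + 1)}
    (hp : p ∈ P) : 1 ≤ ((C.extend P).config.state p).depth := by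
  rw [Node.config_extend]
  simp only [Config.step, if_pos hp]
  exact one_le_depth_view

theorem History.decision_of_depth_eq_zero (h : History n V W) {s : LocalState n V}
    (hs : s.depth = 0) : h.decision s = none := by
  induction h with
  | nil => rfl
  | cons e h ih =>
    cases e with
    | query C P r =>
      rw [History.decision, dif_neg, ih]
      rintro ⟨p, hp, rfl⟩
      have := one_le_depth_extend (C := C) hp
      omega
    | outputQuery => exact ih
    | assignQuery => exact ih
    | endPhase => exact ih

theorem Config.Valid.congr {T : DecisionTask n V W} {d d' : LocalState n V → Option W}
    {C : Config n V} (h : C.Valid T d) (hd : ∀ p, d' (C.state p) = d (C.state p)) :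
    C.Valid T d' := fun τ hτ ho => h τ hτ fun o ho' => (hd o.1).symm.trans (ho o ho')

/-- The node `C` can be reached under the decision map `d`. -/
def Node.Reachable (T : ColorlessTask V W) (d : LocalState n V → Option W) (C : Node n V) : Prop :=
  (T.toTask n).IsInitial C.input ∧ (Config.initial C.input).IsSchedule d C.sched

theorem Node.Reachable.reach {d : LocalState n V → Option W} {C : Node n V}
    (h : C.Reachable T d) : Reach T d C.input C.config :=
  ⟨h.1, C.sched, h.2, rfl⟩

/-- The invariants of the interaction, except for those about the current phase. -/
structure Consistent (T : ColorlessTask V W) (H : Finset (Fin (n + 1) × V) → W)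
    (h : History n V W) (a : FirstRound n V × Know n V W) : Prop where
  good : Good T H a.1 a.2
  reach : ∀ C ∈ h.phaseStart (T.toTask n) ∪ h.reached, C.Reachable T a.2.δ
  nodes : ∀ C ∈ h.phaseStart (T.toTask n) ∪ h.reached, ∀ p, h.Known (C.config.state p)
  known : ∀ s, h.Known s → s.depth ≤ a.2.t ∧ h.decision s = a.2.δ s
  correct : ∀ e ∈ h, ∀ b, Evolves T H a b → ∀ d : Protocol n V W, d.decide = b.2.δ → e.Correct d
  valid : ∀ C P r, Event.query C P r ∈ h → (C.extend P).config.Valid (T.toTask n) a.2.δ ∧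
    ∀ p, h.Known ((C.extend P).config.state p)

theorem Consistent.evolve {h : History n V W} {a b : FirstRound n V × Know n V W}
    (hc : Consistent T H h a) (hab : Evolves T H a b) : Consistent T H h b where
  good := hab.good hc.good
  reach := fun C hC => by
    have hR := (hc.reach C hC).reach
    refine ⟨(hc.reach C hC).1, (hc.reach C hC).2.of_mem (WF.initial _) fun r p s hs => ?_⟩
    rw [hab.agree ((hR.wf.depth_mem_lt hs).le.trans (hc.known _ (hc.nodes C hC p)).1)]
    exact hR.active hs
  nodes := hc.nodes
  known := fun s hs => by
    obtain ⟨h1, h2⟩ := hc.known s hs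
    exact ⟨h1.trans hab.t_le, h2.trans (hab.agree h1).symm⟩
  correct := fun e he c hbc => hc.correct e he c (hab.trans hbc)
  valid := fun C P r he => by
    obtain ⟨h1, h2⟩ := hc.valid C P r he
    exact ⟨h1.congr fun p => hab.agree (hc.known _ (h2 p)).1, h2⟩

theorem Consistent.cons_output {h : History n V W} {a : FirstRound n V × Know n V W}
    (hc : Consistent T H h a) {C : Node n V} {P : Finset (Fin (n + 1))} {y : W}
    {r : Option (Schedule n)} (he : ∀ b, Evolves T H a b → ∀ d : Protocol n V W, d.decide = b.2.δ →
      (Event.outputQuery C P y r).Correct d) :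
    Consistent T H (Event.outputQuery C P y r :: h) a where
  good := hc.good
  reach := hc.reach
  nodes := fun C hC p => (hc.nodes C hC p).cons _
  known := fun s hs => hc.known s <| hs.imp id fun ⟨C, P, r, h1, h2⟩ =>
    ⟨C, P, r, by simpa using h1, h2⟩
  correct := fun e h1 => by
    rcases List.mem_cons.mp h1 with rfl | h1
    exacts [he, hc.correct e h1]
  valid := fun C P r h1 => by
    obtain ⟨h2, h3⟩ := hc.valid C P r (by simpa using h1)
    exact ⟨h2, fun p => (h3 p).cons _⟩

theorem Consistent.cons_assign {h : History n V W} {a : FirstRound n V × Know n V W}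
    (hc : Consistent T H h a) {C : Node n V} {P : Finset (Fin (n + 1))}
    {f : Fin (n + 1) → Option W} {r : Option (Schedule n)}
    (he : ∀ b, Evolves T H a b → ∀ d : Protocol n V W, d.decide = b.2.δ →
      (Event.assignQuery C P f r).Correct d) :
    Consistent T H (Event.assignQuery C P f r :: h) a where
  good := hc.good
  reach := hc.reach
  nodes := fun C hC p => (hc.nodes C hC p).cons _
  known := fun s hs => hc.known s <| hs.imp id fun ⟨C, P, r, h1, h2⟩ =>
    ⟨C, P, r, by simpa using h1, h2⟩
  correct := fun e h1 => by
    rcases List.mem_cons.mp h1 with rfl | h1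
    exacts [he, hc.correct e h1]
  valid := fun C P r h1 => by
    obtain ⟨h2, h3⟩ := hc.valid C P r (by simpa using h1)
    exact ⟨h2, fun p => (h3 p).cons _⟩

theorem Consistent.cons_query {h : History n V W} {a : FirstRound n V × Know n V W}
    (hc : Consistent T H h a) {C : Node n V} {P : Finset (Fin (n + 1))} {r : Fin (n + 1) → Option W}
    (hC : C ∈ h.phaseStart (T.toTask n) ∪ h.reached)
    (hreach : (C.extend P).Reachable T a.2.δ)
    (hdepth : ∀ p, ((C.extend P).config.state p).depth ≤ a.2.t)
    (hin : ∀ p, a.1.In ((C.extend P).config.state p))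
    (hr : ∀ p, r p = a.2.δ ((C.extend P).config.state p)) :
    Consistent T H (Event.query C P r :: h) a := by
  have hnew : ∀ p, History.Known (Event.query C P r :: h) ((C.extend P).config.state p) := by
    intro p
    by_cases hp : p ∈ P
    · exact Or.inr ⟨C, P, r, by simp, p, hp, rfl⟩
    · rw [Node.config_extend]
      simp only [Config.step, if_neg hp]
      exact (hc.nodes C hC p).cons _
  refine ⟨hc.good, ?_, ?_, ?_, ?_, ?_⟩
  · rintro D (hD | hD | hD)
    · exact hc.reach D (Or.inl hD)
    · rw [show D = C.extend P from hD]
      exact hreach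
    · exact hc.reach D (Or.inr hD)
  · rintro D (hD | hD | hD) p
    · exact (hc.nodes D (Or.inl hD) p).cons _
    · rw [show D = C.extend P from hD]
      exact hnew p
    · exact (hc.nodes D (Or.inr hD) p).cons _
  · intro s hs
    rw [History.decision]
    by_cases hex : ∃ p ∈ P, (C.extend P).config.state p = s
    · rw [dif_pos hex, hr, hex.choose_spec.2]
      obtain ⟨p, -, rfl⟩ := hex
      exact ⟨hdepth p, rfl⟩
    · rw [dif_neg hex]
      refine hc.known s (hs.imp id ?_)
      rintro ⟨C', P', r', h1, h2⟩
      rcases List.mem_cons.mp h1 with h1 | h1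
      · simp only [Event.query.injEq] at h1
        obtain ⟨rfl, rfl, rfl⟩ := h1
        exact absurd h2 hex
      · exact ⟨C', P', r', h1, h2⟩
  · intro e he b hab d hd
    rcases List.mem_cons.mp he with rfl | he
    · intro p _
      rw [hd, hr, hab.agree (hdepth p)]
    · exact hc.correct e he b hab d hd
  · intro C' P' r' h1
    rcases List.mem_cons.mp h1 with h1 | h1
    · simp only [Event.query.injEq] at h1
      obtain ⟨rfl, rfl, rfl⟩ := h1
      exact ⟨hc.good.valid_of_in hreach.reach hin, hnew⟩
    · obtain ⟨h2, h3⟩ := hc.valid C' P' r' h1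
      exact ⟨h2, fun p => (h3 p).cons _⟩

theorem Consistent.cons_endPhase {h : History n V W} {a : FirstRound n V × Know n V W}
    (hc : Consistent T H h a) {C : Node n V} (hC : C ∈ h.reached) :
    Consistent T H (Event.endPhase C :: h) a := by
  have hknown : ∀ s, History.Known (Event.endPhase C :: h) s → h.Known s := fun s hs =>
    hs.imp id fun ⟨C, P, r, h1, h2⟩ => ⟨C, P, r, by simpa using h1, h2⟩
  -- The configurations in which the new phase starts look like `C` to those that took steps.
  have hsim : ∀ D : Node n V, D.sched = C.sched → (∀ P ∈ C.sched, ∀ p ∈ P, D.input p = C.input p) →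
      D.config.mem = C.config.mem ∧ ∀ p, D.config.state p = C.config.state p ∨
        (D.config.state p).depth = 0 := by
    intro D hD hinp
    have h1 := run_congr (A := {p | ∃ P ∈ C.sched, p ∈ P}) (γ := C.sched)
      (fun P hP p hp => ⟨P, hP, hp⟩) (C := Config.initial D.input)
      (C' := Config.initial C.input) rfl rfl (by
        rintro p ⟨P, hP, hp⟩
        simp only [Config.initial, hinp P hP p hp])
    unfold Node.config
    rw [hD]
    refine ⟨h1.1, fun p => ?_⟩
    by_cases hp : ∃ P ∈ C.sched, p ∈ P
    · exact Or.inl (h1.2.2 p hp)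
    · right
      rw [state_run_of_notMem (by simpa using hp)]
      simp [Config.initial, depth]
  refine ⟨hc.good, ?_, ?_, fun s hs => hc.known s (hknown s hs), ?_, ?_⟩
  · rintro D (⟨hx, hD, hinp⟩ | hD)
    · refine ⟨hx, ?_⟩
      rw [hD]
      refine (hc.reach C (Or.inr hC)).2.congr (C := Config.initial C.input) (A := {p | ∃ P ∈ C.sched, p ∈ P})
        (fun P hP p hp => ⟨P, hP, hp⟩) rfl rfl ?_
      rintro p ⟨P, hP, hp⟩
      simp only [Config.initial, hinp P hP p hp]
    · exact absurd hD (Set.notMem_empty _)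
  · rintro D (⟨hx, hD, hinp⟩ | hD) p
    · rcases (hsim D hD hinp).2 p with h1 | h1
      · rw [h1]
        exact (hc.nodes C (Or.inr hC) p).cons _
      · exact Or.inl h1
    · exact absurd hD (Set.notMem_empty _)
  · intro e he b hab d hd
    rcases List.mem_cons.mp he with rfl | he
    · trivial
    · exact hc.correct e he b hab d hd
  · intro C' P' r' h1
    obtain ⟨h2, h3⟩ := hc.valid C' P' r' (by simpa using h1)
    exact ⟨h2, fun p => (h3 p).cons _⟩

/-- All configurations of the current phase extend the schedule `γ`, the first round of which is
described by `S`. -/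
def Extends (T : ColorlessTask V W) (γ : Schedule n) (h : History n V W) (S : FirstRound n V) :
    Prop :=
  ∀ C ∈ h.phaseStart (T.toTask n) ∪ h.reached,
    S = FirstRound.after C.input γ .empty ∧ γ <+: C.sched

theorem Extends.fits {γ : Schedule n} {h : History n V W} {S : FirstRound n V}
    (hS : Extends T γ h S) {C : Node n V} (hC : C ∈ h.phaseStart (T.toTask n) ∪ h.reached) :
    S.Fits C.input ((Config.initial C.input).run γ) := by
  rw [(hS C hC).1]
  exact (FirstRound.fits_initial _).run _

theorem Extends.in_of_occ {γ : Schedule n} {h : History n V W} {S : FirstRound n V}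
    (hS : Extends T γ h S) {C : Node n V} (hC : C ∈ h.phaseStart (T.toTask n) ∪ h.reached)
    (γ' : Schedule n) {p : Fin (n + 1)} {e : ℕ} {s : LocalState n V}
    (hs : (C.config.run γ').Occ p e s) : S.In s := by
  obtain ⟨β, hβ⟩ := (hS C hC).2
  refine (hS.fits hC).in_of_occ (β ++ γ') (p := p) (e := e) ?_
  rwa [← run_append, ← List.append_assoc, hβ, run_append]

theorem Extends.cons_query {γ : Schedule n} {h : History n V W} {S : FirstRound n V}
    (hS : Extends T γ h S) {C : Node n V} (hC : C ∈ h.phaseStart (T.toTask n) ∪ h.reached)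
    (P : Finset (Fin (n + 1))) (r : Fin (n + 1) → Option W) :
    Extends T γ (Event.query C P r :: h) S := by
  rintro D (hD | hD | hD)
  · exact hS D (Or.inl hD)
  · rw [show D = C.extend P from hD]
    exact ⟨(hS C hC).1, (hS C hC).2.trans (List.prefix_append _ _)⟩
  · exact hS D (Or.inr hD)

theorem Extends.cons_endPhase {γ : Schedule n} {h : History n V W} {S : FirstRound n V}
    (hS : Extends T γ h S) {C : Node n V} (hC : C ∈ h.reached) :
    Extends T γ (Event.endPhase C :: h) S := by
  obtain ⟨h1, h2⟩ := hS C (Or.inr hC)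
  rintro D (⟨-, hD, hinp⟩ | hD)
  · rw [hD]
    exact ⟨h1.trans (FirstRound.after_congr (fun P hP => hinp P (h2.subset hP)) _).symm, h2⟩
  · exact absurd hD (Set.notMem_empty _)

theorem replySchedule_correct {a b : FirstRound n V × Know n V W} {C : Config n V}
    {P : Finset (Fin (n + 1))} {F : Set (Fin (n + 1) → Option W)} (h : Answered T H C P F a b) :
    ∀ c, Evolves T H b c → match replySchedule T H b C P F with
      | some β => Hits c.2.δ C P F β
      | none => ¬ ∃ β, Hits c.2.δ C P F β := by
  intro c hc
  unfold replySchedule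
  by_cases hex : ∃ β, ∀ c, Evolves T H b c → Hits c.2.δ C P F β
  · rw [dif_pos hex]
    exact hex.choose_spec c hc
  · rw [dif_neg hex]
    exact h.2.2.resolve_left hex c hc

theorem hits_outputGoals {d : LocalState n V → Option W} {C : Config n V}
    {P : Finset (Fin (n + 1))} {y : W} {β : Schedule n} :
    Hits d C P (outputGoals P y) β ↔ (C.IsSchedule d β ∧ ∀ B ∈ β, B ⊆ P) ∧
      ∃ p ∈ P, d ((C.run β).state p) = some y := by
  refine and_congr_right fun _ => ?_
  constructor
  · rintro ⟨f, ⟨p, hp, rfl⟩, hf⟩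
    exact ⟨p, hp, hf p y (by simp)⟩
  · rintro ⟨p, hp, hy⟩
    refine ⟨_, ⟨p, hp, rfl⟩, fun q w hq => ?_⟩
    split_ifs at hq with hqp
    rw [hqp, hy, hq]

theorem Consistent.poised {h : History n V W} {a : FirstRound n V × Know n V W}
    (hc : Consistent T H h a) {C : Node n V} (hC : C ∈ h.phaseStart (T.toTask n) ∪ h.reached)
    {P : Finset (Fin (n + 1))} (hP : C.config.Poised h.decision P) : C.config.Poised a.2.δ P :=
  ⟨hP.1, fun p hp => (hc.known _ (hc.nodes C hC p)).2 ▸ hP.2.1 p hp, hP.2.2⟩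

theorem Consistent.depth_le {h : History n V W} {a : FirstRound n V × Know n V W}
    (hc : Consistent T H h a) {C : Node n V} (hC : C ∈ h.phaseStart (T.toTask n) ∪ h.reached)
    (p : Fin (n + 1)) : (C.config.state p).depth ≤ a.2.t := (hc.known _ (hc.nodes C hC p)).1

/-- The adversary can answer every legal move. -/
theorem exists_suitable (hH : IsHub T n H) {h : History n V W} {a : FirstRound n V × Know n V W}
    (hc : Consistent T H h a) (hS : Extends T h.startSched h a.1) {m : Move n V W}
    (hm : h.Legal .augmented (T.toTask n) m) : ∃ b, Suitable T H a m b := by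
  cases m with
  | query C P =>
    obtain ⟨hC, hP⟩ := hm
    obtain ⟨K', hK'⟩ := hc.good.exists_queried hH (hc.reach C hC).reach (hc.depth_le hC)
      (hc.poised hC hP) fun p => hS.in_of_occ hC [P] (Config.occ_state _ p)
    refine ⟨(a.1, K'), ?_⟩
    rw [← Node.config_extend] at hK'
    exact hK'
  | outputQuery C P y =>
    obtain ⟨-, hC, hP⟩ := hm
    obtain ⟨K', hK'⟩ := hc.good.exists_answered hH (hc.reach C hC).reach (hc.depth_le hC) P
      (outputGoals P y)
    exact ⟨(a.1, K'), hK'⟩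
  | assignQuery C P f =>
    obtain ⟨-, hC, hP⟩ := hm
    obtain ⟨K', hK'⟩ := hc.good.exists_answered hH (hc.reach C hC).reach (hc.depth_le hC) P {f}
    exact ⟨(a.1, K'), hK'⟩
  | endPhase C =>
    have hC : C ∈ h.phaseStart (T.toTask n) ∪ h.reached := Or.inr hm
    have hfit := hS.fits hC
    obtain ⟨h1, β, h2⟩ := hS C hC
    obtain ⟨K', hK'⟩ := hc.good.exists_fills hH (hc.reach C hC).1 β fun a ha =>
      mem_allPairs.mpr ((hfit.mem_top a).mp ha).2
    refine ⟨_, hK', ?_⟩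
    rw [← h2, FirstRound.after_append, h1]

/-- The invariants are maintained in every legal move. -/
theorem Consistent.respond (hH : IsHub T n H) {K₀ : Know n V W} {h : History n V W}
    (hc : Consistent T H h (stage T H K₀ h)) (hS : Extends T h.startSched h (stage T H K₀ h).1) {m : Move n V W}
    (hm : h.Legal .augmented (T.toTask n) m) :
    Suitable T H (stage T H K₀ h) m (stage T H K₀ ((hubAdversary T H K₀).respond h m :: h)) ∧
    Consistent T H ((hubAdversary T H K₀).respond h m :: h)
      (stage T H K₀ ((hubAdversary T H K₀).respond h m :: h)) ∧
    Extends T (History.startSched ((hubAdversary T H K₀).respond h m :: h))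
      ((hubAdversary T H K₀).respond h m :: h)
      (stage T H K₀ ((hubAdversary T H K₀).respond h m :: h)).1 := by
  have hsuit := suitable_advance (exists_suitable hH hc hS hm)
  rw [stage, Adversary.move_respond]
  refine ⟨hsuit, ?_⟩
  set a := stage T H K₀ h with ha
  cases m with
  | query C P =>
    obtain ⟨hC, hP⟩ := hm
    change Queried T H C.input (C.extend P).config P a _ at hsuit
    have hc' := hc.evolve hsuit.evolves
    rw [show (advance T H a (.query C P)).1 = a.1 from hsuit.same]
    refine ⟨hc'.cons_query hC ⟨(hc.reach C hC).1, ?_⟩ hsuit.depth (fun p => ?_) (fun p => rfl),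
      hS.cons_query hC P _⟩
    · have hsch : (Config.initial C.input).IsSchedule a.2.δ (C.extend P).sched :=
        (isSchedule_append _ _ _).mpr ⟨(hc.reach C hC).2, hc.poised hC hP, trivial⟩
      exact hsch.of_mem (WF.initial _) fun r p s hs => hsuit.reach.active hs
    · rw [hsuit.same, Node.config_extend]
      exact hS.in_of_occ hC [P] (Config.occ_state _ p)
  | outputQuery C P y =>
    change Answered T H C.config P (outputGoals P y) a _ at hsuit
    rw [show (advance T H a (.outputQuery C P y)).1 = a.1 from hsuit.2.1]
    refine ⟨(hc.evolve hsuit.1).cons_output fun b hb d hd => ?_, hS⟩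
    have := replySchedule_correct hsuit b hb
    change Event.Correct d (.outputQuery C P y (replySchedule T H
      (advance T H a (.outputQuery C P y)) C.config P (outputGoals P y)))
    cases hr : replySchedule T H (advance T H a (.outputQuery C P y)) C.config P
      (outputGoals P y) with
    | some β =>
      rw [hr] at this
      simp only [hits_outputGoals, ← hd] at this
      exact this
    | none =>
      rw [hr] at this
      simp only [hits_outputGoals, ← hd] at this
      exact this
  | assignQuery C P f =>
    change Answered T H C.config P {f} a _ at hsuit
    rw [show (advance T H a (.assignQuery C P f)).1 = a.1 from hsuit.2.1]
    refine ⟨(hc.evolve hsuit.1).cons_assign fun b hb d hd => ?_, hS⟩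
    have := replySchedule_correct hsuit b hb
    change Event.Correct d (.assignQuery C P f (replySchedule T H
      (advance T H a (.assignQuery C P f)) C.config P {f}))
    cases hr : replySchedule T H (advance T H a (.assignQuery C P f)) C.config P {f} with
    | some β =>
      rw [hr] at this
      simp only [Hits, Set.mem_singleton_iff, exists_eq_left, ← hd] at this
      exact this
    | none =>
      rw [hr] at this
      simp only [Hits, Set.mem_singleton_iff, exists_eq_left, ← hd] at this
      exact this
  | endPhase C =>
    obtain ⟨h1, h2⟩ := hsuit
    refine ⟨(hc.evolve h1).cons_endPhase hm, ?_⟩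
    rintro D (⟨-, hD, hinp⟩ | hD)
    · exact ⟨h2.trans (FirstRound.after_congr hinp _).symm, by rw [hD]; exact List.prefix_rfl⟩
    · exact absurd hD (Set.notMem_empty _)

end Adversary

/-! ### The adversary wins -/

section AdversaryWins

open LocalState Config

variable {n : ℕ} {V W : Type*} {T : ColorlessTask V W} {H : Finset (Fin (n + 1) × V) → W}

theorem History.Legal.augmented {T : DecisionTask n V W} {c : ProverClass} {h : History n V W}
    {m : Move n V W} (hm : h.Legal c T m) : h.Legal .augmented T m := by
  cases m with
  | query C P => exact hm
  | outputQuery C P y => exact ⟨Or.inr rfl, hm.2⟩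
  | assignQuery C P f => exact ⟨rfl, hm.2⟩
  | endPhase C => exact hm

theorem Consistent.nil {K : Know n V W} (hK : Good T H .empty K) :
    Consistent T H ([] : History n V W) (.empty, K) where
  good := hK
  reach := by
    rintro C (⟨h1, h2⟩ | hC)
    · exact ⟨h1, by rw [h2]; trivial⟩
    · exact absurd hC (Set.notMem_empty _)
  nodes := by
    rintro C (⟨h1, h2⟩ | hC) p
    · left
      simp [Node.config, h2, Config.run, Config.initial, depth]
    · exact absurd hC (Set.notMem_empty _)
  known := by
    rintro s (hs | ⟨C, P, r, h1, -⟩)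
    · refine ⟨by omega, ?_⟩
      by_contra hne
      obtain ⟨w, hw⟩ := Option.ne_none_iff_exists'.mp (Ne.symm hne)
      have := (hK.dom s w hw).1
      omega
    · simp at h1
  correct := by simp
  valid := by simp

theorem Extends.nil :
    Extends T (History.startSched ([] : History n V W)) ([] : History n V W) .empty := by
  rintro C (⟨-, h2⟩ | hC)
  · exact ⟨rfl, List.nil_prefix⟩
  · exact absurd hC (Set.notMem_empty _)

section Play

variable {K₀ : Know n V W} {R : Prover n V W}

/-- The stage of the adversary after `k` moves. -/
noncomputable def stageAt (T : ColorlessTask V W) (H : Finset (Fin (n + 1) × V) → W)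
    (K₀ : Know n V W) (R : Prover n V W) (k : ℕ) : FirstRound n V × Know n V W :=
  stage T H K₀ (play (hubAdversary T H K₀) R k)

/-- The invariants hold as long as the prover keeps to the rules. -/
theorem consistent_play (hH : IsHub T n H) (hK₀ : Good T H .empty K₀) {k : ℕ}
    (hl : ∀ j < k, (play (hubAdversary T H K₀) R j).Legal .augmented (T.toTask n)
      (R (play (hubAdversary T H K₀) R j))) :
    Consistent T H (play (hubAdversary T H K₀) R k) (stageAt T H K₀ R k) ∧
      Extends T (play (hubAdversary T H K₀) R k).startSched (play (hubAdversary T H K₀) R k)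
        (stageAt T H K₀ R k).1 := by
  induction k with
  | zero => exact ⟨.nil hK₀, .nil⟩
  | succ k ih =>
    obtain ⟨h1, h2⟩ := ih fun j hj => hl j (by omega)
    exact (h1.respond hH h2 (hl k (by omega))).2

theorem suitable_play (hH : IsHub T n H) (hK₀ : Good T H .empty K₀) {k : ℕ}
    (hl : ∀ j < k + 1, (play (hubAdversary T H K₀) R j).Legal .augmented (T.toTask n)
      (R (play (hubAdversary T H K₀) R j))) :
    Suitable T H (stageAt T H K₀ R k) (R (play (hubAdversary T H K₀) R k))
      (stageAt T H K₀ R (k + 1)) := by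
  obtain ⟨h1, h2⟩ := consistent_play hH hK₀ (k := k) fun j hj => hl j (by omega)
  exact (h1.respond hH h2 (hl k (by omega))).1

theorem Suitable.evolves {a b : FirstRound n V × Know n V W} {m : Move n V W}
    (h : Suitable T H a m b) : Evolves T H a b := by
  cases m with
  | query C P => exact Queried.evolves h
  | outputQuery C P y => exact h.1
  | assignQuery C P f => exact h.1
  | endPhase C => exact h.1

theorem truthful_play (hH : IsHub T n H) (hK₀ : Good T H .empty K₀) {k : ℕ}
    (hl : ∀ j < k, (play (hubAdversary T H K₀) R j).Legal .augmented (T.toTask n)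
      (R (play (hubAdversary T H K₀) R j))) :
    Truthful (play (hubAdversary T H K₀) R k) ∧
      ¬ (play (hubAdversary T H K₀) R k).Violation (T.toTask n) := by
  obtain ⟨hc, -⟩ := consistent_play hH hK₀ hl
  refine ⟨⟨⟨(stageAt T H K₀ R k).2.δ, fun p v => ?_⟩, fun e he => hc.correct e he _ .refl _ rfl⟩, ?_⟩
  · by_contra hne
    obtain ⟨w, hw⟩ := Option.ne_none_iff_exists'.mp hne
    have := (hc.good.dom _ _ hw).1
    simp [depth] at this
  · rintro ⟨C, P, r, he, hv⟩
    obtain ⟨h1, h2⟩ := hc.valid C P r he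
    exact hv (h1.congr fun p => (hc.known _ (h2 p)).2)

/-- All moves of the prover `R` against the adversary are legal. -/
def AllLegal (T : ColorlessTask V W) (H : Finset (Fin (n + 1) × V) → W) (K₀ : Know n V W)
    (R : Prover n V W) : Prop :=
  ∀ j, (play (hubAdversary T H K₀) R j).Legal .augmented (T.toTask n)
    (R (play (hubAdversary T H K₀) R j))

theorem evolves_play (hH : IsHub T n H) (hK₀ : Good T H .empty K₀) (hl : AllLegal T H K₀ R)
    {i j : ℕ} (hij : i ≤ j) : Evolves T H (stageAt T H K₀ R i) (stageAt T H K₀ R j) := by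
  induction j, hij using Nat.le_induction with
  | base => exact .refl
  | succ j _ ih => exact Relation.ReflTransGen.trans ih (suitable_play hH hK₀ fun k _ => hl k).evolves

theorem play_succ (A : Adversary n V W) (k : ℕ) :
    play A R (k + 1) = A.respond (play A R k) (R (play A R k)) :: play A R k := rfl

theorem Extends.play_mono (hl : AllLegal T H K₀ R) {γ : Schedule n} {S : FirstRound n V} {i j : ℕ}
    (hij : i ≤ j) (h : Extends T γ (play (hubAdversary T H K₀) R i) S) :
    Extends T γ (play (hubAdversary T H K₀) R j) S := by
  induction j, hij using Nat.le_induction with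
  | base => exact h
  | succ j _ ih =>
    have hm := hl j
    rw [play_succ]
    cases hR : R (play (hubAdversary T H K₀) R j) with
    | query C P =>
      rw [hR] at hm
      exact ih.cons_query hm.1 _ _
    | outputQuery C P y => exact ih
    | assignQuery C P f => exact ih
    | endPhase C =>
      rw [hR] at hm
      exact ih.cons_endPhase hm

/-- The configurations that are reached in a phase lie beyond its start. -/
theorem length_startSched_lt (hH : IsHub T n H) (hK₀ : Good T H .empty K₀)
    (hl : AllLegal T H K₀ R) (k : ℕ) :
    ∀ C ∈ (play (hubAdversary T H K₀) R k).reached,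
      (play (hubAdversary T H K₀) R k).startSched.length < C.sched.length := by
  induction k with
  | zero => exact fun C hC => absurd hC (Set.notMem_empty _)
  | succ k ih =>
    have hm := hl k
    rw [play_succ]
    cases hR : R (play (hubAdversary T H K₀) R k) with
    | query C P =>
      rw [hR] at hm
      rintro D (hD | hD)
      · rw [show D = C.extend P from hD]
        have := ((consistent_play hH hK₀ fun j _ => hl j).2 C hm.1).2.length_le
        change _ < (C.sched ++ [P]).length
        rw [List.length_append]
        exact Nat.lt_succ_of_le this
      · exact ih D hD
    | outputQuery C P y => exact ih
    | assignQuery C P f => exact ih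
    | endPhase C => exact fun C hC => absurd hC (Set.notMem_empty _)

/-- The processes that occur in a schedule. -/
def procs (γ : Schedule n) : Finset (Fin (n + 1)) := Finset.univ.filter fun p => ∃ P ∈ γ, p ∈ P

theorem one_le_round_run {x : Fin (n + 1) → V} {γ : Schedule n} {p : Fin (n + 1)} :
    1 ≤ ((Config.initial x).run γ).round p ↔ p ∈ procs γ := by
  rw [round_run]
  simp only [Config.initial, zero_add, procs, Finset.mem_filter, Finset.mem_univ, true_and]
  rw [Nat.one_le_iff_ne_zero, ← Nat.pos_iff_ne_zero, List.countP_pos_iff]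
  simp

/-- If only those processes take steps that occur in the known part of the first round, then the
length of the schedule is bounded. -/
theorem Good.length_le {S : FirstRound n V} {K : Know n V W} (h : Good T H S K) {x : Fin (n + 1) → V}
    {γ β : Schedule n} (hx : (T.toTask n).IsInitial x)
    (hS : S.Fits x ((Config.initial x).run γ)) (hγ : (Config.initial x).IsSchedule K.δ (γ ++ β))
    (hp : procs (γ ++ β) ⊆ procs γ) : (γ ++ β).length ≤ (n + 1) * K.t := by
  have hreach : Reach T K.δ x ((Config.initial x).run (γ ++ β)) := ⟨hx, _, hγ, rfl⟩
  refine (length_le_sum_round hγ).trans ((Finset.sum_le_sum (g := fun _ => K.t) fun p _ => ?_).trans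
    (by simp))
  refine h.round_le hreach fun e s hs => ⟨?_, fun v hv a ha => ?_⟩
  · rw [run_append] at hs
    exact hS.in_of_occ β (Or.inl hs)
  · have hfit := (FirstRound.fits_initial (n := n) x).run (γ ++ β)
    obtain ⟨q, hq⟩ := hreach.wf.occ_of_sees (Or.inl hs) hv
    have h1 := (hfit.mem_top a).mp (FirstRound.le_top _ _ (hfit.chain q v hq) ha)
    exact (hS.mem_top a).mpr ⟨one_le_round_run.mpr (hp (one_le_round_run.mp h1.1)), h1.2⟩

/-- From some phase on, no further process takes its first step. The schedules of the later phases
are of bounded length by `Good.length_le`, although they become longer with every phase. -/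
theorem not_infinitelyManyPhases (hH : IsHub T n H) (hK₀ : Good T H .empty K₀)
    (hl : AllLegal T H K₀ R) :
    ¬ InfinitelyManyPhases fun j => R (play (hubAdversary T H K₀) R j) := by
  intro hinf
  set h := play (hubAdversary T H K₀) R with hh
  have hcons := fun k => consistent_play hH hK₀ (k := k) fun j _ => hl j
  have hend : ∀ {k C}, R (h k) = .endPhase C → (h (k + 1)).startSched = C.sched ∧
      C ∈ (h (k + 1)).phaseStart (T.toTask n) ∧ C ∈ (h k).reached := by
    intro k C hR
    have hm := hl k
    rw [← hh, hR] at hm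
    rw [hh, play_succ, ← hh, hR]
    exact ⟨rfl, ⟨((hcons k).1.reach C (Or.inr hm)).1, rfl, fun _ _ _ _ => rfl⟩, hm⟩
  have hstep : ∀ k, (h k).startSched <+: (h (k + 1)).startSched := by
    intro k
    cases hR : R (h k) with
    | query C P => rw [hh, play_succ, ← hh, hR]; exact List.prefix_rfl
    | outputQuery C P y => rw [hh, play_succ, ← hh, hR]; exact List.prefix_rfl
    | assignQuery C P f => rw [hh, play_succ, ← hh, hR]; exact List.prefix_rfl
    | endPhase C =>
      rw [(hend hR).1]
      exact ((hcons k).2 C (Or.inr (hend hR).2.2)).2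
  have hmono : ∀ {i j}, i ≤ j → (h i).startSched <+: (h j).startSched := by
    intro i j hij
    induction j, hij using Nat.le_induction with
    | base => exact List.prefix_rfl
    | succ j _ ih => exact ih.trans (hstep j)
  have hlen : ∀ M N, ∃ k ≥ N, M ≤ (h (k + 1)).startSched.length ∧ ∃ C, R (h k) = .endPhase C := by
    intro M N
    induction M with
    | zero =>
      obtain ⟨k, hk, C, hC⟩ := hinf N
      exact ⟨k, hk, Nat.zero_le _, C, hC⟩
    | succ M ih =>
      obtain ⟨k, hk, hM, -⟩ := ih
      obtain ⟨k', hk', C, hC⟩ := hinf (k + 1)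
      refine ⟨k', by omega, ?_, C, hC⟩
      have h1 := (hmono (show k + 1 ≤ k' from hk')).length_le
      have h2 := length_startSched_lt hH hK₀ hl k' C (hend hC).2.2
      rw [(hend hC).1]
      rw [← hh] at h2
      omega
  -- From some phase on, no further process takes its first step.
  have hprocs : Monotone fun k => procs (h k).startSched := by
    intro i j hij p hp
    obtain ⟨P, hP, hpP⟩ := (Finset.mem_filter.mp hp).2
    exact Finset.mem_filter.mpr ⟨Finset.mem_univ _, P, (hmono hij).subset hP, hpP⟩
  obtain ⟨k₀, hk₀⟩ := WellFoundedGT.monotone_chain_condition ⟨_, hprocs⟩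
  obtain ⟨k, hk, hM, C, hC⟩ := hlen ((n + 1) * (stageAt T H K₀ R k₀).2.t + 1) k₀
  obtain ⟨h1, h2, -⟩ := hend hC
  have hext := (hcons k₀).2.play_mono hl (show k₀ ≤ k + 1 by omega)
  have hC' : C ∈ (h (k + 1)).phaseStart (T.toTask n) ∪ (h (k + 1)).reached := Or.inl h2
  obtain ⟨β, hβ⟩ := (hext C hC').2
  have hreach := (hcons (k + 1)).1.reach C hC'
  have hev := evolves_play hH hK₀ hl (show k₀ ≤ k + 1 by omega)
  have hsch := hreach.2.mono ((hcons k₀).1.good.none_of_agree fun _ hs => hev.agree hs)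
  rw [← hβ] at hsch
  have := (hcons k₀).1.good.length_le hreach.1 (hext.fits hC') hsch (by
    rw [hβ, ← h1]
    exact (hk₀ (k + 1) (by omega)).ge)
  rw [hβ, ← h1] at this
  omega

/-- Each query either leaves the stage unchanged or makes all processes that have taken a step
terminate. As the latter happens at most once for each process in each of the finitely many chains,
the stage is constant from some point on. Then its `t` bounds the rounds, which increase with every
query. -/
theorem not_infiniteChain (hH : IsHub T n H) (hK₀ : Good T H .empty K₀) (hl : AllLegal T H K₀ R) :
    ¬ InfiniteChain fun j => R (play (hubAdversary T H K₀) R j) := by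
  rintro ⟨N, C, P, hq, r, chain, hchain⟩
  replace hq : ∀ k ≥ N, R (play (hubAdversary T H K₀) R k) = .query (C k) (P k) := hq
  have hcons := fun k => consistent_play hH hK₀ (k := k) fun j _ => hl j
  set st := stageAt T H K₀ R with hst
  set D : ℕ → Config n V := fun k => ((C k).extend (P k)).config with hD
  have hDs : ∀ k, D k = (C k).config.step (P k) := fun k => Node.config_extend _ _
  have hlegal : ∀ k ≥ N, C k ∈ (play (hubAdversary T H K₀) R k).phaseStart (T.toTask n) ∪
      (play (hubAdversary T H K₀) R k).reached ∧ (C k).config.Poised (st k).2.δ (P k) := by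
    intro k hk
    have hm := hl k
    rw [hq k hk] at hm
    exact ⟨hm.1, (hcons k).1.poised hm.1 hm.2⟩
  have hqueried : ∀ k ≥ N, Queried T H (C k).input (D k) (P k) (st k) (st (k + 1)) := by
    intro k hk
    have := suitable_play (k := k) hH hK₀ fun j _ => hl j
    rw [hq k hk] at this
    exact this
  have hround : ∀ k p, (C k).config.round p ≤ (D k).round p ∧
      (p ∈ P k → (C k).config.round p < (D k).round p) := by
    intro k p
    rw [hDs]
    simp only [Config.step]
    split_ifs with hp <;> simp [hp]
  -- What is known about a later configuration of the same chain.
  have hsame : ∀ j i, N ≤ i → i < j → chain i = chain j → ∀ p, (D i).round p ≤ (C j).config.round p ∧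
      ((st (i + 1)).2.δ ((D i).state p) ≠ none → (C j).config.state p = (D i).state p) := by
    intro j
    induction j using Nat.strong_induction_on with
    | _ j ih =>
      intro i hi hij hc p
      classical
      set i' := Nat.findGreatest (fun l => i ≤ l ∧ chain l = chain i) (j - 1) with hi'
      obtain ⟨h1, h2⟩ : i ≤ i' ∧ chain i' = chain i :=
        Nat.findGreatest_spec (P := fun l => i ≤ l ∧ chain l = chain i) (m := i) (by omega)
          ⟨le_rfl, rfl⟩
      have h3 : i' ≤ j - 1 := Nat.findGreatest_le _
      have h4 : (C j).config = D i' := by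
        refine hchain i' j (by omega) (by omega) (h2.trans hc) fun l hl1 hl2 hl3 => ?_
        have := Nat.le_findGreatest (P := fun l => i ≤ l ∧ chain l = chain i)
          (show l ≤ j - 1 by omega) ⟨by omega, hl3.trans h2⟩
        omega
      rw [h4]
      rcases h1.eq_or_lt with h5 | h5
      · rw [← h5]
        exact ⟨le_rfl, fun _ => rfl⟩
      · obtain ⟨h6, h7⟩ := ih i' (by omega) i hi h5 h2.symm p
        refine ⟨h6.trans (hround i' p).1, fun h8 => ?_⟩
        have h9 := h7 h8
        have h10 : p ∉ P i' := fun hp => by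
          have h11 := (hlegal i' (by omega)).2.2.1 p hp
          rw [h9, (evolves_play hH hK₀ hl (show i + 1 ≤ i' by omega)).agree
            ((hqueried i hi).depth p)] at h11
          exact h8 h11
        rw [hDs i']
        simp only [Config.step, if_neg h10]
        exact h9
  have hPne : ∀ k, ∃ p, N ≤ k → p ∈ P k := fun k => by
    by_cases hk : N ≤ k
    · obtain ⟨p, hp⟩ := (hlegal k hk).2.1
      exact ⟨p, fun _ => hp⟩
    · exact ⟨0, fun h => absurd h hk⟩
  choose p hp using hPne
  -- In each chain, each process can be stopped only once.
  have hfin : {k | N ≤ k ∧ st (k + 1) ≠ st k}.Finite := by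
    refine Set.Finite.of_finite_image (f := fun k => (chain k, p k)) (Set.toFinite _) ?_
    have key : ∀ i j, N ≤ i → st (i + 1) ≠ st i → i < j → (chain i, p i) = (chain j, p j) →
        False := by
      intro i j hi hne hij heq
      obtain ⟨h1, h2⟩ := Prod.mk.inj heq
      have h3 := (hqueried i hi).raise.resolve_left hne (p i) (hp i hi)
      have h4 := (hsame j i hi hij h1 (p i)).2 h3
      have h5 := (hlegal j (by omega)).2.2.1 (p j) (hp j (by omega))
      rw [← h2, h4, (evolves_play hH hK₀ hl (show i + 1 ≤ j by omega)).agree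
        ((hqueried i hi).depth (p i))] at h5
      exact h3 h5
    intro i hi j hj heq
    rcases Nat.lt_trichotomy i j with h1 | h1 | h1
    · exact (key i j hi.1 hi.2 h1 heq).elim
    · exact h1
    · exact (key j i hj.1 hj.2 h1 heq.symm).elim
  obtain ⟨M, hM⟩ := hfin.bddAbove
  set N' := max N (M + 1) with hN'
  have hconst : ∀ k ≥ N', st k = st N' := by
    intro k hk
    induction k, hk using Nat.le_induction with
    | base => rfl
    | succ k hk ih =>
      rw [← ih]
      by_contra hne
      have := hM ⟨(le_max_left _ _).trans hk, hne⟩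
      have := (le_max_right N (M + 1)).trans hk
      omega
  refine Set.Ici_infinite N' (Set.Finite.of_finite_image
    (f := fun k => (chain k, p k, (D k).round (p k))) ?_ ?_)
  · refine Set.Finite.subset ((Set.finite_univ (α := Fin r)).prod
      ((Set.finite_univ (α := Fin (n + 1))).prod (Set.finite_Iic (st N').2.t))) ?_
    rintro _ ⟨k, hk, rfl⟩
    refine ⟨Set.mem_univ _, Set.mem_univ _, ?_⟩
    have hkN : N ≤ k := (le_max_left _ _).trans hk
    have h1 := (hqueried k hkN).depth (p k)
    rw [(hqueried k hkN).reach.wf.depth_state, hconst (k + 1) (Nat.le_succ_of_le hk)] at h1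
    exact h1
  · have key : ∀ i j, N ≤ i → i < j →
        (chain i, p i, (D i).round (p i)) = (chain j, p j, (D j).round (p j)) → False := by
      intro i j hi hij heq
      simp only [Prod.mk.injEq] at heq
      obtain ⟨h1, h2, h3⟩ := heq
      have h4 := (hsame j i hi hij h1 (p i)).1
      have h5 := (hround j (p j)).2 (hp j (by omega))
      rw [h2] at h4 h3
      omega
    intro i hi j hj heq
    have hiN : N ≤ i := (le_max_left _ _).trans hi
    have hjN : N ≤ j := (le_max_left _ _).trans hj
    rcases Nat.lt_trichotomy i j with h1 | h1 | h1
    · exact (key i j hiN h1 heq).elim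
    · exact h1
    · exact (key j i hjN h1 heq.symm).elim

end Play

/-- A hub yields an adversary that wins against all augmented extension-based provers. -/
theorem IsHub.exists_adversary (hH : IsHub T n H) (c : ProverClass) :
    ∃ A : Adversary n V W, ∀ R : Prover n V W, A.WinsAgainst c (T.toTask n) R := by
  obtain ⟨K₀, hK₀, -⟩ := exists_good_initial T H 1
  refine ⟨hubAdversary T H K₀, fun R => ⟨fun k hl => ?_, ?_⟩⟩
  · exact truthful_play hH hK₀ fun j hj => (hl j hj).augmented
  · rintro ⟨hl, h1 | h1⟩
    · exact not_infinitelyManyPhases hH hK₀ (fun j => (hl j).augmented) h1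
    · exact not_infiniteChain hH hK₀ (fun j => (hl j).augmented) h1

end AdversaryWins

/-! ### Solo executions and bivalence -/

section Solo

open LocalState Config

variable {n : ℕ} {V W : Type*} {T : ColorlessTask V W}

/-- The state of `p` after it has accessed, in state `s` and alone, an IS object. -/
def soloNext (p : Fin (n + 1)) (s : LocalState n V) : LocalState n V :=
  .view p fun j => if j = p then some s else none

/-- The state of `i` after it has seen in an IS object exactly `p` in state `s` and `q` in
state `t`. -/
def pairNext (i p q : Fin (n + 1)) (s t : LocalState n V) : LocalState n V :=
  .view i fun j => if j = p then some s else if j = q then some t else none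

open scoped Classical in
/-- The state of `p` after the first round, if it has seen exactly the inputs in `σ`. -/
noncomputable def firstView (p : Fin (n + 1)) (σ : Finset (Fin (n + 1) × V)) : LocalState n V :=
  .view p fun j => if h : ∃ v, (j, v) ∈ σ then some (.init j h.choose) else none

/-- The relation `R` between local states and decisions determines that `p`, running alone from
its state `s`, terminates with output `w`. -/
def SoloOut (R : LocalState n V → Option W → Prop) (p : Fin (n + 1)) (s : LocalState n V) (w : W) :
    Prop :=
  ∃ k, R ((soloNext p)^[k] s) (some w) ∧ ∀ j < k, R ((soloNext p)^[j] s) none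

theorem SoloOut.mono {R R' : LocalState n V → Option W → Prop} (h : ∀ s o, R s o → R' s o)
    {p : Fin (n + 1)} {s : LocalState n V} {w : W} (hs : SoloOut R p s w) : SoloOut R' p s w :=
  let ⟨k, h1, h2⟩ := hs
  ⟨k, h _ _ h1, fun j hj => h _ _ (h2 j hj)⟩

theorem SoloOut.unique {R : LocalState n V → Option W → Prop}
    (hR : ∀ s o o', R s o → R s o' → o = o') {p : Fin (n + 1)} {s : LocalState n V} {w w' : W}
    (h : SoloOut R p s w) (h' : SoloOut R p s w') : w = w' := by
  obtain ⟨k, h1, h2⟩ := h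
  obtain ⟨k', h1', h2'⟩ := h'
  rcases lt_trichotomy k k' with hk | rfl | hk
  · exact absurd (hR _ _ _ h1 (h2' k hk)) (by simp)
  · exact Option.some.inj (hR _ _ _ h1 h1')
  · exact absurd (hR _ _ _ h1' (h2 k' hk)) (by simp)

theorem SoloOut.cases {R : LocalState n V → Option W → Prop} {p : Fin (n + 1)}
    {s : LocalState n V} {w : W} (h : SoloOut R p s w) :
    R s (some w) ∨ (R s none ∧ SoloOut R p (soloNext p s) w) := by
  obtain ⟨k, h1, h2⟩ := h
  cases k with
  | zero => exact Or.inl h1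
  | succ k =>
    exact Or.inr ⟨h2 0 (by omega), k, h1, fun j hj => h2 (j + 1) (by omega)⟩

/-- The outputs that `p` in state `s` and `q` in state `t` produce when they run alone are known,
and they are not connected in `K`. -/
def Bivalent (K : PreAbstractSimplicialComplex W) (R : LocalState n V → Option W → Prop)
    (p q : Fin (n + 1)) (s t : LocalState n V) : Prop :=
  ∃ w u, SoloOut R p s w ∧ SoloOut R q t u ∧ ¬ Conn K w u

theorem Bivalent.mono {K : PreAbstractSimplicialComplex W} {R R' : LocalState n V → Option W → Prop}
    (h : ∀ s o, R s o → R' s o) {p q : Fin (n + 1)} {s t : LocalState n V}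
    (hb : Bivalent K R p q s t) : Bivalent K R' p q s t :=
  let ⟨w, u, h1, h2, h3⟩ := hb
  ⟨w, u, h1.mono h, h2.mono h, h3⟩

/-- If both processes are active, then one of the three schedules `{p} {q}`, `{q} {p}` and `{p, q}`
preserves bivalence: the three pairs of successor states form a path from `soloNext p s` to
`soloNext q t`. -/
theorem Bivalent.next {K : PreAbstractSimplicialComplex W} {R : LocalState n V → Option W → Prop}
    {p q : Fin (n + 1)} {s t : LocalState n V} {w u w' u' : W} (hw : SoloOut R p (soloNext p s) w)
    (hu : SoloOut R q (soloNext q t) u) (hc : ¬ Conn K w u)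
    (hw' : SoloOut R p (pairNext p p q s t) w') (hu' : SoloOut R q (pairNext q p q s t) u') :
    Bivalent K R p q (soloNext p s) (pairNext q p q s t) ∨
      Bivalent K R p q (pairNext p p q s t) (pairNext q p q s t) ∨
      Bivalent K R p q (pairNext p p q s t) (soloNext q t) := by
  by_cases h1 : Conn K w u'
  · by_cases h2 : Conn K w' u'
    · by_cases h3 : Conn K w' u
      · exact absurd ((h1.trans h2.symm).trans h3) hc
      · exact Or.inr (Or.inr ⟨w', u, hw', hu, h3⟩)
    · exact Or.inr (Or.inl ⟨w', u', hw', hu', h2⟩)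
  · exact Or.inl ⟨w, u', hw, hu', h1⟩

theorem carrier_soloNext (p : Fin (n + 1)) (s : LocalState n V) :
    (soloNext p s).carrier = s.carrier := by
  classical
  ext a
  simp only [soloNext, LocalState.carrier, Finset.mem_biUnion, Finset.mem_univ, true_and]
  constructor
  · rintro ⟨j, hj⟩
    split_ifs at hj
    · exact hj
    · simp [LocalState.cellCarrier] at hj
  · exact fun h => ⟨p, by simpa [LocalState.cellCarrier] using h⟩

theorem carrier_pairNext (i p q : Fin (n + 1)) (s t : LocalState n V) :
    ∀ a ∈ (pairNext i p q s t).carrier, a ∈ s.carrier ∨ a ∈ t.carrier := by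
  classical
  intro a
  simp only [pairNext, LocalState.carrier, Finset.mem_biUnion, Finset.mem_univ, true_and]
  rintro ⟨j, hj⟩
  split_ifs at hj
  · exact Or.inl hj
  · exact Or.inr hj
  · simp [LocalState.cellCarrier] at hj

theorem carrier_iterate_soloNext (p : Fin (n + 1)) (s : LocalState n V) (k : ℕ) :
    ((soloNext p)^[k] s).carrier = s.carrier := by
  induction k with
  | zero => rfl
  | succ k ih => rw [Function.iterate_succ_apply', carrier_soloNext, ih]

/-- No process has accessed an IS object of index `r` or larger. -/
def FreshFrom (C : Config n V) (r : ℕ) : Prop := ∀ r' ≥ r, ∀ q, C.mem r' q = none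

theorem FreshFrom.step {C : Config n V} {r : ℕ} (h : FreshFrom C r) {P : Finset (Fin (n + 1))}
    (hP : ∀ p ∈ P, C.round p < r) : FreshFrom (C.step P) r := by
  intro r' hr q
  simp only [Config.step, Config.write]
  rw [if_neg, h r' hr q]
  rintro ⟨h1, h2⟩
  have := hP q h1
  omega

theorem state_step_singleton {C : Config n V} {p : Fin (n + 1)} (hf : FreshFrom C (C.round p)) :
    (C.step {p}).state p = soloNext p (C.state p) := by
  simp only [Config.step, soloNext, Finset.mem_singleton, if_true]
  congr 1
  funext j
  by_cases hj : j = p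
  · subst hj
    simp [Config.write]
  · simp [Config.write, hj, hf _ le_rfl j]

theorem FreshFrom.mono {C : Config n V} {r r' : ℕ} (h : FreshFrom C r) (hr : r ≤ r') :
    FreshFrom C r' := fun k hk => h k (hr.trans hk)

theorem fresh_step_singleton {C : Config n V} {p : Fin (n + 1)} (hf : FreshFrom C (C.round p)) :
    FreshFrom (C.step {p}) ((C.step {p}).round p) := by
  have h1 : (C.step {p}).round p = C.round p + 1 := by simp [Config.step]
  rw [h1]
  exact (hf.mono (Nat.le_succ _)).step (by simp)

theorem round_step_of_notMem {C : Config n V} {P : Finset (Fin (n + 1))} {q : Fin (n + 1)}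
    (hq : q ∉ P) : (C.step P).round q = C.round q := by
  simp [Config.step, hq]

theorem state_step_of_notMem {C : Config n V} {P : Finset (Fin (n + 1))} {q : Fin (n + 1)}
    (hq : q ∉ P) : (C.step P).state q = C.state q := by
  simp [Config.step, hq]

theorem state_step_of_mem {C : Config n V} {P : Finset (Fin (n + 1))} {q : Fin (n + 1)}
    (hq : q ∈ P) : (C.step P).state q = .view q (C.write P (C.round q)) := by
  simp [Config.step, hq]

theorem run_replicate_succ (C : Config n V) (P : Finset (Fin (n + 1))) (k : ℕ) :
    C.run (List.replicate (k + 1) P) = (C.run (List.replicate k P)).step P := by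
  rw [List.replicate_succ', Config.run_append]
  rfl

theorem solo_run {C : Config n V} {p : Fin (n + 1)} (hf : FreshFrom C (C.round p)) (k : ℕ) :
    FreshFrom (C.run (List.replicate k {p})) ((C.run (List.replicate k {p})).round p) ∧
      (C.run (List.replicate k {p})).state p = (soloNext p)^[k] (C.state p) ∧
      ∀ q, q ≠ p → (C.run (List.replicate k {p})).state q = C.state q := by
  induction k with
  | zero => exact ⟨hf, rfl, fun _ _ => rfl⟩
  | succ k ih =>
    obtain ⟨h1, h2, h3⟩ := ih
    rw [run_replicate_succ]
    refine ⟨fresh_step_singleton h1, ?_, fun q hq => ?_⟩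
    · rw [state_step_singleton h1, h2, Function.iterate_succ_apply']
    · rw [state_step_of_notMem (by simpa using hq), h3 q hq]

theorem isSchedule_replicate {d : LocalState n V → Option W} {C : Config n V} {p : Fin (n + 1)}
    (hf : FreshFrom C (C.round p)) {k : ℕ} (h : ∀ j < k, d ((soloNext p)^[j] (C.state p)) = none) :
    C.IsSchedule d (List.replicate k {p}) := by
  induction k with
  | zero => trivial
  | succ k ih =>
    rw [List.replicate_succ', Config.isSchedule_append]
    refine ⟨ih fun j hj => h j (by omega), ⟨⟨p, by simp⟩, fun q hq => ?_, fun q hq q' hq' => ?_⟩,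
      trivial⟩
    · rw [Finset.mem_singleton.mp hq, (solo_run hf k).2.1]
      exact h k (by omega)
    · rw [Finset.mem_singleton.mp hq, Finset.mem_singleton.mp hq']

/-- Processes `p` and `q` are poised to access the same IS object, which no process has accessed
yet, nor any later one. -/
def Frontier (C : Config n V) (p q : Fin (n + 1)) : Prop :=
  C.round p = C.round q ∧ FreshFrom C (C.round p)

theorem Frontier.symm {C : Config n V} {p q : Fin (n + 1)} (h : Frontier C p q) :
    Frontier C q p := ⟨h.1.symm, h.1 ▸ h.2⟩

theorem Frontier.step_step {C : Config n V} {p q : Fin (n + 1)} (h : Frontier C p q) (hpq : p ≠ q) :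
    Frontier ((C.step {p}).step {q}) p q ∧
      ((C.step {p}).step {q}).state p = soloNext p (C.state p) ∧
      ((C.step {p}).step {q}).state q = pairNext q p q (C.state p) (C.state q) := by
  obtain ⟨h1, h2⟩ := h
  have h3 : ((C.step {p}).step {q}).round p = C.round p + 1 := by simp [Config.step, hpq]
  refine ⟨⟨?_, ?_⟩, ?_, ?_⟩
  · rw [h3, h1]
    simp [Config.step, hpq.symm]
  · rw [h3]
    refine ((h2.mono (Nat.le_succ _)).step (by simp)).step ?_
    simp [round_step_of_notMem (show q ∉ {p} by simpa using hpq.symm), h1]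
  · rw [state_step_of_notMem (by simpa using hpq), state_step_singleton h2]
  · simp only [Config.step, pairNext, Finset.mem_singleton, if_true, if_neg hpq.symm]
    congr 1
    funext j
    by_cases hj : j = p
    · subst hj
      simp [Config.write, hpq, h1]
    · by_cases hj' : j = q
      · subst hj'
        simp [Config.write, hj]
      · simp [Config.write, hj, hj', ← h1, h2 _ le_rfl j]

theorem Frontier.step_pair {C : Config n V} {p q : Fin (n + 1)} (h : Frontier C p q) :
    Frontier (C.step {p, q}) p q ∧
      (C.step {p, q}).state p = pairNext p p q (C.state p) (C.state q) ∧
      (C.step {p, q}).state q = pairNext q p q (C.state p) (C.state q) := by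
  obtain ⟨h1, h2⟩ := h
  have h3 : (C.step {p, q}).round p = C.round p + 1 := by simp [Config.step]
  have h4 : ∀ j, C.write {p, q} (C.round p) j =
      if j = p then some (C.state p) else if j = q then some (C.state q) else none := by
    intro j
    simp only [Config.write, Finset.mem_insert, Finset.mem_singleton]
    by_cases hj : j = p
    · subst hj
      simp
    · by_cases hj' : j = q
      · subst hj'
        simp [hj, h1]
      · simp [hj, hj', h2 _ le_rfl j]
  refine ⟨⟨?_, ?_⟩, ?_, ?_⟩
  · simp [Config.step, h1]
  · rw [h3]
    refine (h2.mono (Nat.le_succ _)).step ?_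
    simp [h1]
  · simp only [Config.step, pairNext]
    rw [if_pos (by simp)]
    congr 1
    exact funext h4
  · simp only [Config.step, pairNext]
    rw [if_pos (by simp), ← h1]
    congr 1
    exact funext h4

theorem pairNext_swap (i : Fin (n + 1)) {p q : Fin (n + 1)} (hpq : p ≠ q) (s t : LocalState n V) :
    pairNext i q p t s = pairNext i p q s t := by
  simp only [pairNext]
  congr 1
  funext j
  by_cases hj : j = p
  · subst hj
    simp [hpq]
  · simp [hj]

/-- Valid outputs of two processes lie in a simplex that is allowed for every input simplex
containing what the two processes have seen. -/
theorem Config.Valid.exists_simplex {d : LocalState n V → Option W} {C : Config n V}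
    (h : C.Valid (T.toTask n) d) {p q : Fin (n + 1)} {w u : W} (hp : d (C.state p) = some w)
    (hq : d (C.state q) = some u) {σ : Finset (Fin (n + 1) × V)} (hσ : σ ∈ (T.toTask n).input)
    (hps : (C.state p).carrier ⊆ σ) (hqs : (C.state q).carrier ⊆ σ) (hpq : p = q → w = u)
    (hne : (C.state p).carrier.Nonempty) :
    ∃ ρ ∈ T.Δ (vals σ), w ∈ ρ ∧ u ∈ ρ := by
  classical
  have h1 := h {(p, w), (q, u)} (by simp) (by
    intro o ho
    rcases Finset.mem_insert.mp ho with rfl | ho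
    · exact hp
    · rw [Finset.mem_singleton.mp ho]
      exact hq)
  have hids : ids ({(p, w), (q, u)} : Finset (Fin (n + 1) × W)) = {p, q} := by
    simp [ids, Finset.image_insert]
  have hsub : C.carrier (ids ({(p, w), (q, u)} : Finset (Fin (n + 1) × W))) ⊆ σ := by
    rw [hids]
    intro a ha
    simp only [Config.carrier, Finset.mem_biUnion, Finset.mem_insert, Finset.mem_singleton] at ha
    obtain ⟨i, rfl | rfl, hi⟩ := ha
    · exact hps hi
    · exact hqs hi
  have hne' : (C.carrier (ids ({(p, w), (q, u)} : Finset (Fin (n + 1) × W)))).Nonempty :=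
    hne.mono (subset_carrier (by simp [hids]))
  refine ⟨_, T.Δ_vals_mono (T.input_of_subset hσ hsub hne') hσ hsub h1.1.2, ?_, ?_⟩
  · exact Finset.mem_image.mpr ⟨(p, w), by simp, rfl⟩
  · exact Finset.mem_image.mpr ⟨(q, u), by simp, rfl⟩

end Solo

/-! ### Hubs from outputs of solo executions -/

section HubCriterion

open LocalState Config

variable {n : ℕ} {V W : Type*} {T : ColorlessTask V W}

/-- A hub arises from outputs `w` of processes `p` for inputs `σ` that they have seen, if outputs are
allowed for `σ`, and connected whenever two processes may have seen `σ` and `σ'`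
at the same time. The hub value of `σ` is an output for the least process of `σ`. -/
theorem exists_hub_of_outputs (hne : ∃ σ, σ ∈ (T.toTask n).input)
    {Out : Fin (n + 1) → Finset (Fin (n + 1) × V) → W → Prop}
    (hex : ∀ σ ∈ (T.toTask n).input, ∀ p ∈ ids σ, ∃ w, Out p σ w)
    (hval : ∀ σ ∈ (T.toTask n).input, ∀ p ∈ ids σ, ∀ w, Out p σ w → ∃ ρ ∈ T.Δ (vals σ), w ∈ ρ)
    (hconn : ∀ σ' ∈ (T.toTask n).input, ∀ σ ⊆ σ', ∀ p ∈ ids σ, ∀ q ∈ ids σ', p ≠ q →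
      (σ = σ' ∨ q ∉ ids σ) → ∀ w u, Out p σ w → Out q σ' u → Conn (T.Δ (vals σ')) w u) :
    ∃ H, IsHub T n H := by
  classical
  have hidne : ∀ σ ∈ (T.toTask n).input, (ids σ).Nonempty := fun σ hσ =>
    ((T.toTask n).input.isRelLowerSet_faces hσ).1.image _
  have hW : Nonempty W := by
    obtain ⟨σ, hσ⟩ := hne
    obtain ⟨p, hp⟩ := hidne σ hσ
    exact ⟨(hex σ hσ p hp).choose⟩
  have hex' : ∀ σ, ∃ (p : Fin (n + 1)) (w : W),
      σ ∈ (T.toTask n).input → p = (ids σ).min ∧ p ∈ ids σ ∧ Out p σ w := by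
    intro σ
    by_cases hσ : σ ∈ (T.toTask n).input
    · have hp := Finset.min'_mem _ (hidne σ hσ)
      obtain ⟨w, hw⟩ := hex σ hσ _ hp
      exact ⟨_, w, fun _ => ⟨Finset.coe_min' _, hp, hw⟩⟩
    · exact ⟨0, hW.some, fun h => absurd h hσ⟩
  choose m H hH using hex'
  refine ⟨H, fun σ hσ => ⟨hval σ hσ _ (hH σ hσ).2.1 _ (hH σ hσ).2.2, fun σ' hσ' hle => ?_⟩⟩
  obtain ⟨-, h1, h2⟩ := hH σ hσ
  obtain ⟨-, h1', h2'⟩ := hH σ' hσ'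
  by_cases heq : σ = σ'
  · subst heq
    exact Relation.ReflTransGen.refl
  -- A process of `σ'` that does not occur in `σ` connects the two values.
  obtain ⟨q, hq, hqσ⟩ : ∃ q ∈ ids σ', q ∉ ids σ := by
    by_contra! hall
    refine heq (hle.antisymm fun a ha => ?_)
    obtain ⟨b, hb, hba⟩ := Finset.mem_image.mp (hall a.1 (Finset.mem_image_of_mem _ ha))
    rwa [← (T.toTask n).chromatic_input σ' hσ' (hle hb) ha hba]
  obtain ⟨u, hu⟩ := hex σ' hσ' q hq
  have h3 := hconn σ' hσ' σ hle _ h1 q hq (fun h => hqσ (h ▸ h1)) (Or.inr hqσ) _ _ h2 hu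
  by_cases hqm : q = m σ'
  · subst hqm
    exact hconn σ' hσ' σ hle _ h1 _ hq (fun h => hqσ (h ▸ h1)) (Or.inr hqσ) _ _ h2 h2'
  · exact h3.trans (hconn σ' hσ' σ' subset_rfl q hq _ h1' hqm (Or.inl rfl) _ _ hu h2')

/-- Every input simplex is part of an initial configuration. -/
theorem exists_initial_of_input {σ : Finset (Fin (n + 1) × V)} (hσ : σ ∈ (T.toTask n).input) :
    ∃ x, (T.toTask n).IsInitial x ∧ σ ⊆ allPairs x := by
  classical
  have hinj := (T.toTask n).chromatic_input σ hσ
  obtain ⟨a, ha⟩ := ((T.toTask n).input.isRelLowerSet_faces hσ).1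
  have hx : ∀ p, ∃ v, (∃ q, (q, v) ∈ σ) ∧ ∀ v', (p, v') ∈ σ → v = v' := by
    intro p
    by_cases hp : ∃ v, (p, v) ∈ σ
    · obtain ⟨v, hv⟩ := hp
      exact ⟨v, ⟨p, hv⟩, fun v' hv' => congrArg Prod.snd (hinj hv hv' rfl)⟩
    · exact ⟨a.2, ⟨a.1, ha⟩, fun v' hv' => absurd ⟨v', hv'⟩ hp⟩
  choose x hx1 hx2 using hx
  refine ⟨x, ⟨?_, ?_⟩, fun b hb => mem_allPairs.mpr (hx2 b.1 b.2 hb).symm⟩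
  · rintro b hb c hc hbc
    have hb' := mem_allPairs.mp (show b ∈ allPairs x from hb)
    have hc' := mem_allPairs.mp (show c ∈ allPairs x from hc)
    exact Prod.ext hbc (by rw [hb', hc', hbc])
  · refine (T.input.isRelLowerSet_faces hσ.2).2 ?_ ⟨x 0, ?_⟩
    · intro v hv
      obtain ⟨b, hb, rfl⟩ := Finset.mem_image.mp hv
      obtain ⟨q, hq⟩ := hx1 b.1
      rw [mem_allPairs.mp (show b ∈ allPairs x from hb)]
      exact Finset.mem_image.mpr ⟨_, hq, rfl⟩
    · exact Finset.mem_image.mpr ⟨(0, x 0), Finset.mem_map.mpr ⟨0, Finset.mem_univ _, rfl⟩, rfl⟩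

variable {x : Fin (n + 1) → V} {σ σ' : Finset (Fin (n + 1) × V)}

theorem mem_ids_iff (hσ : σ ⊆ allPairs x) {j : Fin (n + 1)} : j ∈ ids σ ↔ (j, x j) ∈ σ := by
  constructor
  · intro h
    obtain ⟨a, ha, rfl⟩ := Finset.mem_image.mp h
    rwa [← mem_allPairs.mp (hσ ha)]
  · exact fun h => Finset.mem_image_of_mem Prod.fst h

theorem firstView_eq (hσ : σ ⊆ allPairs x) (p : Fin (n + 1)) :
    firstView p σ = .view p fun j => if j ∈ ids σ then some (.init j (x j)) else none := by
  classical
  simp only [firstView]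
  congr 1
  funext j
  by_cases hj : j ∈ ids σ
  · have hex : ∃ v, (j, v) ∈ σ := ⟨x j, (mem_ids_iff hσ).mp hj⟩
    rw [dif_pos hex, if_pos hj, show hex.choose = x j from mem_allPairs.mp (hσ hex.choose_spec)]
  · rw [dif_neg, if_neg hj]
    rintro ⟨v, hv⟩
    exact hj (Finset.mem_image_of_mem Prod.fst hv)

theorem carrier_firstView (hσ : σ ⊆ allPairs x) (p : Fin (n + 1)) :
    (firstView p σ).carrier = σ := by
  classical
  ext a
  rw [firstView_eq hσ]
  simp only [LocalState.carrier, Finset.mem_biUnion, Finset.mem_univ, true_and]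
  constructor
  · rintro ⟨j, hj⟩
    split_ifs at hj with h
    · simp only [LocalState.cellCarrier, LocalState.carrier, Finset.mem_singleton] at hj
      rw [hj]
      exact (mem_ids_iff hσ).mp h
    · simp [LocalState.cellCarrier] at hj
  · intro ha
    refine ⟨a.1, ?_⟩
    rw [if_pos (show a.1 ∈ ids σ from Finset.mem_image_of_mem Prod.fst ha)]
    simp only [LocalState.cellCarrier, LocalState.carrier, Finset.mem_singleton]
    exact Prod.ext rfl (mem_allPairs.mp (hσ ha))

/-- The configuration in which first the processes of `σ`, then the further ones of `σ'`, and then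
those in `R` have taken a step. -/
def edgeConfig (x : Fin (n + 1) → V) (σ σ' : Finset (Fin (n + 1) × V)) (R : Finset (Fin (n + 1))) :
    Config n V :=
  (((Config.initial x).step (ids σ)).step (ids σ' \ ids σ)).step R

theorem edgeConfig_spec (hσ' : σ' ⊆ allPairs x) (hle : σ ⊆ σ') {R : Finset (Fin (n + 1))}
    (hR : Disjoint R (ids σ')) :
    FreshFrom (edgeConfig x σ σ' R) 1 ∧ (∀ p ∈ ids σ', (edgeConfig x σ σ' R).round p = 1) ∧
      (∀ p ∈ ids σ, (edgeConfig x σ σ' R).state p = firstView p σ) ∧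
      ∀ q ∈ ids σ', (σ = σ' ∨ q ∉ ids σ) → (edgeConfig x σ σ' R).state q = firstView q σ' := by
  classical
  have hid : ids σ ⊆ ids σ' := Finset.image_subset_image hle
  have hRn : ∀ p ∈ ids σ', p ∉ R := fun p hp hpR => Finset.disjoint_left.mp hR hpR hp
  have hfirst : ∀ p ∈ ids σ, (edgeConfig x σ σ' R).state p = firstView p σ := by
    intro p hp
    rw [edgeConfig, state_step_of_notMem (hRn p (hid hp)), state_step_of_notMem (by simp [hp]),
      state_step_of_mem hp, firstView_eq (hle.trans hσ')]
    congr 1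
    funext j
    simp [Config.write, Config.initial]
  refine ⟨?_, fun p hp => ?_, hfirst, fun q hq hqσ => ?_⟩
  · refine FreshFrom.step (FreshFrom.step (FreshFrom.step ?_ ?_) ?_) ?_
    · exact fun _ _ _ => rfl
    · simp [Config.initial]
    · intro p hp
      rw [round_step_of_notMem (Finset.mem_sdiff.mp hp).2]
      simp [Config.initial]
    · intro p hp
      have h1 : p ∉ ids σ' := fun h => hRn p h hp
      rw [round_step_of_notMem (fun h => h1 (Finset.mem_sdiff.mp h).1),
        round_step_of_notMem (fun h => h1 (hid h))]
      simp [Config.initial]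
  · rw [edgeConfig, round_step_of_notMem (hRn p hp)]
    by_cases hpσ : p ∈ ids σ
    · rw [round_step_of_notMem (by simp [hpσ])]
      simp [Config.step, Config.initial, hpσ]
    · simp [Config.step, Config.initial, hpσ, hp]
  · by_cases hqσ' : q ∈ ids σ
    · rw [hfirst q hqσ', hqσ.resolve_right (not_not.mpr hqσ')]
    · rw [edgeConfig, state_step_of_notMem (hRn q hq), firstView_eq hσ']
      have h1 : q ∈ ids σ' \ ids σ := Finset.mem_sdiff.mpr ⟨hq, hqσ'⟩
      rw [state_step_of_mem h1]
      congr 1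
      funext j
      by_cases hj : j ∈ ids σ
      · simp [Config.write, Config.step, Config.initial, hj, hqσ', hid hj]
      · by_cases hj' : j ∈ ids σ' <;>
          simp [Config.write, Config.step, Config.initial, hj, hqσ', hj']

end HubCriterion

/-! ### Infinite executions of bivalent processes -/

section Streams

open LocalState Config

/-- If every list in a non-empty set `S` has a proper extension in `S`, then infinitely many lists
in `S` are prefixes of one infinite sequence. -/
theorem exists_stream {α : Type*} {S : Set (List α)} {l₀ : List α} (h₀ : l₀ ∈ S)
    (h : ∀ l ∈ S, ∃ c, c ≠ [] ∧ l ++ c ∈ S) :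
    ∃ f : ℕ → α, ∀ N, ∃ k ≥ N, (List.range k).map f ∈ S := by
  choose! c hc hS using h
  let L : ℕ → List α := fun i => (fun l => l ++ c l)^[i] l₀
  have hL : ∀ i, L (i + 1) = L i ++ c (L i) := fun i => Function.iterate_succ_apply' _ _ _
  have hmem : ∀ i, L i ∈ S := by
    intro i
    induction i with
    | zero => exact h₀
    | succ i ih =>
      rw [hL]
      exact hS _ ih
  have hpre : ∀ i j, i ≤ j → L i <+: L j := by
    intro i j hij
    induction j, hij using Nat.le_induction with
    | base => exact List.prefix_rfl
    | succ j _ ih =>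
      rw [hL]
      exact ih.trans (List.prefix_append _ _)
  have hlen : ∀ i, i ≤ (L i).length := by
    intro i
    induction i with
    | zero => exact Nat.zero_le _
    | succ i ih =>
      rw [hL, List.length_append]
      have := List.length_pos_iff.mpr (hc _ (hmem i))
      omega
  refine ⟨fun i => (L (i + 1))[i]'(hlen (i + 1)), fun N => ⟨(L N).length, hlen N, ?_⟩⟩
  convert hmem N
  refine List.ext_getElem (by simp) fun i h1 h2 => ?_
  simp only [List.getElem_map, List.getElem_range]
  rcases le_total (i + 1) N with h3 | h3
  · exact (hpre _ _ h3).getElem _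
  · exact ((hpre _ _ h3).getElem _).symm

theorem Config.IsSchedule.of_append {n : ℕ} {V W : Type*} {d : LocalState n V → Option W}
    {C : Config n V} {α β : Schedule n} (h : C.IsSchedule d (α ++ β)) : C.IsSchedule d α :=
  ((Config.isSchedule_append C α β).mp h).1

end Streams

section HubFromPartial

open LocalState Config

variable {n : ℕ} {V W : Type*} {T : ColorlessTask V W}

theorem IsPartialProtocol.not_mem {T : DecisionTask n V W}
    {U : List (Finset (Fin (n + 1) × V))} {δ : Protocol n V W} (hδ : IsPartialProtocol T U δ)
    {x : Fin (n + 1) → V} (hx : T.IsInitial x) (hxU : ContainsLabel x U) {S : Set (Schedule n)}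
    (hS : ∀ β ∈ S, (Config.initial x).IsSchedule δ.decide (U.map ids ++ β))
    (hnext : ∀ β ∈ S, ∃ γ, γ ≠ [] ∧ β ++ γ ∈ S) (β : Schedule n) : β ∉ S := by
  intro hβ
  obtain ⟨f, hf⟩ := exists_stream hβ hnext
  refine (hδ x hx hxU).2 ⟨f, fun k => ?_⟩
  obtain ⟨k', hk, hk'⟩ := hf k
  obtain ⟨m, rfl⟩ := Nat.exists_eq_add_of_le hk
  have := hS _ hk'
  rw [List.range_add, List.map_append, ← List.append_assoc] at this
  exact this.of_append

/-- If `p` has terminated with output `w`, and `q` outputs `u` after a solo execution from the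
same configuration, then `w` and `u` belong to a common simplex, as the outputs after this
execution are valid. -/
theorem exists_simplex_of_soloOut {d : LocalState n V → Option W} {C : Config n V}
    {p q : Fin (n + 1)} (hpq : p ≠ q) (hf : FreshFrom C (C.round q)) {w u : W}
    (hp : d (C.state p) = some w) (hu : SoloOut (fun s o => d s = o) q (C.state q) u)
    (hv : ∀ k, C.IsSchedule d (List.replicate k {q}) →
      (C.run (List.replicate k {q})).Valid (T.toTask n) d)
    {σ : Finset (Fin (n + 1) × V)} (hσ : σ ∈ (T.toTask n).input)
    (hps : (C.state p).carrier ⊆ σ) (hqs : (C.state q).carrier ⊆ σ)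
    (hne : (C.state p).carrier.Nonempty) : ∃ ρ ∈ T.Δ (vals σ), w ∈ ρ ∧ u ∈ ρ := by
  obtain ⟨k, h1, h2⟩ := hu
  obtain ⟨-, h3, h4⟩ := solo_run hf k
  refine (hv k (isSchedule_replicate hf h2)).exists_simplex (p := p) (q := q) ?_ ?_ hσ ?_ ?_
    (fun h => absurd h hpq) ?_
  · rwa [h4 p hpq]
  · rwa [h3]
  · rwa [h4 p hpq]
  · rwa [h3, carrier_iterate_soloNext]
  · rwa [h4 p hpq]

theorem conn_of_mem {K : PreAbstractSimplicialComplex W} {w u : W}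
    (h : ∃ ρ ∈ K, w ∈ ρ ∧ u ∈ ρ) : Conn K w u := Relation.ReflTransGen.single h

variable {U : List (Finset (Fin (n + 1) × V))} {δ : Protocol n V W} {x : Fin (n + 1) → V}

/-- Under a partial protocol, solo executions terminate. -/
theorem IsPartialProtocol.exists_soloOut (hδ : IsPartialProtocol (T.toTask n) U δ)
    (hx : (T.toTask n).IsInitial x) (hxU : ContainsLabel x U) {β : Schedule n}
    (hβ : (Config.initial x).IsSchedule δ.decide (U.map ids ++ β)) {p : Fin (n + 1)}
    (hf : FreshFrom ((Config.initial x).run (U.map ids ++ β))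
      (((Config.initial x).run (U.map ids ++ β)).round p)) :
    ∃ w, SoloOut (fun s o => δ.decide s = o) p
      (((Config.initial x).run (U.map ids ++ β)).state p) w := by
  classical
  by_contra hno
  set C := (Config.initial x).run (U.map ids ++ β) with hC
  have hnone : ∀ k, δ.decide ((soloNext p)^[k] (C.state p)) = none := by
    intro k
    induction k using Nat.strong_induction_on with
    | _ k ih =>
      by_contra h
      obtain ⟨w, hw⟩ := Option.ne_none_iff_exists'.mp h
      exact hno ⟨w, k, hw, ih⟩
  refine hδ.not_mem hx hxU (S := Set.range fun k => β ++ List.replicate k {p}) ?_ ?_ β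
    ⟨0, by simp⟩
  · rintro _ ⟨k, rfl⟩
    rw [← List.append_assoc, Config.isSchedule_append]
    exact ⟨hβ, isSchedule_replicate hf fun j _ => hnone j⟩
  · rintro _ ⟨k, rfl⟩
    exact ⟨[{p}], by simp, k + 1, by simp [List.replicate_succ']⟩

/-- Under a partial protocol, no configuration is bivalent: bivalence could be preserved forever. -/
theorem IsPartialProtocol.not_bivalent (hδ : IsPartialProtocol (T.toTask n) U δ)
    (hx : (T.toTask n).IsInitial x) (hxU : ContainsLabel x U) {β : Schedule n}
    (hβ : (Config.initial x).IsSchedule δ.decide (U.map ids ++ β)) {p q : Fin (n + 1)} (hpq : p ≠ q)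
    (hfr : Frontier ((Config.initial x).run (U.map ids ++ β)) p q)
    {σ : Finset (Fin (n + 1) × V)} (hσ : σ ∈ (T.toTask n).input)
    (hps : (((Config.initial x).run (U.map ids ++ β)).state p).carrier ⊆ σ)
    (hqs : (((Config.initial x).run (U.map ids ++ β)).state q).carrier ⊆ σ) :
    ¬ Bivalent (T.Δ (vals σ)) (fun s o => δ.decide s = o) p q
      (((Config.initial x).run (U.map ids ++ β)).state p)
      (((Config.initial x).run (U.map ids ++ β)).state q) := by
  intro hbiv
  refine hδ.not_mem hx hxU (S := {β | (Config.initial x).IsSchedule δ.decide (U.map ids ++ β) ∧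
    Frontier ((Config.initial x).run (U.map ids ++ β)) p q ∧
    (((Config.initial x).run (U.map ids ++ β)).state p).carrier ⊆ σ ∧
    (((Config.initial x).run (U.map ids ++ β)).state q).carrier ⊆ σ ∧
    Bivalent (T.Δ (vals σ)) (fun s o => δ.decide s = o) p q
      (((Config.initial x).run (U.map ids ++ β)).state p)
      (((Config.initial x).run (U.map ids ++ β)).state q)}) (fun β h => h.1) ?_ β
    ⟨hβ, hfr, hps, hqs, hbiv⟩
  clear hbiv hps hqs hfr hβ
  rintro β ⟨hβ, hfr, hps, hqs, w, u, hw, hu, hc⟩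
  set C := (Config.initial x).run (U.map ids ++ β) with hC
  have hwf : C.WF x := WF.run_initial _ _
  have hvalid : ∀ γ, C.IsSchedule δ.decide γ → (C.run γ).Valid (T.toTask n) δ.decide := by
    intro γ hγ
    rw [hC, ← Config.run_append, List.append_assoc]
    refine (hδ x hx hxU).1 _ ?_
    rw [← List.append_assoc, Config.isSchedule_append]
    exact ⟨hβ, hγ⟩
  rcases hw.cases with hs | ⟨hs, hw'⟩
  · exact absurd (conn_of_mem (exists_simplex_of_soloOut hpq hfr.symm.2 hs hu
      (fun _ => hvalid _) hσ hps hqs ⟨_, hwf.self_mem_carrier (C.occ_state p)⟩)) hc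
  rcases hu.cases with ht | ⟨ht, hu'⟩
  · exact absurd (conn_of_mem (exists_simplex_of_soloOut hpq.symm hfr.2 ht hw
      (fun _ => hvalid _) hσ hqs hps ⟨_, hwf.self_mem_carrier (C.occ_state q)⟩)).symm hc
  -- It is enough to find an extension for which the pair of states remains bivalent.
  have key : ∀ γ, γ ≠ [] → C.IsSchedule δ.decide γ → ∀ s t, (C.run γ).state p = s →
      (C.run γ).state q = t → Frontier (C.run γ) p q → s.carrier ⊆ σ → t.carrier ⊆ σ →
      Bivalent (T.Δ (vals σ)) (fun s o => δ.decide s = o) p q s t → ∃ γ, γ ≠ [] ∧ β ++ γ ∈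
        {β | (Config.initial x).IsSchedule δ.decide (U.map ids ++ β) ∧
          Frontier ((Config.initial x).run (U.map ids ++ β)) p q ∧
          (((Config.initial x).run (U.map ids ++ β)).state p).carrier ⊆ σ ∧
          (((Config.initial x).run (U.map ids ++ β)).state q).carrier ⊆ σ ∧
          Bivalent (T.Δ (vals σ)) (fun s o => δ.decide s = o) p q
            (((Config.initial x).run (U.map ids ++ β)).state p)
            (((Config.initial x).run (U.map ids ++ β)).state q)} := by
    rintro γ hγ hsch _ _ rfl rfl h1 h2 h3 h4
    refine ⟨γ, hγ, ?_⟩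
    rw [Set.mem_ofPred_eq, ← List.append_assoc, Config.run_append, Config.isSchedule_append]
    exact ⟨⟨hβ, hsch⟩, h1, h2, h3, h4⟩
  have hsol : ∀ i j, C.round i = C.round j → δ.decide (C.state i) = none →
      δ.decide (C.state j) = none → C.Poised δ.decide {i, j} := by
    intro i j hr hi hj
    refine ⟨⟨i, by simp⟩, ?_, ?_⟩ <;> simp [hi, hj, hr]
  have hsing : ∀ i j, i ≠ j → δ.decide (C.state i) = none → δ.decide (C.state j) = none →
      C.IsSchedule δ.decide [{i}, {j}] := by
    intro i j hij hi hj
    refine ⟨⟨⟨i, by simp⟩, by simpa using hi, by simp⟩, ⟨⟨j, by simp⟩, ?_, by simp⟩, trivial⟩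
    intro k hk
    rw [Finset.mem_singleton.mp hk, state_step_of_notMem (by simpa using hij.symm)]
    exact hj
  have hpair : C.IsSchedule δ.decide [{p, q}] := ⟨hsol p q hfr.1 hs ht, trivial⟩
  obtain ⟨g1, g2, g3⟩ := hfr.step_pair
  obtain ⟨f1, f2, f3⟩ := hfr.step_step hpq
  obtain ⟨e1, e2, e3⟩ := hfr.symm.step_step hpq.symm
  rw [pairNext_swap _ hpq] at e3
  have hcar : ∀ i, (pairNext i p q (C.state p) (C.state q)).carrier ⊆ σ := fun i a ha =>
    (carrier_pairNext _ _ _ _ _ a ha).elim (fun h => hps h) (fun h => hqs h)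
  have hsolo : ∀ i, FreshFrom (C.step {p, q}) ((C.step {p, q}).round i) →
      ∃ w, SoloOut (fun s o => δ.decide s = o) i ((C.step {p, q}).state i) w := by
    intro i hi
    have h1 : (Config.initial x).run (U.map ids ++ (β ++ [{p, q}])) = C.step {p, q} := by
      rw [← List.append_assoc, Config.run_append]
      rfl
    have h2 := hδ.exists_soloOut hx hxU (β := β ++ [{p, q}]) (p := i) (by
      rw [← List.append_assoc, Config.isSchedule_append]
      exact ⟨hβ, hpair⟩) (by rwa [h1])
    rwa [h1] at h2
  obtain ⟨w', hw''⟩ := hsolo p g1.2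
  obtain ⟨u', hu''⟩ := hsolo q g1.symm.2
  rw [g2] at hw''
  rw [g3] at hu''
  rcases Bivalent.next hw' hu' hc hw'' hu'' with h | h | h
  · exact key [{p}, {q}] (by simp) (hsing p q hpq hs ht) _ _ f2 f3 f1
      (by rwa [carrier_soloNext]) (hcar q) h
  · exact key [{p, q}] (by simp) hpair _ _ g2 g3 g1 (hcar p) (hcar q) h
  · exact key [{q}, {p}] (by simp) (hsing q p hpq.symm ht hs) _ _ e3 e2 e1.symm (hcar p)
      (by rwa [carrier_soloNext]) h

end HubFromPartial

/-! ### A hub from compatible partial protocols -/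

section HubFromPartialProtocols

open LocalState Config

variable {n : ℕ} {V W : Type*} {T : ColorlessTask V W}

theorem SoloOut.cons {R : LocalState n V → Option W → Prop} {p : Fin (n + 1)}
    {s : LocalState n V} {w : W} (hs : R s none) (h : SoloOut R p (soloNext p s) w) :
    SoloOut R p s w := by
  obtain ⟨k, h1, h2⟩ := h
  refine ⟨k + 1, h1, fun j hj => ?_⟩
  cases j with
  | zero => exact hs
  | succ j => exact h2 j (by omega)

theorem cenStep_singleton (δ : Protocol n V W) (p : Fin (n + 1)) (C : Config n V) :
    (δ.decide (C.state p) = none → cenStep δ {p} C = C.step {p}) ∧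
      (δ.decide (C.state p) ≠ none → cenStep δ {p} C = C) := by
  constructor
  · intro h
    rw [cenStep]
    congr 1
    ext q
    simp only [Finset.mem_filter, Finset.mem_singleton, and_iff_left_iff_imp]
    rintro rfl
    simp [h]
  · intro h
    rw [cenStep]
    convert Config.step_empty C
    ext q
    simp only [Finset.mem_filter, Finset.mem_singleton, Finset.notMem_empty, iff_false]
    rintro ⟨rfl, h'⟩
    exact h (Option.isNone_iff_eq_none.mp h')

theorem cenOutput_singleton_iff (δ : Protocol n V W) {p : Fin (n + 1)} {C : Config n V}
    (hf : FreshFrom C (C.round p)) {w : W} :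
    CenOutput δ C {p} p w ↔ SoloOut (fun s o => δ.decide s = o) p (C.state p) w := by
  constructor
  · rintro ⟨k, hk⟩
    induction k generalizing C with
    | zero => exact ⟨0, hk, by simp⟩
    | succ k ih =>
      rw [Function.iterate_succ_apply] at hk
      by_cases h : δ.decide (C.state p) = none
      · rw [(cenStep_singleton δ p C).1 h] at hk
        have := ih (fresh_step_singleton hf) hk
        rw [state_step_singleton hf] at this
        exact this.cons h
      · rw [(cenStep_singleton δ p C).2 h] at hk
        exact ih hf hk
  · rintro ⟨k, h1, h2⟩
    have h3 : ∀ j ≤ k, (cenStep δ {p})^[j] C = C.run (List.replicate j {p}) := by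
      intro j hj
      induction j with
      | zero => rfl
      | succ j ih =>
        rw [Function.iterate_succ_apply', ih (by omega), run_replicate_succ]
        refine (cenStep_singleton δ p _).1 ?_
        rw [(solo_run hf j).2.1]
        exact h2 j (by omega)
    refine ⟨k, ?_⟩
    rw [h3 k le_rfl, (solo_run hf k).2.1]
    exact h1

theorem run_filter_nonempty (C : Config n V) (l : List (Finset (Fin (n + 1) × V))) :
    C.run ((l.filter fun u => decide u.Nonempty).map ids) = C.run (l.map ids) := by
  induction l generalizing C with
  | nil => rfl
  | cons u l ih =>
    by_cases hu : u.Nonempty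
    · rw [List.filter_cons_of_pos (by simpa using hu)]
      exact ih _
    · rw [List.filter_cons_of_neg (by simpa using hu), ih]
      rw [Finset.not_nonempty_iff_eq_empty.mp hu]
      change _ = (C.step (ids ∅)).run (l.map ids)
      rw [show ids (∅ : Finset (Fin (n + 1) × V)) = ∅ from Finset.image_empty _, Config.step_empty]

open scoped Classical in
/-- The label of the executions in which first the processes of `σ`, then the further ones of `σ'`,
and then all others take a step. -/
noncomputable def edgeLabel (x : Fin (n + 1) → V) (σ σ' : Finset (Fin (n + 1) × V)) :
    List (Finset (Fin (n + 1) × V)) :=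
  [σ, σ' \ σ, allPairs x \ σ'].filter fun u => decide u.Nonempty

variable {x : Fin (n + 1) → V} {σ σ' : Finset (Fin (n + 1) × V)}

theorem ids_sdiff [DecidableEq (Fin (n + 1) × V)] (hσ' : σ' ⊆ allPairs x) (hle : σ ⊆ allPairs x) :
    ids (σ' \ σ) = ids σ' \ ids σ := by
  ext j
  rw [Finset.mem_sdiff, mem_ids_iff (x := x) (Finset.sdiff_subset.trans hσ'), mem_ids_iff hσ',
    mem_ids_iff hle, Finset.mem_sdiff]

theorem containsLabel_edgeLabel (hσ' : σ' ⊆ allPairs x) (hle : σ ⊆ σ') :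
    ContainsLabel x (edgeLabel x σ σ') := by
  classical
  intro u hu a ha
  have hsub : u ⊆ allPairs x := by
    have := List.mem_of_mem_filter hu
    simp only [List.mem_cons, List.not_mem_nil, or_false] at this
    rcases this with rfl | rfl | rfl
    · exact hle.trans hσ'
    · exact Finset.sdiff_subset.trans hσ'
    · exact Finset.sdiff_subset
  exact (mem_allPairs.mp (hsub ha)).symm

theorem isFullRoundLabel_edgeLabel (hx : (T.toTask n).IsInitial x) (hσ' : σ' ⊆ allPairs x)
    (hle : σ ⊆ σ') : IsFullRoundLabel (T.toTask n) (edgeLabel x σ σ') := by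
  classical
  refine ⟨⟨allPairs x, hx, by simp [allPairs], fun u hu a ha => ?_⟩, fun u hu => ?_, ?_, fun p => ?_⟩
  · exact mem_allPairs.mpr (containsLabel_edgeLabel hσ' hle u hu a ha).symm
  · simpa using List.of_mem_filter hu
  · refine List.Pairwise.filter _ ?_
    have hid : ids σ ⊆ ids σ' := Finset.image_subset_image hle
    simp only [List.pairwise_cons, List.mem_cons, List.not_mem_nil, or_false, false_implies,
      implies_true, List.Pairwise.nil, and_true, forall_eq_or_imp, forall_eq]
    rw [ids_sdiff hσ' (hle.trans hσ'), ids_sdiff subset_rfl hσ']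
    refine ⟨⟨Finset.disjoint_sdiff, ?_⟩, ?_⟩
    · exact Finset.disjoint_sdiff.mono_left hid
    · exact Finset.disjoint_sdiff.mono_left Finset.sdiff_subset
  · have hp : (p, x p) ∈ allPairs x := mem_allPairs.mpr rfl
    suffices ∃ u ∈ [σ, σ' \ σ, allPairs x \ σ'], (p, x p) ∈ u by
      obtain ⟨u, hu, hpu⟩ := this
      exact ⟨u, List.mem_filter.mpr ⟨hu, by simpa using ⟨_, hpu⟩⟩, Finset.mem_image_of_mem _ hpu⟩
    by_cases h1 : (p, x p) ∈ σ
    · exact ⟨σ, by simp, h1⟩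
    · by_cases h2 : (p, x p) ∈ σ'
      · exact ⟨σ' \ σ, by simp, by simp [h1, h2]⟩
      · exact ⟨allPairs x \ σ', by simp, by simp [hp, h2]⟩

theorem exists_run_edgeLabel (hσ' : σ' ⊆ allPairs x) (hle : σ ⊆ σ') :
    ∃ R, Disjoint R (ids σ') ∧
      (Config.initial x).run ((edgeLabel x σ σ').map ids) = edgeConfig x σ σ' R := by
  classical
  refine ⟨ids (allPairs x \ σ'), ?_, ?_⟩
  · rw [ids_sdiff subset_rfl hσ']
    exact Finset.sdiff_disjoint
  · rw [edgeLabel]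
    convert run_filter_nonempty _ _ using 1
    rw [edgeConfig, ← ids_sdiff hσ' (hle.trans hσ')]
    rfl

theorem Protocol.decide_eq_none (δ : Protocol n V W) {s : LocalState n V} (hs : s.depth = 0) :
    δ.decide s = none := by
  cases s with
  | init p v => exact δ.decide_init p v
  | view p snap =>
    have := one_le_depth_view (p := p) (snap := snap)
    omega

/-- Compatible partial protocols yield a hub. -/
theorem exists_hub_of_partialProtocols (hne : ∃ σ, σ ∈ (T.toTask n).input)
    {δ : List (Finset (Fin (n + 1) × V)) → Protocol n V W}
    (hδ : ∀ U, IsFullRoundLabel (T.toTask n) U → IsPartialProtocol (T.toTask n) U (δ U))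
    (hc : ∀ U U', IsFullRoundLabel (T.toTask n) U → IsFullRoundLabel (T.toTask n) U' →
      Compatible (T.toTask n) U U' (δ U) (δ U')) : ∃ H, IsHub T n H := by
  classical
  -- `After U p σ`: the executions with label `U` take `p` to the first view `σ`.
  let After : List (Finset (Fin (n + 1) × V)) → (Fin (n + 1) → V) → Fin (n + 1) →
      Finset (Fin (n + 1) × V) → Prop := fun U x p σ =>
    IsFullRoundLabel (T.toTask n) U ∧ (T.toTask n).IsInitial x ∧ ContainsLabel x U ∧
      FreshFrom ((Config.initial x).run (U.map ids)) 1 ∧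
      ((Config.initial x).run (U.map ids)).round p = 1 ∧
      ((Config.initial x).run (U.map ids)).state p = firstView p σ
  have hsch : ∀ U x, IsFullRoundLabel (T.toTask n) U →
      (Config.initial x).IsSchedule (δ U).decide (U.map ids ++ []) := fun U x hU => by
    rw [List.append_nil]
    exact hU.isSchedule x fun s hs => (δ U).decide_eq_none hs
  have hafter : ∀ σ' ∈ (T.toTask n).input, ∀ σ ⊆ σ', ∃ U x, σ' ⊆ allPairs x ∧
      (∀ p ∈ ids σ, After U x p σ) ∧ ∀ q ∈ ids σ', (σ = σ' ∨ q ∉ ids σ) → After U x q σ' := by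
    intro σ' hσ' σ hle
    obtain ⟨x, hx, hsub⟩ := exists_initial_of_input hσ'
    obtain ⟨R, hR, hrun⟩ := exists_run_edgeLabel hsub hle
    obtain ⟨h1, h2, h3, h4⟩ := edgeConfig_spec hsub hle hR
    rw [← hrun] at h1 h2 h3 h4
    have hl := isFullRoundLabel_edgeLabel hx hsub hle
    have hcl := containsLabel_edgeLabel hsub hle
    exact ⟨_, x, hsub, fun p hp => ⟨hl, hx, hcl, h1, h2 p (Finset.image_subset_image hle hp),
      h3 p hp⟩, fun q hq hqσ => ⟨hl, hx, hcl, h1, h2 q hq, h4 q hq hqσ⟩⟩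
  have htransfer : ∀ U U' x x' p σ w, After U x p σ → After U' x' p σ →
      SoloOut (fun s o => (δ U).decide s = o) p (firstView p σ) w →
      SoloOut (fun s o => (δ U').decide s = o) p (firstView p σ) w := by
    rintro U U' x x' p σ w ⟨a1, a2, a3, a4, a5, a6⟩ ⟨b1, b2, b3, b4, b5, b6⟩ h
    rw [← b6, ← cenOutput_singleton_iff _ (b5.symm ▸ b4)]
    rw [← a6, ← cenOutput_singleton_iff _ (a5.symm ▸ a4)] at h
    refine (hc U U' a1 b1 x x' a2 a3 b2 b3 {p} (by simp) ?_ p (by simp) w).mp h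
    intro q hq
    rw [Finset.mem_singleton.mp hq, a6, b6]
  refine exists_hub_of_outputs hne (Out := fun p σ w => ∃ U x, After U x p σ ∧
    SoloOut (fun s o => (δ U).decide s = o) p (firstView p σ) w) ?_ ?_ ?_
  · intro σ hσ p hp
    obtain ⟨U, x, -, h1, -⟩ := hafter σ hσ σ subset_rfl
    have h2 := h1 p hp
    obtain ⟨a1, a2, a3, a4, a5, a6⟩ := h1 p hp
    obtain ⟨w, hw⟩ := (hδ U a1).exists_soloOut a2 a3 (hsch U x a1) (p := p) (by
      rw [List.append_nil, a5]
      exact a4)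
    rw [List.append_nil, a6] at hw
    exact ⟨w, U, x, h2, hw⟩
  · rintro σ hσ p hp w ⟨U', x', hU', hw⟩
    obtain ⟨U, x, hsub, h1, -⟩ := hafter σ hσ σ subset_rfl
    obtain ⟨k, h2, h3⟩ := htransfer _ _ _ _ _ _ _ hU' (h1 p hp) hw
    obtain ⟨a1, a2, a3, a4, a5, a6⟩ := h1 p hp
    have hf : FreshFrom ((Config.initial x).run (U.map ids))
        (((Config.initial x).run (U.map ids)).round p) := by rwa [a5]
    obtain ⟨-, h4, -⟩ := solo_run hf k
    have hk := isSchedule_replicate (d := (δ U).decide) hf (k := k) (by rwa [a6])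
    have hv := (hδ U a1 x a2 a3).1 (List.replicate k {p}) (by
      rw [Config.isSchedule_append]
      exact ⟨by simpa using hsch U x a1, hk⟩)
    rw [Config.run_append] at hv
    have hcar : (((Config.initial x).run (U.map ids)).run (List.replicate k {p})).state p =
      (soloNext p)^[k] (firstView p σ) := by rw [h4, a6]
    have hcar' : ((soloNext p)^[k] (firstView p σ)).carrier = σ := by
      rw [carrier_iterate_soloNext, carrier_firstView hsub]
    obtain ⟨ρ, hρ, h5, -⟩ := hv.exists_simplex (p := p) (q := p) (w := w) (u := w)
      (by rwa [hcar]) (by rwa [hcar]) hσ (by rw [hcar, hcar']) (by rw [hcar, hcar']) (fun _ => rfl)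
      (by
        rw [hcar, hcar']
        exact ((T.toTask n).input.isRelLowerSet_faces hσ).1)
    exact ⟨ρ, hρ, h5⟩
  · rintro σ' hσ' σ hle p hp q hq hpq hor w u ⟨U₁, x₁, hU₁, hw⟩ ⟨U₂, x₂, hU₂, hu⟩
    obtain ⟨U, x, hsub, h1, h2⟩ := hafter σ' hσ' σ hle
    have hw' := htransfer _ _ _ _ _ _ _ hU₁ (h1 p hp) hw
    have hu' := htransfer _ _ _ _ _ _ _ hU₂ (h2 q hq hor) hu
    obtain ⟨a1, a2, a3, a4, a5, a6⟩ := h1 p hp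
    obtain ⟨-, -, -, -, b5, b6⟩ := h2 q hq hor
    by_contra hcon
    refine (hδ U a1).not_bivalent a2 a3 (hsch U x a1) hpq ?_ hσ' ?_ ?_ ⟨w, u, ?_, ?_, hcon⟩
    all_goals rw [List.append_nil]
    · exact ⟨a5.trans b5.symm, a5.symm ▸ a4⟩
    · rw [a6, carrier_firstView (hle.trans hsub)]
      exact hle
    · rw [b6, carrier_firstView hsub]
    · rwa [a6]
    · rwa [b6]

end HubFromPartialProtocols

/-! ### Legal plays and disclosed decisions -/

section LegalPlays

open LocalState Config

variable {n : ℕ} {V W : Type*}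

/-- `h` is an interaction of `A` with a prover that keeps to the rules. -/
def LegalPlay (A : Adversary n V W) (c : ProverClass) (T : DecisionTask n V W) :
    History n V W → Prop
  | [] => True
  | e :: h => LegalPlay A c T h ∧ ∃ m, History.Legal c T h m ∧ e = A.respond h m

variable {A : Adversary n V W} {c : ProverClass} {T : DecisionTask n V W}

theorem exists_suffix_of_length_lt {α : Type*} {l : List α} {j : ℕ} (hj : j < l.length) :
    ∃ e h, e :: h <:+ l ∧ h.length = j := by
  induction l with
  | nil => simp at hj
  | cons e l ih =>
    rcases Nat.lt_succ_iff_lt_or_eq.mp hj with h | h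
    · obtain ⟨e', h', h1, h2⟩ := ih h
      exact ⟨e', h', h1.trans (List.suffix_cons _ _), h2⟩
    · exact ⟨e, l, List.suffix_rfl, h.symm⟩

/-- One prover leads the adversary through all the histories of an increasing sequence. -/
theorem exists_prover (x : Fin (n + 1) → V) {Hs : ℕ → History n V W}
    (hmono : ∀ i j, i ≤ j → Hs i <:+ Hs j) (hlegal : ∀ i, LegalPlay A c T (Hs i)) :
    ∃ R : Prover n V W, (∀ i, play A R (Hs i).length = Hs i) ∧
      ∀ i e h, e :: h <:+ Hs i → play A R h.length = h ∧ R h = e.move ∧ History.Legal c T h (R h) := by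
  classical
  let R : Prover n V W := fun h =>
    if he : ∃ e i, e :: h <:+ Hs i then he.choose.move else .endPhase ⟨x, []⟩
  have hR : ∀ i e h, e :: h <:+ Hs i → R h = e.move := by
    intro i e h hs
    have he : ∃ e i, e :: h <:+ Hs i := ⟨e, i, hs⟩
    obtain ⟨i', hi'⟩ := he.choose_spec
    have h1 : he.choose :: h = e :: h := by
      refine List.IsSuffix.eq_of_length (List.suffix_of_suffix_length_le
        (hi'.trans (hmono i' _ (le_max_right i i'))) (hs.trans (hmono i _ (le_max_left i i'))) ?_) ?_
        <;> simp
    simp only [R, dif_pos he]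
    rw [(List.cons.inj h1).1]
  have hplay : ∀ i h, h <:+ Hs i → LegalPlay A c T h → play A R h.length = h ∧
      ∀ e h', e :: h' <:+ h → History.Legal c T h' (R h') ∧ play A R h'.length = h' := by
    intro i h
    induction h with
    | nil => exact fun _ _ => ⟨rfl, fun e h' hs => by simp at hs⟩
    | cons e h ih =>
      rintro hs ⟨hl, m, hm, he⟩
      obtain ⟨h1, h2⟩ := ih ((List.suffix_cons _ _).trans hs) hl
      have h3 : R h = m := by rw [hR i e h hs, he, Adversary.move_respond]
      refine ⟨?_, fun e' h' hs' => ?_⟩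
      · rw [List.length_cons, play, h1, h3, ← he]
      · rcases List.suffix_cons_iff.mp hs' with h4 | h4
        · obtain ⟨-, rfl⟩ := List.cons.inj h4
          rw [h3]
          exact ⟨hm, h1⟩
        · exact h2 e' h' h4
  exact ⟨R, fun i => (hplay i _ List.suffix_rfl (hlegal i)).1, fun i e h hs =>
    ⟨((hplay i _ List.suffix_rfl (hlegal i)).2 e h hs).2, hR i e h hs,
      ((hplay i _ List.suffix_rfl (hlegal i)).2 e h hs).1⟩⟩

theorem LegalPlay.truthful (hA : ∀ R, A.WinsAgainst c T R) (x : Fin (n + 1) → V)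
    {h : History n V W} (hl : LegalPlay A c T h) : Truthful h ∧ ¬ h.Violation T := by
  obtain ⟨R, h1, h2⟩ := exists_prover x (Hs := fun _ => h) (fun _ _ _ => List.suffix_rfl)
    (fun _ => hl)
  have h3 := (hA R).1 h.length fun j hj => by
    obtain ⟨e, h', h4, rfl⟩ := exists_suffix_of_length_lt hj
    obtain ⟨h5, -, h6⟩ := h2 0 e h' h4
    rwa [h5]
  rwa [h1 0] at h3

/-- An increasing sequence of interactions of a winning adversary is generated by moves with
neither infinitely many phases nor an infinite chain. -/
theorem exists_moves (hA : ∀ R, A.WinsAgainst c T R) (x : Fin (n + 1) → V)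
    {Hs : ℕ → History n V W} (hsucc : ∀ i, ∃ e l, Hs (i + 1) = e :: (l ++ Hs i))
    (hlegal : ∀ i, LegalPlay A c T (Hs i)) :
    ∃ m : ℕ → Move n V W, (∀ i e h, e :: h <:+ Hs i → m h.length = e.move) ∧
      ¬ InfinitelyManyPhases m ∧ ¬ InfiniteChain m := by
  have hmono : ∀ i j, i ≤ j → Hs i <:+ Hs j := by
    intro i j hij
    induction j, hij using Nat.le_induction with
    | base => exact List.suffix_rfl
    | succ j _ ih =>
      obtain ⟨e, l, he⟩ := hsucc j
      rw [he]
      exact ih.trans ((List.suffix_append _ _).trans (List.suffix_cons _ _))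
  have hlen : ∀ i, i ≤ (Hs i).length := by
    intro i
    induction i with
    | zero => exact Nat.zero_le _
    | succ i ih =>
      obtain ⟨e, l, he⟩ := hsucc i
      rw [he, List.length_cons, List.length_append]
      omega
  obtain ⟨R, -, h2⟩ := exists_prover x hmono hlegal
  have h3 := (hA R).2
  rw [not_and, not_or] at h3
  refine ⟨fun j => R (play A R j), fun i e h hs => ?_, h3 fun j => ?_⟩
  · obtain ⟨h4, h5, -⟩ := h2 i e h hs
    simp only [h4, h5]
  · obtain ⟨e, h, h4, rfl⟩ := exists_suffix_of_length_lt (hlen (j + 1))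
    obtain ⟨h5, -, h6⟩ := h2 _ e h h4
    rwa [h5]

/-- The interaction `h` has disclosed that the decision for the local state `s` is `o`. -/
def Disclosed (h : History n V W) (s : LocalState n V) (o : Option W) : Prop :=
  (s.depth = 0 ∧ o = none) ∨
    ∃ C P reply, Event.query C P reply ∈ h ∧ ∃ p ∈ P, (C.extend P).config.state p = s ∧ reply p = o

theorem Disclosed.mono {h h' : History n V W} (hh : h ⊆ h') {s : LocalState n V} {o : Option W}
    (hs : Disclosed h s o) : Disclosed h' s o := by
  rcases hs with hs | ⟨C, P, r, h1, h2⟩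
  · exact Or.inl hs
  · exact Or.inr ⟨C, P, r, hh h1, h2⟩

theorem Disclosed.eq {h : History n V W} {δ : Protocol n V W} (hδ : ∀ e ∈ h, e.Correct δ)
    {s : LocalState n V} {o : Option W} (hs : Disclosed h s o) : δ.decide s = o := by
  rcases hs with ⟨h1, rfl⟩ | ⟨C, P, r, h1, p, hp, rfl, rfl⟩
  · exact δ.decide_eq_none h1
  · exact hδ _ h1 p hp

theorem Disclosed.unique {h : History n V W} (ht : Truthful h) (s : LocalState n V)
    (o o' : Option W) (hs : Disclosed h s o) (hs' : Disclosed h s o') : o = o' := by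
  obtain ⟨δ, hδ⟩ := ht
  rw [← hs.eq hδ, ← hs'.eq hδ]

theorem Disclosed.decision {h : History n V W} (ht : Truthful h) {s : LocalState n V}
    {o : Option W} (hs : Disclosed h s o) : h.decision s = o := by
  obtain ⟨δ, hδ⟩ := ht
  rcases hs with ⟨h1, rfl⟩ | hs
  · exact h.decision_of_depth_eq_zero h1
  obtain ⟨C, P, r, h1, p, hp, hps, h3⟩ := hs
  have h4 : δ.decide s = o := by rw [← h3, ← hps]; exact hδ _ h1 p hp
  rw [← h4]
  clear h3 h4
  induction h with
  | nil => simp at h1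
  | cons e h ih =>
    have hδ' : ∀ e ∈ h, e.Correct δ := fun e he => hδ e (List.mem_cons_of_mem _ he)
    rcases List.mem_cons.mp h1 with rfl | h6
    · have hs : ∃ p ∈ P, (C.extend P).config.state p = s := ⟨p, hp, hps⟩
      have h5 := hδ _ List.mem_cons_self _ hs.choose_spec.1
      rw [History.decision, dif_pos hs, ← h5, hs.choose_spec.2]
    · cases e with
      | query C' P' r' =>
        rw [History.decision]
        split_ifs with hs
        · have h5 := hδ _ List.mem_cons_self _ hs.choose_spec.1
          rw [← h5, hs.choose_spec.2]
        · exact ih hδ' h6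
      | outputQuery => exact ih hδ' h6
      | assignQuery => exact ih hδ' h6
      | endPhase => exact ih hδ' h6

/-- `h'` continues `h` by queries `(C, P)`. -/
def QueryExt (h h' : History n V W) : Prop :=
  ∃ l, h' = l ++ h ∧ ∀ e ∈ l, ∃ C P r, e = Event.query C P r

theorem QueryExt.refl (h : History n V W) : QueryExt h h := ⟨[], rfl, by simp⟩

theorem QueryExt.trans {h h' h'' : History n V W} (h1 : QueryExt h h') (h2 : QueryExt h' h'') :
    QueryExt h h'' := by
  obtain ⟨l, rfl, hl⟩ := h1
  obtain ⟨l', rfl, hl'⟩ := h2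
  refine ⟨l' ++ l, by simp, fun e he => ?_⟩
  rcases List.mem_append.mp he with he | he
  exacts [hl' e he, hl e he]

theorem QueryExt.subset {h h' : History n V W} (h1 : QueryExt h h') : h ⊆ h' := by
  obtain ⟨l, rfl, -⟩ := h1
  exact List.subset_append_right _ _

theorem QueryExt.phaseStart {h h' : History n V W} (h1 : QueryExt h h') :
    h'.phaseStart T = h.phaseStart T ∧ h.reached ⊆ h'.reached := by
  obtain ⟨l, rfl, hl⟩ := h1
  induction l with
  | nil => exact ⟨rfl, subset_rfl⟩
  | cons e l ih =>
    obtain ⟨C, P, r, rfl⟩ := hl e List.mem_cons_self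
    obtain ⟨h2, h3⟩ := ih fun e he => hl e (List.mem_cons_of_mem _ he)
    exact ⟨h2, h3.trans (Set.subset_insert _ _)⟩

/-- A node in which the prover may make queries, and the decisions for whose states have been
disclosed. -/
structure Position (T : DecisionTask n V W) (h : History n V W) (C : Node n V) : Prop where
  avail : C ∈ h.phaseStart T ∪ h.reached
  disclosed : ∀ p, ∃ o, Disclosed h (C.config.state p) o
  initial : T.IsInitial C.input

theorem Position.mono {h h' : History n V W} (hh : QueryExt h h') {C : Node n V}
    (hC : Position T h C) : Position T h' C where
  avail := by
    obtain ⟨h1, h2⟩ := hh.phaseStart (T := T)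
    rw [h1]
    exact hC.avail.imp id fun h => h2 h
  disclosed p := (hC.disclosed p).imp fun _ h => h.mono hh.subset
  initial := hC.initial

/-- A query has led to the configuration of `C`. -/
def Visited (h : History n V W) (C : Node n V) : Prop :=
  ∃ C' P r, Event.query C' P r ∈ h ∧ (C'.extend P).config = C.config

theorem Visited.mono {h h' : History n V W} (hh : h ⊆ h') {C : Node n V} (hC : Visited h C) :
    Visited h' C :=
  let ⟨C', P, r, h1, h2⟩ := hC
  ⟨C', P, r, hh h1, h2⟩

theorem Visited.valid {h : History n V W} (hv : ¬ h.Violation T) {C : Node n V}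
    (hC : Visited h C) : C.config.Valid T h.decision := by
  obtain ⟨C', P, r, h1, h2⟩ := hC
  rw [← h2]
  by_contra h3
  exact hv ⟨C', P, r, h1, h3⟩

theorem Position.query (hA : ∀ R, A.WinsAgainst c T R) {h : History n V W}
    (hl : LegalPlay A c T h) {C : Node n V} (hC : Position T h C) {P : Finset (Fin (n + 1))}
    (hP : P.Nonempty) (hact : ∀ p ∈ P, Disclosed h (C.config.state p) none)
    (hround : ∀ p ∈ P, ∀ q ∈ P, C.config.round p = C.config.round q) {h' : History n V W}
    (hh' : h' = Event.query C P (A.replyQuery h C P) :: h) :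
    LegalPlay A c T h' ∧ QueryExt h h' ∧ Position T h' (C.extend P) ∧ Visited h' (C.extend P) := by
  subst hh'
  obtain ⟨ht, -⟩ := hl.truthful hA C.input
  refine ⟨⟨hl, .query C P, ⟨hC.avail, hP, fun p hp => (hact p hp).decision ht, hround⟩, rfl⟩,
    ⟨[_], rfl, by simp⟩, ⟨Or.inr (Set.mem_insert _ _), fun p => ?_, hC.initial⟩,
    ⟨C, P, _, List.mem_cons_self, rfl⟩⟩
  by_cases hp : p ∈ P
  · exact ⟨_, Or.inr ⟨C, P, _, List.mem_cons_self, p, hp, rfl, rfl⟩⟩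
  · obtain ⟨o, ho⟩ := hC.disclosed p
    refine ⟨o, ?_⟩
    rw [Node.config_extend, state_step_of_notMem hp]
    exact ho.mono (List.subset_cons_self _ _)

/-- The node reached from `C` if `p` takes `k` steps alone. -/
def soloNode (C : Node n V) (p : Fin (n + 1)) (k : ℕ) : Node n V :=
  ⟨C.input, C.sched ++ List.replicate k {p}⟩

theorem config_soloNode (C : Node n V) (p : Fin (n + 1)) (k : ℕ) :
    (soloNode C p k).config = C.config.run (List.replicate k {p}) :=
  Config.run_append _ _ _

theorem soloNode_succ (C : Node n V) (p : Fin (n + 1)) (k : ℕ) :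
    soloNode C p (k + 1) = (soloNode C p k).extend {p} := by
  simp [soloNode, Node.extend, List.replicate_succ']

/-- The prover can run a process alone until it terminates, as it would construct an infinite chain
otherwise. -/
theorem Position.exists_solo (hA : ∀ R, A.WinsAgainst c T R) {h : History n V W}
    (hl : LegalPlay A c T h) {C : Node n V} (hC : Position T h C) {p : Fin (n + 1)}
    (hf : FreshFrom C.config (C.config.round p)) :
    ∃ h' k w, LegalPlay A c T h' ∧ QueryExt h h' ∧
      (Visited h C → Visited h' (soloNode C p k)) ∧
      Disclosed h' ((soloNext p)^[k] (C.config.state p)) (some w) ∧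
      ∀ j < k, Disclosed h' ((soloNext p)^[j] (C.config.state p)) none := by
  by_contra hno
  let Hs : ℕ → History n V W := fun k => Nat.rec h
    (fun k g => Event.query (soloNode C p k) {p} (A.replyQuery g (soloNode C p k) {p}) :: g) k
  have hsucc : ∀ k, Hs (k + 1) = Event.query (soloNode C p k) {p}
    (A.replyQuery (Hs k) (soloNode C p k) {p}) :: Hs k := fun k => rfl
  have hstate : ∀ k, (soloNode C p k).config.state p = (soloNext p)^[k] (C.config.state p) :=
    fun k => by rw [config_soloNode, (solo_run hf k).2.1]
  have key : ∀ k, LegalPlay A c T (Hs k) ∧ QueryExt h (Hs k) ∧ Position T (Hs k) (soloNode C p k) ∧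
      (Visited h C → Visited (Hs k) (soloNode C p k)) ∧
      ∀ j < k, Disclosed (Hs k) ((soloNext p)^[j] (C.config.state p)) none := by
    intro k
    induction k with
    | zero =>
      have h0 : soloNode C p 0 = C := by simp [soloNode]
      rw [h0]
      exact ⟨hl, QueryExt.refl _, hC, id, by simp⟩
    | succ k ih =>
      obtain ⟨h1, h2, h3, h4, h5⟩ := ih
      have h6 : Disclosed (Hs k) ((soloNext p)^[k] (C.config.state p)) none := by
        obtain ⟨o, ho⟩ := h3.disclosed p
        rw [hstate] at ho
        cases o with
        | none => exact ho
        | some w => exact absurd ⟨Hs k, k, w, h1, h2, h4, ho, h5⟩ hno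
      obtain ⟨g1, g2, g3, g4⟩ := h3.query hA h1 (P := {p}) (by simp)
        (by simpa [hstate] using h6) (by simp) (hsucc k)
      rw [← soloNode_succ] at g3 g4
      refine ⟨g1, h2.trans g2, g3, fun _ => g4, fun j hj => ?_⟩
      rcases Nat.lt_succ_iff_lt_or_eq.mp hj with hj | rfl
      · exact (h5 j hj).mono g2.subset
      · exact h6.mono g2.subset
  obtain ⟨m, h1, -, h2⟩ := exists_moves hA C.input (Hs := Hs) (fun i => ⟨_, [], hsucc i⟩)
    fun i => (key i).1
  have hlen : ∀ k, (Hs k).length = k + h.length := by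
    intro k
    induction k with
    | zero => simp [Hs]
    | succ k ih =>
      rw [hsucc, List.length_cons, ih]
      omega
  refine h2 ⟨h.length, fun k => soloNode C p (k - h.length), fun _ => {p}, fun k hk => ?_, 1,
    fun _ => 0, fun i j hi hij _ hbetween => ?_⟩
  · obtain ⟨k, rfl⟩ := Nat.exists_eq_add_of_le' hk
    have := h1 (k + 1) (.query (soloNode C p k) {p} _) (Hs k) List.suffix_rfl
    rw [hlen] at this
    rw [this]
    simp only [Nat.add_sub_cancel]
    rfl
  · have h3 : j = i + 1 := by
      by_contra hne
      exact hbetween (i + 1) (by omega) (by omega) rfl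
    simp only [h3, Nat.succ_sub hi, soloNode_succ]

end LegalPlays

/-! ### A hub from a winning adversary -/

section HubFromAdversary

open LocalState Config

variable {n : ℕ} {V W : Type*} {A : Adversary n V W} {c : ProverClass} {T : ColorlessTask V W}

/-- In the first phase, the prover can reach every configuration `edgeConfig x σ σ' ∅`. -/
theorem exists_edge_position (hA : ∀ R, A.WinsAgainst c (T.toTask n) R) {h : History n V W}
    (hl : LegalPlay A c (T.toTask n) h) (hh : QueryExt [] h) {x : Fin (n + 1) → V}
    (hx : (T.toTask n).IsInitial x) {σ σ' : Finset (Fin (n + 1) × V)} (hσ : σ.Nonempty) :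
    ∃ h' C, LegalPlay A c (T.toTask n) h' ∧ QueryExt h h' ∧ Position (T.toTask n) h' C ∧
      Visited h' C ∧ C.config = edgeConfig x σ σ' ∅ := by
  classical
  have h0 : Position (T.toTask n) h ⟨x, []⟩ := by
    refine ⟨Or.inl ?_, fun p => ⟨none, Or.inl ⟨?_, rfl⟩⟩, hx⟩
    · rw [hh.phaseStart.1]
      exact ⟨hx, rfl⟩
    · simp [Node.config, Config.run, Config.initial, LocalState.depth]
  obtain ⟨h1, h2, h3, h4⟩ := h0.query hA hl (P := ids σ) (hσ.image _)
    (fun p _ => Or.inl ⟨by simp [Node.config, Config.run, Config.initial, LocalState.depth], rfl⟩)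
    (fun p _ q _ => rfl) rfl
  set D : Node n V := Node.extend ⟨x, []⟩ (ids σ) with hD
  have hDc : D.config = (Config.initial x).step (ids σ) := Node.config_extend _ _
  by_cases hB : (ids σ' \ ids σ).Nonempty
  · have hst : ∀ p ∈ ids σ' \ ids σ, D.config.state p = .init p (x p) ∧ D.config.round p = 0 := by
      intro p hp
      rw [hDc, state_step_of_notMem (Finset.mem_sdiff.mp hp).2,
        round_step_of_notMem (Finset.mem_sdiff.mp hp).2]
      exact ⟨rfl, rfl⟩
    obtain ⟨g1, g2, g3, g4⟩ := h3.query hA h1 hB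
      (fun p hp => Or.inl ⟨by rw [(hst p hp).1]; simp [LocalState.depth], rfl⟩)
      (fun p hp q hq => by rw [(hst p hp).2, (hst q hq).2]) rfl
    refine ⟨_, _, g1, h2.trans g2, g3, g4, ?_⟩
    rw [Node.config_extend, edgeConfig, Config.step_empty, hDc]
  · refine ⟨_, D, h1, h2, h3, h4, ?_⟩
    rw [edgeConfig, Config.step_empty, Finset.not_nonempty_iff_eq_empty.mp hB, Config.step_empty,
      hDc]

/-- The prover has reached, in the interaction `h`, the node `C`, in which `p` and `q` are
bivalent, as far as the replies disclose, and have seen nothing but inputs in `σ`. -/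
structure BivalentAt (A : Adversary n V W) (c : ProverClass) (T : ColorlessTask V W)
    (σ : Finset (Fin (n + 1) × V)) (p q : Fin (n + 1)) (h : History n V W) (C : Node n V) :
    Prop where
  legal : LegalPlay A c (T.toTask n) h
  position : Position (T.toTask n) h C
  visited : Visited h C
  frontier : Frontier C.config p q
  carrier_left : (C.config.state p).carrier ⊆ σ
  carrier_right : (C.config.state q).carrier ⊆ σ
  bivalent : Bivalent (T.Δ (vals σ)) (Disclosed h) p q (C.config.state p) (C.config.state q)

/-- If `p` has terminated, then the prover can run `q` alone until it terminates as well, and the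
outputs have to be valid. -/
theorem conn_of_terminated (hA : ∀ R, A.WinsAgainst c (T.toTask n) R)
    {σ : Finset (Fin (n + 1) × V)} (hσ : σ ∈ (T.toTask n).input) {p q : Fin (n + 1)} (hpq : p ≠ q)
    {h : History n V W} {C : Node n V} (hl : LegalPlay A c (T.toTask n) h)
    (hC : Position (T.toTask n) h C) (hv : Visited h C)
    (hf : FreshFrom C.config (C.config.round q)) (hps : (C.config.state p).carrier ⊆ σ)
    (hqs : (C.config.state q).carrier ⊆ σ) {w u : W}
    (hw : Disclosed h (C.config.state p) (some w))
    (hu : SoloOut (Disclosed h) q (C.config.state q) u) : Conn (T.Δ (vals σ)) w u := by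
  obtain ⟨h', k, u', h1, h2, h3, h4, h5⟩ := hC.exists_solo hA hl hf
  obtain ⟨ht, hviol⟩ := h1.truthful hA C.input
  obtain rfl : u' = u := SoloOut.unique (Disclosed.unique ht) ⟨k, h4, h5⟩
    (hu.mono fun _ _ => Disclosed.mono h2.subset)
  obtain ⟨-, g1, g2⟩ := solo_run hf k
  have hval := (h3 hv).valid hviol
  rw [config_soloNode] at hval
  refine conn_of_mem (hval.exists_simplex (p := p) (q := q) ?_ ?_ hσ ?_ ?_
    (fun h => absurd h hpq) ?_)
  · rw [g2 p hpq]
    exact (hw.mono h2.subset).decision ht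
  · rw [g1]
    exact h4.decision ht
  · rwa [g2 p hpq]
  · rwa [g1, carrier_iterate_soloNext]
  · rw [g2 p hpq]
    exact ⟨_, (WF.run_initial C.input C.sched).self_mem_carrier (Config.occ_state _ p)⟩

/-- From a bivalent node, the prover can reach a bivalent successor, at which it ends the phase. -/
theorem BivalentAt.next (hA : ∀ R, A.WinsAgainst c (T.toTask n) R)
    {σ : Finset (Fin (n + 1) × V)} (hσ : σ ∈ (T.toTask n).input) {p q : Fin (n + 1)} (hpq : p ≠ q)
    {h : History n V W} {C : Node n V} (hb : BivalentAt A c T σ p q h C) :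
    ∃ l C', BivalentAt A c T σ p q (Event.endPhase C' :: (l ++ h)) C' := by
  obtain ⟨hl, hC, hvis, hfr, hps, hqs, w, u, hw, hu, hc⟩ := hb
  rcases hw.cases with hs | ⟨hs, hw'⟩
  · exact absurd (conn_of_terminated hA hσ hpq hl hC hvis hfr.symm.2 hps hqs hs hu) hc
  rcases hu.cases with ht | ⟨ht, hu'⟩
  · exact absurd (conn_of_terminated hA hσ hpq.symm hl hC hvis hfr.2 hqs hps ht hw).symm hc
  have hqs' : (C.extend {p}).config.state q = C.config.state q := by
    rw [Node.config_extend, state_step_of_notMem (by simpa using hpq.symm)]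
  have hps' : (C.extend {q}).config.state p = C.config.state p := by
    rw [Node.config_extend, state_step_of_notMem (by simpa using hpq)]
  -- The queries that lead to the three candidates.
  obtain ⟨a1, a2, a3, -⟩ := hC.query hA hl (P := {p}) (by simp) (by simpa using hs) (by simp) rfl
  obtain ⟨b1, b2, b3, b4⟩ := a3.query hA a1 (P := {q}) (by simp)
    (by simpa [hqs'] using ht.mono a2.subset) (by simp) rfl
  have b5 := a2.trans b2
  obtain ⟨d1, d2, d3, -⟩ := (hC.mono b5).query hA b1 (P := {q}) (by simp)
    (by simpa using ht.mono b5.subset) (by simp) rfl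
  have d5 := b5.trans d2
  obtain ⟨e1, e2, e3, e4⟩ := d3.query hA d1 (P := {p}) (by simp)
    (by simpa [hps'] using hs.mono d5.subset) (by simp) rfl
  have e5 := d5.trans e2
  obtain ⟨g1, g2, g3, g4⟩ := (hC.mono e5).query hA e1 (P := {p, q}) (by simp)
    (by simpa using ⟨hs.mono e5.subset, ht.mono e5.subset⟩) (by simp [hfr.1]) rfl
  have g5 := e5.trans g2
  obtain ⟨r1, r2, r3⟩ := hfr.step_pair
  obtain ⟨s1, s2, s3⟩ := hfr.step_step hpq
  obtain ⟨t1, t2, t3⟩ := hfr.symm.step_step hpq.symm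
  rw [pairNext_swap _ hpq] at t3
  rw [← Node.config_extend] at r1 r2 r3
  rw [← Node.config_extend, ← Node.config_extend] at s1 s2 s3 t1 t2 t3
  obtain ⟨h₁, k₁, w', i1, i2, -, i4, i5⟩ := g3.exists_solo hA g1 r1.2
  obtain ⟨h₂, k₂, u', j1, j2, -, j4, j5⟩ := (g3.mono i2).exists_solo hA i1 r1.symm.2
  have hw'' : SoloOut (Disclosed h₂) p _ w' :=
    SoloOut.mono (fun _ _ => Disclosed.mono j2.subset) ⟨k₁, i4, i5⟩
  have hu'' : SoloOut (Disclosed h₂) q _ u' := ⟨k₂, j4, j5⟩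
  rw [r2] at hw''
  rw [r3] at hu''
  have h6 := (g5.trans i2).trans j2
  have hmono : ∀ s o, Disclosed h s o → Disclosed h₂ s o := fun _ _ => Disclosed.mono h6.subset
  have hcar : ∀ i, (pairNext i p q (C.config.state p) (C.config.state q)).carrier ⊆ σ :=
    fun i a ha => (carrier_pairNext _ _ _ _ _ a ha).elim (fun h => hps h) (fun h => hqs h)
  have key : ∀ h₀ C', QueryExt h₀ h₂ → Position (T.toTask n) h₀ C' → C' ∈ h₀.reached →
      Visited h₀ C' → Frontier C'.config p q → ∀ s t, C'.config.state p = s →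
      C'.config.state q = t → s.carrier ⊆ σ → t.carrier ⊆ σ →
      Bivalent (T.Δ (vals σ)) (Disclosed h₂) p q s t →
      ∃ l C', BivalentAt A c T σ p q (Event.endPhase C' :: (l ++ h)) C' := by
    rintro h₀ C' hext hpos hreach hvis' hfr' _ _ rfl rfl hs' ht' hbiv
    obtain ⟨l, hl', -⟩ := h6
    refine ⟨l, C', ?_⟩
    rw [← hl']
    refine ⟨⟨j1, .endPhase C', hext.phaseStart (T := T.toTask n) |>.2 hreach, rfl⟩,
      ⟨Or.inl ⟨hpos.initial, rfl, fun _ _ _ _ => rfl⟩, fun i => ?_, hpos.initial⟩,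
      hvis'.mono (List.Subset.trans hext.subset (List.subset_cons_self _ _)), hfr', hs', ht',
      hbiv.mono fun _ _ => Disclosed.mono (List.subset_cons_self _ _)⟩
    exact (hpos.disclosed i).imp fun _ hd =>
      hd.mono (List.Subset.trans hext.subset (List.subset_cons_self _ _))
  rcases Bivalent.next (hw'.mono hmono) (hu'.mono hmono) hc hw'' hu'' with h7 | h7 | h7
  · exact key _ _ (((d2.trans e2).trans g2).trans i2 |>.trans j2) b3 (Set.mem_insert _ _) b4 s1 _ _
      s2 s3 (by rwa [carrier_soloNext]) (hcar q) h7
  · exact key _ _ (i2.trans j2) g3 (Set.mem_insert _ _) g4 r1 _ _ r2 r3 (hcar p) (hcar q) h7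
  · exact key _ _ ((g2.trans i2).trans j2) e3 (Set.mem_insert _ _) e4 t1.symm _ _ t3 t2 (hcar p)
      (by rwa [carrier_soloNext]) h7

/-- A prover that has found a bivalent node can continue for infinitely many phases. -/
theorem not_bivalentAt (hA : ∀ R, A.WinsAgainst c (T.toTask n) R)
    {σ : Finset (Fin (n + 1) × V)} (hσ : σ ∈ (T.toTask n).input) {p q : Fin (n + 1)} (hpq : p ≠ q)
    {h : History n V W} {C : Node n V} : ¬ BivalentAt A c T σ p q h C := by
  intro hb
  have hnext : ∀ a : {a : History n V W × Node n V // BivalentAt A c T σ p q a.1 a.2},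
      ∃ b : {a : History n V W × Node n V // BivalentAt A c T σ p q a.1 a.2},
        ∃ l, b.1.1 = Event.endPhase b.1.2 :: (l ++ a.1.1) := by
    rintro ⟨⟨h, C⟩, hb⟩
    obtain ⟨l, C', hb'⟩ := hb.next hA hσ hpq
    exact ⟨⟨(_, C'), hb'⟩, l, rfl⟩
  choose nx hnx using hnext
  let s : ℕ → {a : History n V W × Node n V // BivalentAt A c T σ p q a.1 a.2} :=
    fun i => nx^[i] ⟨(h, C), hb⟩
  have hs : ∀ i, ∃ l, (s (i + 1)).1.1 = Event.endPhase (s (i + 1)).1.2 :: (l ++ (s i).1.1) := by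
    intro i
    have : s (i + 1) = nx (s i) := Function.iterate_succ_apply' _ _ _
    rw [this]
    exact hnx _
  obtain ⟨m, h1, h2, -⟩ := exists_moves hA C.input (Hs := fun i => (s i).1.1)
    (fun i => ⟨_, hs i⟩) fun i => (s i).2.legal
  refine h2 fun N => ?_
  have hlen : ∀ i, i ≤ (s i).1.1.length := by
    intro i
    induction i with
    | zero => exact Nat.zero_le _
    | succ i ih =>
      obtain ⟨l, hl⟩ := hs i
      rw [hl, List.length_cons, List.length_append]
      omega
  obtain ⟨l, hl⟩ := hs N
  refine ⟨(l ++ (s N).1.1).length, ?_, (s (N + 1)).1.2, ?_⟩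
  · rw [List.length_append]
    have := hlen N
    omega
  · refine h1 (N + 1) (Event.endPhase (s (N + 1)).1.2) _ ?_
    rw [← hl]

/-- An adversary that wins against all restricted extension-based provers yields a hub. -/
theorem exists_hub_of_adversary (hne : ∃ σ, σ ∈ (T.toTask n).input)
    (hA : ∀ R, A.WinsAgainst c (T.toTask n) R) : ∃ H, IsHub T n H := by
  classical
  -- A single interaction discloses the outputs of all solo executions after the first round.
  let G : Set (Fin (n + 1) × Finset (Fin (n + 1) × V)) :=
    {g | g.2 ∈ (T.toTask n).input ∧ g.1 ∈ ids g.2}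
  have hG : G.Finite := by
    refine ((Set.finite_univ (α := Fin (n + 1))).prod (T.toTask n).finite_input).subset ?_
    rintro g ⟨hg, -⟩
    exact ⟨Set.mem_univ _, hg⟩
  have hdisc : ∀ F : Finset (Fin (n + 1) × Finset (Fin (n + 1) × V)), ↑F ⊆ G →
      ∃ h, LegalPlay A c (T.toTask n) h ∧ QueryExt [] h ∧
        ∀ g ∈ F, ∃ w, SoloOut (Disclosed h) g.1 (firstView g.1 g.2) w := by
    intro F
    induction F using Finset.induction_on with
    | empty => exact fun _ => ⟨[], trivial, QueryExt.refl _, by simp⟩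
    | insert g F hg ih =>
      intro hF
      rw [Finset.coe_insert, Set.insert_subset_iff] at hF
      obtain ⟨h, h1, h2, h3⟩ := ih hF.2
      obtain ⟨hσ, hp⟩ := hF.1
      obtain ⟨x, hx, hsub⟩ := exists_initial_of_input hσ
      obtain ⟨h', C, h4, h5, h6, -, h8⟩ := exists_edge_position hA h1 h2 hx
        ((T.toTask n).input.isRelLowerSet_faces hσ).1 (σ' := g.2)
      obtain ⟨g1, g2, g3, -⟩ := edgeConfig_spec hsub (subset_refl g.2)
        (Finset.disjoint_empty_left (ids g.2))
      rw [← h8] at g1 g2 g3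
      obtain ⟨h'', k, w, i1, i2, -, i4, i5⟩ := h6.exists_solo hA h4 (p := g.1)
        (by rwa [g2 _ hp])
      rw [g3 _ hp] at i4 i5
      refine ⟨h'', i1, (h2.trans h5).trans i2, fun g' hg' => ?_⟩
      rcases Finset.mem_insert.mp hg' with rfl | hg'
      · exact ⟨w, k, i4, i5⟩
      · obtain ⟨w', hw'⟩ := h3 g' hg'
        exact ⟨w', hw'.mono fun _ _ => Disclosed.mono (h5.trans i2).subset⟩
  obtain ⟨h, hl, hext, hout⟩ := hdisc hG.toFinset (by simp)
  have hpos : ∀ σ' ∈ (T.toTask n).input, ∀ σ ⊆ σ', σ.Nonempty → ∃ h' C x, σ' ⊆ allPairs x ∧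
      LegalPlay A c (T.toTask n) h' ∧ QueryExt h h' ∧ Position (T.toTask n) h' C ∧
      Visited h' C ∧ FreshFrom C.config 1 ∧ (∀ p ∈ ids σ', C.config.round p = 1) ∧
      (∀ p ∈ ids σ, C.config.state p = firstView p σ) ∧
      ∀ q ∈ ids σ', (σ = σ' ∨ q ∉ ids σ) → C.config.state q = firstView q σ' := by
    intro σ' hσ' σ hle hσ
    obtain ⟨x, hx, hsub⟩ := exists_initial_of_input hσ'
    obtain ⟨h', C, h4, h5, h6, h7, h8⟩ := exists_edge_position hA hl hext hx hσ (σ' := σ')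
    have hspec := edgeConfig_spec hsub hle (Finset.disjoint_empty_left (ids σ'))
    rw [← h8] at hspec
    exact ⟨h', C, x, hsub, h4, h5, h6, h7, hspec⟩
  refine exists_hub_of_outputs hne
    (Out := fun p σ w => SoloOut (Disclosed h) p (firstView p σ) w) ?_ ?_ ?_
  · intro σ hσ p hp
    exact hout (p, σ) (hG.mem_toFinset.mpr ⟨hσ, hp⟩)
  · intro σ hσ p hp w hw
    have hσne := ((T.toTask n).input.isRelLowerSet_faces hσ).1
    obtain ⟨h', C, x, hsub, h1, h2, h3, h4, h5, h6, h7, -⟩ := hpos σ hσ σ subset_rfl hσne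
    have hf : FreshFrom C.config (C.config.round p) := by rwa [h6 p hp]
    obtain ⟨h'', k, w', i1, i2, i3, i4, i5⟩ := h3.exists_solo hA h1 hf
    obtain ⟨ht, hviol⟩ := i1.truthful hA x
    rw [h7 p hp] at i4 i5
    obtain rfl : w' = w := SoloOut.unique (Disclosed.unique ht) ⟨k, i4, i5⟩
      (hw.mono fun _ _ => Disclosed.mono (h2.trans i2).subset)
    have hst : (soloNode C p k).config.state p = (soloNext p)^[k] (firstView p σ) := by
      rw [config_soloNode, (solo_run hf k).2.1, h7 p hp]
    have hcar : ((soloNext p)^[k] (firstView p σ)).carrier = σ := by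
      rw [carrier_iterate_soloNext, carrier_firstView hsub]
    obtain ⟨ρ, hρ, hwρ, -⟩ := ((i3 h4).valid hviol).exists_simplex (p := p) (q := p) (w := w')
      (u := w') (by rw [hst]; exact i4.decision ht) (by rw [hst]; exact i4.decision ht) hσ
      (by rw [hst, hcar]) (by rw [hst, hcar]) (fun _ => rfl) (by rwa [hst, hcar])
    exact ⟨ρ, hρ, hwρ⟩
  · intro σ' hσ' σ hle p hp q hq hpq hor w u hw hu
    obtain ⟨h', C, x, hsub, h1, h2, h3, h4, h5, h6, h7, h8⟩ := hpos σ' hσ' σ hle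
      (Finset.image_nonempty.mp ⟨p, hp⟩)
    have hp' := Finset.image_subset_image hle hp
    by_contra hcon
    refine not_bivalentAt hA hσ' hpq (h := h') (C := C) ⟨h1, h3, h4, ⟨?_, ?_⟩, ?_, ?_, w, u, ?_, ?_,
      hcon⟩
    · rw [h6 p hp', h6 q hq]
    · rwa [h6 p hp']
    · rw [h7 p hp, carrier_firstView (hle.trans hsub)]
      exact hle
    · rw [h8 q hq hor, carrier_firstView hsub]
    · rw [h7 p hp]
      exact hw.mono fun _ _ => Disclosed.mono h2.subset
    · rw [h8 q hq hor]
      exact hu.mono fun _ _ => Disclosed.mono h2.subset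

end HubFromAdversary

/-! ### The equivalence -/

/-- Without inputs there is nothing to solve: the prover has no legal move, and there are no
labels. -/
theorem Adversary.winsAgainst_of_no_input {n : ℕ} {V W : Type*} {T : DecisionTask n V W}
    (hne : ¬ ∃ σ, σ ∈ T.input) (A : Adversary n V W) (c : ProverClass) (R : Prover n V W) :
    A.WinsAgainst c T R := by
  have hlegal : ¬ History.Legal c T (play A R 0) (R (play A R 0)) := by
    intro h
    have hC : ∀ C : Node n V, C ∉ History.phaseStart T ([] : History n V W) ∪
        History.reached ([] : History n V W) := by
      rintro C (⟨h1, -⟩ | h1)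
      · exact hne ⟨_, h1⟩
      · exact h1
    revert h
    simp only [play]
    cases R [] with
    | query C P => exact fun h => hC C h.1
    | outputQuery C P y => exact fun h => hC C h.2.1
    | assignQuery C P f => exact fun h => hC C h.2.1
    | endPhase C => exact fun h => hC C (Or.inr h)
  refine ⟨fun k hk => ?_, fun h => hlegal (h.1 0)⟩
  cases k with
  | zero =>
    refine ⟨⟨⟨fun _ => none, fun _ _ => rfl⟩, by simp [play]⟩, ?_⟩
    rintro ⟨C, P, r, h, -⟩
    simp [play] at h
  | succ k => exact absurd (hk 0 (Nat.succ_pos k)) hlegal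

theorem mainTheorem1 {V W : Type*} (T : ColorlessTask V W) (n : ℕ) (c : ProverClass) :
    (∃ A : Adversary n V W, ∀ R : Prover n V W, A.WinsAgainst c (T.toTask n) R) ↔
      ∃ δ : List (Finset (Fin (n + 1) × V)) → Protocol n V W,
        (∀ U, IsFullRoundLabel (T.toTask n) U → IsPartialProtocol (T.toTask n) U (δ U)) ∧
        ∀ U U', IsFullRoundLabel (T.toTask n) U → IsFullRoundLabel (T.toTask n) U' →
          Compatible (T.toTask n) U U' (δ U) (δ U') := by
  by_cases hne : ∃ σ, σ ∈ (T.toTask n).input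
  · constructor
    · rintro ⟨A, hA⟩
      obtain ⟨H, hH⟩ := exists_hub_of_adversary hne hA
      exact hH.exists_partialProtocols
    · rintro ⟨δ, hδ, hc⟩
      obtain ⟨H, hH⟩ := exists_hub_of_partialProtocols hne hδ hc
      exact hH.exists_adversary c
  · have hU : ∀ U, ¬ IsFullRoundLabel (T.toTask n) U := fun U hU => by
      obtain ⟨⟨s, hs, -⟩, -⟩ := hU
      exact hne ⟨s, hs⟩
    refine iff_of_true ⟨⟨fun _ _ _ _ => none, fun _ _ _ _ => none, fun _ _ _ _ => none⟩,
      fun R => Adversary.winsAgainst_of_no_input hne _ c R⟩ ?_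
    exact ⟨fun _ => ⟨fun _ => none, fun _ _ => rfl⟩, fun U h => absurd h (hU U),
      fun U _ h => absurd h (hU U)⟩
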